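/- All vector spaces are over $\mathbb{Q}$, chain complexes are concentrated in non-negative homological degrees, and the symmetry $v\otimes w\mapsto(-1)^{|v||w|}w\otimes v$ is used for tensor products. An operad of chain complexes $O$ is a functor $A\mapsto O_A$ from the groupoid of finite sets and bijections to chain complexes, together with chain maps $\circ_a:O_A\otimes O_B\to O_{(A-\{a\})\sqcup B}$ for $a\in A$ that are functorial and associative; a morphism of operads is a natural family of chain maps compatible with all $\circ_a$. **The operad $BV$.** A BV algebra is a graded-commutative associative algebra $V$ with a bracket making the shifted space $V[1]$ a graded Lie algebra, such that $[a,bc]=[a,b]c+(-1)^{(|a|+1)|b|}b[a,c]$, and with an operator $\Delta$ such that $\Delta^2=0$ and $[a,b]=(-1)^{|a|}\Delta(ab)-(-1)^{|a|}(\Delta a)b-a\Delta b$; the product has degree $0$, and the bracket and $\Delta$ have homological degree $1$. For a finite set $A$, $BV_A$ is the graded vector space of all expressions built from the elements of $A$ (of degree $0$), each occurring exactly once in every monomial, with the operations of BV algebras, modulo the relations of BV algebras. It is a chain complex with zero differential, and $\circ_a$ is the substitution for $a$ (with Koszul signs). There are two versions: BV algebras with a unit $1$ for the product (so that the constant $1$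 may occur in expressions), and BV algebras without unit. **The operad $\bigwedge\tilde{\mathfrak t}$.** For a finite set $A$ let $\tilde{\mathfrak t}_A$ be the Lie algebra with generators $t_{ab}$ ($a,b\in A$, $a\ne b$) and $s_a$ ($a\in A$) and relations $$t_{ab}=t_{ba},\qquad [t_{ab},t_{cd}]=0\ \ (a,b,c,d\text{ all different}),\qquad [t_{ac},t_{ab}+t_{bc}]=0\ \ (a,b,c\text{ all different}),\qquad [s_a,x]=0\ \ (x\in\tilde{\mathfrak t}_A).$$ For finite sets $A$, $B$ and $a\in A$ there is a morphism of Lie algebras $\circ_a:\tilde{\mathfrak t}_A\oplus\tilde{\mathfrak t}_B\to\tilde{\mathfrak t}_{(A-\{a\})\sqcup B}$ that sends $t_{xy}\mapsto t_{xy}$ and $s_x\mapsto s_x$ if $x,y\in A-\{a\}$ or $x,y\in B$, and $$t_{ax}\mapsto\sum_{y\in B}t_{xy}\quad(x\in A-\{a\}),\qquad s_a\mapsto\sum_{x\in B}s_x+\sum_{\{x,y\}\subset B}t_{xy}.$$ Let $\bigwedge\tilde{\mathfrak t}_A$ be the Chevalley–Eilenberg chain complex of $\tilde{\mathfrak t}_A$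 with trivial coefficients (the exterior algebra, with $\tilde{\mathfrak t}_A$ in degree $1$ and $d(x\wedge y)=[x,y]$). With the compositions $v\otimes w\mapsto\circ_a(v)\wedge\circ_a(w)$ induced by the morphisms $\circ_a$, these complexes form an operad of chain complexes $\bigwedge\tilde{\mathfrak t}$. **Lemma.** There is exactly one morphism of operads of chain complexes $\varphi:BV\to\bigwedge\tilde{\mathfrak t}$ with $$ab\mapsto 1,\qquad [a,b]\mapsto t_{ab},\qquad \Delta a\mapsto s_a$$ (for $ab,[a,b]\in BV_{\{a,b\}}$ and $\Delta a\in BV_{\{a\}}$), and it is a quasi-isomorphism: $\varphi_A:BV_A\to\bigwedge\tilde{\mathfrak t}_A$ is a quasi-isomorphism for every finite set $A$ in the version with unit, and for every non-empty finite set $A$ in the version without unit. -/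

import Mathlib

open CategoryTheory

universe u

namespace FramedDisks

/-! ### Chain complexes of rational vector spaces, as graded vector spaces with a differential -/

/-- A chain complex of `ℚ`-vector spaces in non-negative degrees, written as a vector space that is
the internal direct sum of its homogeneous parts `gr n`, with a differential of degree `-1`. -/
structure DGSpace where
  carrier : Type u
  [addCommGroup : AddCommGroup carrier]
  [module : Module ℚ carrier]
  gr : ℕ → Submodule ℚ carrier
  isInternal : DirectSum.IsInternal gr
  d : carrier →ₗ[ℚ] carrier
  d_mem : ∀ (n : ℕ) (x : carrier), x ∈ gr (n + 1) → d x ∈ gr n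
  d_gr_zero : ∀ x ∈ gr 0, d x = 0
  d_d : ∀ x, d (d x) = 0

namespace DGSpace

instance : CoeSort DGSpace.{u} (Type u) := ⟨DGSpace.carrier⟩

attribute [instance] DGSpace.addCommGroup DGSpace.module

/-- The same object as a Mathlib chain complex: the space in degree `n` is `gr n`. -/
noncomputable def toChainComplex (C : DGSpace.{u}) : ChainComplex (ModuleCat.{u} ℚ) ℕ :=
  ChainComplex.of (fun n => ModuleCat.of ℚ (C.gr n))
    (fun n => ModuleCat.ofHom (C.d.restrict (C.d_mem n)))
    (fun n => by
      apply ModuleCat.hom_ext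
      ext x
      exact C.d_d x.1)

/-- Linear maps of degree zero commuting with the differentials. -/
structure Hom (C D : DGSpace.{u}) where
  toLin : C →ₗ[ℚ] D
  map_gr : ∀ (n : ℕ) (x : C), x ∈ C.gr n → toLin x ∈ D.gr n
  map_d : ∀ x : C, toLin (C.d x) = D.d (toLin x)

instance (C D : DGSpace.{u}) : CoeFun (Hom C D) (fun _ => C → D) := ⟨fun f => f.toLin⟩

/-- The morphism of Mathlib chain complexes given by a morphism of `DGSpace`s. -/
noncomputable def Hom.toChainMap {C D : DGSpace.{u}} (f : Hom C D) :
    C.toChainComplex ⟶ D.toChainComplex :=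
  ChainComplex.ofHom
    (fun n => (ModuleCat.ofHom (f.toLin.restrict (f.map_gr n)) :
      ModuleCat.of ℚ (C.gr n) ⟶ ModuleCat.of ℚ (D.gr n)))
    (fun n => by
      simp only [toChainComplex, ChainComplex.of_d]
      apply ModuleCat.hom_ext
      ext x
      exact (f.map_d x.1).symm)

end DGSpace

/-! ### Operads of chain complexes -/

/-- The set `(A - {a}) ⊔ B`. -/
abbrev Ins {A : Type u} (a : A) (B : Type u) : Type u := {x : A // x ≠ a} ⊕ B

namespace Ins

variable {A A' B B' D : Type u}

/-- The bijection `(A - {a}) ⊔ B ≃ (A' - {e a}) ⊔ B'` induced by bijections `e`, `f`. -/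
def congr (e : A ≃ A') (f : B ≃ B') (a : A) : Ins a B ≃ Ins (e a) B' :=
  Equiv.sumCongr (e.subtypeEquiv fun _ => not_congr e.apply_eq_iff_eq.symm) f

/-- For `a ∈ A`, `b ∈ B`: the identification
`(((A - {a}) ⊔ B) - {b}) ⊔ D ≃ (A - {a}) ⊔ ((B - {b}) ⊔ D)`. -/
def seq (a : A) (b : B) : Ins (Sum.inr b : Ins a B) D ≃ Ins a (Ins b D) where
  toFun
    | Sum.inl ⟨Sum.inl x, _⟩ => Sum.inl x
    | Sum.inl ⟨Sum.inr y, h⟩ => Sum.inr (Sum.inl ⟨y, fun e => h (congrArg Sum.inr e)⟩)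
    | Sum.inr z => Sum.inr (Sum.inr z)
  invFun
    | Sum.inl x => Sum.inl ⟨Sum.inl x, Sum.inl_ne_inr⟩
    | Sum.inr (Sum.inl y) => Sum.inl ⟨Sum.inr y.1, fun e => y.2 (Sum.inr_injective e)⟩
    | Sum.inr (Sum.inr z) => Sum.inr z
  left_inv := by rintro (⟨x | y, h⟩ | z) <;> rfl
  right_inv := by rintro (x | y | z) <;> rfl

/-- For `a ≠ a'` in `A`, one direction of `par`. -/
def parFun (a a' : A) (h : a ≠ a') :
    Ins (Sum.inl ⟨a', h.symm⟩ : Ins a B) D → Ins (Sum.inl ⟨a, h⟩ : Ins a' D) B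
  | Sum.inl ⟨Sum.inl x, hx⟩ =>
      Sum.inl ⟨Sum.inl ⟨x.1, fun e => hx (congrArg Sum.inl (Subtype.ext e))⟩,
        fun e => x.2 (congrArg Subtype.val (Sum.inl_injective e))⟩
  | Sum.inl ⟨Sum.inr y, _⟩ => Sum.inr y
  | Sum.inr z => Sum.inl ⟨Sum.inr z, Sum.inr_ne_inl⟩

/-- For `a ≠ a'` in `A`: the identification
`(((A - {a}) ⊔ B) - {a'}) ⊔ D ≃ (((A - {a'}) ⊔ D) - {a}) ⊔ B`. -/
def par (a a' : A) (h : a ≠ a') :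
    Ins (Sum.inl ⟨a', h.symm⟩ : Ins a B) D ≃ Ins (Sum.inl ⟨a, h⟩ : Ins a' D) B where
  toFun := parFun a a' h
  invFun := parFun a' a h.symm
  left_inv := by rintro (⟨x | y, h⟩ | z) <;> rfl
  right_inv := by rintro (⟨x | y, h⟩ | z) <;> rfl

end Ins

/-- An operad of chain complexes of `ℚ`-vector spaces: a functor `A ↦ O_A` on the groupoid of finite
sets together with morphisms `∘_a : O_A ⊗ O_B → O_{(A - {a}) ⊔ B}` (bilinear maps of degree zero
obeying the Leibniz rule) that are functorial and associative, the symmetry of the tensor product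
being the one with the Koszul sign. -/
structure Operad where
  obj : (A : Type u) → [Finite A] → DGSpace.{u}
  map : {A B : Type u} → [Finite A] → [Finite B] → (A ≃ B) → DGSpace.Hom (obj A) (obj B)
  map_refl : ∀ (A : Type u) [Finite A] (x : obj A), map (Equiv.refl A) x = x
  map_trans : ∀ {A B D : Type u} [Finite A] [Finite B] [Finite D] (e : A ≃ B) (f : B ≃ D)
    (x : obj A), map (e.trans f) x = map f (map e x)
  comp : {A B : Type u} → [Finite A] → [Finite B] → (a : A) →
    obj A →ₗ[ℚ] obj B →ₗ[ℚ] obj (Ins a B)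
  comp_gr : ∀ {A B : Type u} [Finite A] [Finite B] (a : A) (i j : ℕ) (x : obj A) (y : obj B),
    x ∈ (obj A).gr i → y ∈ (obj B).gr j → comp a x y ∈ (obj (Ins a B)).gr (i + j)
  comp_d : ∀ {A B : Type u} [Finite A] [Finite B] (a : A) (i : ℕ) (x : obj A) (y : obj B),
    x ∈ (obj A).gr i → (obj (Ins a B)).d (comp a x y) =
      comp a ((obj A).d x) y + (-1 : ℚ) ^ i • comp a x ((obj B).d y)
  map_comp : ∀ {A A' B B' : Type u} [Finite A] [Finite A'] [Finite B] [Finite B'] (e : A ≃ A')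
    (f : B ≃ B') (a : A) (x : obj A) (y : obj B),
    map (Ins.congr e f a) (comp a x y) = comp (e a) (map e x) (map f y)
  assoc_seq : ∀ {A B D : Type u} [Finite A] [Finite B] [Finite D] (a : A) (b : B) (x : obj A)
    (y : obj B) (z : obj D),
    map (Ins.seq a b) (comp (Sum.inr b) (comp a x y) z) = comp a x (comp b y z)
  assoc_par : ∀ {A B D : Type u} [Finite A] [Finite B] [Finite D] (a a' : A) (h : a ≠ a')
    (j k : ℕ) (x : obj A) (y : obj B) (z : obj D), y ∈ (obj B).gr j → z ∈ (obj D).gr k →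
    map (Ins.par a a' h) (comp (Sum.inl ⟨a', h.symm⟩) (comp a x y) z) =
      (-1 : ℚ) ^ (j * k) • comp (Sum.inl ⟨a, h⟩) (comp a' x z) y

/-- Morphisms of operads of chain complexes. -/
structure Operad.Hom (O P : Operad.{u}) where
  app : (A : Type u) → [Finite A] → DGSpace.Hom (O.obj A) (P.obj A)
  naturality : ∀ {A B : Type u} [Finite A] [Finite B] (e : A ≃ B) (x : O.obj A),
    app B (O.map e x) = P.map e (app A x)
  app_comp : ∀ {A B : Type u} [Finite A] [Finite B] (a : A) (x : O.obj A) (y : O.obj B),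
    app (Ins a B) (O.comp a x y) = P.comp a (app A x) (app B y)

/-! ### The Chevalley-Eilenberg complex of a Lie algebra with trivial coefficients -/

namespace CE

open ExteriorAlgebra (ι)

section

variable (L : Type u) [LieRing L] [LieAlgebra ℚ L]

/-- Left exterior multiplication `x ↦ (w ↦ x ∧ w)`. -/
noncomputable def wedgeLeft : L →ₗ[ℚ] ExteriorAlgebra ℚ L →ₗ[ℚ] ExteriorAlgebra ℚ L :=
  (LinearMap.mul ℚ (ExteriorAlgebra ℚ L)).comp (ι ℚ)

variable {L}

theorem ι_sq_mul (x : L) (w : ExteriorAlgebra ℚ L) : ι ℚ x * (ι ℚ x * w) = 0 := by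
  rw [← mul_assoc, ExteriorAlgebra.ι_sq_zero, zero_mul]

theorem ι_swap_mul (x y : L) (w : ExteriorAlgebra ℚ L) :
    ι ℚ x * (ι ℚ y * w) = -(ι ℚ y * (ι ℚ x * w)) := by
  rw [← mul_assoc, ← mul_assoc, eq_neg_iff_add_eq_zero, ← add_mul, ExteriorAlgebra.ι_add_mul_swap,
    zero_mul]

/-- The derivation of `⋀ L` extending `ad x = ⁅x, -⁆`: it is determined by `θ x 1 = 0` and
`θ x (y ∧ w) = ⁅x, y⁆ ∧ w + y ∧ θ x w`. -/
noncomputable def θ (x : L) : ExteriorAlgebra ℚ L →ₗ[ℚ] ExteriorAlgebra ℚ L :=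
  CliffordAlgebra.foldr' (0 : QuadraticForm ℚ L)
    (((wedgeLeft L).comp (LieModule.toEnd ℚ L L x)).compl₂ (LinearMap.fst ℚ _ _) +
      (wedgeLeft L).compl₂ (LinearMap.snd ℚ _ _))
    (fun y w fw => by
      change ι ℚ ⁅x, y⁆ * (ι ℚ y * w) + ι ℚ y * (ι ℚ ⁅x, y⁆ * w + ι ℚ y * fw) = (0 : ℚ) • fw
      rw [mul_add, ι_sq_mul, ι_swap_mul ⁅x, y⁆ y, add_zero, zero_smul, neg_add_cancel])
    0

theorem θ_algebraMap (x : L) (r : ℚ) : θ x (algebraMap ℚ _ r) = 0 := by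
  rw [θ, CliffordAlgebra.foldr'_algebraMap, smul_zero]

theorem θ_ι_mul (x y : L) (w : ExteriorAlgebra ℚ L) :
    θ x (ι ℚ y * w) = ι ℚ ⁅x, y⁆ * w + ι ℚ y * θ x w :=
  CliffordAlgebra.foldr'_ι_mul _ _ _ _ _ _

theorem induction {P : ExteriorAlgebra ℚ L → Prop} (hr : ∀ r : ℚ, P (algebraMap _ _ r))
    (ha : ∀ x y, P x → P y → P (x + y)) (hm : ∀ (x : L) w, P w → P (ι ℚ x * w)) : ∀ w, P w :=
  CliffordAlgebra.left_induction (0 : QuadraticForm ℚ L) hr ha (fun w x h => hm x w h)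

theorem θ_add (x y : L) (w : ExteriorAlgebra ℚ L) : θ (x + y) w = θ x w + θ y w := by
  induction w using CE.induction with
  | hr r => simp only [θ_algebraMap, add_zero]
  | ha v w hv hw => rw [map_add, map_add, map_add, hv, hw]; abel
  | hm z w hw => rw [θ_ι_mul, θ_ι_mul, θ_ι_mul, hw, add_lie, map_add, add_mul, mul_add]; abel

theorem θ_smul (c : ℚ) (x : L) (w : ExteriorAlgebra ℚ L) : θ (c • x) w = c • θ x w := by
  induction w using CE.induction with
  | hr r => simp only [θ_algebraMap, smul_zero]
  | ha v w hv hw => rw [map_add, map_add, hv, hw, smul_add]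
  | hm z w hw =>
    rw [θ_ι_mul, θ_ι_mul, hw, smul_lie, map_smul, smul_mul_assoc, mul_smul_comm, smul_add]

theorem θ_mul (x : L) (v w : ExteriorAlgebra ℚ L) : θ x (v * w) = θ x v * w + v * θ x w := by
  induction v using CE.induction with
  | hr r => rw [← Algebra.smul_def, map_smul, θ_algebraMap, zero_mul, zero_add, Algebra.smul_def]
  | ha u v hu hv => rw [add_mul, map_add, map_add, hu, hv, add_mul, add_mul]; abel
  | hm z v hv =>
    rw [mul_assoc, θ_ι_mul, θ_ι_mul, hv, mul_add, add_mul, mul_assoc, mul_assoc, mul_assoc]; abel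

theorem θ_lie (x y : L) (w : ExteriorAlgebra ℚ L) : θ ⁅x, y⁆ w = θ x (θ y w) - θ y (θ x w) := by
  induction w using CE.induction with
  | hr r => simp only [θ_algebraMap, map_zero, sub_zero]
  | ha v w hv hw => simp only [map_add, hv, hw]; abel
  | hm z w hw =>
    simp only [θ_ι_mul, map_add, hw, lie_lie, map_sub, sub_mul, mul_sub]; abel

variable (L) in
/-- `θ` as a linear map in both arguments. -/
noncomputable def θLin : L →ₗ[ℚ] ExteriorAlgebra ℚ L →ₗ[ℚ] ExteriorAlgebra ℚ L where
  toFun := θ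
  map_add' x y := LinearMap.ext (θ_add x y)
  map_smul' c x := LinearMap.ext (θ_smul c x)

variable (L) in
/-- The Chevalley-Eilenberg differential on `⋀ L`, determined by `d 1 = 0` and
`d (x ∧ w) = θ x w - x ∧ d w`, that is,
`d (x₁ ∧ ⋯ ∧ xₙ) = ∑ i < j, (-1) ^ (i + j + 1) ⁅xᵢ, xⱼ⁆ ∧ x₁ ∧ ⋯ x̂ᵢ ⋯ x̂ⱼ ⋯ ∧ xₙ`. -/
noncomputable def d : ExteriorAlgebra ℚ L →ₗ[ℚ] ExteriorAlgebra ℚ L :=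
  CliffordAlgebra.foldr' (0 : QuadraticForm ℚ L)
    ((θLin L).compl₂ (LinearMap.fst ℚ _ _) - (wedgeLeft L).compl₂ (LinearMap.snd ℚ _ _))
    (fun y w fw => by
      change θ y (ι ℚ y * w) - ι ℚ y * (θ y w - ι ℚ y * fw) = (0 : ℚ) • fw
      rw [θ_ι_mul, mul_sub, ι_sq_mul, lie_self, map_zero, zero_mul, zero_smul]; abel)
    0

theorem d_algebraMap (r : ℚ) : d L (algebraMap ℚ _ r) = 0 := by
  rw [d, CliffordAlgebra.foldr'_algebraMap, smul_zero]

theorem d_ι_mul (x : L) (w : ExteriorAlgebra ℚ L) :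
    d L (ι ℚ x * w) = θ x w - ι ℚ x * d L w :=
  CliffordAlgebra.foldr'_ι_mul _ _ _ _ _ _

theorem d_θ (x : L) (w : ExteriorAlgebra ℚ L) : d L (θ x w) = θ x (d L w) := by
  induction w using CE.induction with
  | hr r => simp only [θ_algebraMap, d_algebraMap, map_zero]
  | ha v w hv hw => simp only [map_add, hv, hw]
  | hm z w hw =>
    simp only [θ_ι_mul, d_ι_mul, map_add, map_sub, hw, θ_lie]; abel

theorem d_d (w : ExteriorAlgebra ℚ L) : d L (d L w) = 0 := by
  induction w using CE.induction with
  | hr r => simp only [d_algebraMap, map_zero]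
  | ha v w hv hw => simp only [map_add, hv, hw, add_zero]
  | hm z w hw => rw [d_ι_mul, map_sub, d_ι_mul, d_θ, hw, mul_zero, sub_zero, sub_self]

theorem gr_zero : ⋀[ℚ]^0 L = 1 := pow_zero _

theorem gr_succ (n : ℕ) : ⋀[ℚ]^(n + 1) L = LinearMap.range (ι ℚ : L →ₗ[ℚ] _) * ⋀[ℚ]^n L :=
  pow_succ' _ _

theorem ι_mul_mem_gr {n : ℕ} (x : L) {w : ExteriorAlgebra ℚ L} (h : w ∈ ⋀[ℚ]^n L) :
    ι ℚ x * w ∈ ⋀[ℚ]^(n + 1) L := by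
  rw [gr_succ]
  exact Submodule.mul_mem_mul (LinearMap.mem_range_self _ x) h

theorem gr_induction {P : ℕ → ExteriorAlgebra ℚ L → Prop}
    (hr : ∀ r : ℚ, P 0 (algebraMap _ _ r))
    (ha : ∀ n v w, P n v → P n w → P n (v + w))
    (hm : ∀ n (x : L) (w : ExteriorAlgebra ℚ L), w ∈ ⋀[ℚ]^n L → P n w → P (n + 1) (ι ℚ x * w))
    (n : ℕ) (w : ExteriorAlgebra ℚ L) (hw : w ∈ ⋀[ℚ]^n L) : P n w := by
  induction n generalizing w with
  | zero =>
    rw [gr_zero, Submodule.mem_one] at hw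
    obtain ⟨r, rfl⟩ := hw
    exact hr r
  | succ n ih =>
    rw [gr_succ] at hw
    refine Submodule.mul_induction_on hw ?_ (fun v w => ha _ v w)
    rintro _ ⟨x, rfl⟩ w hw
    exact hm n x w hw (ih w hw)

theorem θ_mem_gr (x : L) (n : ℕ) (w : ExteriorAlgebra ℚ L) (hw : w ∈ ⋀[ℚ]^n L) :
    θ x w ∈ ⋀[ℚ]^n L := by
  refine gr_induction (P := fun n w => θ x w ∈ ⋀[ℚ]^n L) ?_ ?_ ?_ n w hw
  · intro r; rw [θ_algebraMap]; exact zero_mem _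
  · intro n v w hv hw; rw [map_add]; exact add_mem hv hw
  · intro n y w hw h
    rw [θ_ι_mul]
    exact add_mem (ι_mul_mem_gr _ hw) (ι_mul_mem_gr _ h)

theorem d_mem_gr (n : ℕ) (w : ExteriorAlgebra ℚ L) (hw : w ∈ ⋀[ℚ]^(n + 1) L) :
    d L w ∈ ⋀[ℚ]^n L := by
  refine gr_induction (P := fun m w => ∀ n, m = n + 1 → d L w ∈ ⋀[ℚ]^n L) ?_ ?_ ?_
    (n + 1) w hw n rfl
  · intro r n h; rw [d_algebraMap]; exact zero_mem _
  · intro m v w hv hw n h; rw [map_add]; exact add_mem (hv n h) (hw n h)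
  · intro m y w hw h n hn
    obtain rfl : m = n := by omega
    rw [d_ι_mul]
    refine sub_mem (θ_mem_gr y m w hw) ?_
    rcases m with _ | m
    · rw [gr_zero, Submodule.mem_one] at hw
      obtain ⟨r, rfl⟩ := hw
      rw [d_algebraMap, mul_zero]; exact zero_mem _
    · exact ι_mul_mem_gr _ (h m rfl)

variable (L) in
/-- The Chevalley-Eilenberg chain complex `⋀ L`, computing the homology of `L` with trivial
coefficients. -/
noncomputable abbrev complex : DGSpace.{u} where
  carrier := ExteriorAlgebra ℚ L
  gr n := ⋀[ℚ]^n L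
  isInternal := DirectSum.Decomposition.isInternal _
  d := d L
  d_mem := d_mem_gr
  d_gr_zero w hw := by
    rw [gr_zero, Submodule.mem_one] at hw
    obtain ⟨r, rfl⟩ := hw
    exact d_algebraMap r
  d_d := d_d

variable {L' : Type u} [LieRing L'] [LieAlgebra ℚ L']

theorem map_θ (f : L →ₗ⁅ℚ⁆ L') (x : L) (w : ExteriorAlgebra ℚ L) :
    ExteriorAlgebra.map (f : L →ₗ[ℚ] L') (θ x w) =
      θ (f x) (ExteriorAlgebra.map (f : L →ₗ[ℚ] L') w) := by
  induction w using CE.induction with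
  | hr r => simp only [θ_algebraMap, map_zero, AlgHom.commutes]
  | ha v w hv hw => simp only [map_add, hv, hw]
  | hm z w hw =>
    simp only [θ_ι_mul, map_add, map_mul, ExteriorAlgebra.map_apply_ι, hw, LieHom.coe_toLinearMap,
      LieHom.map_lie]

theorem map_d (f : L →ₗ⁅ℚ⁆ L') (w : ExteriorAlgebra ℚ L) :
    ExteriorAlgebra.map (f : L →ₗ[ℚ] L') (d L w) =
      d L' (ExteriorAlgebra.map (f : L →ₗ[ℚ] L') w) := by
  induction w using CE.induction with
  | hr r => simp only [d_algebraMap, map_zero, AlgHom.commutes]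
  | ha v w hv hw => simp only [map_add, hv, hw]
  | hm z w hw =>
    simp only [d_ι_mul, map_sub, map_mul, ExteriorAlgebra.map_apply_ι, hw, map_θ,
      LieHom.coe_toLinearMap]

theorem map_mem_gr (f : L →ₗ[ℚ] L') (n : ℕ) (w : ExteriorAlgebra ℚ L) (hw : w ∈ ⋀[ℚ]^n L) :
    ExteriorAlgebra.map f w ∈ ⋀[ℚ]^n L' := by
  refine gr_induction (P := fun n w => ExteriorAlgebra.map f w ∈ ⋀[ℚ]^n L') ?_ ?_ ?_ n w hw
  · intro r; rw [AlgHom.commutes, gr_zero]; exact Submodule.algebraMap_mem r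
  · intro n v w hv hw; rw [map_add]; exact add_mem hv hw
  · intro n y w hw h
    rw [map_mul, ExteriorAlgebra.map_apply_ι]
    exact ι_mul_mem_gr _ h

/-- The morphism of Chevalley-Eilenberg complexes induced by a morphism of Lie algebras. -/
noncomputable def mapHom (f : L →ₗ⁅ℚ⁆ L') : DGSpace.Hom (complex L) (complex L') where
  toLin := (ExteriorAlgebra.map (f : L →ₗ[ℚ] L')).toLinearMap
  map_gr n w hw := map_mem_gr (f : L →ₗ[ℚ] L') n w hw
  map_d := map_d f

/-- The bilinear map `⋀ L₁ ⊗ ⋀ L₂ ≅ ⋀ (L₁ ⊕ L₂) → ⋀ L` induced by a morphism of Lie algebras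
`L₁ ⊕ L₂ → L`, where `v ⊗ w` corresponds to `v ∧ w`. -/
noncomputable def mapProd {L₁ L₂ : Type u} [LieRing L₁] [LieAlgebra ℚ L₁] [LieRing L₂]
    [LieAlgebra ℚ L₂] (f : L₁ × L₂ →ₗ⁅ℚ⁆ L) :
    ExteriorAlgebra ℚ L₁ →ₗ[ℚ] ExteriorAlgebra ℚ L₂ →ₗ[ℚ] ExteriorAlgebra ℚ L :=
  LinearMap.mk₂ ℚ
    (fun v w => ExteriorAlgebra.map (f.comp (LieHom.inl ℚ L₁ L₂) : L₁ →ₗ[ℚ] L) v *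
      ExteriorAlgebra.map (f.comp (LieHom.inr ℚ L₁ L₂) : L₂ →ₗ[ℚ] L) w)
    (fun v v' w => by rw [map_add, add_mul])
    (fun c v w => by rw [map_smul, smul_mul_assoc])
    (fun v w w' => by rw [map_add, mul_add])
    (fun c v w => by rw [map_smul, mul_smul_comm])

theorem mapProd_gr {L₁ L₂ : Type u} [LieRing L₁] [LieAlgebra ℚ L₁] [LieRing L₂]
    [LieAlgebra ℚ L₂] (f : L₁ × L₂ →ₗ⁅ℚ⁆ L) (i j : ℕ) (v : ExteriorAlgebra ℚ L₁)
    (w : ExteriorAlgebra ℚ L₂) (hv : v ∈ ⋀[ℚ]^i L₁) (hw : w ∈ ⋀[ℚ]^j L₂) :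
    mapProd f v w ∈ ⋀[ℚ]^(i + j) L := by
  have h : ⋀[ℚ]^(i + j) L = ⋀[ℚ]^i L * ⋀[ℚ]^j L := pow_add _ _ _
  rw [h]
  exact Submodule.mul_mem_mul (map_mem_gr _ i v hv) (map_mem_gr _ j w hw)

theorem θ_map_of_commute {L₁ : Type u} [LieRing L₁] [LieAlgebra ℚ L₁] (f : L₁ →ₗ⁅ℚ⁆ L) (x : L)
    (h : ∀ y, ⁅x, f y⁆ = 0) (w : ExteriorAlgebra ℚ L₁) :
    θ x (ExteriorAlgebra.map (f : L₁ →ₗ[ℚ] L) w) = 0 := by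
  induction w using CE.induction with
  | hr r => simp only [AlgHom.commutes, θ_algebraMap]
  | ha v w hv hw => simp only [map_add, hv, hw, add_zero]
  | hm z w hw =>
    simp only [map_mul, ExteriorAlgebra.map_apply_ι, θ_ι_mul, hw, LieHom.coe_toLinearMap, h,
      map_zero, zero_mul, mul_zero, add_zero]

theorem mapProd_d {L₁ L₂ : Type u} [LieRing L₁] [LieAlgebra ℚ L₁] [LieRing L₂]
    [LieAlgebra ℚ L₂] (f : L₁ × L₂ →ₗ⁅ℚ⁆ L) (i : ℕ) (v : ExteriorAlgebra ℚ L₁)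
    (w : ExteriorAlgebra ℚ L₂) (hv : v ∈ ⋀[ℚ]^i L₁) :
    d L (mapProd f v w) = mapProd f (d L₁ v) w + (-1 : ℚ) ^ i • mapProd f v (d L₂ w) := by
  have hc : ∀ x y, ⁅f.comp (LieHom.inl ℚ L₁ L₂) x, f.comp (LieHom.inr ℚ L₁ L₂) y⁆ = 0 := by
    intro x y
    rw [LieHom.comp_apply, LieHom.comp_apply, ← LieHom.map_lie, LieAlgebra.Prod.bracket_apply]
    simp only [LieHom.inl_apply, LieHom.inr_apply, lie_zero, zero_lie]
    exact f.map_zero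
  have key : ∀ v w, mapProd f v w =
      ExteriorAlgebra.map (f.comp (LieHom.inl ℚ L₁ L₂) : L₁ →ₗ[ℚ] L) v *
      ExteriorAlgebra.map (f.comp (LieHom.inr ℚ L₁ L₂) : L₂ →ₗ[ℚ] L) w := fun _ _ => rfl
  simp only [key]
  refine gr_induction (P := fun i v => d L
      (ExteriorAlgebra.map (f.comp (LieHom.inl ℚ L₁ L₂) : L₁ →ₗ[ℚ] L) v *
      ExteriorAlgebra.map (f.comp (LieHom.inr ℚ L₁ L₂) : L₂ →ₗ[ℚ] L) w) =
      ExteriorAlgebra.map (f.comp (LieHom.inl ℚ L₁ L₂) : L₁ →ₗ[ℚ] L) (d L₁ v) *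
      ExteriorAlgebra.map (f.comp (LieHom.inr ℚ L₁ L₂) : L₂ →ₗ[ℚ] L) w + (-1 : ℚ) ^ i •
      (ExteriorAlgebra.map (f.comp (LieHom.inl ℚ L₁ L₂) : L₁ →ₗ[ℚ] L) v *
      ExteriorAlgebra.map (f.comp (LieHom.inr ℚ L₁ L₂) : L₂ →ₗ[ℚ] L) (d L₂ w))) ?_ ?_ ?_ i v hv
  · intro r
    rw [d_algebraMap, AlgHom.commutes, map_zero, zero_mul, zero_add, pow_zero, one_smul,
      ← Algebra.smul_def, map_smul, map_d, Algebra.smul_def]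
  · intro n v v' h h'
    simp only [map_add, add_mul, h, h', smul_add]; abel
  · intro n x v hv h
    rw [d_ι_mul, map_sub, map_mul (ExteriorAlgebra.map _), map_mul (ExteriorAlgebra.map _), ExteriorAlgebra.map_apply_ι, mul_assoc,
      d_ι_mul, h, θ_mul, map_θ, LieHom.coe_toLinearMap]
    rw [θ_map_of_commute (f.comp (LieHom.inr ℚ L₁ L₂)) _ (hc x)]
    simp only [mul_zero, add_zero, mul_add, sub_mul, mul_assoc, pow_succ, mul_smul_comm]
    module

end

end CE

/-! ### The Drinfeld-Kohno Lie algebras with central generators -/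

/-- Generators `t a b` (for `a ≠ b`) and `s a`. -/
inductive DKGen (A : Type u) : Type u
  | t (a b : A) (h : a ≠ b) : DKGen A
  | s (a : A) : DKGen A

/-- The generator `t_{ab}` of the free Lie algebra. -/
noncomputable abbrev genT {A : Type u} (a b : A) (h : a ≠ b) : FreeLieAlgebra ℚ (DKGen A) :=
  FreeLieAlgebra.of ℚ (DKGen.t a b h)

/-- The generator `s_a` of the free Lie algebra. -/
noncomputable abbrev genS {A : Type u} (a : A) : FreeLieAlgebra ℚ (DKGen A) :=
  FreeLieAlgebra.of ℚ (DKGen.s a)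

/-- The relations of the Lie algebra `t̃_A`, each written as an element that is set to zero. -/
inductive DKRel {A : Type u} : FreeLieAlgebra ℚ (DKGen A) → Prop
  | symm (a b : A) (h : a ≠ b) : DKRel (genT a b h - genT b a h.symm)
  | disj (a b c d : A) (hab : a ≠ b) (hac : a ≠ c) (had : a ≠ d) (hbc : b ≠ c) (hbd : b ≠ d)
      (hcd : c ≠ d) : DKRel ⁅genT a b hab, genT c d hcd⁆
  | three (a b c : A) (hab : a ≠ b) (hac : a ≠ c) (hbc : b ≠ c) :
      DKRel ⁅genT a c hac, genT a b hab + genT b c hbc⁆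
  | central (a : A) (x : FreeLieAlgebra ℚ (DKGen A)) : DKRel ⁅genS a, x⁆

/-- The ideal generated by the relations. -/
noncomputable def dkIdeal (A : Type u) : LieIdeal ℚ (FreeLieAlgebra ℚ (DKGen A)) :=
  LieSubmodule.lieSpan ℚ _ {r | DKRel r}

/-- The Lie algebra `t̃_A`. -/
abbrev DK (A : Type u) : Type u := FreeLieAlgebra ℚ (DKGen A) ⧸ dkIdeal A

namespace DK

section

variable {A B C D : Type u}

/-- The quotient map, as a morphism of Lie algebras. -/
noncomputable def proj : FreeLieAlgebra ℚ (DKGen A) →ₗ⁅ℚ⁆ DK A where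
  toLinearMap := (LieSubmodule.Quotient.mk' (dkIdeal A) : _ →ₗ[ℚ] _)
  map_lie' {x y} := LieSubmodule.Quotient.mk_bracket (I := dkIdeal A) x y

theorem proj_surjective : Function.Surjective (proj (A := A)) :=
  LieSubmodule.Quotient.surjective_mk' _

theorem proj_rel {r : FreeLieAlgebra ℚ (DKGen A)} (h : DKRel r) : proj r = 0 :=
  (LieSubmodule.Quotient.mk_eq_zero' (N := dkIdeal A)).mpr (LieSubmodule.subset_lieSpan h)

open Classical in
/-- The element `t_{ab}` of `t̃_A`; by convention it is zero if `a = b`. -/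
noncomputable def t (a b : A) : DK A :=
  if h : a ≠ b then proj (genT a b h) else 0

/-- The element `s_a` of `t̃_A`. -/
noncomputable def s (a : A) : DK A := proj (genS a)

theorem t_of_ne {a b : A} (h : a ≠ b) : t a b = proj (genT a b h) := dif_pos h

theorem t_self (a : A) : t a a = 0 := dif_neg (not_not.mpr rfl)

theorem t_symm (a b : A) : t a b = t b a := by
  by_cases h : a = b
  · rw [h]
  · rw [t_of_ne h, t_of_ne (Ne.symm h), ← sub_eq_zero, ← map_sub]
    exact proj_rel (.symm a b h)

theorem t_disj {a b c d : A} (hac : a ≠ c) (had : a ≠ d) (hbc : b ≠ c) (hbd : b ≠ d) :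
    ⁅t a b, t c d⁆ = 0 := by
  by_cases hab : a = b
  · rw [hab, t_self, zero_lie]
  by_cases hcd : c = d
  · rw [hcd, t_self, lie_zero]
  rw [t_of_ne hab, t_of_ne hcd, ← LieHom.map_lie]
  exact proj_rel (.disj a b c d hab hac had hbc hbd hcd)

theorem t_three {a b c : A} (hab : a ≠ b) (hac : a ≠ c) (hbc : b ≠ c) :
    ⁅t a c, t a b⁆ + ⁅t a c, t b c⁆ = 0 := by
  rw [← lie_add, t_of_ne hab, t_of_ne hac, t_of_ne hbc, ← map_add, ← LieHom.map_lie]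
  exact proj_rel (.three a b c hab hac hbc)

theorem s_central (a : A) (x : DK A) : ⁅s a, x⁆ = 0 := by
  obtain ⟨x, rfl⟩ := proj_surjective x
  rw [s, ← LieHom.map_lie]
  exact proj_rel (.central a x)

theorem free_centralizes {X : Type u} {L : Type u} [LieRing L] [LieAlgebra ℚ L]
    (F : FreeLieAlgebra ℚ X →ₗ⁅ℚ⁆ L) (y : L) (h : ∀ g, ⁅y, F (.of ℚ g)⁆ = 0) (x) :
    ⁅y, F x⁆ = 0 := by
  let K : LieSubalgebra ℚ L :=
    { carrier := {z | ⁅y, z⁆ = 0}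
      add_mem' := fun {a b} ha hb => by
        change ⁅y, a + b⁆ = 0
        rw [lie_add, show ⁅y, a⁆ = 0 from ha, show ⁅y, b⁆ = 0 from hb, add_zero]
      zero_mem' := lie_zero y
      smul_mem' := fun c a ha => by
        change ⁅y, c • a⁆ = 0
        rw [lie_smul, show ⁅y, a⁆ = 0 from ha, smul_zero]
      lie_mem' := fun {a b} ha hb => by
        change ⁅y, ⁅a, b⁆⁆ = 0
        rw [leibniz_lie, show ⁅y, a⁆ = 0 from ha, show ⁅y, b⁆ = 0 from hb, zero_lie, lie_zero,
          add_zero] }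
  have hF : F = K.incl.comp (FreeLieAlgebra.lift ℚ fun g => (⟨F (.of ℚ g), h g⟩ : K)) := by
    apply FreeLieAlgebra.hom_ext
    intro g
    simp
  rw [hF]
  exact (FreeLieAlgebra.lift ℚ (fun g => (⟨F (.of ℚ g), h g⟩ : K)) x).2

/-- Morphisms out of `t̃_A`. -/
noncomputable def lift {L : Type u} [LieRing L] [LieAlgebra ℚ L] (F : FreeLieAlgebra ℚ (DKGen A) →ₗ⁅ℚ⁆ L)
    (h : ∀ r, DKRel r → F r = 0) : DK A →ₗ⁅ℚ⁆ L where
  toLinearMap := (dkIdeal A).toSubmodule.liftQ (F : _ →ₗ[ℚ] L) (by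
    have : dkIdeal A ≤ F.ker := LieSubmodule.lieSpan_le.mpr fun r hr => F.mem_ker.mpr (h r hr)
    intro x hx
    exact F.mem_ker.mp (this hx))
  map_lie' {x y} := by
    obtain ⟨x, rfl⟩ := proj_surjective x
    obtain ⟨y, rfl⟩ := proj_surjective y
    rw [← LieHom.map_lie]
    exact F.map_lie x y

theorem lift_proj {L : Type u} [LieRing L] [LieAlgebra ℚ L]
    (F : FreeLieAlgebra ℚ (DKGen A) →ₗ⁅ℚ⁆ L) (h : ∀ r, DKRel r → F r = 0) (x) :
    lift F h (proj x) = F x := rfl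

theorem hom_ext {L : Type u} [LieRing L] [LieAlgebra ℚ L] {F G : DK A →ₗ⁅ℚ⁆ L}
    (ht : ∀ a b, a ≠ b → F (t a b) = G (t a b)) (hs : ∀ a, F (s a) = G (s a)) : F = G := by
  have h : F.comp proj = G.comp proj := by
    apply FreeLieAlgebra.hom_ext
    rintro (⟨a, b, hab⟩ | a)
    · have := ht a b hab
      rwa [t_of_ne hab] at this
    · exact hs a
  ext x
  obtain ⟨x, rfl⟩ := proj_surjective x
  exact LieHom.congr_fun h x

theorem centralizes {L : Type u} [LieRing L] [LieAlgebra ℚ L] (F : DK A →ₗ⁅ℚ⁆ L) (y : L)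
    (ht : ∀ a b, a ≠ b → ⁅y, F (t a b)⁆ = 0) (hs : ∀ a, ⁅y, F (s a)⁆ = 0) (x : DK A) :
    ⁅y, F x⁆ = 0 := by
  obtain ⟨x, rfl⟩ := proj_surjective x
  refine free_centralizes (F.comp proj) y ?_ x
  rintro (⟨a, b, hab⟩ | a)
  · have := ht a b hab
    rwa [t_of_ne hab] at this
  · exact hs a

theorem t_pair_sum {X : Finset A} {u v w : A} (hu : u ∈ X) (hv : v ∈ X) (huv : u ≠ v)
    (hwu : w ≠ u) (hwv : w ≠ v) : ∑ x ∈ X, ⁅t u v, t x w⁆ = 0 := by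
  rw [Finset.sum_eq_add_of_mem u v hu hv huv]
  · rw [t_symm v w]
    exact t_three hwu.symm huv hwv
  · intro x hx hne
    exact t_disj hne.1.symm hwu.symm hne.2.symm hwv.symm

theorem t_total_sum {X : Finset A} {u v : A} (hu : u ∈ X) (hv : v ∈ X) (huv : u ≠ v) :
    ∑ x ∈ X, ∑ y ∈ X, ⁅t u v, t x y⁆ = 0 := by
  rw [Finset.sum_comm, Finset.sum_eq_add_of_mem u v hu hv huv]
  · rw [← Finset.sum_add_distrib]
    refine Finset.sum_eq_zero fun x _ => ?_
    by_cases hxu : x = u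
    · rw [hxu, t_self, lie_zero, lie_self, add_zero]
    by_cases hxv : x = v
    · rw [hxv, t_self, lie_zero, t_symm v u, lie_self, add_zero]
    rw [t_symm x u]
    exact t_three (Ne.symm hxu) huv hxv
  · intro y _ hne
    exact t_pair_sum hu hv huv hne.1 hne.2

/-! #### Cabling along a partial map -/

/-- The fibre over `a` of a partially defined map `f` from `C` to `A`. -/
noncomputable def fiber [Finite C] (f : C → Option A) (a : A) : Finset C :=
  (Set.toFinite {c | f c = some a}).toFinset

theorem mem_fiber [Finite C] {f : C → Option A} {a : A} {c : C} :
    c ∈ fiber f a ↔ f c = some a :=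
  Set.Finite.mem_toFinset _

theorem ne_of_mem_fiber [Finite C] {f : C → Option A} {a b : A} (h : a ≠ b) {x y : C}
    (hx : x ∈ fiber f a) (hy : y ∈ fiber f b) : x ≠ y := by
  rintro rfl
  rw [mem_fiber] at hx hy
  exact h (Option.some_injective _ (hx.symm.trans hy))

/-- `∑ t_{xy}` over `x ∈ f⁻¹(a)`, `y ∈ f⁻¹(b)`. -/
noncomputable def cableT [Finite C] (f : C → Option A) (a b : A) : DK C :=
  ∑ x ∈ fiber f a, ∑ y ∈ fiber f b, t x y

/-- `∑ s_x + ∑ t_{xy}` over the elements `x` and the two-element subsets `{x, y}` of `f⁻¹(a)`. (The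
double sum counts each two-element subset twice, and `t_{xx} = 0`.) -/
noncomputable def cableS [Finite C] (f : C → Option A) (a : A) : DK C :=
  ∑ x ∈ fiber f a, s x + (2⁻¹ : ℚ) • ∑ x ∈ fiber f a, ∑ y ∈ fiber f a, t x y

theorem cableT_symm [Finite C] (f : C → Option A) (a b : A) : cableT f a b = cableT f b a := by
  rw [cableT, cableT, Finset.sum_comm]
  exact Finset.sum_congr rfl fun _ _ => Finset.sum_congr rfl fun _ _ => t_symm _ _

theorem cableS_eq [Finite C] (f : C → Option A) (a : A) :
    cableS f a = ∑ x ∈ fiber f a, s x + (2⁻¹ : ℚ) • cableT f a a := rfl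

theorem lie_sum_sum {ι κ L : Type*} [LieRing L] (y : L) (X : Finset ι) (Y : Finset κ)
    (g : ι → κ → L) : ⁅y, ∑ a ∈ X, ∑ b ∈ Y, g a b⁆ = ∑ a ∈ X, ∑ b ∈ Y, ⁅y, g a b⁆ := by
  rw [lie_sum]
  exact Finset.sum_congr rfl fun _ _ => lie_sum _ _ _

theorem t_cableT [Finite C] (f : C → Option A) {a : A} {u v : C} (hu : u ∈ fiber f a)
    (hv : v ∈ fiber f a) {b c : A} (hbc : b ≠ c) : ⁅t u v, cableT f b c⁆ = 0 := by
  by_cases huv : u = v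
  · rw [huv, t_self, zero_lie]
  have key : ∀ {c}, a ≠ c → ⁅t u v, cableT f a c⁆ = 0 := by
    intro c hac
    rw [cableT, lie_sum_sum, Finset.sum_comm]
    exact Finset.sum_eq_zero fun w hw => t_pair_sum hu hv huv
      (ne_of_mem_fiber hac.symm hw hu) (ne_of_mem_fiber hac.symm hw hv)
  by_cases hab : a = b
  · subst hab; exact key hbc
  by_cases hac : a = c
  · subst hac; rw [cableT_symm]; exact key hab
  rw [cableT, lie_sum_sum]
  exact Finset.sum_eq_zero fun x hx => Finset.sum_eq_zero fun y hy =>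
    t_disj (ne_of_mem_fiber hab hu hx) (ne_of_mem_fiber hac hu hy) (ne_of_mem_fiber hab hv hx)
      (ne_of_mem_fiber hac hv hy)

theorem lie_s (x : DK A) (a : A) : ⁅x, s a⁆ = 0 := by
  rw [← lie_skew, s_central, neg_zero]

theorem t_cableS [Finite C] (f : C → Option A) {a : A} {u v : C} (hu : u ∈ fiber f a)
    (hv : v ∈ fiber f a) (b : A) : ⁅t u v, cableS f b⁆ = 0 := by
  by_cases huv : u = v
  · rw [huv, t_self, zero_lie]
  rw [cableS, lie_add, lie_sum, Finset.sum_eq_zero fun x _ => lie_s _ x, zero_add, lie_smul,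
    lie_sum_sum]
  by_cases hab : a = b
  · subst hab
    rw [t_total_sum hu hv huv, smul_zero]
  · rw [Finset.sum_eq_zero, smul_zero]
    exact fun x hx => Finset.sum_eq_zero fun y hy =>
      t_disj (ne_of_mem_fiber hab hu hx) (ne_of_mem_fiber hab hu hy) (ne_of_mem_fiber hab hv hx)
        (ne_of_mem_fiber hab hv hy)

theorem cableS_lie [Finite C] (f : C → Option A) (a : A) (y : DK C)
    (h : ∀ u ∈ fiber f a, ∀ v ∈ fiber f a, ⁅t u v, y⁆ = 0) : ⁅cableS f a, y⁆ = 0 := by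
  rw [cableS, add_lie, sum_lie, Finset.sum_eq_zero fun x _ => s_central x y, zero_add,
    smul_lie, sum_lie, Finset.sum_eq_zero, smul_zero]
  intro u hu
  rw [sum_lie]
  exact Finset.sum_eq_zero fun v hv => h u hu v hv

theorem cableT_disj [Finite C] (f : C → Option A) {a b c d : A} (hac : a ≠ c) (had : a ≠ d)
    (hbc : b ≠ c) (hbd : b ≠ d) : ⁅cableT f a b, cableT f c d⁆ = 0 := by
  rw [cableT, sum_lie]
  refine Finset.sum_eq_zero fun x hx => ?_
  rw [sum_lie]
  refine Finset.sum_eq_zero fun y hy => ?_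
  rw [cableT, lie_sum_sum]
  exact Finset.sum_eq_zero fun z hz => Finset.sum_eq_zero fun w hw =>
    t_disj (ne_of_mem_fiber hac hx hz) (ne_of_mem_fiber had hx hw) (ne_of_mem_fiber hbc hy hz)
      (ne_of_mem_fiber hbd hy hw)

theorem cableT_three [Finite C] (f : C → Option A) {a b c : A} (hab : a ≠ b) (hac : a ≠ c)
    (hbc : b ≠ c) : ⁅cableT f a c, cableT f a b + cableT f b c⁆ = 0 := by
  rw [cableT, sum_lie]
  refine Finset.sum_eq_zero fun x hx => ?_
  rw [sum_lie]
  refine Finset.sum_eq_zero fun z hz => ?_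
  have hxz := ne_of_mem_fiber hac hx hz
  rw [lie_add, cableT, cableT, lie_sum_sum, lie_sum_sum, Finset.sum_comm, ← Finset.sum_add_distrib]
  refine Finset.sum_eq_zero fun y hy => ?_
  have hxy := ne_of_mem_fiber hab hx hy
  have hyz := ne_of_mem_fiber hbc hy hz
  rw [Finset.sum_eq_single_of_mem x hx, Finset.sum_eq_single_of_mem z hz]
  · exact t_three hxy hxz hyz
  · intro w hw hne
    exact t_disj hxy (ne_of_mem_fiber hac hx hw) hyz.symm hne.symm
  · intro w hw hne
    exact t_disj hne.symm hxy (ne_of_mem_fiber hac hw hz).symm hyz.symm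

/-- The morphism `t̃_A → t̃_C` induced by a partially defined map `f` from `C` to `A` (replacing each
`a` by the elements of its fibre):
`t_{ab} ↦ ∑ t_{xy}` over `x ∈ f⁻¹(a)`, `y ∈ f⁻¹(b)`, and
`s_a ↦ ∑ s_x + ∑ t_{xy}` over `x ∈ f⁻¹(a)` and two-element subsets `{x, y} ⊆ f⁻¹(a)`. -/
noncomputable def cable [Finite C] (f : C → Option A) : DK A →ₗ⁅ℚ⁆ DK C :=
  lift (FreeLieAlgebra.lift ℚ (DKGen.rec (fun a b _ => cableT f a b) (fun a => cableS f a))) (by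
    have hT : ∀ a b h, FreeLieAlgebra.lift ℚ
      (DKGen.rec (fun a b _ => cableT f a b) (fun a => cableS f a)) (genT a b h) = cableT f a b :=
      fun a b h => FreeLieAlgebra.lift_of_apply _ _
    have hS : ∀ a, FreeLieAlgebra.lift ℚ
      (DKGen.rec (fun a b _ => cableT f a b) (fun a => cableS f a)) (genS a) = cableS f a :=
      fun a => FreeLieAlgebra.lift_of_apply _ _
    rintro r (⟨a, b, h⟩ | ⟨a, b, c, d, hab, hac, had, hbc, hbd, hcd⟩ | ⟨a, b, c, hab, hac, hbc⟩ |
      ⟨a, x⟩)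
    · rw [map_sub, hT, hT, cableT_symm, sub_self]
    · rw [LieHom.map_lie, hT, hT]
      exact cableT_disj f hac had hbc hbd
    · rw [LieHom.map_lie, map_add, hT, hT, hT]
      exact cableT_three f hab hac hbc
    · rw [LieHom.map_lie, hS]
      refine free_centralizes _ _ ?_ x
      rintro (⟨b, c, hbc⟩ | b)
      · rw [hT]
        exact cableS_lie f a _ fun u hu v hv => t_cableT f hu hv hbc
      · rw [hS]
        exact cableS_lie f a _ fun u hu v hv => t_cableS f hu hv b)

theorem cable_t [Finite C] (f : C → Option A) {a b : A} (h : a ≠ b) :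
    cable f (t a b) = ∑ x ∈ fiber f a, ∑ y ∈ fiber f b, t x y := by
  rw [t_of_ne h]
  exact FreeLieAlgebra.lift_of_apply _ _

theorem cable_s [Finite C] (f : C → Option A) (a : A) :
    cable f (s a) =
      ∑ x ∈ fiber f a, s x + (2⁻¹ : ℚ) • ∑ x ∈ fiber f a, ∑ y ∈ fiber f a, t x y :=
  FreeLieAlgebra.lift_of_apply _ _

theorem fiber_some [Finite A] (a : A) : fiber (some : A → Option A) a = {a} := by
  ext x; simp [mem_fiber]

theorem cable_some [Finite A] : cable (some : A → Option A) = LieHom.id := by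
  apply hom_ext
  · intro a b h
    rw [cable_t _ h, fiber_some, fiber_some, Finset.sum_singleton, Finset.sum_singleton]; rfl
  · intro a
    rw [cable_s, fiber_some, Finset.sum_singleton, Finset.sum_singleton, Finset.sum_singleton,
      t_self, smul_zero, add_zero]; rfl

theorem sum_fiber_bind [Finite C] [Finite D] {M : Type*} [AddCommMonoid M] (g : C → Option A)
    (f : D → Option C) (a : A) (φ : D → M) :
    ∑ x ∈ fiber g a, ∑ u ∈ fiber f x, φ u = ∑ u ∈ fiber (fun d => (f d).bind g) a, φ u := by
  classical
  rw [← Finset.sum_biUnion]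
  · refine Finset.sum_congr ?_ fun _ _ => rfl
    ext u
    simp only [Finset.mem_biUnion, mem_fiber, Option.bind_eq_some_iff]
    exact ⟨fun ⟨x, h1, h2⟩ => ⟨x, h2, h1⟩, fun ⟨x, h1, h2⟩ => ⟨x, h2, h1⟩⟩
  · intro x _ y _ hxy
    exact Finset.disjoint_left.mpr fun u hu hu' => ne_of_mem_fiber hxy hu hu' rfl

theorem sum_cableT_bind [Finite C] [Finite D] (g : C → Option A) (f : D → Option C) (a b : A) :
    ∑ x ∈ fiber g a, ∑ y ∈ fiber g b, cableT f x y = cableT (fun d => (f d).bind g) a b := by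
  rw [cableT, ← sum_fiber_bind]
  refine Finset.sum_congr rfl fun x _ => ?_
  simp only [cableT]
  rw [Finset.sum_comm]
  exact Finset.sum_congr rfl fun u _ => sum_fiber_bind g f b _

theorem cable_bind [Finite C] [Finite D] (g : C → Option A) (f : D → Option C) (x : DK A) :
    cable f (cable g x) = cable (fun d => (f d).bind g) x := by
  have h : (cable f).comp (cable g) = cable (fun d => (f d).bind g) := by
    apply hom_ext
    · intro a b hab
      rw [LieHom.comp_apply, cable_t _ hab, cable_t _ hab, map_sum]
      refine (Finset.sum_congr rfl fun x hx => ?_).trans (sum_cableT_bind g f a b)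
      rw [map_sum]
      exact Finset.sum_congr rfl fun y hy => cable_t f (ne_of_mem_fiber hab hx hy)
    · intro a
      have h2 : ∀ x ∈ fiber g a, cable f (s x) + (2⁻¹ : ℚ) • ∑ y ∈ fiber g a, cable f (t x y) =
          ∑ u ∈ fiber f x, s u + (2⁻¹ : ℚ) • ∑ y ∈ fiber g a, cableT f x y := by
        classical
        intro x hx
        rw [← Finset.add_sum_erase _ _ hx, ← Finset.add_sum_erase _ _ hx, t_self, map_zero,
          zero_add, cable_s, smul_add, ← add_assoc]
        congr 2
        exact Finset.sum_congr rfl fun y hy => cable_t f (Finset.ne_of_mem_erase hy).symm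
      rw [LieHom.comp_apply, cable_s, cable_s, map_add, map_smul, map_sum, map_sum,
        ← sum_fiber_bind]
      simp only [map_sum]
      rw [Finset.smul_sum, ← Finset.sum_add_distrib, Finset.sum_congr rfl h2,
        Finset.sum_add_distrib, ← Finset.smul_sum, sum_cableT_bind]
      rfl
  exact LieHom.congr_fun h x

/-! #### The operadic structure on `t̃` -/

/-- The map `(A - {a}) ⊔ B → A` sending all of `B` to `a`. -/
def toLeft (a : A) : Ins a B → Option A
  | Sum.inl x => some x.1
  | Sum.inr _ => some a

/-- The partially defined map `(A - {a}) ⊔ B → B` that is the identity on `B`. -/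
def toRight (a : A) : Ins a B → Option B
  | Sum.inl _ => none
  | Sum.inr y => some y

theorem fiber_toRight [Finite A] [Finite B] (a : A) (y : B) :
    fiber (toRight a : Ins a B → Option B) y = {Sum.inr y} := by
  ext (x | x) <;> simp [mem_fiber, toRight]

theorem circ_commute [Finite A] [Finite B] (a : A) (x : DK A) (y : DK B) :
    ⁅cable (toLeft a : Ins a B → Option A) x, cable (toRight a : Ins a B → Option B) y⁆ = 0 := by
  have hm : ∀ y : B, Sum.inr y ∈ fiber (toLeft a : Ins a B → Option A) a :=
    fun y => mem_fiber.mpr rfl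
  have ht : ∀ (u v : B) (x : DK A),
      ⁅t (Sum.inr u : Ins a B) (Sum.inr v), cable (toLeft a : Ins a B → Option A) x⁆ = 0 := by
    intro u v x
    refine centralizes _ _ ?_ ?_ x
    · intro b c hbc
      rw [cable_t _ hbc]
      exact t_cableT _ (hm u) (hm v) hbc
    · intro b
      rw [cable_s]
      exact t_cableS _ (hm u) (hm v) b
  refine centralizes _ _ ?_ ?_ y
  · intro u v huv
    rw [cable_t _ huv, fiber_toRight, fiber_toRight, Finset.sum_singleton, Finset.sum_singleton,
      ← lie_skew, ht, neg_zero]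
  · intro u
    rw [cable_s, fiber_toRight, Finset.sum_singleton, Finset.sum_singleton, Finset.sum_singleton,
      t_self, smul_zero, add_zero, lie_s]

/-- The operadic composition `∘_a : t̃_A ⊕ t̃_B → t̃_{(A - {a}) ⊔ B}`. -/
noncomputable def circ [Finite A] [Finite B] (a : A) : DK A × DK B →ₗ⁅ℚ⁆ DK (Ins a B) where
  toFun p := cable (toLeft a) p.1 + cable (toRight a) p.2
  map_add' p q := by
    rw [Prod.fst_add, Prod.snd_add, map_add, map_add]; abel
  map_smul' c p := by
    rw [Prod.smul_fst, Prod.smul_snd, map_smul, map_smul, RingHom.id_apply, smul_add]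
  map_lie' {p q} := by
    rw [LieAlgebra.Prod.bracket_apply, add_lie, lie_add, lie_add, circ_commute,
      ← lie_skew (cable (toRight a) p.2), circ_commute, LieHom.map_lie, LieHom.map_lie]
    abel

theorem fiber_toLeft_ne [Finite A] [Finite B] {a x : A} (h : x ≠ a) :
    fiber (toLeft a : Ins a B → Option A) x = {Sum.inl ⟨x, h⟩} := by
  ext (y | y)
  · simp [mem_fiber, toLeft, Subtype.ext_iff]
  · simp [mem_fiber, toLeft, h.symm]

theorem sum_fiber_toLeft_self [Finite A] [Fintype B] {M : Type*} [AddCommMonoid M] (a : A)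
    (φ : Ins a B → M) : ∑ x ∈ fiber (toLeft a : Ins a B → Option A) a, φ x =
      ∑ y : B, φ (Sum.inr y) := by
  classical
  have : fiber (toLeft a : Ins a B → Option A) a = Finset.univ.image Sum.inr := by
    ext (y | y)
    · simpa [mem_fiber, toLeft] using y.2
    · simp [mem_fiber, toLeft]
  rw [this, Finset.sum_image fun _ _ _ _ h => Sum.inr_injective h]

theorem circ_t_left [Finite A] [Finite B] {a x y : A} (hx : x ≠ a) (hy : y ≠ a) :
    circ a (t x y, (0 : DK B)) = t (Sum.inl ⟨x, hx⟩) (Sum.inl ⟨y, hy⟩) := by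
  change cable (toLeft a) (t x y) + cable (toRight a) (0 : DK B) = _
  rw [map_zero, add_zero]
  by_cases h : x = y
  · subst h; rw [t_self, t_self, map_zero]
  · rw [cable_t _ h, fiber_toLeft_ne hx, fiber_toLeft_ne hy, Finset.sum_singleton,
      Finset.sum_singleton]

theorem circ_s_left [Finite A] [Finite B] {a x : A} (hx : x ≠ a) :
    circ a (s x, (0 : DK B)) = s (Sum.inl ⟨x, hx⟩) := by
  change cable (toLeft a) (s x) + cable (toRight a) (0 : DK B) = _
  rw [map_zero, add_zero, cable_s, fiber_toLeft_ne hx, Finset.sum_singleton,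
      Finset.sum_singleton, Finset.sum_singleton, t_self, smul_zero, add_zero]

theorem circ_t_right [Finite A] [Finite B] (a : A) (x y : B) :
    circ a ((0 : DK A), t x y) = t (Sum.inr x) (Sum.inr y) := by
  change cable (toLeft a) (0 : DK A) + cable (toRight a) (t x y) = _
  rw [map_zero, zero_add]
  by_cases h : x = y
  · subst h; rw [t_self, t_self, map_zero]
  · rw [cable_t _ h, fiber_toRight, fiber_toRight, Finset.sum_singleton,
      Finset.sum_singleton]

theorem circ_s_right [Finite A] [Finite B] (a : A) (x : B) :
    circ a ((0 : DK A), s x) = s (Sum.inr x) := by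
  change cable (toLeft a) (0 : DK A) + cable (toRight a) (s x) = _
  rw [map_zero, zero_add, cable_s, fiber_toRight, Finset.sum_singleton,
      Finset.sum_singleton, Finset.sum_singleton, t_self, smul_zero, add_zero]

theorem circ_t_self [Finite A] [Fintype B] {a x : A} (hx : x ≠ a) :
    circ a (t a x, (0 : DK B)) = ∑ y : B, t (Sum.inl ⟨x, hx⟩) (Sum.inr y) := by
  change cable (toLeft a) (t a x) + cable (toRight a) (0 : DK B) = _
  rw [map_zero, add_zero, cable_t _ hx.symm, fiber_toLeft_ne hx, sum_fiber_toLeft_self]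
  exact Finset.sum_congr rfl fun y _ => by rw [Finset.sum_singleton, t_symm]

theorem circ_s_self [Finite A] [Fintype B] (a : A) :
    circ a (s a, (0 : DK B)) = ∑ y : B, s (Sum.inr y) +
      (2⁻¹ : ℚ) • ∑ x : B, ∑ y : B, t (Sum.inr x : Ins a B) (Sum.inr y) := by
  change cable (toLeft a) (s a) + cable (toRight a) (0 : DK B) = _
  rw [map_zero, add_zero, cable_s, sum_fiber_toLeft_self, sum_fiber_toLeft_self]
  congr 2
  exact Finset.sum_congr rfl fun y _ => sum_fiber_toLeft_self _ _

/-- The relabelling of `t̃` along a bijection: `t_{ab} ↦ t_{e(a)e(b)}`, `s_a ↦ s_{e(a)}`. -/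
noncomputable def relabel [Finite B] (e : A ≃ B) : DK A →ₗ⁅ℚ⁆ DK B :=
  cable fun b => some (e.symm b)

theorem fiber_symm [Finite B] (e : A ≃ B) (a : A) : fiber (fun b => some (e.symm b)) a = {e a} := by
  ext b
  simp [mem_fiber, Equiv.symm_apply_eq]

theorem relabel_t [Finite B] (e : A ≃ B) (a b : A) : relabel e (t a b) = t (e a) (e b) := by
  by_cases h : a = b
  · subst h; rw [t_self, t_self, map_zero]
  · rw [relabel, cable_t _ h, fiber_symm, fiber_symm, Finset.sum_singleton, Finset.sum_singleton]

theorem relabel_s [Finite B] (e : A ≃ B) (a : A) : relabel e (s a) = s (e a) := by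
  rw [relabel, cable_s, fiber_symm, Finset.sum_singleton, Finset.sum_singleton,
    Finset.sum_singleton, t_self, smul_zero, add_zero]

end

end DK

/-! ### The operad `⋀ t̃` -/

namespace CE

open ExteriorAlgebra (ι)

theorem ι_mul_comm {L : Type u} [LieRing L] [LieAlgebra ℚ L] (x : L) (j : ℕ)
    (v : ExteriorAlgebra ℚ L) (hv : v ∈ ⋀[ℚ]^j L) :
    ι ℚ x * v = (-1 : ℚ) ^ j • (v * ι ℚ x) := by
  refine gr_induction (P := fun j v => ι ℚ x * v = (-1 : ℚ) ^ j • (v * ι ℚ x)) ?_ ?_ ?_ j v hv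
  · intro r
    rw [pow_zero, one_smul, Algebra.commutes]
  · intro n v w hv hw
    rw [mul_add, hv, hw, add_mul, smul_add]
  · intro n y w _ h
    rw [ι_swap_mul, h, mul_smul_comm, pow_succ, mul_assoc]
    module

theorem graded_comm {L : Type u} [LieRing L] [LieAlgebra ℚ L] (i j : ℕ)
    (v w : ExteriorAlgebra ℚ L) (hv : v ∈ ⋀[ℚ]^i L) (hw : w ∈ ⋀[ℚ]^j L) :
    v * w = (-1 : ℚ) ^ (i * j) • (w * v) := by
  refine gr_induction (P := fun i v => v * w = (-1 : ℚ) ^ (i * j) • (w * v)) ?_ ?_ ?_ i v hv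
  · intro r
    rw [zero_mul, pow_zero, one_smul, Algebra.commutes]
  · intro n v v' h h'
    rw [add_mul, h, h', mul_add, smul_add]
  · intro n y v _ h
    rw [mul_assoc, h, mul_smul_comm, ← mul_assoc, ι_mul_comm y j w hw, smul_mul_assoc, smul_smul,
      mul_assoc, ← pow_add, add_mul, one_mul]

end CE

namespace DK

variable {A B C D : Type u}

/-- The algebra morphism `⋀ t̃_A → ⋀ t̃_C` induced by `cable f`. -/
noncomputable abbrev wcable [Finite C] (f : C → Option A) :
    ExteriorAlgebra ℚ (DK A) →ₐ[ℚ] ExteriorAlgebra ℚ (DK C) :=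
  ExteriorAlgebra.map (cable f : DK A →ₗ[ℚ] DK C)

theorem wcable_bind [Finite C] [Finite D] (g : C → Option A) (f : D → Option C)
    (x : ExteriorAlgebra ℚ (DK A)) :
    wcable f (wcable g x) = wcable (fun d => (f d).bind g) x := by
  rw [wcable, wcable, ← AlgHom.comp_apply, ExteriorAlgebra.map_comp_map]
  congr 2
  ext x
  exact cable_bind g f x

theorem mapHom_relabel [Finite B] (e : A ≃ B) (x : ExteriorAlgebra ℚ (DK A)) :
    CE.mapHom (relabel e) x = wcable (fun b => some (e.symm b)) x := rfl

theorem mapProd_circ [Finite A] [Finite B] (a : A) (x : ExteriorAlgebra ℚ (DK A))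
    (y : ExteriorAlgebra ℚ (DK B)) :
    CE.mapProd (circ a) x y = wcable (toLeft a) x * wcable (toRight a) y := by
  have h1 : (circ a).comp (LieHom.inl ℚ (DK A) (DK B)) = cable (toLeft a) := by
    ext x
    change cable (toLeft a) x + cable (toRight a) (0 : DK B) = _
    rw [map_zero, add_zero]
  have h2 : (circ a).comp (LieHom.inr ℚ (DK A) (DK B)) = cable (toRight a) := by
    ext x
    change cable (toLeft a) (0 : DK A) + cable (toRight a) x = _
    rw [map_zero, zero_add]
  rw [CE.mapProd, LinearMap.mk₂_apply, h1, h2]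

theorem wedge_map_comp {A' B' : Type u} [Finite A] [Finite A'] [Finite B] [Finite B'] (e : A ≃ A')
    (f : B ≃ B') (a : A) (x : ExteriorAlgebra ℚ (DK A)) (y : ExteriorAlgebra ℚ (DK B)) :
    wcable (fun b => some ((Ins.congr e f a).symm b)) (CE.mapProd (circ a) x y) =
      CE.mapProd (circ (e a)) (wcable (fun b => some (e.symm b)) x)
        (wcable (fun b => some (f.symm b)) y) := by
  rw [mapProd_circ, mapProd_circ, map_mul, wcable_bind, wcable_bind, wcable_bind, wcable_bind]
  congr 3
  · ext1 (z | z)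
    · rfl
    · simp [toLeft, Ins.congr]
  · ext1 (z | z) <;> rfl

theorem wedge_assoc_seq [Finite A] [Finite B] [Finite D] (a : A) (b : B)
    (x : ExteriorAlgebra ℚ (DK A)) (y : ExteriorAlgebra ℚ (DK B)) (z : ExteriorAlgebra ℚ (DK D)) :
    wcable (fun c => some ((Ins.seq a b).symm c))
      (CE.mapProd (circ (Sum.inr b : Ins a B)) (CE.mapProd (circ a) x y) z) =
      CE.mapProd (circ a) x (CE.mapProd (circ b) y z) := by
  simp only [mapProd_circ, map_mul, wcable_bind]
  rw [mul_assoc]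
  congr 3
  · ext1 (z | z | z) <;> rfl
  · congr 3
    ext1 (z | z | z) <;> rfl
  · congr 3
    ext1 (z | z | z) <;> rfl

theorem wedge_assoc_par [Finite A] [Finite B] [Finite D] (a a' : A) (h : a ≠ a') (j k : ℕ)
    (x : ExteriorAlgebra ℚ (DK A)) (y : ExteriorAlgebra ℚ (DK B)) (z : ExteriorAlgebra ℚ (DK D))
    (hy : y ∈ ⋀[ℚ]^j (DK B)) (hz : z ∈ ⋀[ℚ]^k (DK D)) :
    wcable (fun c => some ((Ins.par a a' h).symm c))
      (CE.mapProd (circ (Sum.inl ⟨a', h.symm⟩ : Ins a B)) (CE.mapProd (circ a) x y) z) =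
      (-1 : ℚ) ^ (j * k) •
        CE.mapProd (circ (Sum.inl ⟨a, h⟩ : Ins a' D)) (CE.mapProd (circ a') x z) y := by
  simp only [mapProd_circ, map_mul, wcable_bind]
  rw [mul_assoc, mul_assoc, CE.graded_comm j k _ _ (CE.map_mem_gr _ j y hy)
    (CE.map_mem_gr _ k z hz), mul_smul_comm]
  congr 4
  · ext1 (⟨z | z, hz⟩ | z) <;> rfl
  · congr 3
    ext1 (⟨z | z, hz⟩ | z) <;> rfl
  · congr 3
    ext1 (⟨z | z, hz⟩ | z) <;> rfl

end DK

open DK in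
/-- The operad `⋀ t̃` of chain complexes: `A ↦ ⋀ t̃_A` with the Chevalley-Eilenberg differential, and
with the compositions induced by the morphisms of Lie algebras
`∘_a : t̃_A ⊕ t̃_B → t̃_{(A - {a}) ⊔ B}`. -/
noncomputable def wedgeDK : Operad.{u} where
  obj A _ := CE.complex (DK A)
  map e := CE.mapHom (relabel e)
  map_refl A _ x := by
    change wcable (some : A → Option A) x = x
    rw [wcable, cable_some]
    exact AlgHom.congr_fun ExteriorAlgebra.map_id x
  map_trans e f x := (wcable_bind (fun b => some (e.symm b)) (fun b => some (f.symm b)) x).symm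
  comp a := CE.mapProd (circ a)
  comp_gr a i j x y hx hy := CE.mapProd_gr (circ a) i j x y hx hy
  comp_d a i x y hx := CE.mapProd_d (circ a) i x y hx
  map_comp e f a x y := wedge_map_comp e f a x y
  assoc_seq a b x y z := wedge_assoc_seq a b x y z
  assoc_par a a' h j k x y z hy hz := wedge_assoc_par a a' h j k x y z hy hz

/-! ### Expressions in Batalin-Vilkovisky algebras -/

/-- Formal expressions built from variables in `A` by the operations of a BV algebra: the product
`x y`, the bracket `[x, y]` and the operator `Δ x`; if `un = true`, also the unit `1`. -/
inductive BVExpr (un : Bool) (A : Type u) : Type u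
  | one (h : un = true) : BVExpr un A
  | var (a : A) : BVExpr un A
  | mul (x y : BVExpr un A) : BVExpr un A
  | br (x y : BVExpr un A) : BVExpr un A
  | del (x : BVExpr un A) : BVExpr un A

namespace BVExpr

variable {un : Bool} {A : Type u}

/-- The (homological) degree: variables have degree `0`, the product has degree `0`, and the
bracket and `Δ` have degree `1`. -/
def deg : BVExpr un A → ℕ
  | one _ => 0
  | var _ => 0
  | mul x y => deg x + deg y
  | br x y => deg x + deg y + 1
  | del x => deg x + 1

/-- The multiset of variables, with multiplicities. -/
def vars : BVExpr un A → Multiset A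
  | one _ => 0
  | var a => {a}
  | mul x y => vars x + vars y
  | br x y => vars x + vars y
  | del x => vars x

/-- An expression containing each element of `A` exactly once. -/
def IsMultilinear (x : BVExpr un A) : Prop := x.vars.Nodup ∧ ∀ a, a ∈ x.vars

end BVExpr

open BVExpr Finsupp in
/-- The relations of (graded) BV algebras, as linear combinations of expressions that are set to
zero: those of a graded commutative associative algebra, of a graded Lie algebra on the shifted
space, the Leibniz rule, `Δ² = 0` and the formula expressing the bracket through `Δ`; closed under
applying the operations. -/
inductive BVRel {un : Bool} {A : Type u} : (BVExpr un A →₀ ℚ) → Prop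
  | one_mul (h : un = true) (x : BVExpr un A) :
      BVRel (single (mul (one h) x) 1 - single x 1)
  | mul_comm (x y : BVExpr un A) :
      BVRel (single (mul x y) 1 - (-1 : ℚ) ^ (deg x * deg y) • single (mul y x) 1)
  | mul_assoc (x y z : BVExpr un A) :
      BVRel (single (mul (mul x y) z) 1 - single (mul x (mul y z)) 1)
  | br_skew (x y : BVExpr un A) :
      BVRel (single (br x y) 1 +
        (-1 : ℚ) ^ ((deg x + 1) * (deg y + 1)) • single (br y x) 1)
  | jacobi (x y z : BVExpr un A) :
      BVRel (single (br x (br y z)) 1 - single (br (br x y) z) 1 -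
        (-1 : ℚ) ^ ((deg x + 1) * (deg y + 1)) • single (br y (br x z)) 1)
  | leibniz (x y z : BVExpr un A) :
      BVRel (single (br x (mul y z)) 1 - single (mul (br x y) z) 1 -
        (-1 : ℚ) ^ ((deg x + 1) * deg y) • single (mul y (br x z)) 1)
  | del_del (x : BVExpr un A) : BVRel (single (del (del x)) 1)
  | br_eq (x y : BVExpr un A) :
      BVRel (single (br x y) 1 - (-1 : ℚ) ^ deg x • single (del (mul x y)) 1 +
        (-1 : ℚ) ^ deg x • single (mul (del x) y) 1 + single (mul x (del y)) 1)
  | mul_left (w : BVExpr un A) (r : BVExpr un A →₀ ℚ) :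
      BVRel r → BVRel (lmapDomain ℚ ℚ (fun x => mul w x) r)
  | mul_right (w : BVExpr un A) (r : BVExpr un A →₀ ℚ) :
      BVRel r → BVRel (lmapDomain ℚ ℚ (fun x => mul x w) r)
  | br_left (w : BVExpr un A) (r : BVExpr un A →₀ ℚ) :
      BVRel r → BVRel (lmapDomain ℚ ℚ (fun x => br w x) r)
  | br_right (w : BVExpr un A) (r : BVExpr un A →₀ ℚ) :
      BVRel r → BVRel (lmapDomain ℚ ℚ (fun x => br x w) r)
  | del (r : BVExpr un A →₀ ℚ) : BVRel r → BVRel (lmapDomain ℚ ℚ (fun x => del x) r)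

/-- The span of the relations. -/
noncomputable def bvRelations (un : Bool) (A : Type u) : Submodule ℚ (BVExpr un A →₀ ℚ) :=
  Submodule.span ℚ {r | BVRel r}

/-- The free BV algebra on the set `A` of variables of degree `0`. -/
abbrev FreeBV (un : Bool) (A : Type u) : Type u := (BVExpr un A →₀ ℚ) ⧸ bvRelations un A

namespace FreeBV

open BVExpr

section

variable {un : Bool} {A B C D : Type u}

/-- The element of the free BV algebra given by an expression. -/
noncomputable def mk (x : BVExpr un A) : FreeBV un A :=
  (bvRelations un A).mkQ (Finsupp.single x 1)

theorem mkQ_single (x : BVExpr un A) (c : ℚ) :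
    (bvRelations un A).mkQ (Finsupp.single x c) = c • mk x := by
  rw [mk, ← map_smul, Finsupp.smul_single, smul_eq_mul, mul_one]

theorem mkQ_eq_zero {r : BVExpr un A →₀ ℚ} (h : BVRel r) : (bvRelations un A).mkQ r = 0 :=
  (Submodule.Quotient.mk_eq_zero _).mpr (Submodule.subset_span h)

theorem induction {P : FreeBV un A → Prop} (h0 : P 0) (ha : ∀ x y, P x → P y → P (x + y))
    (hs : ∀ (c : ℚ) x, P x → P (c • x)) (hm : ∀ t, P (mk t)) (x : FreeBV un A) : P x := by
  obtain ⟨r, rfl⟩ := Submodule.mkQ_surjective _ x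
  induction r using Finsupp.induction_linear with
  | zero => rw [map_zero]; exact h0
  | add f g hf hg => rw [map_add]; exact ha _ _ hf hg
  | single t c => rw [mkQ_single]; exact hs c _ (hm t)

/-- The linear map on the free BV algebra given by a function on expressions whose linear extension
kills the relations. -/
noncomputable def lift {M : Type*} [AddCommGroup M] [Module ℚ M] (f : BVExpr un A → M)
    (h : ∀ r, BVRel r → Finsupp.linearCombination ℚ f r = 0) : FreeBV un A →ₗ[ℚ] M :=
  (bvRelations un A).liftQ (Finsupp.linearCombination ℚ f) (Submodule.span_le.mpr h)

theorem lift_mk {M : Type*} [AddCommGroup M] [Module ℚ M] (f : BVExpr un A → M)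
    (h : ∀ r, BVRel r → Finsupp.linearCombination ℚ f r = 0) (t : BVExpr un A) :
    lift f h (mk t) = f t := by
  change Finsupp.linearCombination ℚ f (Finsupp.single t 1) = f t
  rw [Finsupp.linearCombination_single, one_smul]

theorem linearCombination_mk (r : BVExpr un A →₀ ℚ) :
    Finsupp.linearCombination ℚ mk r = (bvRelations un A).mkQ r := by
  induction r using Finsupp.induction_linear with
  | zero => rw [map_zero, map_zero]
  | add f g hf hg => rw [map_add, map_add, hf, hg]
  | single t c => rw [mkQ_single, Finsupp.linearCombination_single]

/-- The bilinear operation on the free BV algebra given by an operation on expressions. -/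
noncomputable def binOp (op : BVExpr un A → BVExpr un A → BVExpr un A)
    (hl : ∀ w r, BVRel r → BVRel (Finsupp.lmapDomain ℚ ℚ (fun x => op w x) r))
    (hr : ∀ w r, BVRel r → BVRel (Finsupp.lmapDomain ℚ ℚ (fun x => op x w) r)) :
    FreeBV un A →ₗ[ℚ] FreeBV un A →ₗ[ℚ] FreeBV un A :=
  lift (fun s => lift (fun t => mk (op s t)) fun r h => by
      have := mkQ_eq_zero (hl s r h)
      rwa [← linearCombination_mk, Finsupp.lmapDomain_apply,
        Finsupp.linearCombination_mapDomain] at this)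
    fun r h => by
      refine LinearMap.ext fun x => ?_
      refine induction (P := fun x => _ = (0 : FreeBV un A →ₗ[ℚ] FreeBV un A) x) ?_ ?_ ?_ ?_ x
      · rw [map_zero, map_zero]
      · intro x y hx hy; rw [map_add, hx, hy, map_add]
      · intro c x hx; rw [map_smul, hx, map_smul]
      · intro t
        have := mkQ_eq_zero (hr t r h)
        rw [← linearCombination_mk, Finsupp.lmapDomain_apply,
          Finsupp.linearCombination_mapDomain] at this
        rw [LinearMap.zero_apply]
        refine Eq.trans ?_ this
        simp only [Finsupp.linearCombination_apply, Finsupp.sum, LinearMap.sum_apply,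
          LinearMap.smul_apply, lift_mk, Function.comp_apply]

/-- The product of the free BV algebra. -/
noncomputable def fmul : FreeBV un A →ₗ[ℚ] FreeBV un A →ₗ[ℚ] FreeBV un A :=
  binOp mul BVRel.mul_left BVRel.mul_right

/-- The bracket of the free BV algebra. -/
noncomputable def fbr : FreeBV un A →ₗ[ℚ] FreeBV un A →ₗ[ℚ] FreeBV un A :=
  binOp br BVRel.br_left BVRel.br_right

/-- The operator `Δ` of the free BV algebra. -/
noncomputable def fdel : FreeBV un A →ₗ[ℚ] FreeBV un A :=
  lift (fun t => mk (del t)) fun r h => by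
    have := mkQ_eq_zero (BVRel.del r h)
    rwa [← linearCombination_mk, Finsupp.lmapDomain_apply,
      Finsupp.linearCombination_mapDomain] at this

theorem fmul_mk (s t : BVExpr un A) : fmul (mk s) (mk t) = mk (mul s t) := by
  rw [fmul, binOp, lift_mk, lift_mk]

theorem fbr_mk (s t : BVExpr un A) : fbr (mk s) (mk t) = mk (br s t) := by
  rw [fbr, binOp, lift_mk, lift_mk]

theorem fdel_mk (t : BVExpr un A) : fdel (mk t) = mk (del t) := by
  rw [fdel, lift_mk]

/-! #### The grading by degree -/

/-- The homogeneous part of degree `n` of the free BV algebra. -/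
noncomputable def gr (un : Bool) (A : Type u) (n : ℕ) : Submodule ℚ (FreeBV un A) :=
  Submodule.span ℚ (mk '' {t | deg t = n})

theorem mk_mem_gr (t : BVExpr un A) : mk t ∈ gr un A (deg t) :=
  Submodule.subset_span ⟨t, rfl, rfl⟩

theorem gr_induction {n : ℕ} {P : FreeBV un A → Prop} (h0 : P 0)
    (ha : ∀ x y, P x → P y → P (x + y)) (hs : ∀ (c : ℚ) x, P x → P (c • x))
    (hm : ∀ t, deg t = n → P (mk t)) {x : FreeBV un A} (hx : x ∈ gr un A n) : P x := by
  refine Submodule.span_induction ?_ h0 (fun x y _ _ => ha x y) (fun c x _ => hs c x) hx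
  rintro _ ⟨t, ht, rfl⟩
  exact hm t ht

theorem fmul_mem_gr {i j : ℕ} {x y : FreeBV un A} (hx : x ∈ gr un A i) (hy : y ∈ gr un A j) :
    fmul x y ∈ gr un A (i + j) := by
  refine gr_induction (P := fun x => fmul x y ∈ gr un A (i + j)) ?_ ?_ ?_ ?_ hx
  · rw [map_zero]; exact zero_mem _
  · intro x x' h h'; rw [map_add]; exact add_mem h h'
  · intro c x h; rw [map_smul]; exact Submodule.smul_mem _ c h
  rintro s rfl
  refine gr_induction (P := fun y => fmul (mk s) y ∈ gr un A (deg s + j)) ?_ ?_ ?_ ?_ hy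
  · rw [map_zero]; exact zero_mem _
  · intro x x' h h'; rw [map_add]; exact add_mem h h'
  · intro c x h; rw [map_smul]; exact Submodule.smul_mem _ c h
  rintro t rfl
  rw [fmul_mk]; exact mk_mem_gr (mul s t)

theorem fbr_mem_gr {i j : ℕ} {x y : FreeBV un A} (hx : x ∈ gr un A i) (hy : y ∈ gr un A j) :
    fbr x y ∈ gr un A (i + j + 1) := by
  refine gr_induction (P := fun x => fbr x y ∈ gr un A (i + j + 1)) ?_ ?_ ?_ ?_ hx
  · rw [map_zero]; exact zero_mem _
  · intro x x' h h'; rw [map_add]; exact add_mem h h'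
  · intro c x h; rw [map_smul]; exact Submodule.smul_mem _ c h
  rintro s rfl
  refine gr_induction (P := fun y => fbr (mk s) y ∈ gr un A (deg s + j + 1)) ?_ ?_ ?_ ?_ hy
  · rw [map_zero]; exact zero_mem _
  · intro x x' h h'; rw [map_add]; exact add_mem h h'
  · intro c x h; rw [map_smul]; exact Submodule.smul_mem _ c h
  rintro t rfl
  rw [fbr_mk]; exact mk_mem_gr (br s t)

theorem fdel_mem_gr {i : ℕ} {x : FreeBV un A} (hx : x ∈ gr un A i) :
    fdel x ∈ gr un A (i + 1) := by
  refine gr_induction (P := fun x => fdel x ∈ gr un A (i + 1)) ?_ ?_ ?_ ?_ hx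
  · rw [map_zero]; exact zero_mem _
  · intro x x' h h'; rw [map_add]; exact add_mem h h'
  · intro c x h; rw [map_smul]; exact Submodule.smul_mem _ c h
  rintro s rfl
  rw [fdel_mk]; exact mk_mem_gr (del s)

/-! #### The identities of a BV algebra -/

theorem ext₁ {M : Type*} [AddCommGroup M] [Module ℚ M] {i : ℕ} {f g : FreeBV un A →ₗ[ℚ] M}
    (h : ∀ t, deg t = i → f (mk t) = g (mk t)) {x : FreeBV un A} (hx : x ∈ gr un A i) :
    f x = g x := by
  refine gr_induction (P := fun x => f x = g x) ?_ ?_ ?_ h hx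
  · rw [map_zero, map_zero]
  · intro x y hx hy; rw [map_add, map_add, hx, hy]
  · intro c x hx; rw [map_smul, map_smul, hx]

theorem ext_all {M : Type*} [AddCommGroup M] [Module ℚ M] {f g : FreeBV un A →ₗ[ℚ] M}
    (h : ∀ t, f (mk t) = g (mk t)) : f = g := by
  refine LinearMap.ext fun x => ?_
  refine induction (P := fun x => f x = g x) ?_ ?_ ?_ h x
  · rw [map_zero, map_zero]
  · intro x y hx hy; rw [map_add, map_add, hx, hy]
  · intro c x hx; rw [map_smul, map_smul, hx]

theorem fone_mul (h : un = true) (x : FreeBV un A) : fmul (mk (one h)) x = x := by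
  have : fmul (mk (one h)) = (LinearMap.id : FreeBV un A →ₗ[ℚ] FreeBV un A) := by
    refine ext_all fun t => ?_
    have := mkQ_eq_zero (BVRel.one_mul h t)
    rw [map_sub, sub_eq_zero] at this
    rw [fmul_mk]
    exact this
  rw [this, LinearMap.id_apply]

theorem fmul_comm {i j : ℕ} {x y : FreeBV un A} (hx : x ∈ gr un A i) (hy : y ∈ gr un A j) :
    fmul x y = (-1 : ℚ) ^ (i * j) • fmul y x := by
  refine ext₁ (f := fmul.flip y) (g := (-1 : ℚ) ^ (i * j) • fmul y) ?_ hx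
  rintro s rfl
  refine ext₁ (f := fmul (mk s)) (g := (-1 : ℚ) ^ (deg s * j) • fmul.flip (mk s)) ?_ hy
  rintro t rfl
  have := mkQ_eq_zero (BVRel.mul_comm s t)
  rw [map_sub, map_smul, sub_eq_zero] at this
  rw [LinearMap.smul_apply, LinearMap.flip_apply, fmul_mk, fmul_mk]
  exact this

theorem fmul_assoc (x y z : FreeBV un A) : fmul (fmul x y) z = fmul x (fmul y z) := by
  have key : ∀ r s t : BVExpr un A,
      fmul (fmul (mk r) (mk s)) (mk t) = fmul (mk r) (fmul (mk s) (mk t)) := by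
    intro r s t
    have := mkQ_eq_zero (BVRel.mul_assoc r s t)
    rw [map_sub, sub_eq_zero] at this
    simp only [fmul_mk]
    exact this
  refine LinearMap.congr_fun (f := (fmul.flip z).comp (fmul x))
    (g := (fmul x).comp (fmul.flip z)) (ext_all fun s => ?_) y
  refine LinearMap.congr_fun (f := (fmul.flip z).comp (fmul.flip (mk s)))
    (g := fmul.flip (fmul (mk s) z)) (ext_all fun r => ?_) x
  exact LinearMap.congr_fun (f := fmul (fmul (mk r) (mk s)))
    (g := (fmul (mk r)).comp (fmul (mk s))) (ext_all fun t => key r s t) z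

theorem fbr_skew {i j : ℕ} {x y : FreeBV un A} (hx : x ∈ gr un A i) (hy : y ∈ gr un A j) :
    fbr x y = -((-1 : ℚ) ^ ((i + 1) * (j + 1)) • fbr y x) := by
  refine ext₁ (f := fbr.flip y) (g := -((-1 : ℚ) ^ ((i + 1) * (j + 1)) • fbr y)) ?_ hx
  rintro s rfl
  refine ext₁ (f := fbr (mk s))
    (g := -((-1 : ℚ) ^ ((deg s + 1) * (j + 1)) • fbr.flip (mk s))) ?_ hy
  rintro t rfl
  have := mkQ_eq_zero (BVRel.br_skew s t)
  rw [map_add, map_smul, ← eq_neg_iff_add_eq_zero] at this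
  rw [LinearMap.neg_apply, LinearMap.smul_apply, LinearMap.flip_apply, fbr_mk, fbr_mk]
  exact this

theorem fjacobi {i j : ℕ} {x y : FreeBV un A} (hx : x ∈ gr un A i) (hy : y ∈ gr un A j)
    (z : FreeBV un A) :
    fbr x (fbr y z) = fbr (fbr x y) z + (-1 : ℚ) ^ ((i + 1) * (j + 1)) • fbr y (fbr x z) := by
  refine ext₁ (f := fbr.flip (fbr y z)) (g := (fbr.flip z).comp (fbr.flip y) +
    (-1 : ℚ) ^ ((i + 1) * (j + 1)) • (fbr y).comp (fbr.flip z)) ?_ hx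
  rintro r rfl
  refine ext₁ (f := (fbr (mk r)).comp (fbr.flip z)) (g := (fbr.flip z).comp (fbr (mk r)) +
    (-1 : ℚ) ^ ((deg r + 1) * (j + 1)) • fbr.flip (fbr (mk r) z)) ?_ hy
  rintro s rfl
  refine LinearMap.congr_fun (f := (fbr (mk r)).comp (fbr (mk s)))
    (g := fbr (fbr (mk r) (mk s)) +
    (-1 : ℚ) ^ ((deg r + 1) * (deg s + 1)) • (fbr (mk s)).comp (fbr (mk r)))
    (ext_all fun t => ?_) z
  have := mkQ_eq_zero (BVRel.jacobi r s t)
  rw [sub_sub, map_sub, map_add, map_smul, sub_eq_zero] at this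
  simp only [LinearMap.add_apply, LinearMap.smul_apply, LinearMap.comp_apply, fbr_mk]
  exact this

theorem fleibniz {i j : ℕ} {x y : FreeBV un A} (hx : x ∈ gr un A i) (hy : y ∈ gr un A j)
    (z : FreeBV un A) :
    fbr x (fmul y z) = fmul (fbr x y) z + (-1 : ℚ) ^ ((i + 1) * j) • fmul y (fbr x z) := by
  refine ext₁ (f := fbr.flip (fmul y z)) (g := (fmul.flip z).comp (fbr.flip y) +
    (-1 : ℚ) ^ ((i + 1) * j) • (fmul y).comp (fbr.flip z)) ?_ hx
  rintro r rfl
  refine ext₁ (f := (fbr (mk r)).comp (fmul.flip z)) (g := (fmul.flip z).comp (fbr (mk r)) +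
    (-1 : ℚ) ^ ((deg r + 1) * j) • fmul.flip (fbr (mk r) z)) ?_ hy
  rintro s rfl
  refine LinearMap.congr_fun (f := (fbr (mk r)).comp (fmul (mk s)))
    (g := fmul (fbr (mk r) (mk s)) +
    (-1 : ℚ) ^ ((deg r + 1) * deg s) • (fmul (mk s)).comp (fbr (mk r)))
    (ext_all fun t => ?_) z
  have := mkQ_eq_zero (BVRel.leibniz r s t)
  rw [sub_sub, map_sub, map_add, map_smul, sub_eq_zero] at this
  simp only [LinearMap.add_apply, LinearMap.smul_apply, LinearMap.comp_apply, fbr_mk, fmul_mk]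
  exact this

theorem fdel_fdel (x : FreeBV un A) : fdel (fdel x) = 0 := by
  refine LinearMap.congr_fun (f := fdel.comp fdel) (g := 0) (ext_all fun t => ?_) x
  rw [LinearMap.comp_apply, fdel_mk, fdel_mk]
  exact mkQ_eq_zero (BVRel.del_del t)

theorem fbr_eq {i : ℕ} {x : FreeBV un A} (hx : x ∈ gr un A i) (y : FreeBV un A) :
    fbr x y = (-1 : ℚ) ^ i • fdel (fmul x y) - (-1 : ℚ) ^ i • fmul (fdel x) y -
      fmul x (fdel y) := by
  refine ext₁ (f := fbr.flip y) (g := (-1 : ℚ) ^ i • fdel.comp (fmul.flip y) -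
    (-1 : ℚ) ^ i • (fmul.flip y).comp fdel - fmul.flip (fdel y)) ?_ hx
  rintro s rfl
  refine LinearMap.congr_fun (f := fbr (mk s)) (g := (-1 : ℚ) ^ deg s • fdel.comp (fmul (mk s)) -
    (-1 : ℚ) ^ deg s • fmul (fdel (mk s)) - (fmul (mk s)).comp fdel) (ext_all fun t => ?_) y
  have := mkQ_eq_zero (BVRel.br_eq s t)
  simp only [map_add, map_sub, map_smul, mkQ_single, one_smul] at this
  simp only [LinearMap.sub_apply, LinearMap.smul_apply, LinearMap.comp_apply, fbr_mk, fmul_mk,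
    fdel_mk]
  refine sub_eq_zero.mp (Eq.trans ?_ this)
  module

/-! #### Substitutions -/

theorem lc_map {M : Type*} [AddCommGroup M] [Module ℚ M] (f : BVExpr un A → M)
    (g : BVExpr un A → BVExpr un A) (r : BVExpr un A →₀ ℚ) :
    Finsupp.linearCombination ℚ f (Finsupp.lmapDomain ℚ ℚ g r) =
      Finsupp.linearCombination ℚ (fun x => f (g x)) r := by
  rw [Finsupp.lmapDomain_apply, Finsupp.linearCombination_mapDomain]
  rfl

theorem lc_lin {M N : Type*} [AddCommGroup M] [Module ℚ M] [AddCommGroup N] [Module ℚ N]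
    (f g : BVExpr un A → M) (l l' : M →ₗ[ℚ] N) (r : BVExpr un A →₀ ℚ) :
    Finsupp.linearCombination ℚ (fun x => l (f x) + l' (g x)) r =
      l (Finsupp.linearCombination ℚ f r) + l' (Finsupp.linearCombination ℚ g r) := by
  induction r using Finsupp.induction_linear with
  | zero => simp only [map_zero, add_zero]
  | add f g hf hg => simp only [map_add, hf, hg]; abel
  | single t c => simp only [Finsupp.linearCombination_single, map_smul, smul_add]

theorem lc_congr {M : Type*} [AddCommGroup M] [Module ℚ M] {f g : BVExpr un A → M}
    {r : BVExpr un A →₀ ℚ} (h : ∀ t ∈ r.support, f t = g t) :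
    Finsupp.linearCombination ℚ f r = Finsupp.linearCombination ℚ g r := by
  rw [Finsupp.linearCombination_apply, Finsupp.linearCombination_apply]
  exact Finset.sum_congr rfl fun t ht => congrArg (r t • ·) (h t ht)

theorem rel_homogeneous {r : BVExpr un A →₀ ℚ} (h : BVRel r) :
    ∃ n, r ∈ Finsupp.supported ℚ ℚ {t : BVExpr un A | deg t = n} := by
  have hs : ∀ {n : ℕ} (t : BVExpr un A), deg t = n →
      Finsupp.single t (1 : ℚ) ∈ Finsupp.supported ℚ ℚ {t : BVExpr un A | deg t = n} :=
    fun t ht => Finsupp.single_mem_supported ℚ 1 ht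
  have hm : ∀ {n m : ℕ} {r : BVExpr un A →₀ ℚ} (g : BVExpr un A → BVExpr un A),
      (∀ t, deg t = n → deg (g t) = m) →
      r ∈ Finsupp.supported ℚ ℚ {t : BVExpr un A | deg t = n} →
      Finsupp.lmapDomain ℚ ℚ g r ∈ Finsupp.supported ℚ ℚ {t : BVExpr un A | deg t = m} := by
    classical
    intro n m r g hg hr t ht
    obtain ⟨s, hs, rfl⟩ := Finset.mem_image.mp (Finsupp.mapDomain_support ht)
    exact hg s (hr hs)
  induction h with
  | one_mul h x => exact ⟨deg x, sub_mem (hs _ (by simp only [deg]; omega)) (hs _ rfl)⟩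
  | mul_comm x y =>
    exact ⟨deg x + deg y, sub_mem (hs _ rfl)
      (Submodule.smul_mem _ _ (hs _ (by simp only [deg]; omega)))⟩
  | mul_assoc x y z =>
    exact ⟨deg x + deg y + deg z, sub_mem (hs _ rfl) (hs _ (by simp only [deg]; omega))⟩
  | br_skew x y =>
    exact ⟨deg x + deg y + 1, add_mem (hs _ rfl)
      (Submodule.smul_mem _ _ (hs _ (by simp only [deg]; omega)))⟩
  | jacobi x y z =>
    exact ⟨deg x + deg y + deg z + 2, sub_mem (sub_mem (hs _ (by simp only [deg]; omega))
      (hs _ (by simp only [deg]; omega)))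
      (Submodule.smul_mem _ _ (hs _ (by simp only [deg]; omega)))⟩
  | leibniz x y z =>
    exact ⟨deg x + deg y + deg z + 1, sub_mem (sub_mem (hs _ (by simp only [deg]; omega))
      (hs _ (by simp only [deg]; omega)))
      (Submodule.smul_mem _ _ (hs _ (by simp only [deg]; omega)))⟩
  | del_del x => exact ⟨_, hs _ rfl⟩
  | br_eq x y =>
    exact ⟨deg x + deg y + 1, add_mem (add_mem (sub_mem (hs _ (by simp only [deg]))
      (Submodule.smul_mem _ _ (hs _ (by simp only [deg]))))
      (Submodule.smul_mem _ _ (hs _ (by simp only [deg]; omega))))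
      (hs _ (by simp only [deg]; omega))⟩
  | mul_left w r _ ih =>
    obtain ⟨n, hn⟩ := ih
    exact ⟨deg w + n, hm _ (fun t ht => by simp only [deg, ht]) hn⟩
  | mul_right w r _ ih =>
    obtain ⟨n, hn⟩ := ih
    exact ⟨n + deg w, hm _ (fun t ht => by simp only [deg, ht]) hn⟩
  | br_left w r _ ih =>
    obtain ⟨n, hn⟩ := ih
    exact ⟨deg w + n + 1, hm _ (fun t ht => by simp only [deg, ht]) hn⟩
  | br_right w r _ ih =>
    obtain ⟨n, hn⟩ := ih
    exact ⟨n + deg w + 1, hm _ (fun t ht => by simp only [deg, ht]) hn⟩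
  | del r _ ih =>
    obtain ⟨n, hn⟩ := ih
    exact ⟨n + 1, hm _ (fun t ht => by simp only [deg, ht]) hn⟩

/-- Renaming of variables along a partially defined map `ν`: the variables on which `ν` is not
defined are replaced by zero. -/
noncomputable def renT (ν : A → Option C) : BVExpr un A → FreeBV un C
  | one h => mk (one h)
  | var a => (ν a).elim 0 fun c => mk (var c)
  | mul x y => fmul (renT ν x) (renT ν y)
  | br x y => fbr (renT ν x) (renT ν y)
  | del x => fdel (renT ν x)

/-- The part linear in `σ` of the substitution `a ↦ ν a + σ a`, where the `σ a` are elements of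
degree `k`. (The signs are those of moving a symbol of degree `k` from the variable `a` to the far
right of the expression, where the degree of the bracket is at its comma.) -/
noncomputable def derT (ν : A → Option C) (k : ℕ) (σ : A → FreeBV un C) :
    BVExpr un A → FreeBV un C
  | one _ => 0
  | var a => σ a
  | mul x y => fmul (renT ν x) (derT ν k σ y) +
      (-1 : ℚ) ^ (k * deg y) • fmul (derT ν k σ x) (renT ν y)
  | br x y => fbr (renT ν x) (derT ν k σ y) +
      (-1 : ℚ) ^ (k * (deg y + 1)) • fbr (derT ν k σ x) (renT ν y)
  | del x => fdel (derT ν k σ x)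

theorem renT_mem_gr (ν : A → Option C) (t : BVExpr un A) : renT ν t ∈ gr un C (deg t) := by
  induction t with
  | one h => exact mk_mem_gr (one h)
  | var a =>
    rw [renT]
    cases ν a with
    | none => exact zero_mem _
    | some c => exact mk_mem_gr (var c)
  | mul x y hx hy => exact fmul_mem_gr hx hy
  | br x y hx hy => exact fbr_mem_gr hx hy
  | del x hx => exact fdel_mem_gr hx

theorem derT_mem_gr (ν : A → Option C) (k : ℕ) (σ : A → FreeBV un C) (hσ : ∀ a, σ a ∈ gr un C k)
    (t : BVExpr un A) : derT ν k σ t ∈ gr un C (deg t + k) := by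
  induction t with
  | one h => exact zero_mem _
  | var a => rw [deg, zero_add]; exact hσ a
  | mul x y hx hy =>
    refine add_mem ?_ (Submodule.smul_mem _ _ ?_)
    · rw [deg, add_assoc]; exact fmul_mem_gr (renT_mem_gr ν x) hy
    · rw [deg, add_right_comm]; exact fmul_mem_gr hx (renT_mem_gr ν y)
  | br x y hx hy =>
    refine add_mem ?_ (Submodule.smul_mem _ _ ?_)
    · rw [deg, add_right_comm, add_assoc (deg x)]; exact fbr_mem_gr (renT_mem_gr ν x) hy
    · rw [deg, add_right_comm, add_right_comm (deg x)]; exact fbr_mem_gr hx (renT_mem_gr ν y)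
  | del x hx =>
    rw [deg, add_right_comm]; exact fdel_mem_gr hx

theorem renT_rel (ν : A → Option C) (r : BVExpr un A →₀ ℚ) (h : BVRel r) :
    Finsupp.linearCombination ℚ (renT ν) r = 0 := by
  have hl : ∀ (l : FreeBV un C →ₗ[ℚ] FreeBV un C) (r : BVExpr un A →₀ ℚ),
      Finsupp.linearCombination ℚ (renT ν) r = 0 →
      Finsupp.linearCombination ℚ (fun x => l (renT ν x)) r = 0 := by
    intro l r h
    have := lc_lin (renT ν) (renT ν) l 0 r
    simp only [LinearMap.zero_apply, add_zero] at this
    rw [this, h, map_zero]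
  induction h with
  | one_mul h x =>
    simp only [map_sub, Finsupp.linearCombination_single, one_smul, renT, fone_mul, sub_self]
  | mul_comm x y =>
    simp only [map_sub, map_smul, Finsupp.linearCombination_single, one_smul, renT]
    rw [fmul_comm (renT_mem_gr ν x) (renT_mem_gr ν y), sub_self]
  | mul_assoc x y z =>
    simp only [map_sub, Finsupp.linearCombination_single, one_smul, renT]
    rw [fmul_assoc, sub_self]
  | br_skew x y =>
    simp only [map_add, map_smul, Finsupp.linearCombination_single, one_smul, renT]
    rw [fbr_skew (renT_mem_gr ν x) (renT_mem_gr ν y), neg_add_cancel]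
  | jacobi x y z =>
    simp only [map_sub, map_smul, Finsupp.linearCombination_single, one_smul, renT]
    rw [fjacobi (renT_mem_gr ν x) (renT_mem_gr ν y)]; abel
  | leibniz x y z =>
    simp only [map_sub, map_smul, Finsupp.linearCombination_single, one_smul, renT]
    rw [fleibniz (renT_mem_gr ν x) (renT_mem_gr ν y)]; abel
  | del_del x =>
    simp only [Finsupp.linearCombination_single, one_smul, renT]
    rw [fdel_fdel]
  | br_eq x y =>
    simp only [map_sub, map_add, map_smul, Finsupp.linearCombination_single, one_smul, renT]
    rw [fbr_eq (renT_mem_gr ν x)]; abel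
  | mul_left w r _ ih => rw [lc_map]; exact hl (fmul (renT ν w)) r ih
  | mul_right w r _ ih => rw [lc_map]; exact hl (fmul.flip (renT ν w)) r ih
  | br_left w r _ ih => rw [lc_map]; exact hl (fbr (renT ν w)) r ih
  | br_right w r _ ih => rw [lc_map]; exact hl (fbr.flip (renT ν w)) r ih
  | del r _ ih => rw [lc_map]; exact hl fdel r ih

theorem derT_rel (ν : A → Option C) (k : ℕ) (σ : A → FreeBV un C) (hσ : ∀ a, σ a ∈ gr un C k)
    (r : BVExpr un A →₀ ℚ) (h : BVRel r) : Finsupp.linearCombination ℚ (derT ν k σ) r = 0 := by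
  have hN := renT_mem_gr (un := un) ν
  have hD := derT_mem_gr ν k σ hσ
  have hl : ∀ (l l' : FreeBV un C →ₗ[ℚ] FreeBV un C) (r : BVExpr un A →₀ ℚ), BVRel r →
      Finsupp.linearCombination ℚ (derT ν k σ) r = 0 →
      Finsupp.linearCombination ℚ (fun x => l (derT ν k σ x) + l' (renT ν x)) r = 0 := by
    intro l l' r h h'
    rw [lc_lin, h', renT_rel ν r h, map_zero, map_zero, add_zero]
  induction h with
  | one_mul h x =>
    simp only [map_sub, Finsupp.linearCombination_single, one_smul, renT, derT, fone_mul, map_zero,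
      LinearMap.zero_apply, smul_zero, add_zero, sub_self]
  | mul_comm x y =>
    simp only [map_sub, map_smul, Finsupp.linearCombination_single, one_smul, derT]
    rw [fmul_comm (hN x) (hD y), fmul_comm (hD x) (hN y)]
    rcases neg_one_pow_eq_or ℚ (deg x) with hi | hi <;>
    rcases neg_one_pow_eq_or ℚ (deg y) with hj | hj <;>
    rcases neg_one_pow_eq_or ℚ k with hk | hk <;>
    simp only [mul_add, add_mul, pow_add, pow_mul, hi, hj, hk, one_pow] <;> module
  | mul_assoc x y z =>
    simp only [map_sub, map_add, map_smul, Finsupp.linearCombination_single, one_smul, derT, renT,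
      LinearMap.add_apply, LinearMap.smul_apply, fmul_assoc, deg, mul_add, pow_add]
    module
  | br_skew x y =>
    simp only [map_add, map_smul, Finsupp.linearCombination_single, one_smul, derT]
    rw [fbr_skew (hN x) (hD y), fbr_skew (hD x) (hN y)]
    rcases neg_one_pow_eq_or ℚ (deg x) with hi | hi <;>
    rcases neg_one_pow_eq_or ℚ (deg y) with hj | hj <;>
    rcases neg_one_pow_eq_or ℚ k with hk | hk <;>
    simp only [mul_add, add_mul, mul_one, one_mul, pow_one, pow_add, pow_mul, hi, hj, hk,
      one_pow] <;> module
  | jacobi x y z =>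
    simp only [map_sub, map_add, map_smul, Finsupp.linearCombination_single, one_smul, derT, renT,
      LinearMap.add_apply, LinearMap.smul_apply, deg]
    rw [fjacobi (hN x) (hN y) (derT ν k σ z), fjacobi (hN x) (hD y) (renT ν z),
      fjacobi (hD x) (hN y) (renT ν z)]
    rcases neg_one_pow_eq_or ℚ (deg x) with hi | hi <;>
    rcases neg_one_pow_eq_or ℚ (deg y) with hj | hj <;>
    rcases neg_one_pow_eq_or ℚ (deg z) with hm | hm <;>
    rcases neg_one_pow_eq_or ℚ k with hk | hk <;>
    simp only [mul_add, add_mul, mul_one, one_mul, pow_one, pow_add, pow_mul, hi, hj, hk, hm,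
      one_pow] <;> module
  | leibniz x y z =>
    simp only [map_sub, map_add, map_smul, Finsupp.linearCombination_single, one_smul, derT, renT,
      LinearMap.add_apply, LinearMap.smul_apply, deg]
    rw [fleibniz (hN x) (hN y) (derT ν k σ z), fleibniz (hN x) (hD y) (renT ν z),
      fleibniz (hD x) (hN y) (renT ν z)]
    rcases neg_one_pow_eq_or ℚ (deg x) with hi | hi <;>
    rcases neg_one_pow_eq_or ℚ (deg y) with hj | hj <;>
    rcases neg_one_pow_eq_or ℚ (deg z) with hm | hm <;>
    rcases neg_one_pow_eq_or ℚ k with hk | hk <;>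
    simp only [mul_add, add_mul, mul_one, one_mul, pow_add, pow_mul, hi, hj, hk, hm,
      one_pow] <;> module
  | del_del x =>
    simp only [Finsupp.linearCombination_single, one_smul, derT]
    rw [fdel_fdel]
  | br_eq x y =>
    simp only [map_sub, map_add, map_smul, Finsupp.linearCombination_single, one_smul, derT, renT,
      deg]
    rw [fbr_eq (hN x) (derT ν k σ y), fbr_eq (hD x) (renT ν y)]
    rcases neg_one_pow_eq_or ℚ (deg x) with hi | hi <;>
    rcases neg_one_pow_eq_or ℚ (deg y) with hj | hj <;>
    rcases neg_one_pow_eq_or ℚ k with hk | hk <;>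
    simp only [mul_add, mul_one, one_mul, pow_add, pow_mul, hi, hj, hk,
      one_pow] <;> module
  | mul_left w r h ih =>
    obtain ⟨n, hn⟩ := rel_homogeneous h
    rw [lc_map]
    refine Eq.trans (lc_congr fun t ht => ?_)
      (hl (fmul (renT ν w)) ((-1 : ℚ) ^ (k * n) • fmul (derT ν k σ w)) r h ih)
    rw [derT, show deg t = n from hn ht, LinearMap.smul_apply]
  | mul_right w r h ih =>
    rw [lc_map]
    refine Eq.trans (lc_congr fun t ht => ?_)
      (hl ((-1 : ℚ) ^ (k * deg w) • fmul.flip (renT ν w)) (fmul.flip (derT ν k σ w)) r h ih)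
    rw [derT, LinearMap.smul_apply, LinearMap.flip_apply, LinearMap.flip_apply, add_comm]
  | br_left w r h ih =>
    obtain ⟨n, hn⟩ := rel_homogeneous h
    rw [lc_map]
    refine Eq.trans (lc_congr fun t ht => ?_)
      (hl (fbr (renT ν w)) ((-1 : ℚ) ^ (k * (n + 1)) • fbr (derT ν k σ w)) r h ih)
    rw [derT, show deg t = n from hn ht, LinearMap.smul_apply]
  | br_right w r h ih =>
    rw [lc_map]
    refine Eq.trans (lc_congr fun t ht => ?_)
      (hl ((-1 : ℚ) ^ (k * (deg w + 1)) • fbr.flip (renT ν w)) (fbr.flip (derT ν k σ w)) r h ih)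
    rw [derT, LinearMap.smul_apply, LinearMap.flip_apply, LinearMap.flip_apply, add_comm]
  | del r h ih =>
    rw [lc_map]
    refine Eq.trans (lc_congr fun t ht => ?_) (hl fdel 0 r h ih)
    rw [derT, LinearMap.zero_apply, add_zero]

/-- `renT` on the free BV algebra. -/
noncomputable def ren (ν : A → Option C) : FreeBV un A →ₗ[ℚ] FreeBV un C :=
  lift (renT ν) (renT_rel ν)

/-- `derT` on the free BV algebra. -/
noncomputable def der (ν : A → Option C) (k : ℕ) (σ : A → FreeBV un C)
    (hσ : ∀ a, σ a ∈ gr un C k) : FreeBV un A →ₗ[ℚ] FreeBV un C :=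
  lift (derT ν k σ) (derT_rel ν k σ hσ)

theorem ren_mk (ν : A → Option C) (t : BVExpr un A) : ren ν (mk t) = renT ν t := lift_mk _ _ t

theorem der_mk (ν : A → Option C) (k : ℕ) (σ : A → FreeBV un C) (hσ : ∀ a, σ a ∈ gr un C k)
    (t : BVExpr un A) : der ν k σ hσ (mk t) = derT ν k σ t := lift_mk _ _ t

theorem ren_mem_gr (ν : A → Option C) {n : ℕ} {x : FreeBV un A} (hx : x ∈ gr un A n) :
    ren ν x ∈ gr un C n := by
  refine gr_induction (P := fun x => ren ν x ∈ gr un C n) ?_ ?_ ?_ ?_ hx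
  · rw [map_zero]; exact zero_mem _
  · intro x x' h h'; rw [map_add]; exact add_mem h h'
  · intro c x h; rw [map_smul]; exact Submodule.smul_mem _ c h
  · rintro t rfl; rw [ren_mk]; exact renT_mem_gr ν t

theorem der_mem_gr (ν : A → Option C) (k : ℕ) (σ : A → FreeBV un C) (hσ : ∀ a, σ a ∈ gr un C k)
    {n : ℕ} {x : FreeBV un A} (hx : x ∈ gr un A n) : der ν k σ hσ x ∈ gr un C (n + k) := by
  refine gr_induction (P := fun x => der ν k σ hσ x ∈ gr un C (n + k)) ?_ ?_ ?_ ?_ hx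
  · rw [map_zero]; exact zero_mem _
  · intro x x' h h'; rw [map_add]; exact add_mem h h'
  · intro c x h; rw [map_smul]; exact Submodule.smul_mem _ c h
  · rintro t rfl; rw [der_mk]; exact derT_mem_gr ν k σ hσ t

theorem ren_fmul (ν : A → Option C) (x y : FreeBV un A) :
    ren ν (fmul x y) = fmul (ren ν x) (ren ν y) := by
  have : fmul.compr₂ (ren ν) = fmul.compl₁₂ (ren ν) (ren (un := un) ν) :=
    ext_all fun s => ext_all fun t => by
      simp only [LinearMap.compr₂_apply, LinearMap.compl₁₂_apply, fmul_mk, ren_mk, renT]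
  exact LinearMap.congr_fun₂ this x y

theorem ren_fbr (ν : A → Option C) (x y : FreeBV un A) :
    ren ν (fbr x y) = fbr (ren ν x) (ren ν y) := by
  have : fbr.compr₂ (ren ν) = fbr.compl₁₂ (ren ν) (ren (un := un) ν) :=
    ext_all fun s => ext_all fun t => by
      simp only [LinearMap.compr₂_apply, LinearMap.compl₁₂_apply, fbr_mk, ren_mk, renT]
  exact LinearMap.congr_fun₂ this x y

theorem ren_fdel (ν : A → Option C) (x : FreeBV un A) : ren ν (fdel x) = fdel (ren ν x) := by
  have : (ren ν).comp fdel = fdel.comp (ren (un := un) ν) := ext_all fun t => by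
    simp only [LinearMap.comp_apply, fdel_mk, ren_mk, renT]
  exact LinearMap.congr_fun this x

theorem der_fmul (ν : A → Option C) (k : ℕ) (σ : A → FreeBV un C) (hσ : ∀ a, σ a ∈ gr un C k)
    (x : FreeBV un A) {j : ℕ} {y : FreeBV un A} (hy : y ∈ gr un A j) :
    der ν k σ hσ (fmul x y) = fmul (ren ν x) (der ν k σ hσ y) +
      (-1 : ℚ) ^ (k * j) • fmul (der ν k σ hσ x) (ren ν y) := by
  refine ext₁ (f := (der ν k σ hσ).comp (fmul x)) (g := (fmul (ren ν x)).comp (der ν k σ hσ) +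
    (-1 : ℚ) ^ (k * j) • (fmul (der ν k σ hσ x)).comp (ren ν)) ?_ hy
  rintro t rfl
  refine LinearMap.congr_fun (f := (der ν k σ hσ).comp (fmul.flip (mk t)))
    (g := (fmul.flip (der ν k σ hσ (mk t))).comp (ren ν) +
    (-1 : ℚ) ^ (k * deg t) • (fmul.flip (ren ν (mk t))).comp (der ν k σ hσ))
    (ext_all fun s => ?_) x
  simp only [LinearMap.comp_apply, LinearMap.add_apply, LinearMap.smul_apply, LinearMap.flip_apply,
    fmul_mk, ren_mk, der_mk, derT]

theorem der_fbr (ν : A → Option C) (k : ℕ) (σ : A → FreeBV un C) (hσ : ∀ a, σ a ∈ gr un C k)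
    (x : FreeBV un A) {j : ℕ} {y : FreeBV un A} (hy : y ∈ gr un A j) :
    der ν k σ hσ (fbr x y) = fbr (ren ν x) (der ν k σ hσ y) +
      (-1 : ℚ) ^ (k * (j + 1)) • fbr (der ν k σ hσ x) (ren ν y) := by
  refine ext₁ (f := (der ν k σ hσ).comp (fbr x)) (g := (fbr (ren ν x)).comp (der ν k σ hσ) +
    (-1 : ℚ) ^ (k * (j + 1)) • (fbr (der ν k σ hσ x)).comp (ren ν)) ?_ hy
  rintro t rfl
  refine LinearMap.congr_fun (f := (der ν k σ hσ).comp (fbr.flip (mk t)))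
    (g := (fbr.flip (der ν k σ hσ (mk t))).comp (ren ν) +
    (-1 : ℚ) ^ (k * (deg t + 1)) • (fbr.flip (ren ν (mk t))).comp (der ν k σ hσ))
    (ext_all fun s => ?_) x
  simp only [LinearMap.comp_apply, LinearMap.add_apply, LinearMap.smul_apply, LinearMap.flip_apply,
    fbr_mk, ren_mk, der_mk, derT]

theorem der_fdel (ν : A → Option C) (k : ℕ) (σ : A → FreeBV un C) (hσ : ∀ a, σ a ∈ gr un C k)
    (x : FreeBV un A) : der ν k σ hσ (fdel x) = fdel (der ν k σ hσ x) := by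
  have : (der ν k σ hσ).comp fdel = fdel.comp (der ν k σ hσ) := ext_all fun t => by
    simp only [LinearMap.comp_apply, fdel_mk, der_mk, derT]
  exact LinearMap.congr_fun this x

/-! #### Compositions of substitutions -/

theorem ren_renT (ν : A → Option C) (μ : C → Option D) (t : BVExpr un A) :
    ren μ (renT ν t) = renT (fun a => (ν a).bind μ) t := by
  induction t with
  | one h => exact ren_mk μ _
  | var a =>
    rw [renT, renT]
    cases ν a with
    | none => exact map_zero _
    | some c => exact ren_mk μ _
  | mul x y hx hy => rw [renT, renT, ren_fmul, hx, hy]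
  | br x y hx hy => rw [renT, renT, ren_fbr, hx, hy]
  | del x hx => rw [renT, renT, ren_fdel, hx]

theorem ren_derT (ν : A → Option C) (k : ℕ) (σ : A → FreeBV un C) (μ : C → Option D)
    (t : BVExpr un A) :
    ren μ (derT ν k σ t) = derT (fun a => (ν a).bind μ) k (fun a => ren μ (σ a)) t := by
  induction t with
  | one h => exact map_zero _
  | var a => rfl
  | mul x y hx hy =>
    rw [derT, derT, map_add, map_smul, ren_fmul, ren_fmul, hx, hy, ren_renT, ren_renT]
  | br x y hx hy =>
    rw [derT, derT, map_add, map_smul, ren_fbr, ren_fbr, hx, hy, ren_renT, ren_renT]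
  | del x hx => rw [derT, derT, ren_fdel, hx]

theorem der_renT (ν : A → Option C) (μ : C → Option D) (l : ℕ) (τ : C → FreeBV un D)
    (hτ : ∀ c, τ c ∈ gr un D l) (t : BVExpr un A) :
    der μ l τ hτ (renT ν t) =
      derT (fun a => (ν a).bind μ) l (fun a => (ν a).elim 0 τ) t := by
  induction t with
  | one h => exact der_mk μ l τ hτ _
  | var a =>
    rw [renT, derT]
    cases ν a with
    | none => exact map_zero _
    | some c => exact der_mk μ l τ hτ _
  | mul x y hx hy =>
    rw [renT, derT, der_fmul μ l τ hτ _ (renT_mem_gr ν y), ren_renT, ren_renT, hx, hy]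
  | br x y hx hy =>
    rw [renT, derT, der_fbr μ l τ hτ _ (renT_mem_gr ν y), ren_renT, ren_renT, hx, hy]
  | del x hx => rw [renT, derT, der_fdel, hx]

theorem derT_zero (ν : A → Option C) (k : ℕ) (t : BVExpr un A) :
    derT ν k (fun _ => 0) t = 0 := by
  induction t with
  | one h => rfl
  | var a => rfl
  | mul x y hx hy =>
    rw [derT, hx, hy, map_zero, map_zero, LinearMap.zero_apply, smul_zero, add_zero]
  | br x y hx hy =>
    rw [derT, hx, hy, map_zero, map_zero, LinearMap.zero_apply, smul_zero, add_zero]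
  | del x hx => rw [derT, hx, map_zero]

theorem der_derT_seq (ν : A → Option C) (k : ℕ) (σ : A → FreeBV un C)
    (hσ : ∀ a, σ a ∈ gr un C k) (μ : C → Option D) (l : ℕ)
    (τ : C → FreeBV un D) (hτ : ∀ c, τ c ∈ gr un D l) (h : ∀ a, (ν a).elim 0 τ = 0)
    (t : BVExpr un A) :
    der μ l τ hτ (derT ν k σ t) =
      derT (fun a => (ν a).bind μ) (k + l) (fun a => der μ l τ hτ (σ a)) t := by
  have h0 : ∀ t : BVExpr un A, der μ l τ hτ (renT ν t) = 0 := by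
    intro t
    rw [der_renT, show (fun a => (ν a).elim 0 τ) = fun _ => 0 from funext h, derT_zero]
  induction t with
  | one h => exact map_zero _
  | var a => rfl
  | mul x y hx hy =>
    rw [derT, derT, map_add, map_smul, der_fmul μ l τ hτ _ (derT_mem_gr ν k σ hσ y),
      der_fmul μ l τ hτ _ (renT_mem_gr ν y), h0, h0, hx, hy, ren_renT, ren_renT, map_zero, map_zero,
      LinearMap.zero_apply, smul_zero, add_zero, zero_add, smul_smul, ← pow_add, add_mul]
  | br x y hx hy =>
    rw [derT, derT, map_add, map_smul, der_fbr μ l τ hτ _ (derT_mem_gr ν k σ hσ y),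
      der_fbr μ l τ hτ _ (renT_mem_gr ν y), h0, h0, hx, hy, ren_renT, ren_renT, map_zero, map_zero,
      LinearMap.zero_apply, smul_zero, add_zero, zero_add, smul_smul, ← pow_add, add_mul]
  | del x hx => rw [derT, derT, der_fdel, hx]

theorem der_derT_par {C' : Type u} (ν : A → Option C) (k : ℕ) (σ : A → FreeBV un C)
    (hσ : ∀ a, σ a ∈ gr un C k) (μ : C → Option D) (l : ℕ) (τ : C → FreeBV un D)
    (hτ : ∀ c, τ c ∈ gr un D l) (ν' : A → Option C') (σ' : A → FreeBV un C')
    (hσ' : ∀ a, σ' a ∈ gr un C' l) (μ' : C' → Option D) (τ' : C' → FreeBV un D)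
    (hτ' : ∀ c, τ' c ∈ gr un D k)
    (h1 : ∀ a, (ν a).bind μ = (ν' a).bind μ')
    (h2 : ∀ a, (ν a).elim 0 τ = ren μ' (σ' a)) (h2' : ∀ a, (ν' a).elim 0 τ' = ren μ (σ a))
    (h3 : ∀ a, der μ l τ hτ (σ a) = 0) (h3' : ∀ a, der μ' k τ' hτ' (σ' a) = 0)
    (t : BVExpr un A) :
    der μ l τ hτ (derT ν k σ t) = (-1 : ℚ) ^ (k * l) • der μ' k τ' hτ' (derT ν' l σ' t) := by
  have e1 : ∀ t : BVExpr un A, ren μ (renT ν t) = ren μ' (renT ν' t) := fun t => by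
    rw [ren_renT, ren_renT, show (fun a => (ν a).bind μ) = _ from funext h1]
  have e2 : ∀ t : BVExpr un A, der μ l τ hτ (renT ν t) = ren μ' (derT ν' l σ' t) := fun t => by
    rw [der_renT, ren_derT, show (fun a => (ν a).bind μ) = _ from funext h1,
      show (fun a => (ν a).elim 0 τ) = _ from funext h2]
  have e2' : ∀ t : BVExpr un A, der μ' k τ' hτ' (renT ν' t) = ren μ (derT ν k σ t) := fun t => by
    rw [der_renT, ren_derT, ← show (fun a => (ν a).bind μ) = _ from funext h1,
      show (fun a => (ν' a).elim 0 τ') = _ from funext h2']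
  induction t with
  | one h =>
    rw [derT, derT, map_zero, map_zero, smul_zero]
  | var a => rw [derT, derT, h3, h3', smul_zero]
  | mul x y hx hy =>
    simp only [derT, map_add, map_smul]
    rw [der_fmul μ l τ hτ _ (derT_mem_gr ν k σ hσ y), der_fmul μ l τ hτ _ (renT_mem_gr ν y),
      der_fmul μ' k τ' hτ' _ (derT_mem_gr ν' l σ' hσ' y),
      der_fmul μ' k τ' hτ' _ (renT_mem_gr ν' y), hx, hy, e1, e1, e2, e2, e2', e2']
    simp only [map_smul, LinearMap.smul_apply]
    rcases neg_one_pow_eq_or ℚ (deg y) with hj | hj <;>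
    rcases neg_one_pow_eq_or ℚ k with hk | hk <;>
    rcases neg_one_pow_eq_or ℚ l with hl | hl <;>
    simp only [mul_add, pow_add, pow_mul, hj, hk, hl, one_pow] <;> module
  | br x y hx hy =>
    simp only [derT, map_add, map_smul]
    rw [der_fbr μ l τ hτ _ (derT_mem_gr ν k σ hσ y), der_fbr μ l τ hτ _ (renT_mem_gr ν y),
      der_fbr μ' k τ' hτ' _ (derT_mem_gr ν' l σ' hσ' y),
      der_fbr μ' k τ' hτ' _ (renT_mem_gr ν' y), hx, hy, e1, e1, e2, e2, e2', e2']
    simp only [map_smul, LinearMap.smul_apply]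
    rcases neg_one_pow_eq_or ℚ (deg y) with hj | hj <;>
    rcases neg_one_pow_eq_or ℚ k with hk | hk <;>
    rcases neg_one_pow_eq_or ℚ l with hl | hl <;>
    simp only [mul_add, mul_one, pow_add, pow_mul, hj, hk, hl, one_pow] <;>
    module
  | del x hx => rw [derT, derT, der_fdel, der_fdel, hx, map_smul]

/-! #### The operadic composition -/

theorem derT_add (ν : A → Option C) (k : ℕ) (σ τ : A → FreeBV un C) (t : BVExpr un A) :
    derT ν k (σ + τ) t = derT ν k σ t + derT ν k τ t := by
  induction t with
  | one h => exact (add_zero _).symm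
  | var a => rfl
  | mul x y hx hy =>
    simp only [derT, hx, hy, map_add, LinearMap.add_apply, smul_add]; abel
  | br x y hx hy =>
    simp only [derT, hx, hy, map_add, LinearMap.add_apply, smul_add]; abel
  | del x hx => simp only [derT, hx, map_add]

theorem derT_smul (ν : A → Option C) (k : ℕ) (c : ℚ) (σ : A → FreeBV un C) (t : BVExpr un A) :
    derT ν k (c • σ) t = c • derT ν k σ t := by
  induction t with
  | one h => exact (smul_zero _).symm
  | var a => rfl
  | mul x y hx hy =>
    simp only [derT, hx, hy, map_smul, LinearMap.smul_apply, smul_add, smul_comm c]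
  | br x y hx hy =>
    simp only [derT, hx, hy, map_smul, LinearMap.smul_apply, smul_add, smul_comm c]
  | del x hx => simp only [derT, hx, map_smul]

/-- `derT` as a linear function of `σ`. -/
noncomputable def derLin (ν : A → Option C) (k : ℕ) (t : BVExpr un A) :
    (A → FreeBV un C) →ₗ[ℚ] FreeBV un C where
  toFun σ := derT ν k σ t
  map_add' σ τ := derT_add ν k σ τ t
  map_smul' c σ := derT_smul ν k c σ t

open Classical in
/-- The variables in `A - {a}`, as elements of `(A - {a}) ⊔ B`. -/
noncomputable def keep (B : Type u) (a : A) (b : A) : Option (Ins a B) :=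
  if h : b ≠ a then some (Sum.inl ⟨b, h⟩) else none

theorem keep_self (a : A) : keep B a a = none := dif_neg (not_not.mpr rfl)

theorem keep_ne {a b : A} (h : b ≠ a) : keep B a b = some (Sum.inl ⟨b, h⟩) := dif_pos h

open Classical in
/-- The function on `A` with value `y` at `a` and `0` elsewhere. -/
noncomputable def plug (a : A) : FreeBV un B →ₗ[ℚ] A → FreeBV un (Ins a B) :=
  LinearMap.pi fun b => if b = a then ren (fun c => some (Sum.inr c)) else 0

theorem plug_self (a : A) (y : FreeBV un B) :
    plug a y a = ren (fun c => some (Sum.inr c)) y := by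
  rw [plug, LinearMap.pi_apply, if_pos rfl]

theorem plug_ne {a b : A} (h : b ≠ a) (y : FreeBV un B) : plug a y b = 0 := by
  rw [plug, LinearMap.pi_apply, if_neg h, LinearMap.zero_apply]

theorem plug_mem_gr (a : A) {k : ℕ} {y : FreeBV un B} (hy : y ∈ gr un B k) (b : A) :
    plug a y b ∈ gr un (Ins a B) k := by
  by_cases h : b = a
  · rw [h, plug_self]; exact ren_mem_gr _ hy
  · rw [plug_ne h]; exact zero_mem _

/-- The substitution of an expression `u` for the variable `a`, with the Koszul sign, as a linear
map. (It kills the expressions that do not contain `a` exactly once.) -/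
noncomputable def substExpr (a : A) (u : BVExpr un B) : FreeBV un A →ₗ[ℚ] FreeBV un (Ins a B) :=
  der (keep B a) (deg u) (plug a (mk u)) (plug_mem_gr a (mk_mem_gr u))

/-- The composition `∘_a` on free BV algebras: `comp a y x` is the result of substituting `y` for the
variable `a` in `x`. -/
noncomputable def comp (a : A) : FreeBV un B →ₗ[ℚ] FreeBV un A →ₗ[ℚ] FreeBV un (Ins a B) :=
  lift (substExpr a) fun r h => by
    obtain ⟨k, hk⟩ := rel_homogeneous h
    refine ext_all fun t => ?_
    have h1 : (Finsupp.linearCombination ℚ (substExpr a) r) (mk t) =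
        Finsupp.linearCombination ℚ (fun u => derLin (keep B a) k t (plug a (mk u))) r := by
      rw [Finsupp.linearCombination_apply, Finsupp.linearCombination_apply, Finsupp.sum,
        Finsupp.sum, LinearMap.sum_apply]
      refine Finset.sum_congr rfl fun u hu => ?_
      rw [LinearMap.smul_apply, substExpr, der_mk, show deg u = k from hk hu]
      rfl
    have h2 := lc_lin (un := un) (A := B) mk mk ((derLin (keep B a) k t).comp (plug a)) 0 r
    simp only [LinearMap.zero_apply, add_zero, LinearMap.comp_apply, linearCombination_mk,
      mkQ_eq_zero h, map_zero] at h2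
    rw [h1, h2, LinearMap.zero_apply]

theorem comp_mk (a : A) (u : BVExpr un B) : comp a (mk u) = substExpr a u := lift_mk _ _ u

theorem comp_of_gr (a : A) {k : ℕ} {y : FreeBV un B} (hy : y ∈ gr un B k) :
    comp a y = der (keep B a) k (plug a y) (plug_mem_gr a hy) := by
  refine ext_all fun t => ?_
  rw [der_mk]
  refine ext₁ (f := (comp a).flip (mk t)) (g := (derLin (keep B a) k t).comp (plug a)) ?_ hy
  rintro u rfl
  rw [LinearMap.flip_apply, comp_mk, substExpr, der_mk]
  rfl

theorem comp_mem_gr (a : A) {i j : ℕ} {x : FreeBV un A} {y : FreeBV un B} (hx : x ∈ gr un A i)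
    (hy : y ∈ gr un B j) : comp a y x ∈ gr un (Ins a B) (i + j) := by
  rw [comp_of_gr a hy]
  exact der_mem_gr _ _ _ _ hx

theorem ren_some (x : FreeBV un A) : ren (fun a => some a) x = x := by
  have : ∀ t : BVExpr un A, renT (fun a => some a) t = mk t := by
    intro t
    induction t with
    | one h => rfl
    | var a => rfl
    | mul x y hx hy => rw [renT, hx, hy, fmul_mk]
    | br x y hx hy => rw [renT, hx, hy, fbr_mk]
    | del x hx => rw [renT, hx, fdel_mk]
  refine LinearMap.congr_fun (g := LinearMap.id) (ext_all fun t => ?_) x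
  rw [ren_mk, this, LinearMap.id_apply]

theorem ren_ren (ν : A → Option C) (μ : C → Option D) (x : FreeBV un A) :
    ren μ (ren ν x) = ren (fun a => (ν a).bind μ) x := by
  refine LinearMap.congr_fun (f := (ren μ).comp (ren ν)) (ext_all fun t => ?_) x
  rw [LinearMap.comp_apply, ren_mk, ren_renT, ren_mk]

theorem ren_comp {A' B' : Type u} (e : A ≃ A') (f : B ≃ B') (a : A) (x : FreeBV un A)
    (y : FreeBV un B) :
    ren (fun c => some (Ins.congr e f a c)) (comp a y x) =
      comp (e a) (ren (fun c => some (f c)) y) (ren (fun c => some (e c)) x) := by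
  refine LinearMap.congr_fun₂
    (f := (comp a).compr₂ (ren (un := un) fun c => some (Ins.congr e f a c)))
    (g := (comp (e a)).compl₁₂ (ren fun c => some (f c)) (ren fun c => some (e c)))
    (ext_all fun u => ext_all fun t => ?_) y x
  rw [LinearMap.compr₂_apply, LinearMap.compl₁₂_apply, comp_mk, substExpr, der_mk,
    comp_of_gr (e a) (ren_mem_gr _ (mk_mem_gr u)), ren_mk _ t, der_renT, ren_derT]
  congr 1
  · funext b
    by_cases h : b = a
    · subst h
      rw [keep_self, Option.bind_some, keep_self]; rfl
    · rw [keep_ne h, Option.bind_some, Option.bind_some, keep_ne (fun h' => h (e.injective h'))]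
      rfl
  · funext b
    by_cases h : b = a
    · subst h
      rw [plug_self, Option.elim_some, plug_self, ren_ren, ren_ren]; rfl
    · rw [plug_ne h, Option.elim_some, plug_ne (fun h' => h (e.injective h')), map_zero]

theorem comp_assoc_seq (a : A) (b : B) (x : FreeBV un A) (y : FreeBV un B) (z : FreeBV un D) :
    ren (fun c => some (Ins.seq a b c)) (comp (Sum.inr b : Ins a B) z (comp a y x)) =
      comp a (comp b z y) x := by
  have key : ∀ (t : BVExpr un A) (u : BVExpr un B) (v : BVExpr un D),
      ren (fun c => some (Ins.seq a b c))
        (comp (Sum.inr b : Ins a B) (mk v) (comp a (mk u) (mk t))) =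
      comp a (comp b (mk v) (mk u)) (mk t) := by
    intro t u v
    have hne : ∀ x : {x : A // x ≠ a}, (Sum.inl x : Ins a B) ≠ Sum.inr b :=
      fun x => Sum.inl_ne_inr
    rw [comp_mk a u, substExpr, der_mk, comp_mk, substExpr, der_derT_seq, ren_derT,
      comp_of_gr a (comp_mem_gr b (mk_mem_gr u) (mk_mem_gr v)), der_mk]
    · congr 1
      · funext b'
        by_cases h : b' = a
        · subst h
          rw [keep_self, keep_self]; rfl
        · rw [keep_ne h, keep_ne h, Option.bind_some, keep_ne (hne _)]; rfl
      · funext b'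
        by_cases h : b' = a
        · subst h
          rw [plug_self, plug_self, ren_mk, der_renT, ren_derT, comp_mk, substExpr, der_mk,
            ren_derT]
          congr 1
          · funext d
            by_cases hd : d = b
            · subst hd
              rw [keep_self, Option.bind_some, keep_self]; rfl
            · rw [keep_ne hd, Option.bind_some, keep_ne (fun h' => hd (Sum.inr_injective h'))]; rfl
          · funext d
            by_cases hd : d = b
            · subst hd
              rw [plug_self, Option.elim_some, plug_self, ren_ren, ren_ren]; rfl
            · rw [plug_ne hd, Option.elim_some, plug_ne (fun h' => hd (Sum.inr_injective h')),
                map_zero, map_zero]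
        · rw [plug_ne h, plug_ne h, map_zero, map_zero]
    · exact plug_mem_gr a (mk_mem_gr u)
    · intro a'
      by_cases h : a' = a
      · subst h; rw [keep_self]; rfl
      · rw [keep_ne h, Option.elim_some, plug_ne (hne _)]
  refine LinearMap.congr_fun (f := (ren (fun c => some (Ins.seq a b c))).comp
    ((comp (Sum.inr b : Ins a B) z).comp (comp a y))) (g := comp a (comp b z y))
    (ext_all fun t => ?_) x
  refine LinearMap.congr_fun (f := (ren (fun c => some (Ins.seq a b c))).comp
    ((comp (Sum.inr b : Ins a B) z).comp ((comp a).flip (mk t))))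
    (g := ((comp a).flip (mk t)).comp (comp b z)) (ext_all fun u => ?_) y
  exact LinearMap.congr_fun (f := (ren (fun c => some (Ins.seq a b c))).comp
    ((comp (Sum.inr b : Ins a B)).flip (comp a (mk u) (mk t))))
    (g := ((comp a).flip (mk t)).comp ((comp b).flip (mk u))) (ext_all fun v => key t u v) z

theorem der_ren_zero (ν : A → Option C) (μ : C → Option D) (l : ℕ) (τ : C → FreeBV un D)
    (hτ : ∀ c, τ c ∈ gr un D l) (h : ∀ a, (ν a).elim 0 τ = 0) (x : FreeBV un A) :
    der μ l τ hτ (ren ν x) = 0 := by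
  refine LinearMap.congr_fun (f := (der μ l τ hτ).comp (ren ν)) (g := 0) (ext_all fun t => ?_) x
  rw [LinearMap.comp_apply, ren_mk, der_renT, show (fun a => (ν a).elim 0 τ) = fun _ => 0 from
    funext h, derT_zero, LinearMap.zero_apply]

theorem comp_assoc_par (a a' : A) (h : a ≠ a') (j k : ℕ) (x : FreeBV un A) (y : FreeBV un B)
    (z : FreeBV un D) (hy : y ∈ gr un B j) (hz : z ∈ gr un D k) :
    ren (fun c => some (Ins.par a a' h c)) (comp (Sum.inl ⟨a', h.symm⟩ : Ins a B) z (comp a y x)) =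
      (-1 : ℚ) ^ (j * k) • comp (Sum.inl ⟨a, h⟩ : Ins a' D) y (comp a' z x) := by
  refine LinearMap.congr_fun (f := (ren (fun c => some (Ins.par a a' h c))).comp
    ((comp (Sum.inl ⟨a', h.symm⟩ : Ins a B) z).comp (comp a y)))
    (g := (-1 : ℚ) ^ (j * k) • (comp (Sum.inl ⟨a, h⟩ : Ins a' D) y).comp (comp a' z))
    (ext_all fun t => ?_) x
  have hz' := plug_mem_gr (Sum.inl ⟨a', h.symm⟩ : Ins a B) hz
  have hren : ∀ w : FreeBV un (Ins a B), ren (fun c => some (Ins.par a a' h c))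
      (comp (Sum.inl ⟨a', h.symm⟩ : Ins a B) z w) =
      der (fun c => (keep D (Sum.inl ⟨a', h.symm⟩ : Ins a B) c).bind
        fun c => some (Ins.par a a' h c)) k
        (fun c => ren (fun c => some (Ins.par a a' h c)) (plug _ z c))
        (fun c => ren_mem_gr _ (hz' c)) w := by
    intro w
    refine LinearMap.congr_fun (f := (ren (fun c => some (Ins.par a a' h c))).comp
      (comp (Sum.inl ⟨a', h.symm⟩ : Ins a B) z)) (ext_all fun s => ?_) w
    rw [LinearMap.comp_apply, comp_of_gr _ hz, der_mk, ren_derT, der_mk]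
  simp only [LinearMap.comp_apply, LinearMap.smul_apply]
  rw [hren, comp_of_gr a hy, comp_of_gr a' hz, der_mk, der_mk, comp_of_gr _ hy]
  have hl : ∀ {x : A} (hx : x ≠ a) (hx' : x ≠ a'),
      (Sum.inl ⟨x, hx⟩ : Ins a B) ≠ Sum.inl ⟨a', h.symm⟩ :=
    fun hx hx' e => hx' (congrArg Subtype.val (Sum.inl_injective e))
  have hr : ∀ {x : A} (hx : x ≠ a) (hx' : x ≠ a'),
      (Sum.inl ⟨x, hx'⟩ : Ins a' D) ≠ Sum.inl ⟨a, h⟩ :=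
    fun hx hx' e => hx (congrArg Subtype.val (Sum.inl_injective e))
  refine der_derT_par _ _ _ (plug_mem_gr a hy) _ _ _ _ _ _ (plug_mem_gr a' hz) _ _ _ ?_ ?_ ?_ ?_
    ?_ t
  · intro b
    by_cases hb : b = a
    · subst hb; rw [keep_self, keep_ne h, Option.bind_some, keep_self]; rfl
    by_cases hb' : b = a'
    · subst hb'; rw [keep_self, keep_ne hb, Option.bind_some, keep_self]; rfl
    rw [keep_ne hb, keep_ne hb', Option.bind_some, Option.bind_some, keep_ne (hl hb hb'),
      keep_ne (hr hb hb')]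
    rfl
  · intro b
    by_cases hb : b = a
    · subst hb; rw [keep_self, plug_ne h, map_zero]; rfl
    by_cases hb' : b = a'
    · subst hb'
      rw [keep_ne hb, plug_self, Option.elim_some, plug_self, ren_ren, ren_ren]
      congr 2
      funext c
      rw [Option.bind_some, Option.bind_some, keep_ne Sum.inr_ne_inl]
      rfl
    rw [keep_ne hb, plug_ne hb', Option.elim_some, plug_ne (hl hb hb'), map_zero, map_zero]
  · intro b
    by_cases hb' : b = a'
    · subst hb'; rw [keep_self, plug_ne h.symm, map_zero]; rfl
    by_cases hb : b = a
    · subst hb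
      rw [keep_ne hb', plug_self, Option.elim_some, plug_self, ren_ren]
      congr 2
      funext c
      rw [Option.bind_some, keep_ne Sum.inr_ne_inl]
      rfl
    rw [keep_ne hb', plug_ne hb, Option.elim_some, plug_ne (hr hb hb'), map_zero]
  · intro b
    by_cases hb : b = a
    · subst hb
      rw [plug_self]
      refine der_ren_zero _ _ _ _ _ (fun c => ?_) y
      rw [Option.elim_some, plug_ne Sum.inr_ne_inl, map_zero]
    · rw [plug_ne hb, map_zero]
  · intro b
    by_cases hb : b = a'
    · subst hb
      rw [plug_self]
      refine der_ren_zero _ _ _ _ _ (fun c => ?_) z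
      rw [Option.elim_some, plug_ne Sum.inr_ne_inl]
    · rw [plug_ne hb, map_zero]

/-! #### The composition on multilinear expressions -/

open Classical in
/-- The expression over `(A - {a}) ⊔ B` obtained from an expression over `A` by substituting `u` for
the variable `a`. -/
noncomputable def substT (a : A) (u : BVExpr un (Ins a B)) :
    BVExpr un A → BVExpr un (Ins a B)
  | one h => one h
  | var b => if h : b ≠ a then var (Sum.inl ⟨b, h⟩) else u
  | mul x y => mul (substT a u x) (substT a u y)
  | br x y => br (substT a u x) (substT a u y)
  | del x => del (substT a u x)

/-- The renaming of variables along a map. -/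
def rename (f : A → C) : BVExpr un A → BVExpr un C
  | one h => one h
  | var a => var (f a)
  | mul x y => mul (rename f x) (rename f y)
  | br x y => br (rename f x) (rename f y)
  | del x => del (rename f x)

open Classical in
/-- The number of symbols of degree one (commas of brackets and operators `Δ`) to the right of the
variable `a`, in an expression containing `a` exactly once. -/
noncomputable def oddRight (a : A) : BVExpr un A → ℕ
  | one _ => 0
  | var _ => 0
  | mul x y => if a ∈ y.vars then oddRight a y else oddRight a x + deg y
  | br x y => if a ∈ y.vars then oddRight a y else oddRight a x + (deg y + 1)
  | del x => oddRight a x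

theorem renT_some (f : A → C) (t : BVExpr un A) : renT (fun a => some (f a)) t = mk (rename f t) := by
  induction t with
  | one h => rfl
  | var a => rfl
  | mul x y hx hy => rw [renT, hx, hy, fmul_mk]; rfl
  | br x y hx hy => rw [renT, hx, hy, fbr_mk]; rfl
  | del x hx => rw [renT, hx, fdel_mk]; rfl

theorem ren_mk_some (f : A → C) (t : BVExpr un A) :
    ren (fun a => some (f a)) (mk t) = mk (rename f t) := by
  rw [ren_mk, renT_some]

theorem keep_of_notMem (a : A) (k : ℕ) (u : BVExpr un B) (w : BVExpr un (Ins a B))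
    (t : BVExpr un A) (h : a ∉ t.vars) :
    renT (keep B a) t = mk (substT a w t) ∧ derT (keep B a) k (plug a (mk u)) t = 0 := by
  induction t with
  | one h => exact ⟨rfl, rfl⟩
  | var b =>
    have hb : b ≠ a := fun e => h (by rw [e]; exact Multiset.mem_singleton_self a)
    rw [renT, derT, keep_ne hb, plug_ne hb, substT, dif_pos hb]
    exact ⟨rfl, rfl⟩
  | mul x y hx hy =>
    rw [vars, Multiset.mem_add, not_or] at h
    rw [renT, derT, (hx h.1).1, (hy h.2).1, (hx h.1).2, (hy h.2).2, fmul_mk, map_zero, map_zero,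
      LinearMap.zero_apply, smul_zero, add_zero]
    exact ⟨rfl, rfl⟩
  | br x y hx hy =>
    rw [vars, Multiset.mem_add, not_or] at h
    rw [renT, derT, (hx h.1).1, (hy h.2).1, (hx h.1).2, (hy h.2).2, fbr_mk, map_zero, map_zero,
      LinearMap.zero_apply, smul_zero, add_zero]
    exact ⟨rfl, rfl⟩
  | del x hx =>
    rw [renT, derT, (hx h).1, (hx h).2, map_zero, fdel_mk]
    exact ⟨rfl, rfl⟩

theorem keep_of_mem (a : A) (t : BVExpr un A) (h : a ∈ t.vars) : renT (keep B a) t = 0 := by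
  induction t with
  | one h' => exact absurd h (Multiset.notMem_zero a)
  | var b =>
    obtain rfl : a = b := Multiset.mem_singleton.mp h
    rw [renT, keep_self]; rfl
  | mul x y hx hy =>
    rw [renT]
    rcases Multiset.mem_add.mp h with h | h
    · rw [hx h, map_zero, LinearMap.zero_apply]
    · rw [hy h, map_zero]
  | br x y hx hy =>
    rw [renT]
    rcases Multiset.mem_add.mp h with h | h
    · rw [hx h, map_zero, LinearMap.zero_apply]
    · rw [hy h, map_zero]
  | del x hx => rw [renT, hx h, map_zero]

/-- On an expression `t` containing `a` once, `∘_a` is the substitution of `u` for `a`, with the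
Koszul sign of moving `u` past the symbols of degree one that are to the right of `a` in `t`. -/
theorem comp_mk_mk (a : A) (t : BVExpr un A) (u : BVExpr un B) (h : a ∈ t.vars)
    (h' : t.vars.Nodup) :
    comp a (mk u) (mk t) =
      (-1 : ℚ) ^ (deg u * oddRight a t) • mk (substT a (rename Sum.inr u) t) := by
  rw [comp_mk, substExpr, der_mk]
  have h0 := keep_of_notMem a (deg u) u (rename Sum.inr u : BVExpr un (Ins a B))
  induction t with
  | one h'' => exact absurd h (Multiset.notMem_zero a)
  | var b =>
    obtain rfl : a = b := Multiset.mem_singleton.mp h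
    rw [derT, plug_self, ren_mk_some, oddRight, mul_zero, pow_zero, one_smul, substT,
      dif_neg (not_not.mpr rfl)]
  | mul x y hx hy =>
    rw [vars, Multiset.nodup_add] at h'
    rw [derT, substT, ← fmul_mk, oddRight]
    by_cases hay : a ∈ y.vars
    · have hax : a ∉ x.vars := fun hax => Multiset.disjoint_left.mp h'.2.2 hax hay
      rw [if_pos hay, hy hay h'.2.1, (h0 x hax).1, (h0 x hax).2, map_zero, LinearMap.zero_apply,
        smul_zero, add_zero, map_smul]
    · have hax : a ∈ x.vars := (Multiset.mem_add.mp h).resolve_right hay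
      rw [if_neg hay, hx hax h'.1, (h0 y hay).1, (h0 y hay).2, map_zero, zero_add, map_smul,
        LinearMap.smul_apply, smul_smul, ← pow_add, mul_add, add_comm]
  | br x y hx hy =>
    rw [vars, Multiset.nodup_add] at h'
    rw [derT, substT, ← fbr_mk, oddRight]
    by_cases hay : a ∈ y.vars
    · have hax : a ∉ x.vars := fun hax => Multiset.disjoint_left.mp h'.2.2 hax hay
      rw [if_pos hay, hy hay h'.2.1, (h0 x hax).1, (h0 x hax).2, map_zero, LinearMap.zero_apply,
        smul_zero, add_zero, map_smul]
    · have hax : a ∈ x.vars := (Multiset.mem_add.mp h).resolve_right hay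
      rw [if_neg hay, hx hax h'.1, (h0 y hay).1, (h0 y hay).2, map_zero, zero_add, map_smul,
        LinearMap.smul_apply, smul_smul, ← pow_add, ← mul_add, add_comm]
  | del x hx =>
    rw [derT, hx h h', map_smul, fdel_mk]
    rfl

/-! #### The multilinear part -/

/-- The space `BV_A`: the part of the free BV algebra on `A` spanned by the expressions containing
each element of `A` exactly once. -/
noncomputable def multilinear (un : Bool) (A : Type u) : Submodule ℚ (FreeBV un A) :=
  Submodule.span ℚ (mk '' {t | IsMultilinear t})

theorem vars_rename (f : A → C) (t : BVExpr un A) : (rename f t).vars = t.vars.map f := by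
  induction t with
  | one h => rfl
  | var a => rfl
  | mul x y hx hy => rw [rename, vars, vars, hx, hy, Multiset.map_add]
  | br x y hx hy => rw [rename, vars, vars, hx, hy, Multiset.map_add]
  | del x hx => exact hx

theorem isMultilinear_rename (e : A ≃ B) {t : BVExpr un A} (h : t.IsMultilinear) :
    (rename e t).IsMultilinear := by
  rw [IsMultilinear, vars_rename]
  exact ⟨h.1.map e.injective, fun b => Multiset.mem_map.mpr ⟨e.symm b, h.2 _, e.apply_symm_apply b⟩⟩

theorem ren_mem_multilinear (e : A ≃ B) {x : FreeBV un A} (hx : x ∈ multilinear un A) :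
    ren (fun a => some (e a)) x ∈ multilinear un B := by
  refine Submodule.span_induction (p := fun x _ => ren (fun a => some (e a)) x ∈ multilinear un B)
    ?_ ?_ ?_ ?_ hx
  · rintro _ ⟨t, ht, rfl⟩
    rw [ren_mk_some]
    exact Submodule.subset_span ⟨_, isMultilinear_rename e ht, rfl⟩
  · rw [map_zero]; exact zero_mem _
  · intro x y _ _ hx hy; rw [map_add]; exact add_mem hx hy
  · intro c x _ hx; rw [map_smul]; exact Submodule.smul_mem _ c hx

theorem vars_substT_of_notMem (a : A) (w : BVExpr un (Ins a B)) (t : BVExpr un A)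
    (h : a ∉ t.vars) : (substT a w t).vars = t.vars.filterMap (keep B a) := by
  induction t with
  | one h => rfl
  | var b =>
    have hb : b ≠ a := fun e => h (by rw [e]; exact Multiset.mem_singleton_self a)
    rw [substT, dif_pos hb, vars, vars, ← Multiset.cons_zero b,
      Multiset.filterMap_cons_some _ _ _ (keep_ne hb)]
    rfl
  | mul x y hx hy =>
    rw [vars, Multiset.mem_add, not_or] at h
    rw [substT, vars, vars, hx h.1, hy h.2, Multiset.filterMap_add]
  | br x y hx hy =>
    rw [vars, Multiset.mem_add, not_or] at h
    rw [substT, vars, vars, hx h.1, hy h.2, Multiset.filterMap_add]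
  | del x hx => exact hx h

theorem vars_substT (a : A) (w : BVExpr un (Ins a B)) (t : BVExpr un A) (h : a ∈ t.vars)
    (h' : t.vars.Nodup) : (substT a w t).vars = t.vars.filterMap (keep B a) + w.vars := by
  induction t with
  | one h'' => exact absurd h (Multiset.notMem_zero a)
  | var b =>
    obtain rfl : a = b := Multiset.mem_singleton.mp h
    rw [substT, dif_neg (not_not.mpr rfl), vars, ← Multiset.cons_zero a,
      Multiset.filterMap_cons_none _ _ (keep_self a), Multiset.filterMap_zero, zero_add]
  | mul x y hx hy =>
    rw [vars, Multiset.nodup_add] at h'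
    rw [substT, vars, vars, Multiset.filterMap_add]
    by_cases hay : a ∈ y.vars
    · have hax : a ∉ x.vars := fun hax => Multiset.disjoint_left.mp h'.2.2 hax hay
      rw [hy hay h'.2.1, vars_substT_of_notMem a w x hax, add_assoc]
    · have hax : a ∈ x.vars := (Multiset.mem_add.mp h).resolve_right hay
      rw [hx hax h'.1, vars_substT_of_notMem a w y hay, add_right_comm]
  | br x y hx hy =>
    rw [vars, Multiset.nodup_add] at h'
    rw [substT, vars, vars, Multiset.filterMap_add]
    by_cases hay : a ∈ y.vars
    · have hax : a ∉ x.vars := fun hax => Multiset.disjoint_left.mp h'.2.2 hax hay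
      rw [hy hay h'.2.1, vars_substT_of_notMem a w x hax, add_assoc]
    · have hax : a ∈ x.vars := (Multiset.mem_add.mp h).resolve_right hay
      rw [hx hax h'.1, vars_substT_of_notMem a w y hay, add_right_comm]
  | del x hx => exact hx h h'

theorem keep_eq_some {a b : A} {c : Ins a B} (h : keep B a b = some c) :
    ∃ hb : b ≠ a, c = Sum.inl ⟨b, hb⟩ := by
  by_cases hb : b = a
  · rw [hb, keep_self] at h; exact absurd h (Option.some_ne_none c).symm
  · rw [keep_ne hb] at h; exact ⟨hb, (Option.some_injective _ h).symm⟩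

theorem isMultilinear_subst (a : A) {t : BVExpr un A} {u : BVExpr un B} (ht : t.IsMultilinear)
    (hu : u.IsMultilinear) :
    (substT a (rename Sum.inr u : BVExpr un (Ins a B)) t).IsMultilinear := by
  rw [IsMultilinear, vars_substT a _ t (ht.2 a) ht.1, vars_rename]
  refine ⟨Multiset.nodup_add.mpr ⟨?_, hu.1.map Sum.inr_injective, ?_⟩, ?_⟩
  · refine ht.1.filterMap _ fun b b' c hb hb' => ?_
    obtain ⟨_, rfl⟩ := keep_eq_some hb
    obtain ⟨_, h⟩ := keep_eq_some hb'
    exact congrArg Subtype.val (Sum.inl_injective h)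
  · refine Multiset.disjoint_left.mpr fun {c} hc hc' => ?_
    obtain ⟨b, _, hb⟩ := (Multiset.mem_filterMap _ _).mp hc
    obtain ⟨_, rfl⟩ := keep_eq_some hb
    obtain ⟨y, _, hy⟩ := Multiset.mem_map.mp hc'
    exact Sum.inr_ne_inl hy
  · rintro (⟨b, hb⟩ | y)
    · exact Multiset.mem_add.mpr (Or.inl ((Multiset.mem_filterMap _ _).mpr ⟨b, ht.2 b, keep_ne hb⟩))
    · exact Multiset.mem_add.mpr (Or.inr (Multiset.mem_map.mpr ⟨y, hu.2 y, rfl⟩))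

theorem comp_mem_multilinear (a : A) {x : FreeBV un A} {y : FreeBV un B}
    (hx : x ∈ multilinear un A) (hy : y ∈ multilinear un B) :
    comp a y x ∈ multilinear un (Ins a B) := by
  refine Submodule.span_induction (p := fun x _ => comp a y x ∈ multilinear un (Ins a B))
    ?_ ?_ ?_ ?_ hx
  · rintro _ ⟨t, ht, rfl⟩
    refine Submodule.span_induction (p := fun y _ => comp a y (mk t) ∈ multilinear un (Ins a B))
      ?_ ?_ ?_ ?_ hy
    · rintro _ ⟨u, hu, rfl⟩
      rw [comp_mk_mk a t u (ht.2 a) ht.1]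
      exact Submodule.smul_mem _ _ (Submodule.subset_span ⟨_, isMultilinear_subst a ht hu, rfl⟩)
    · rw [map_zero]; exact zero_mem _
    · intro x y _ _ hx hy; rw [map_add]; exact add_mem hx hy
    · intro c x _ hx; rw [map_smul]; exact Submodule.smul_mem _ c hx
  · rw [map_zero]; exact zero_mem _
  · intro x y _ _ hx hy; rw [map_add]; exact add_mem hx hy
  · intro c x _ hx; rw [map_smul]; exact Submodule.smul_mem _ c hx

/-- The projection of the free BV algebra to its homogeneous part of degree `n`. -/
noncomputable def proj (n : ℕ) : FreeBV un A →ₗ[ℚ] FreeBV un A :=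
  lift (fun t => if deg t = n then mk t else 0) fun r h => by
    obtain ⟨k, hk⟩ := rel_homogeneous h
    by_cases hn : k = n
    · rw [lc_congr (g := mk) fun t ht => if_pos ((show deg t = k from hk ht).trans hn),
        linearCombination_mk, mkQ_eq_zero h]
    · rw [lc_congr (g := fun _ => 0) fun t ht =>
        if_neg fun e => hn ((show deg t = k from hk ht).symm.trans e)]
      rw [Finsupp.linearCombination_apply, Finsupp.sum]
      exact Finset.sum_eq_zero fun t _ => smul_zero _

theorem proj_of_mem {n : ℕ} {x : FreeBV un A} (hx : x ∈ gr un A n) : proj n x = x := by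
  refine ext₁ (g := LinearMap.id) (fun t ht => ?_) hx
  rw [proj, lift_mk, if_pos ht, LinearMap.id_apply]

theorem proj_of_mem_ne {n m : ℕ} (h : m ≠ n) {x : FreeBV un A} (hx : x ∈ gr un A m) :
    proj n x = 0 := by
  refine ext₁ (g := 0) (fun t ht => ?_) hx
  rw [proj, lift_mk, if_neg (fun e => h (ht.symm.trans e)), LinearMap.zero_apply]

theorem multilinear_isInternal (un : Bool) (A : Type u) :
    DirectSum.IsInternal fun n => (gr un A n).comap (multilinear un A).subtype := by
  refine DirectSum.isInternal_submodule_of_iSupIndep_of_iSup_eq_top ?_ ?_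
  · refine iSupIndep_def.mpr fun n => Submodule.disjoint_def.mpr fun x hx hx' => ?_
    have h : ⨆ j, ⨆ (_ : j ≠ n), (gr un A j).comap (multilinear un A).subtype ≤
        LinearMap.ker ((proj n).comp (multilinear un A).subtype) :=
      iSup_le fun j => iSup_le fun hj y hy => proj_of_mem_ne hj hy
    have h1 : proj n x.1 = 0 := h hx'
    rw [proj_of_mem (show x.1 ∈ gr un A n from hx)] at h1
    exact Subtype.ext h1
  · refine eq_top_iff.mpr fun x _ => ?_
    obtain ⟨x, hx⟩ := x
    refine Submodule.span_induction (p := fun x hx => (⟨x, hx⟩ : multilinear un A) ∈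
      ⨆ n, (gr un A n).comap (multilinear un A).subtype) ?_ ?_ ?_ ?_ hx
    · rintro _ ⟨t, ht, rfl⟩
      exact Submodule.mem_iSup_of_mem (deg t) (mk_mem_gr t)
    · exact zero_mem _
    · intro x y hx hy h h'; exact add_mem h h'
    · intro c x hx h; exact Submodule.smul_mem _ c h

end

end FreeBV

/-! ### The operad `BV` -/

namespace BV

open FreeBV

section

variable (un : Bool) {A B : Type u}

/-- The graded vector space `BV_A`, as a chain complex with zero differential. -/
noncomputable abbrev space (A : Type u) : DGSpace.{u} where
  carrier := multilinear un A
  gr n := (gr un A n).comap (multilinear un A).subtype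
  isInternal := multilinear_isInternal un A
  d := 0
  d_mem _ _ _ := zero_mem _
  d_gr_zero _ _ := rfl
  d_d _ := rfl

/-- The renaming of variables. -/
noncomputable def relabel (e : A ≃ B) : DGSpace.Hom (space un A) (space un B) where
  toLin := (ren fun a => some (e a)).restrict fun _ hx => ren_mem_multilinear e hx
  map_gr _ _ hx := ren_mem_gr _ hx
  map_d _ := map_zero _

/-- The composition `∘_a`: substitution for the variable `a`. -/
noncomputable def circ (a : A) :
    multilinear un A →ₗ[ℚ] multilinear un B →ₗ[ℚ] multilinear un (Ins a B) :=
  LinearMap.mk₂ ℚ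
    (fun x y => ⟨FreeBV.comp a y.1 x.1, comp_mem_multilinear a x.2 y.2⟩)
    (fun x x' y => Subtype.ext (map_add (FreeBV.comp a y.1) x.1 x'.1))
    (fun c x y => Subtype.ext (map_smul (FreeBV.comp a y.1) c x.1))
    (fun x y y' => Subtype.ext (LinearMap.map_add₂ (FreeBV.comp a) y.1 y'.1 x.1))
    (fun c x y => Subtype.ext (LinearMap.map_smul₂ (FreeBV.comp a) c y.1 x.1))

end

end BV

/-- The operad `BV` (`un = false`: without unit; `un = true`: the operad of unital BV algebras). -/
noncomputable def BV (un : Bool) : Operad.{u} where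
  obj A _ := BV.space un A
  map e := BV.relabel un e
  map_refl _ _ x := Subtype.ext (FreeBV.ren_some x.1)
  map_trans e f x := Subtype.ext
    (FreeBV.ren_ren (fun a => some (e a)) (fun b => some (f b)) x.1).symm
  comp a := BV.circ un a
  comp_gr a _ _ _ _ hx hy := FreeBV.comp_mem_gr a hx hy
  comp_d a i x y _ := by
    change (0 : FreeBV.multilinear un _) = BV.circ un a 0 y + (-1 : ℚ) ^ i • BV.circ un a x 0
    rw [map_zero, map_zero, LinearMap.zero_apply, smul_zero, add_zero]
  map_comp e f a x y := Subtype.ext (FreeBV.ren_comp e f a x.1 y.1)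
  assoc_seq a b x y z := Subtype.ext (FreeBV.comp_assoc_seq a b x.1 y.1 z.1)
  assoc_par a a' h j k x y z hy hz :=
    Subtype.ext (FreeBV.comp_assoc_par a a' h j k x.1 y.1 z.1 hy hz)

namespace BV

section

variable (un : Bool) {A : Type u}

/-- The element of `BV_A` given by an expression containing each element of `A` exactly once. -/
noncomputable def ofExpr [Finite A] (t : BVExpr un A) (h : t.IsMultilinear) : (BV un).obj A :=
  (⟨FreeBV.mk t, Submodule.subset_span ⟨t, h, rfl⟩⟩ : FreeBV.multilinear un A)

variable {un}

theorem pair_isMultilinear {a b : A} (hab : a ≠ b) (hA : ∀ x, x = a ∨ x = b) :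
    ({a} + {b} : Multiset A).Nodup ∧ ∀ x, x ∈ ({a} + {b} : Multiset A) := by
  refine ⟨Multiset.nodup_add.mpr ⟨Multiset.nodup_singleton a, Multiset.nodup_singleton b,
    Multiset.disjoint_singleton.mpr fun h => hab (Multiset.mem_singleton.mp h).symm⟩, fun x => ?_⟩
  rw [Multiset.mem_add, Multiset.mem_singleton, Multiset.mem_singleton]
  exact hA x

variable (un)

/-- The generator `ab` of `BV_{{a, b}}`. -/
noncomputable def genMul [Finite A] (a b : A) (hab : a ≠ b) (hA : ∀ x, x = a ∨ x = b) : (BV un).obj A :=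
  ofExpr un (.mul (.var a) (.var b)) (pair_isMultilinear hab hA)

/-- The generator `[a, b]` of `BV_{{a, b}}`. -/
noncomputable def genBr [Finite A] (a b : A) (hab : a ≠ b) (hA : ∀ x, x = a ∨ x = b) : (BV un).obj A :=
  ofExpr un (.br (.var a) (.var b)) (pair_isMultilinear hab hA)

/-- The generator `Δ a` of `BV_{{a}}`. -/
noncomputable def genDel [Finite A] (a : A) (hA : ∀ x, x = a) : (BV un).obj A :=
  ofExpr un (.del (.var a))
    ⟨Multiset.nodup_singleton a, fun x => Multiset.mem_singleton.mpr (hA x)⟩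

variable {un}

/-- The morphism of operads `φ` sends `ab` to `1`, `[a, b]` to `t_{ab}` and `Δ a` to `s_a`. -/
def SendsGenerators (φ : Operad.Hom (BV.{u} un) wedgeDK.{u}) : Prop :=
  (∀ (A : Type u) [Finite A] (a b : A) (hab : a ≠ b) (hA : ∀ x, x = a ∨ x = b),
    φ.app A (genMul un a b hab hA) = (1 : ExteriorAlgebra ℚ (DK A)) ∧
    φ.app A (genBr un a b hab hA) = ExteriorAlgebra.ι ℚ (DK.t a b)) ∧
  (∀ (A : Type u) [Finite A] (a : A) (hA : ∀ x, x = a),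
    φ.app A (genDel un a hA) = ExteriorAlgebra.ι ℚ (DK.s a))

end

end BV

end FramedDisks

/-!
The morphism `φ` is given by an explicit formula: a product is sent to the product, `Δ x` to
`(∑ s_a + ∑ t_{ab}) ∧ φ x` with sums over the variables of `x` and their pairs, and `[x, y]` to
`φ x ∧ (∑ t_{ab}) ∧ φ y` with `a` running through the variables of `x` and `b` through those of `y`. The
relations of BV algebras hold for these values because the sums are additive in the sets of variables
(`FreeBV.phiT_rel`). On multilinear expressions the values are cycles, since the sum contributed by an
operation commutes with all `t_{ab}` contributed inside one of its arguments (`FreeBV.d_phiT_mul`), and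
substitution becomes the composition of `⋀ t̃` (`FreeBV.phi_comp`).

That `φ_A` is a quasi-isomorphism follows by adding one element `*` to `A` at a time
(`FreeBV.represents`). On one side, `t̃` on `A ⊔ {*}` is an extension of `t̃_A` by the product of the free
Lie algebra on the elements `t_{a*}` and the line spanned by the central element `s_*`
(`DK.baseIncl_add_bijective`). The homology of a free Lie algebra is spanned by `1` and the generators
(`FreeLie.exists_of_cycle`), so that the homology of this kernel has the basis
`1, t_{a*}, s_*, t_{a*} s_*`. Each of these classes extends to a chain map `DK.double` from `⋀ t̃_A` to the
complex for `A ⊔ {*}`: include `t̃_A`, or double the strand `a` when `t_{a*}` occurs, and multiply by the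
class. The filtration by the degree in `⋀ t̃_A` shows that the homology for `A ⊔ {*}` is the direct sum of
the images of these maps (`CE.quasiIso_of_fiber`, `DK.double_quasiIso`).

On the other side, a multilinear expression on `A ⊔ {*}` is a combination of expressions on `A`
multiplied by `*` or `Δ *`, or with a variable `a` replaced by `[a, *]` or `[a, Δ *]`
(`FreeBV.exists_eq_sum_insertStar`), and `φ` sends these four kinds of insertions to the four kinds of
maps `DK.double` (`FreeBV.phi_insertStar`). So the values of `φ` represent each homology class exactly
once for `A ⊔ {*}` if they do so for `A`. The linear independence needed in `BV_A` comes out of the same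
argument, without the choice of a basis. The induction starts with the empty set in the presence of a
unit, and with one element otherwise.

The insertions are also operadic compositions with `p q`, `[p, q]`, `p (Δ q)` and `[p, Δ q]`, which gives
the uniqueness of `φ` (`BV.hom_ext`). The values on the identity of the operad and on the unit, which are
not among the prescribed ones, are forced because they are scalars in degree zero and the compositions
of `p q` with them have prescribed values.
-/

namespace FramedDisks

open ExteriorAlgebra (ι)
open scoped TensorProduct

/-! ### Derivations and direct sum decompositions of exterior algebras -/

namespace CE

section Extension

variable {L M : Type u} [LieRing L] [LieAlgebra ℚ L] [LieRing M] [LieAlgebra ℚ M]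

/-- The derivation of `⋀ M` extending a linear endomorphism `D` of `M`. -/
noncomputable def ext (D : M →ₗ[ℚ] M) : ExteriorAlgebra ℚ M →ₗ[ℚ] ExteriorAlgebra ℚ M :=
  CliffordAlgebra.foldr' (0 : QuadraticForm ℚ M)
    (((wedgeLeft M).comp D).compl₂ (LinearMap.fst ℚ _ _) +
      (wedgeLeft M).compl₂ (LinearMap.snd ℚ _ _))
    (fun y w fw => by
      change ι ℚ (D y) * (ι ℚ y * w) + ι ℚ y * (ι ℚ (D y) * w + ι ℚ y * fw) = (0 : ℚ) • fw
      rw [mul_add, ι_sq_mul, ι_swap_mul (D y) y, add_zero, zero_smul, neg_add_cancel])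
    0

theorem ext_algebraMap (D : M →ₗ[ℚ] M) (r : ℚ) : ext D (algebraMap ℚ _ r) = 0 := by
  rw [ext, CliffordAlgebra.foldr'_algebraMap, smul_zero]

theorem ext_ι_mul (D : M →ₗ[ℚ] M) (y : M) (w : ExteriorAlgebra ℚ M) :
    ext D (ι ℚ y * w) = ι ℚ (D y) * w + ι ℚ y * ext D w :=
  CliffordAlgebra.foldr'_ι_mul _ _ _ _ _ _

/-- If `ad x` preserves the image of `j : M → L`, acting there as the endomorphism `D` of `M`, then
`θ x` acts on the image of `⋀ M` as the derivation extending `D`. -/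
theorem θ_map (j : M →ₗ[ℚ] L) (D : M →ₗ[ℚ] M) (x : L) (h : ∀ m, ⁅x, j m⁆ = j (D m))
    (w : ExteriorAlgebra ℚ M) :
    θ x (ExteriorAlgebra.map j w) = ExteriorAlgebra.map j (ext D w) := by
  induction w using CE.induction with
  | hr r => simp only [AlgHom.commutes, θ_algebraMap, ext_algebraMap, map_zero]
  | ha v w hv hw => simp only [map_add, hv, hw]
  | hm z w hw =>
    simp only [map_mul, ExteriorAlgebra.map_apply_ι, θ_ι_mul, ext_ι_mul, map_add, hw, h]

theorem d_ι (x : L) : d L (ι ℚ x) = 0 := by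
  have := d_ι_mul x 1
  rw [mul_one, ← map_one (algebraMap ℚ (ExteriorAlgebra ℚ L)), θ_algebraMap, d_algebraMap,
    mul_zero, sub_zero] at this
  exact this

theorem d_one : d L (1 : ExteriorAlgebra ℚ L) = 0 := by
  rw [← map_one (algebraMap ℚ (ExteriorAlgebra ℚ L)), d_algebraMap]

/-- Right exterior multiplication by an element commuting with the image of `f` is compatible with
the differentials. -/
theorem d_map_mul_ι (f : M →ₗ⁅ℚ⁆ L) (x : L) (h : ∀ m, ⁅f m, x⁆ = 0) (w : ExteriorAlgebra ℚ M) :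
    d L (ExteriorAlgebra.map (f : M →ₗ[ℚ] L) w * ι ℚ x) =
      ExteriorAlgebra.map (f : M →ₗ[ℚ] L) (d M w) * ι ℚ x := by
  induction w using CE.induction with
  | hr r =>
    rw [AlgHom.commutes, ← Algebra.smul_def, map_smul, d_ι, smul_zero, d_algebraMap, map_zero,
      zero_mul]
  | ha v w hv hw => simp only [map_add, add_mul, hv, hw]
  | hm z w hw =>
    have h1 : θ (f z) (ι ℚ x) = 0 := by
      have := θ_ι_mul (f z) x 1
      rw [mul_one, h, map_zero, zero_mul, ← map_one (algebraMap ℚ (ExteriorAlgebra ℚ L)),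
        θ_algebraMap, mul_zero, add_zero] at this
      exact this
    simp only [map_mul, ExteriorAlgebra.map_apply_ι, d_ι_mul, map_sub, map_θ,
      LieHom.coe_toLinearMap, mul_assoc, sub_mul, hw]
    rw [θ_mul, h1, mul_zero, add_zero]

/-- The differential vanishes for an abelian Lie algebra. -/
theorem d_abelian (h : ∀ x y : L, ⁅x, y⁆ = 0) (w : ExteriorAlgebra ℚ L) : d L w = 0 := by
  induction w using CE.induction with
  | hr r => exact d_algebraMap r
  | ha v w hv hw => rw [map_add, hv, hw, add_zero]
  | hm z w hw =>
    have hθ : ∀ (x : L) (w : ExteriorAlgebra ℚ L), θ x w = 0 := fun x w => by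
      induction w using CE.induction with
      | hr r => exact θ_algebraMap x r
      | ha v w hv hw => rw [map_add, hv, hw, add_zero]
      | hm z w hw => rw [θ_ι_mul, h, hw, map_zero, zero_mul, mul_zero, add_zero]
    rw [d_ι_mul, hθ, hw, mul_zero, sub_zero]

end Extension

section Line

variable {V M : Type u} [AddCommGroup V] [Module ℚ V] [AddCommGroup M] [Module ℚ M]
  (j : M →ₗ[ℚ] V) (x : V)

/-- If `V` is spanned by `x` and the image of `j`, then `⋀ V = ⋀ M + x ∧ ⋀ M`. -/
theorem exists_line_decomposition (h : ∀ v, ∃ m c, v = j m + (c : ℚ) • x)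
    (z : ExteriorAlgebra ℚ V) :
    ∃ a b, z = ExteriorAlgebra.map j a + ι ℚ x * ExteriorAlgebra.map j b := by
  induction z using CliffordAlgebra.left_induction with
  | algebraMap r => exact ⟨algebraMap ℚ _ r, 0, by rw [AlgHom.commutes, map_zero, mul_zero, add_zero]⟩
  | add v w hv hw =>
    obtain ⟨a, b, rfl⟩ := hv
    obtain ⟨a', b', rfl⟩ := hw
    exact ⟨a + a', b + b', by simp only [map_add, mul_add]; abel⟩
  | ι_mul w v hw =>
    obtain ⟨a, b, rfl⟩ := hw
    obtain ⟨m, c, rfl⟩ := h v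
    refine ⟨ι ℚ m * a, c • a - ι ℚ m * b, ?_⟩
    change ι ℚ (j m + c • x) * _ = _
    have h1 : ι ℚ (j m) * (ι ℚ x * ExteriorAlgebra.map j b) =
        -(ι ℚ x * (ι ℚ (j m) * ExteriorAlgebra.map j b)) := by
      rw [← mul_assoc, ← mul_assoc, eq_neg_iff_add_eq_zero, ← add_mul,
        ExteriorAlgebra.ι_add_mul_swap, zero_mul]
    have h2 : ι ℚ x * (ι ℚ x * ExteriorAlgebra.map j b) = 0 := by
      rw [← mul_assoc, ExteriorAlgebra.ι_sq_zero, zero_mul]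
    simp only [map_add, map_sub, map_smul, map_mul, ExteriorAlgebra.map_apply_ι, add_mul, mul_add,
      mul_sub, smul_mul_assoc, mul_smul_comm, h1, h2]
    simp only [smul_zero, add_zero]
    abel

/-- The decomposition `⋀ V = ⋀ M + x ∧ ⋀ M` is unique if `V` is the direct sum of `M` and the line
spanned by `x`. -/
theorem line_decomposition_unique (p : V →ₗ[ℚ] M) (ξ : V →ₗ[ℚ] ℚ) (hp : ∀ m, p (j m) = m)
    (hpx : p x = 0) (hξ : ∀ m, ξ (j m) = 0) (hξx : ξ x = 1) {a b : ExteriorAlgebra ℚ M}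
    (h : ExteriorAlgebra.map j a + ι ℚ x * ExteriorAlgebra.map j b = 0) : a = 0 ∧ b = 0 := by
  have hid : ∀ w, ExteriorAlgebra.map p (ExteriorAlgebra.map j w) = w := fun w => by
    rw [← AlgHom.comp_apply, ExteriorAlgebra.map_comp_map,
      show p.comp j = LinearMap.id from LinearMap.ext hp]
    exact AlgHom.congr_fun ExteriorAlgebra.map_id w
  have ha : a = 0 := by
    have := congrArg (ExteriorAlgebra.map p) h
    rwa [map_add, map_mul, ExteriorAlgebra.map_apply_ι, hpx, map_zero, zero_mul, add_zero, hid,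
      map_zero] at this
  refine ⟨ha, ?_⟩
  rw [ha, map_zero, zero_add] at h
  have hc : ∀ w : ExteriorAlgebra ℚ M, CliffordAlgebra.contractLeft (R := ℚ) (M := V)
      (Q := (0 : QuadraticForm ℚ V)) ξ (ExteriorAlgebra.map j w) = 0 := by
    intro w
    induction w using CliffordAlgebra.left_induction with
    | algebraMap r =>
      rw [show (algebraMap ℚ (CliffordAlgebra (0 : QuadraticForm ℚ M)) r) =
        algebraMap ℚ (ExteriorAlgebra ℚ M) r from rfl, AlgHom.commutes]
      exact CliffordAlgebra.contractLeft_algebraMap (Q := (0 : QuadraticForm ℚ V)) ξ r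
    | add v w hv hw =>
      rw [map_add (ExteriorAlgebra.map j)]
      exact (map_add (CliffordAlgebra.contractLeft (Q := (0 : QuadraticForm ℚ V)) ξ) _ _).trans
        (by rw [hv, hw, add_zero])
    | ι_mul w v hw =>
      have : ExteriorAlgebra.map j (CliffordAlgebra.ι (0 : QuadraticForm ℚ M) v * w) =
        CliffordAlgebra.ι (0 : QuadraticForm ℚ V) (j v) * ExteriorAlgebra.map j w := by
        rw [map_mul]; congr 1; exact ExteriorAlgebra.map_apply_ι j v
      rw [this]
      refine (CliffordAlgebra.contractLeft_ι_mul (Q := (0 : QuadraticForm ℚ V)) ξ (j v)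
        (ExteriorAlgebra.map j w)).trans ?_
      rw [hξ, hw, zero_smul, mul_zero, sub_zero]
  have h2 := CliffordAlgebra.contractLeft_ι_mul (Q := (0 : QuadraticForm ℚ V)) ξ x
    (ExteriorAlgebra.map j b)
  rw [hξx, hc, one_smul, mul_zero, sub_zero] at h2
  have h3 : CliffordAlgebra.ι (0 : QuadraticForm ℚ V) x * ExteriorAlgebra.map j b = 0 := h
  have h4 : ExteriorAlgebra.map j b = 0 := by
    rw [h3] at h2
    exact h2.symm.trans (map_zero (CliffordAlgebra.contractLeft (Q := (0 : QuadraticForm ℚ V)) ξ))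
  have h5 := hid b
  rw [h4, map_zero] at h5
  exact h5.symm

end Line

end CE

/-! ### Derivations of free Lie algebras -/

section Tangent

/-- The Lie algebra `L ⊗ ℚ[ε]`, `ε ^ 2 = 0`: the pair stands for `val + ε der`. -/
structure Tangent (L : Type u) : Type u where
  /-- The value at `ε = 0`. -/
  val : L
  /-- The coefficient of `ε`. -/
  der : L

namespace Tangent

variable {L : Type u}

/-- The underlying pair. -/
def toProd : Tangent L ≃ L × L where
  toFun p := (p.val, p.der)
  invFun p := ⟨p.1, p.2⟩
  left_inv _ := rfl
  right_inv _ := rfl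

variable [LieRing L]

instance : AddCommGroup (Tangent L) := toProd.addCommGroup

instance : Bracket (Tangent L) (Tangent L) where
  bracket p q := ⟨⁅p.val, q.val⁆, ⁅p.val, q.der⁆ + ⁅p.der, q.val⁆⟩

theorem add_def (p q : Tangent L) : p + q = ⟨p.val + q.val, p.der + q.der⟩ := rfl
theorem zero_def : (0 : Tangent L) = ⟨0, 0⟩ := rfl
theorem lie_def (p q : Tangent L) :
    ⁅p, q⁆ = ⟨⁅p.val, q.val⁆, ⁅p.val, q.der⁆ + ⁅p.der, q.val⁆⟩ := rfl

instance : LieRing (Tangent L) where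
  add_lie p q r := by simp only [add_def, lie_def, add_lie, mk.injEq, true_and]; abel
  lie_add p q r := by simp only [add_def, lie_def, lie_add, mk.injEq, true_and]; abel
  lie_self p := by
    simp only [lie_def, lie_self, zero_def, mk.injEq, true_and]
    rw [← lie_skew, neg_add_cancel]
  leibniz_lie p q r := by
    simp only [add_def, lie_def, lie_add, add_lie, mk.injEq]
    refine ⟨leibniz_lie _ _ _, ?_⟩
    rw [leibniz_lie p.val q.val r.der, leibniz_lie p.val q.der r.val,
      leibniz_lie p.der q.val r.val]
    abel

variable [LieAlgebra ℚ L]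

instance : Module ℚ (Tangent L) := toProd.module ℚ

theorem smul_def (c : ℚ) (p : Tangent L) : c • p = ⟨c • p.val, c • p.der⟩ := rfl

instance : LieAlgebra ℚ (Tangent L) where
  lie_smul c p q := by simp only [smul_def, lie_def, lie_smul, smul_add]

end Tangent

end Tangent

namespace FreeLie

variable {X Y : Type u}

/-- Induction for free Lie algebras. -/
theorem induction {P : FreeLieAlgebra ℚ X → Prop} (hof : ∀ x, P (.of ℚ x))
    (hadd : ∀ u v, P u → P v → P (u + v)) (hsmul : ∀ (c : ℚ) u, P u → P (c • u))
    (hlie : ∀ u v, P u → P v → P ⁅u, v⁆) (h0 : P 0) (u) : P u := by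
  let K : LieSubalgebra ℚ (FreeLieAlgebra ℚ X) :=
    { carrier := {u | P u}
      add_mem' := fun {a b} => hadd a b
      zero_mem' := h0
      smul_mem' := fun c a => hsmul c a
      lie_mem' := fun {a b} => hlie a b }
  have hF : K.incl.comp (FreeLieAlgebra.lift ℚ fun x => (⟨.of ℚ x, hof x⟩ : K)) = LieHom.id := by
    apply FreeLieAlgebra.hom_ext
    intro x
    simp
  have := (FreeLieAlgebra.lift ℚ (fun x => (⟨.of ℚ x, hof x⟩ : K)) u).2
  rw [show ((FreeLieAlgebra.lift ℚ (fun x => (⟨.of ℚ x, hof x⟩ : K)) u : K) :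
    FreeLieAlgebra ℚ X) = u from LieHom.congr_fun hF u] at this
  exact this

/-- The tangent morphism `u ↦ u + ε D u` for the derivation `D` with `D x = f x`. -/
noncomputable def tangentLift (f : X → FreeLieAlgebra ℚ X) :
    FreeLieAlgebra ℚ X →ₗ⁅ℚ⁆ Tangent (FreeLieAlgebra ℚ X) :=
  FreeLieAlgebra.lift ℚ fun x => ⟨.of ℚ x, f x⟩

theorem tangentLift_of (f : X → FreeLieAlgebra ℚ X) (x : X) :
    tangentLift f (.of ℚ x) = ⟨.of ℚ x, f x⟩ :=
  FreeLieAlgebra.lift_of_apply _ _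

theorem tangentLift_fst (f : X → FreeLieAlgebra ℚ X) (u : FreeLieAlgebra ℚ X) :
    (tangentLift f u).val = u := by
  induction u using FreeLie.induction with
  | hof x => rw [tangentLift_of]
  | hadd u v hu hv => rw [map_add, Tangent.add_def]; simp only [hu, hv]
  | hsmul c u hu => rw [map_smul, Tangent.smul_def]; simp only [hu]
  | hlie u v hu hv => rw [LieHom.map_lie, Tangent.lie_def]; simp only [hu, hv]
  | h0 => rw [map_zero, Tangent.zero_def]

/-- The derivation of a free Lie algebra with prescribed values on the generators, obtained from the
universal property applied to `Tangent`. -/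
noncomputable def der (f : X → FreeLieAlgebra ℚ X) :
    LieDerivation ℚ (FreeLieAlgebra ℚ X) (FreeLieAlgebra ℚ X) where
  toFun u := (tangentLift f u).der
  map_add' u v := by rw [map_add, Tangent.add_def]
  map_smul' c u := by rw [map_smul, Tangent.smul_def]; rfl
  leibniz' u v := by
    change (tangentLift f ⁅u, v⁆).der = ⁅u, (tangentLift f v).der⁆ - ⁅v, (tangentLift f u).der⁆
    rw [LieHom.map_lie, Tangent.lie_def]
    simp only [tangentLift_fst]
    rw [← lie_skew v, sub_neg_eq_add]

theorem der_of (f : X → FreeLieAlgebra ℚ X) (x : X) : der f (.of ℚ x) = f x :=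
  congrArg Tangent.der (tangentLift_of f x)

theorem der_ext {D D' : LieDerivation ℚ (FreeLieAlgebra ℚ X) (FreeLieAlgebra ℚ X)}
    (h : ∀ x, D (.of ℚ x) = D' (.of ℚ x)) : D = D' := by
  refine LieDerivation.ext fun u => ?_
  induction u using FreeLie.induction with
  | hof x => exact h x
  | hadd u v hu hv => rw [map_add, map_add, hu, hv]
  | hsmul c u hu => rw [map_smul, map_smul, hu]
  | hlie u v hu hv => rw [LieDerivation.apply_lie_eq_add, LieDerivation.apply_lie_eq_add, hu, hv]
  | h0 => rw [map_zero, map_zero]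

end FreeLie

/-! ### Gradings of free Lie algebras and of their exterior algebras -/

namespace FreeLie

section Grading

variable {X Y : Type u} {Γ Δ : Type} [AddCommMonoid Γ] [AddCommMonoid Δ]

/-- Bracket monomials in the generators, of given degree; `ω` assigns degrees to generators. Degrees
lie in an arbitrary commutative monoid, so that several gradings can be followed at once. -/
inductive LieMon (ω : X → Γ) : Γ → FreeLieAlgebra ℚ X → Prop
  | of (x : X) : LieMon ω (ω x) (.of ℚ x)
  | lie {γ δ : Γ} {u v : FreeLieAlgebra ℚ X} :
      LieMon ω γ u → LieMon ω δ v → LieMon ω (γ + δ) ⁅u, v⁆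

/-- Exterior products of bracket monomials, of given total degree. -/
inductive ExtMon (ω : X → Γ) : Γ → ExteriorAlgebra ℚ (FreeLieAlgebra ℚ X) → Prop
  | one : ExtMon ω 0 1
  | cons {γ δ : Γ} {u : FreeLieAlgebra ℚ X} {w : ExteriorAlgebra ℚ (FreeLieAlgebra ℚ X)} :
      LieMon ω γ u → ExtMon ω δ w → ExtMon ω (γ + δ) (ι ℚ u * w)

/-- The span of the bracket monomials whose degree lies in `S`. -/
noncomputable def lieGr (ω : X → Γ) (S : Set Γ) : Submodule ℚ (FreeLieAlgebra ℚ X) :=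
  Submodule.span ℚ {u | ∃ γ ∈ S, LieMon ω γ u}

/-- The span of the exterior monomials whose degree lies in `S`. -/
noncomputable def extGr (ω : X → Γ) (S : Set Γ) : Submodule ℚ (ExteriorAlgebra ℚ (FreeLieAlgebra ℚ X)) :=
  Submodule.span ℚ {w | ∃ γ ∈ S, ExtMon ω γ w}

variable {ω : X → Γ} {ω' : Y → Δ} {S T U : Set Γ}

theorem LieMon.mem {γ : Γ} {u : FreeLieAlgebra ℚ X} (h : LieMon ω γ u) (hγ : γ ∈ S) :
    u ∈ lieGr ω S := Submodule.subset_span ⟨γ, hγ, h⟩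

theorem ExtMon.mem {γ : Γ} {w : ExteriorAlgebra ℚ (FreeLieAlgebra ℚ X)} (h : ExtMon ω γ w)
    (hγ : γ ∈ S) : w ∈ extGr ω S := Submodule.subset_span ⟨γ, hγ, h⟩

theorem lieGr_mono (h : S ⊆ T) : lieGr ω S ≤ lieGr ω T :=
  Submodule.span_mono fun _ ⟨γ, hγ, hu⟩ => ⟨γ, h hγ, hu⟩

theorem extGr_mono (h : S ⊆ T) : extGr ω S ≤ extGr ω T :=
  Submodule.span_mono fun _ ⟨γ, hγ, hu⟩ => ⟨γ, h hγ, hu⟩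

/-- A linear map sends a span of monomials into `N` if it does so for the monomials. -/
theorem map_mem_of_span {M N : Type u} [AddCommGroup M] [Module ℚ M] [AddCommGroup N] [Module ℚ N]
    (f : M →ₗ[ℚ] N) {s : Set M} {N' : Submodule ℚ N} (h : ∀ x ∈ s, f x ∈ N') {x : M}
    (hx : x ∈ Submodule.span ℚ s) : f x ∈ N' :=
  (Submodule.span_le (p := N'.comap f)).mpr h hx

theorem lie_mem_lieGr (h : ∀ γ ∈ S, ∀ δ ∈ T, γ + δ ∈ U) {u v : FreeLieAlgebra ℚ X}
    (hu : u ∈ lieGr ω S) (hv : v ∈ lieGr ω T) : ⁅u, v⁆ ∈ lieGr ω U := by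
  refine LinearMap.BilinMap.apply_apply_mem_of_mem_span (lieGr ω U) _ _
    (LinearMap.mk₂ ℚ (fun u v => ⁅u, v⁆) add_lie smul_lie lie_add lie_smul) ?_ u v hu hv
  rintro u ⟨γ, hγ, hu⟩ v ⟨δ, hδ, hv⟩
  exact (hu.lie hv).mem (h γ hγ δ hδ)

theorem mul_mem_extGr (h : ∀ γ ∈ S, ∀ δ ∈ T, γ + δ ∈ U) {u : FreeLieAlgebra ℚ X}
    {w : ExteriorAlgebra ℚ (FreeLieAlgebra ℚ X)} (hu : u ∈ lieGr ω S) (hw : w ∈ extGr ω T) :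
    ι ℚ u * w ∈ extGr ω U := by
  refine LinearMap.BilinMap.apply_apply_mem_of_mem_span (extGr ω U) _ _
    (CE.wedgeLeft (FreeLieAlgebra ℚ X)) ?_ u w hu hw
  rintro u ⟨γ, hγ, hu⟩ v ⟨δ, hδ, hv⟩
  exact (ExtMon.cons hu hv).mem (h γ hγ δ hδ)

theorem ι_mem_extGr {u : FreeLieAlgebra ℚ X} (hu : u ∈ lieGr ω S) : ι ℚ u ∈ extGr ω S := by
  rw [← mul_one (ι ℚ u)]
  refine mul_mem_extGr (T := {0}) ?_ hu (ExtMon.one.mem rfl)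
  rintro γ hγ δ rfl
  rwa [add_zero]

theorem map_mem_lieGr (φ : Γ →+ Δ) (f : FreeLieAlgebra ℚ X →ₗ⁅ℚ⁆ FreeLieAlgebra ℚ Y)
    (hf : ∀ x, f (.of ℚ x) ∈ lieGr ω' {φ (ω x)}) {T : Set Δ} (h : ∀ γ ∈ S, φ γ ∈ T)
    {u : FreeLieAlgebra ℚ X} (hu : u ∈ lieGr ω S) : f u ∈ lieGr ω' T := by
  refine map_mem_of_span (f : FreeLieAlgebra ℚ X →ₗ[ℚ] FreeLieAlgebra ℚ Y) ?_ hu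
  rintro u ⟨γ, hγ, hu⟩
  refine lieGr_mono (Set.singleton_subset_iff.mpr (h γ hγ)) ?_
  clear hγ
  induction hu with
  | of x => exact hf x
  | lie hu hv ihu ihv =>
    rw [LieHom.coe_toLinearMap, LieHom.map_lie, map_add]
    refine lie_mem_lieGr ?_ ihu ihv
    rintro _ rfl _ rfl
    rfl

theorem map_mem_extGr (φ : Γ →+ Δ) (f : FreeLieAlgebra ℚ X →ₗ⁅ℚ⁆ FreeLieAlgebra ℚ Y)
    (hf : ∀ x, f (.of ℚ x) ∈ lieGr ω' {φ (ω x)}) {T : Set Δ} (h : ∀ γ ∈ S, φ γ ∈ T)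
    {w : ExteriorAlgebra ℚ (FreeLieAlgebra ℚ X)} (hw : w ∈ extGr ω S) :
    ExteriorAlgebra.map (f : FreeLieAlgebra ℚ X →ₗ[ℚ] FreeLieAlgebra ℚ Y) w ∈ extGr ω' T := by
  refine map_mem_of_span (ExteriorAlgebra.map
    (f : FreeLieAlgebra ℚ X →ₗ[ℚ] FreeLieAlgebra ℚ Y)).toLinearMap ?_ hw
  rintro u ⟨γ, hγ, hu⟩
  refine extGr_mono (Set.singleton_subset_iff.mpr (h γ hγ)) ?_
  clear hγ
  induction hu with
  | one =>
    rw [AlgHom.toLinearMap_apply, map_one, map_zero]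
    exact ExtMon.one.mem rfl
  | @cons γ₁ δ₁ u w hu _ ih =>
    rw [AlgHom.toLinearMap_apply, map_mul, ExteriorAlgebra.map_apply_ι, map_add]
    refine mul_mem_extGr ?_
      (map_mem_lieGr φ f hf (S := {γ₁}) (T := {φ γ₁}) ?_ (hu.mem rfl)) ih
    · rintro _ rfl _ rfl
      rfl
    · rintro _ rfl
      rfl

variable (D : LieDerivation ℚ (FreeLieAlgebra ℚ X) (FreeLieAlgebra ℚ X)) (δ : Γ)

theorem der_mem_lieGr (hD : ∀ x, D (.of ℚ x) ∈ lieGr ω {ω x + δ}) (h : ∀ γ ∈ S, γ + δ ∈ T)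
    {u : FreeLieAlgebra ℚ X} (hu : u ∈ lieGr ω S) : D u ∈ lieGr ω T := by
  refine map_mem_of_span (D : FreeLieAlgebra ℚ X →ₗ[ℚ] FreeLieAlgebra ℚ X) ?_ hu
  rintro u ⟨γ, hγ, hu⟩
  refine lieGr_mono (Set.singleton_subset_iff.mpr (h γ hγ)) ?_
  clear hγ
  rw [LieDerivation.coeFn_coe]
  induction hu with
  | of x => exact hD x
  | lie hu hv ihu ihv =>
    rw [LieDerivation.apply_lie_eq_add]
    refine add_mem (lie_mem_lieGr ?_ (hu.mem rfl) ihv) (lie_mem_lieGr ?_ ihu (hv.mem rfl))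
    · rintro _ rfl _ rfl
      rw [add_assoc]; rfl
    · rintro _ rfl _ rfl
      rw [add_right_comm]; rfl

theorem ext_mem_extGr (hD : ∀ x, D (.of ℚ x) ∈ lieGr ω {ω x + δ}) (h : ∀ γ ∈ S, γ + δ ∈ T)
    {w : ExteriorAlgebra ℚ (FreeLieAlgebra ℚ X)} (hw : w ∈ extGr ω S) :
    CE.ext (D : FreeLieAlgebra ℚ X →ₗ[ℚ] FreeLieAlgebra ℚ X) w ∈ extGr ω T := by
  refine map_mem_of_span (CE.ext (D : FreeLieAlgebra ℚ X →ₗ[ℚ] FreeLieAlgebra ℚ X)) ?_ hw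
  rintro u ⟨γ, hγ, hu⟩
  refine extGr_mono (Set.singleton_subset_iff.mpr (h γ hγ)) ?_
  clear hγ
  induction hu with
  | one =>
    rw [← map_one (algebraMap ℚ (ExteriorAlgebra ℚ (FreeLieAlgebra ℚ X))), CE.ext_algebraMap]
    exact zero_mem _
  | @cons γ₁ δ₁ u w hu hw ih =>
    rw [CE.ext_ι_mul]
    refine add_mem (mul_mem_extGr (T := {δ₁}) ?_
      (der_mem_lieGr D δ hD (S := {γ₁}) (T := {γ₁ + δ}) ?_ (hu.mem rfl))
      (hw.mem rfl)) (mul_mem_extGr (S := {γ₁}) ?_ (hu.mem rfl) ih)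
    · rintro _ rfl _ rfl
      rw [add_right_comm]; rfl
    · rintro _ rfl; rfl
    · rintro _ rfl _ rfl
      rw [add_assoc]; rfl

end Grading

section Low

/-- A boundary has no component of degree zero, and its component of degree one is killed by
morphisms to abelian Lie algebras. -/
theorem low_degree_of_boundary {L A : Type u} [LieRing L] [LieAlgebra ℚ L] [LieRing A]
    [LieAlgebra ℚ A] (hA : ∀ x y : A, ⁅x, y⁆ = 0) (χ : L →ₗ⁅ℚ⁆ A) {c : ℚ} {v : L}
    {w : ExteriorAlgebra ℚ L} (h : algebraMap ℚ _ c + ι ℚ v = CE.d L w) : c = 0 ∧ χ v = 0 := by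
  have h1 := congrArg (ExteriorAlgebra.map (χ : L →ₗ[ℚ] A)) h
  rw [CE.map_d, CE.d_abelian hA, map_add, AlgHom.commutes, ExteriorAlgebra.map_apply_ι] at h1
  have hc : c = 0 := by
    have := congrArg ExteriorAlgebra.algebraMapInv h1
    rw [map_add, ExteriorAlgebra.algebraMap_leftInverse A, map_zero] at this
    simpa [ExteriorAlgebra.algebraMapInv] using this
  refine ⟨hc, ?_⟩
  rw [hc, map_zero, zero_add] at h1
  exact ExteriorAlgebra.ι_inj ℚ _ _ |>.mp (h1.trans (map_zero _).symm)

end Low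

end FreeLie

/-! ### Derivations of Lie algebras acting on the Chevalley-Eilenberg complex -/

namespace CE

variable {M : Type u} [LieRing M] [LieAlgebra ℚ M] (D : LieDerivation ℚ M M)

theorem ext_θ (x : M) (w : ExteriorAlgebra ℚ M) :
    ext (D : M →ₗ[ℚ] M) (θ x w) = θ (D x) w + θ x (ext (D : M →ₗ[ℚ] M) w) := by
  induction w using CE.induction with
  | hr r => simp only [θ_algebraMap, ext_algebraMap, map_zero, add_zero]
  | ha v w hv hw => simp only [map_add, hv, hw]; abel
  | hm z w hw =>
    simp only [θ_ι_mul, ext_ι_mul, map_add, hw, LieDerivation.coeFn_coe,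
      LieDerivation.apply_lie_eq_add, add_mul, mul_add]
    abel

theorem d_ext (w : ExteriorAlgebra ℚ M) :
    d M (ext (D : M →ₗ[ℚ] M) w) = ext (D : M →ₗ[ℚ] M) (d M w) := by
  induction w using CE.induction with
  | hr r => simp only [d_algebraMap, ext_algebraMap, map_zero]
  | ha v w hv hw => simp only [map_add, hv, hw]
  | hm z w hw =>
    simp only [ext_ι_mul, d_ι_mul, map_add, map_sub, hw, ext_θ, LieDerivation.coeFn_coe]
    abel

end CE

/-! ### Elimination of a generator of a free Lie algebra -/

/-- A vector space regarded as an abelian Lie algebra. -/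
@[ext] structure Ab (V : Type u) : Type u where
  /-- The underlying vector. -/
  val : V

namespace Ab

variable (V : Type u)

/-- The identity map. -/
def equiv : Ab V ≃ V where
  toFun := val
  invFun := mk
  left_inv _ := rfl
  right_inv _ := rfl

variable [AddCommGroup V]

instance : AddCommGroup (Ab V) := (equiv V).addCommGroup
instance : Bracket (Ab V) (Ab V) := ⟨fun _ _ => 0⟩

variable {V}

theorem lie_eq_zero (x y : Ab V) : ⁅x, y⁆ = 0 := rfl
theorem val_zero : (0 : Ab V).val = 0 := rfl
theorem val_add (x y : Ab V) : (x + y).val = x.val + y.val := rfl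

instance : LieRing (Ab V) where
  add_lie _ _ _ := (add_zero (0 : Ab V)).symm
  lie_add _ _ _ := (add_zero (0 : Ab V)).symm
  lie_self _ := rfl
  leibniz_lie _ _ _ := (add_zero (0 : Ab V)).symm

variable [Module ℚ V]

instance : Module ℚ (Ab V) := (equiv V).module ℚ

theorem val_smul (c : ℚ) (x : Ab V) : (c • x).val = c • x.val := rfl

instance : LieAlgebra ℚ (Ab V) where
  lie_smul c _ _ := (smul_zero (A := Ab V) c).symm

end Ab

namespace FreeLie

section Elimination

variable {X : Type u} (x : X)

/-- The free generators `(ad x)ᵏ y`, `y ≠ x`, of the ideal complementary to `x`. -/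
abbrev ElimGen : Type u := {y : X // y ≠ x} × ℕ

/-- The iterated bracket `(ad x)ᵏ y`. -/
noncomputable def adPow (y : X) : ℕ → FreeLieAlgebra ℚ X
  | 0 => .of ℚ y
  | k + 1 => ⁅FreeLieAlgebra.of ℚ x, adPow y k⁆

/-- The morphism `(y, k) ↦ (ad x)ᵏ y`, an isomorphism onto the ideal generated by the `y ≠ x`. -/
noncomputable def elim : FreeLieAlgebra ℚ (ElimGen x) →ₗ⁅ℚ⁆ FreeLieAlgebra ℚ X :=
  FreeLieAlgebra.lift ℚ fun p => adPow x p.1.1 p.2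

theorem elim_of (p : ElimGen x) : elim x (.of ℚ p) = adPow x p.1.1 p.2 :=
  FreeLieAlgebra.lift_of_apply _ _

/-- The derivation `(y, k) ↦ (y, k + 1)`, corresponding to `ad x`. -/
noncomputable def shift :
    LieDerivation ℚ (FreeLieAlgebra ℚ (ElimGen x)) (FreeLieAlgebra ℚ (ElimGen x)) :=
  der fun p => .of ℚ (p.1, p.2 + 1)

theorem shift_of (p : ElimGen x) : shift x (.of ℚ p) = .of ℚ (p.1, p.2 + 1) := der_of _ _

/-- Under `elim`, the derivation `ad x` becomes `shift x`. -/
theorem lie_elim (m : FreeLieAlgebra ℚ (ElimGen x)) :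
    ⁅FreeLieAlgebra.of ℚ x, elim x m⁆ = elim x (shift x m) := by
  induction m using FreeLie.induction with
  | hof p => rw [elim_of, shift_of, elim_of, adPow]
  | hadd u v hu hv => simp only [map_add, lie_add, hu, hv]
  | hsmul c u hu => simp only [map_smul, lie_smul, hu]
  | hlie u v hu hv =>
    rw [LieHom.map_lie, leibniz_lie, hu, hv, LieDerivation.apply_lie_eq_add, map_add,
      LieHom.map_lie, LieHom.map_lie, add_comm]
  | h0 => simp only [map_zero, lie_zero]

/-- The action of the line spanned by `x` by multiples of the derivation `shift`. -/
noncomputable def shiftHom :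
    Ab ℚ →ₗ⁅ℚ⁆ LieDerivation ℚ (FreeLieAlgebra ℚ (ElimGen x)) (FreeLieAlgebra ℚ (ElimGen x)) where
  toFun c := c.val • shift x
  map_add' a b := add_smul a.val b.val (shift x)
  map_smul' a b := mul_smul a b.val (shift x)
  map_lie' {a b} := by
    rw [smul_lie, lie_smul, lie_self, smul_zero, smul_zero]
    exact zero_smul ℚ (shift x)

theorem shiftHom_apply (c : Ab ℚ) : shiftHom x c = c.val • shift x := rfl

/-- The free Lie algebra as a semidirect product of a free Lie algebra and a line. -/
abbrev Semidirect : Type u :=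
  LieAlgebra.SemiDirectSum (FreeLieAlgebra ℚ (ElimGen x)) (Ab ℚ) (shiftHom x)

open Classical in
/-- The isomorphism from the free Lie algebra to the semidirect product. -/
noncomputable def toSemidirect : FreeLieAlgebra ℚ X →ₗ⁅ℚ⁆ Semidirect x :=
  FreeLieAlgebra.lift ℚ fun y => if h : y = x then ⟨0, ⟨1⟩⟩ else ⟨.of ℚ (⟨y, h⟩, 0), 0⟩

theorem toSemidirect_self : toSemidirect x (.of ℚ x) = ⟨0, ⟨1⟩⟩ := by
  rw [toSemidirect, FreeLieAlgebra.lift_of_apply, dif_pos rfl]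

theorem toSemidirect_elim (m : FreeLieAlgebra ℚ (ElimGen x)) :
    toSemidirect x (elim x m) = ⟨m, 0⟩ := by
  have : (toSemidirect x).comp (elim x) = LieAlgebra.SemiDirectSum.inl (shiftHom x) := by
    apply FreeLieAlgebra.hom_ext
    rintro ⟨⟨y, hy⟩, k⟩
    rw [LieHom.comp_apply, elim_of, LieAlgebra.SemiDirectSum.inl_eq_mk]
    induction k with
    | zero => rw [adPow, toSemidirect, FreeLieAlgebra.lift_of_apply, dif_neg hy]
    | succ k ih =>
      dsimp only at ih ⊢
      rw [adPow, LieHom.map_lie, ih, toSemidirect_self]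
      rw [LieAlgebra.SemiDirectSum.lie_eq_mk]
      dsimp only
      rw [shiftHom_apply, map_zero, LieDerivation.smul_apply, one_smul,
        shift_of, zero_lie, zero_add, sub_zero, lie_zero]
  exact LieHom.congr_fun this m

/-- Uniqueness of the decomposition `⋀ F = ⋀ M + x ∧ ⋀ M`, where `F` is the free Lie algebra and `M`
the free Lie algebra on the `(ad x)ᵏ y`. -/
theorem elim_unique {a b : ExteriorAlgebra ℚ (FreeLieAlgebra ℚ (ElimGen x))}
    (h : ExteriorAlgebra.map
        (elim x : FreeLieAlgebra ℚ (ElimGen x) →ₗ[ℚ] FreeLieAlgebra ℚ X) a +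
      ι ℚ (FreeLieAlgebra.of ℚ x) * ExteriorAlgebra.map
        (elim x : FreeLieAlgebra ℚ (ElimGen x) →ₗ[ℚ] FreeLieAlgebra ℚ X) b = 0) :
    a = 0 ∧ b = 0 := by
  let p : FreeLieAlgebra ℚ X →ₗ[ℚ] FreeLieAlgebra ℚ (ElimGen x) :=
    (LieAlgebra.SemiDirectSum.projl (shiftHom x)).comp (toSemidirect x).toLinearMap
  let ξ : FreeLieAlgebra ℚ X →ₗ[ℚ] ℚ :=
    { toFun := fun v => (toSemidirect x v).right.val
      map_add' := fun v w => by rw [map_add]; rfl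
      map_smul' := fun c v => by rw [map_smul]; rfl }
  have hp : ∀ v, p v = (toSemidirect x v).left := fun _ => rfl
  have hξ : ∀ v, ξ v = (toSemidirect x v).right.val := fun _ => rfl
  refine CE.line_decomposition_unique
    (elim x : FreeLieAlgebra ℚ (ElimGen x) →ₗ[ℚ] FreeLieAlgebra ℚ X)
    (FreeLieAlgebra.of ℚ x) p ξ (fun m => ?_) ?_ (fun m => ?_) ?_ h
  · rw [hp, LieHom.coe_toLinearMap, toSemidirect_elim]
  · rw [hp, toSemidirect_self]
  · rw [hξ, LieHom.coe_toLinearMap, toSemidirect_elim]; rfl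
  · rw [hξ, toSemidirect_self]

open Classical in
/-- The endomorphism killing the generators in `s`. -/
noncomputable def kill (s : Set X) : FreeLieAlgebra ℚ X →ₗ⁅ℚ⁆ FreeLieAlgebra ℚ X :=
  FreeLieAlgebra.lift ℚ fun y => if y ∈ s then 0 else .of ℚ y

theorem kill_of_mem {s : Set X} {y : X} (h : y ∈ s) : kill s (.of ℚ y) = 0 := by
  rw [kill, FreeLieAlgebra.lift_of_apply, if_pos h]

theorem kill_of_notMem {s : Set X} {y : X} (h : y ∉ s) : kill s (.of ℚ y) = .of ℚ y := by
  rw [kill, FreeLieAlgebra.lift_of_apply, if_neg h]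

theorem kill_kill (s t : Set X) (u : FreeLieAlgebra ℚ X) :
    kill s (kill t u) = kill (s ∪ t) u := by
  have : (kill s).comp (kill t) = kill (s ∪ t) := by
    apply FreeLieAlgebra.hom_ext
    intro y
    rw [LieHom.comp_apply]
    by_cases ht : y ∈ t
    · rw [kill_of_mem ht, kill_of_mem (s := s ∪ t) (Or.inr ht), map_zero]
    · rw [kill_of_notMem ht]
      by_cases hs : y ∈ s
      · rw [kill_of_mem hs, kill_of_mem (s := s ∪ t) (Or.inl hs)]
      · rw [kill_of_notMem hs, kill_of_notMem (by rintro (h | h); exacts [hs h, ht h])]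
  exact LieHom.congr_fun this u

/-- On the complement of `x`, killing `x` amounts to killing all `(ad x)ᵏ y` with `k > 0`. -/
theorem elim_kill (m : FreeLieAlgebra ℚ (ElimGen x)) :
    elim x (kill {p | p.2 ≠ 0} m) = kill {x} (elim x m) := by
  have : (elim x).comp (kill {p | p.2 ≠ 0}) = (kill {x}).comp (elim x) := by
    apply FreeLieAlgebra.hom_ext
    rintro ⟨⟨y, hy⟩, k⟩
    rw [LieHom.comp_apply, LieHom.comp_apply, elim_of]
    rcases k with _ | k
    · rw [kill_of_notMem (by simp), elim_of, adPow, kill_of_notMem (s := {x}) hy]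
    · rw [kill_of_mem (by simp), adPow, LieHom.map_lie, kill_of_mem (s := {x}) rfl, zero_lie, map_zero]
  exact LieHom.congr_fun this m

end Elimination

end FreeLie

/-! ### Weights under the elimination of a generator -/

namespace FreeLie

section Weights

variable {X : Type u} (x : X) {Γ : Type} [AddCommMonoid Γ] (ω : X → Γ)

/-- The degrees of the generators `(ad x)ᵏ y`: the number of generators (one) and the degree in the
original free Lie algebra. -/
def elimDeg (p : ElimGen x) : ℕ × Γ := (1, ω p.1 + p.2 • ω x)

variable {x ω}

theorem adPow_mem (y : X) (k : ℕ) : adPow x y k ∈ lieGr ω {ω y + k • ω x} := by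
  induction k with
  | zero => rw [zero_smul, add_zero]; exact (LieMon.of y).mem rfl
  | succ k ih =>
    refine lie_mem_lieGr ?_ ((LieMon.of x).mem (S := {ω x}) rfl) ih
    rintro _ rfl _ rfl
    rw [Set.mem_singleton_iff, succ_nsmul]; abel

theorem elim_mem_extGr {S : Set (ℕ × Γ)} {T : Set Γ} (h : ∀ γ ∈ S, γ.2 ∈ T)
    {w : ExteriorAlgebra ℚ (FreeLieAlgebra ℚ (ElimGen x))} (hw : w ∈ extGr (elimDeg x ω) S) :
    ExteriorAlgebra.map (elim x : FreeLieAlgebra ℚ (ElimGen x) →ₗ[ℚ] FreeLieAlgebra ℚ X) w ∈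
      extGr ω T := by
  refine map_mem_extGr (AddMonoidHom.snd ℕ Γ) (elim x) (fun p => ?_) h hw
  rw [elim_of]
  exact adPow_mem _ _

theorem shift_gen_mem (p : ElimGen x) :
    shift x (.of ℚ p) ∈ lieGr (elimDeg x ω) {elimDeg x ω p + (0, ω x)} := by
  rw [shift_of]
  refine (LieMon.of _).mem ?_
  rw [elimDeg, elimDeg, Prod.mk_add_mk, add_zero, succ_nsmul, add_assoc]
  rfl

theorem kill_gen_mem {s : Set X} (y : X) :
    kill s (.of ℚ y) ∈ lieGr ω {AddMonoidHom.id Γ (ω y)} := by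
  by_cases h : y ∈ s
  · rw [kill_of_mem h]; exact zero_mem _
  · rw [kill_of_notMem h]; exact (LieMon.of y).mem rfl

theorem kill_mem_extGr {s : Set X} {S : Set Γ} {w : ExteriorAlgebra ℚ (FreeLieAlgebra ℚ X)}
    (hw : w ∈ extGr ω S) :
    ExteriorAlgebra.map (kill s : FreeLieAlgebra ℚ X →ₗ[ℚ] FreeLieAlgebra ℚ X) w ∈ extGr ω S :=
  map_mem_extGr (AddMonoidHom.id Γ) (kill s) kill_gen_mem (fun _ h => h) hw

variable (wt : Γ →+ ℕ)

/-- Each bracket monomial of weight `n` is a multiple of `x`, plus a combination of brackets of less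
than `n` of the generators `(ad x)ᵏ y`, plus a bracket of `n` generators `y ≠ x`. -/
theorem LieMon.elim (hwt : ∀ y, wt (ω y) = 1) {γ : Γ} {u : FreeLieAlgebra ℚ X}
    (hu : LieMon ω γ u) : ∃ (c : ℚ) (u₁ u₀ : FreeLieAlgebra ℚ (ElimGen x)),
      u = c • FreeLieAlgebra.of ℚ x + FreeLie.elim x (u₁ + u₀) ∧ (c ≠ 0 → γ = ω x) ∧
      u₁ ∈ lieGr (elimDeg x ω) {p | p.1 < wt γ ∧ p.2 = γ} ∧
      u₀ ∈ lieGr (elimDeg x ω) {p | p.1 = wt γ ∧ p.2 = γ} ∧ kill {p : ElimGen x | p.2 ≠ 0} u₀ = u₀ := by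
  induction hu with
  | of y =>
    by_cases hy : y = x
    · exact ⟨1, 0, 0, by rw [hy, one_smul, add_zero, map_zero, add_zero], fun _ => by rw [hy],
        zero_mem _, zero_mem _, map_zero _⟩
    · refine ⟨0, 0, .of ℚ (⟨y, hy⟩, 0), ?_, fun h => absurd rfl h, zero_mem _,
        (LieMon.of _).mem ?_, kill_of_notMem (by simp)⟩
      · rw [zero_smul, zero_add, zero_add, elim_of, adPow]
      · exact ⟨(hwt y).symm, by rw [elimDeg, zero_smul, add_zero]⟩
  | @lie γ δ u v hu hv ihu ihv =>
    obtain ⟨c, u₁, u₀, rfl, hc, hu₁, hu₀, hk⟩ := ihu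
    obtain ⟨c', v₁, v₀, rfl, hc', hv₁, hv₀, hk'⟩ := ihv
    -- a multiple of `shift x w` by a coefficient that can be nonzero only in degree `δ = ω x` has the
    -- degrees of `w` increased by `δ`
    have hshift : ∀ {S T : Set (ℕ × Γ)} {w} (a : ℚ) {δ : Γ}, (a ≠ 0 → δ = ω x) →
        (∀ p ∈ S, (p.1, p.2 + δ) ∈ T) → w ∈ lieGr (elimDeg x ω) S →
        a • shift x w ∈ lieGr (elimDeg x ω) T := by
      intro S T w a δ ha h hw
      by_cases h0 : a = 0
      · rw [h0, zero_smul]; exact zero_mem _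
      · refine Submodule.smul_mem _ _ (der_mem_lieGr (shift x) (0, ω x) shift_gen_mem ?_ hw)
        intro p hp
        have := h p hp
        rw [ha h0] at this
        rwa [show p + (0, ω x) = (p.1, p.2 + ω x) from Prod.ext (add_zero _) rfl]
    have hpos : ∀ {a : ℚ} {δ : Γ}, (a ≠ 0 → δ = ω x) → a ≠ 0 → 0 < wt δ := by
      intro a δ h h0
      rw [h h0, hwt]; exact one_pos
    refine ⟨0, c • shift x (v₁ + v₀) - c' • shift x (u₁ + u₀) +
      (⁅u₁, v₁⁆ + ⁅u₁, v₀⁆ + ⁅u₀, v₁⁆), ⁅u₀, v₀⁆, ?_, fun h => absurd rfl h, ?_, ?_, ?_⟩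
    · simp only [map_add, map_sub, map_smul, LieHom.map_lie, ← lie_elim, lie_add, add_lie, smul_lie,
        lie_smul, lie_self]
      rw [← lie_skew (FreeLieAlgebra.of ℚ x) (FreeLie.elim x u₁),
        ← lie_skew (FreeLieAlgebra.of ℚ x) (FreeLie.elim x u₀)]
      module
    · refine add_mem (sub_mem ?_ ?_) (add_mem (add_mem ?_ ?_) ?_)
      · by_cases h0 : c = 0
        · rw [h0, zero_smul]; exact zero_mem _
        have := hpos hc h0
        refine hshift c (S := {p | p.1 ≤ wt δ ∧ p.2 = δ}) hc ?_
          (add_mem (lieGr_mono ?_ hv₁) (lieGr_mono ?_ hv₀))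
        · rintro p ⟨h1, rfl⟩
          exact ⟨by rw [map_add]; simp only; omega, add_comm _ _⟩
        · rintro p ⟨h1, h2⟩; exact ⟨h1.le, h2⟩
        · rintro p ⟨h1, h2⟩; exact ⟨h1.le, h2⟩
      · by_cases h0 : c' = 0
        · rw [h0, zero_smul]; exact zero_mem _
        have := hpos hc' h0
        refine hshift c' (S := {p | p.1 ≤ wt γ ∧ p.2 = γ}) hc' ?_
          (add_mem (lieGr_mono ?_ hu₁) (lieGr_mono ?_ hu₀))
        · rintro p ⟨h1, rfl⟩
          exact ⟨by rw [map_add]; simp only; omega, rfl⟩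
        · rintro p ⟨h1, h2⟩; exact ⟨h1.le, h2⟩
        · rintro p ⟨h1, h2⟩; exact ⟨h1.le, h2⟩
      · refine lie_mem_lieGr ?_ hu₁ hv₁
        rintro p ⟨h1, rfl⟩ q ⟨h2, rfl⟩
        exact ⟨by rw [map_add, Prod.fst_add]; omega, rfl⟩
      · refine lie_mem_lieGr ?_ hu₁ hv₀
        rintro p ⟨h1, rfl⟩ q ⟨h2, rfl⟩
        exact ⟨by rw [map_add, Prod.fst_add]; omega, rfl⟩
      · refine lie_mem_lieGr ?_ hu₀ hv₁
        rintro p ⟨h1, rfl⟩ q ⟨h2, rfl⟩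
        exact ⟨by rw [map_add, Prod.fst_add]; omega, rfl⟩
    · refine lie_mem_lieGr ?_ hu₀ hv₀
      rintro p ⟨h1, rfl⟩ q ⟨h2, rfl⟩
      exact ⟨by rw [map_add, Prod.fst_add]; omega, rfl⟩
    · rw [LieHom.map_lie, hk, hk']

/-- The decomposition of exterior monomials corresponding to `LieMon.elim`. -/
theorem ExtMon.elim (hwt : ∀ y, wt (ω y) = 1) {γ : Γ}
    {w : ExteriorAlgebra ℚ (FreeLieAlgebra ℚ X)} (hw : ExtMon ω γ w) :
    ∃ a a₀ b : ExteriorAlgebra ℚ (FreeLieAlgebra ℚ (ElimGen x)),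
      w = ExteriorAlgebra.map
          (FreeLie.elim x : FreeLieAlgebra ℚ (ElimGen x) →ₗ[ℚ] FreeLieAlgebra ℚ X) (a + a₀) +
        ι ℚ (FreeLieAlgebra.of ℚ x) * ExteriorAlgebra.map
          (FreeLie.elim x : FreeLieAlgebra ℚ (ElimGen x) →ₗ[ℚ] FreeLieAlgebra ℚ X) b ∧
      a ∈ extGr (elimDeg x ω) {p | p.1 < wt γ ∧ p.2 = γ} ∧
      a₀ ∈ extGr (elimDeg x ω) {p | p.1 = wt γ ∧ p.2 = γ} ∧
      ExteriorAlgebra.map (kill {p : ElimGen x | p.2 ≠ 0} :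
        FreeLieAlgebra ℚ (ElimGen x) →ₗ[ℚ] FreeLieAlgebra ℚ (ElimGen x)) a₀ = a₀ ∧
      b ∈ extGr (elimDeg x ω) {p | p.1 < wt γ ∧ p.2 + ω x = γ} := by
  induction hw with
  | one =>
    refine ⟨0, 1, 0, ?_, zero_mem _, ExtMon.one.mem ⟨(map_zero wt).symm, rfl⟩, map_one _, zero_mem _⟩
    rw [zero_add, map_one, map_zero, mul_zero, add_zero]
  | @cons γ δ u w hu hw ih =>
    obtain ⟨a, a₀, b, rfl, ha, ha₀, hr, hb⟩ := ih
    obtain ⟨c, u₁, u₀, rfl, hc, hu₁, hu₀, hk⟩ := hu.elim (x := x) wt hwt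
    refine ⟨ι ℚ u₁ * a + ι ℚ u₁ * a₀ + ι ℚ u₀ * a, ι ℚ u₀ * a₀,
      c • (a + a₀) - ι ℚ (u₁ + u₀) * b, ?_, ?_, ?_, ?_, ?_⟩
    · have h1 : ∀ m : FreeLieAlgebra ℚ (ElimGen x), ι ℚ (FreeLie.elim x m) *
          (ι ℚ (FreeLieAlgebra.of ℚ x) * ExteriorAlgebra.map (FreeLie.elim x :
            FreeLieAlgebra ℚ (ElimGen x) →ₗ[ℚ] FreeLieAlgebra ℚ X) b) =
          -(ι ℚ (FreeLieAlgebra.of ℚ x) * (ι ℚ (FreeLie.elim x m) * ExteriorAlgebra.map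
            (FreeLie.elim x : FreeLieAlgebra ℚ (ElimGen x) →ₗ[ℚ] FreeLieAlgebra ℚ X) b)) :=
        fun m => CE.ι_swap_mul _ _ _
      simp only [map_add, map_sub, map_smul, map_mul, ExteriorAlgebra.map_apply_ι,
        LieHom.coe_toLinearMap, add_mul, mul_add, mul_sub, smul_mul_assoc, mul_smul_comm, h1,
        CE.ι_sq_mul]
      module
    · refine add_mem (add_mem ?_ ?_) ?_
      · refine mul_mem_extGr ?_ hu₁ ha
        rintro p ⟨h1, rfl⟩ q ⟨h2, rfl⟩
        exact ⟨by rw [map_add, Prod.fst_add]; omega, rfl⟩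
      · refine mul_mem_extGr ?_ hu₁ ha₀
        rintro p ⟨h1, rfl⟩ q ⟨h2, rfl⟩
        exact ⟨by rw [map_add, Prod.fst_add]; omega, rfl⟩
      · refine mul_mem_extGr ?_ hu₀ ha
        rintro p ⟨h1, rfl⟩ q ⟨h2, rfl⟩
        exact ⟨by rw [map_add, Prod.fst_add]; omega, rfl⟩
    · refine mul_mem_extGr ?_ hu₀ ha₀
      rintro p ⟨h1, rfl⟩ q ⟨h2, rfl⟩
      exact ⟨by rw [map_add, Prod.fst_add]; omega, rfl⟩
    · rw [map_mul, hr, ExteriorAlgebra.map_apply_ι, LieHom.coe_toLinearMap, hk]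
    · refine sub_mem ?_ ?_
      · by_cases h0 : c = 0
        · rw [h0, zero_smul]; exact zero_mem _
        refine Submodule.smul_mem _ _ (add_mem (extGr_mono ?_ ha) (extGr_mono ?_ ha₀))
        · rintro p ⟨h1, rfl⟩
          exact ⟨by rw [map_add, hc h0, hwt]; omega, by rw [hc h0, add_comm]⟩
        · rintro p ⟨h1, rfl⟩
          exact ⟨by rw [map_add, hc h0, hwt]; omega, by rw [hc h0, add_comm]⟩
      · refine mul_mem_extGr (S := {p | p.1 ≤ wt γ ∧ p.2 = γ}) ?_
          (add_mem (lieGr_mono ?_ hu₁) (lieGr_mono ?_ hu₀)) hb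
        · rintro p ⟨h1, rfl⟩ q ⟨h2, rfl⟩
          exact ⟨by rw [map_add, Prod.fst_add]; omega, by rw [Prod.snd_add, add_assoc]⟩
        · rintro p ⟨h1, h2⟩; exact ⟨h1.le, h2⟩
        · rintro p ⟨h1, h2⟩; exact ⟨h1.le, h2⟩

/-- The decomposition of elements of weight at most `m`, corresponding to `LieMon.elim`. -/
theorem exists_elim_extGr (hwt : ∀ y, wt (ω y) = 1) {S : Set Γ} {m : ℕ}
    (hS : ∀ γ ∈ S, wt γ < m + 1) {z : ExteriorAlgebra ℚ (FreeLieAlgebra ℚ X)}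
    (hz : z ∈ extGr ω S) :
    ∃ a a₀ b : ExteriorAlgebra ℚ (FreeLieAlgebra ℚ (ElimGen x)),
      z = ExteriorAlgebra.map
          (FreeLie.elim x : FreeLieAlgebra ℚ (ElimGen x) →ₗ[ℚ] FreeLieAlgebra ℚ X) (a + a₀) +
        ι ℚ (FreeLieAlgebra.of ℚ x) * ExteriorAlgebra.map
          (FreeLie.elim x : FreeLieAlgebra ℚ (ElimGen x) →ₗ[ℚ] FreeLieAlgebra ℚ X) b ∧
      a ∈ extGr (elimDeg x ω) {p | p.1 < m ∧ p.2 ∈ S} ∧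
      ExteriorAlgebra.map (kill {p : ElimGen x | p.2 ≠ 0} :
        FreeLieAlgebra ℚ (ElimGen x) →ₗ[ℚ] FreeLieAlgebra ℚ (ElimGen x)) a₀ = a₀ ∧
      b ∈ extGr (elimDeg x ω) {p | p.1 < m ∧ p.2 + ω x ∈ S} := by
  induction hz using Submodule.span_induction with
  | mem w hw =>
    obtain ⟨γ, hγ, hw⟩ := hw
    obtain ⟨a, a₀, b, h, ha, -, hr, hb⟩ := hw.elim (x := x) wt hwt
    have := hS γ hγ
    refine ⟨a, a₀, b, h, extGr_mono ?_ ha, hr, extGr_mono ?_ hb⟩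
    · rintro p ⟨h1, rfl⟩; exact ⟨by omega, hγ⟩
    · rintro p ⟨h1, rfl⟩; exact ⟨by omega, hγ⟩
  | zero =>
    exact ⟨0, 0, 0, by simp only [add_zero, map_zero, mul_zero], zero_mem _, map_zero _, zero_mem _⟩
  | add v w _ _ hv hw =>
    obtain ⟨a, a₀, b, rfl, ha, hr, hb⟩ := hv
    obtain ⟨a', a₀', b', rfl, ha', hr', hb'⟩ := hw
    refine ⟨a + a', a₀ + a₀', b + b', ?_, add_mem ha ha', by rw [map_add, hr, hr'], add_mem hb hb'⟩
    simp only [map_add, mul_add]; abel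
  | smul c w _ hw =>
    obtain ⟨a, a₀, b, rfl, ha, hr, hb⟩ := hw
    refine ⟨c • a, c • a₀, c • b, ?_, Submodule.smul_mem _ _ ha, by rw [map_smul, hr],
      Submodule.smul_mem _ _ hb⟩
    simp only [map_smul, map_add, smul_add, mul_smul_comm]

end Weights

end FreeLie

/-! ### The homology of free Lie algebras -/

/-- The map of exterior algebras induced by a morphism of Lie algebras. -/
noncomputable abbrev CE.wmap {L M : Type u} [LieRing L] [LieAlgebra ℚ L] [LieRing M]
    [LieAlgebra ℚ M] (f : L →ₗ⁅ℚ⁆ M) : ExteriorAlgebra ℚ L →ₐ[ℚ] ExteriorAlgebra ℚ M :=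
  ExteriorAlgebra.map (f : L →ₗ[ℚ] M)

namespace FreeLie

section Homology

variable {X : Type u} {Γ : Type} [AddCommMonoid Γ] (ω : X → Γ) (S : Set Γ)

/-- The span of those among the constant `1` and the generators that have degree in `S`. -/
noncomputable def basic : Submodule ℚ (ExteriorAlgebra ℚ (FreeLieAlgebra ℚ X)) :=
  Submodule.span ℚ {w | (w = 1 ∧ 0 ∈ S) ∨ ∃ x, ω x ∈ S ∧ w = ι ℚ (FreeLieAlgebra.of ℚ x)}

/-- The chains with degrees in `S` that are boundaries up to constants and generators. -/
noncomputable def trivialCycles : Submodule ℚ (ExteriorAlgebra ℚ (FreeLieAlgebra ℚ X)) :=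
  basic ω S ⊔ (extGr ω S).map (CE.d (FreeLieAlgebra ℚ X))

/-- In weights below `m`, the homology of free Lie algebras is spanned by the constants and the
generators. All sets of generators and all gradings are included because the elimination of a
generator changes both. -/
def HomologyBelow (m : ℕ) : Prop :=
  ∀ (X : Type u) (Γ : Type) [AddCommMonoid Γ] (ω : X → Γ) (wt : Γ →+ ℕ), (∀ x, wt (ω x) = 1) →
    ∀ S : Set Γ, (∀ γ ∈ S, wt γ < m) → ∀ z ∈ extGr ω S, CE.d _ z = 0 → z ∈ trivialCycles ω S

variable {ω S}

theorem one_mem_basic (h : 0 ∈ S) : 1 ∈ basic ω S := Submodule.subset_span (Or.inl ⟨rfl, h⟩)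

theorem ι_mem_basic {x : X} (h : ω x ∈ S) : ι ℚ (FreeLieAlgebra.of ℚ x) ∈ basic ω S :=
  Submodule.subset_span (Or.inr ⟨x, h, rfl⟩)

theorem basic_le : basic ω S ≤ trivialCycles ω S := le_sup_left

theorem d_mem_trivialCycles {w : ExteriorAlgebra ℚ (FreeLieAlgebra ℚ X)} (h : w ∈ extGr ω S) :
    CE.d _ w ∈ trivialCycles ω S :=
  Submodule.mem_sup_right (Submodule.mem_map_of_mem h)

theorem exists_of_mem_basic {w : ExteriorAlgebra ℚ (FreeLieAlgebra ℚ X)} (h : w ∈ basic ω S) :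
    ∃ (c : ℚ) (v : FreeLieAlgebra ℚ X), w = algebraMap ℚ _ c + ι ℚ v ∧ (c ≠ 0 → 0 ∈ S) ∧
      v ∈ Submodule.span ℚ (Set.range (FreeLieAlgebra.of ℚ)) := by
  induction h using Submodule.span_induction with
  | mem w h =>
    obtain ⟨rfl, h⟩ | ⟨x, hx, rfl⟩ := h
    · exact ⟨1, 0, by rw [map_one, map_zero, add_zero], fun _ => h, zero_mem _⟩
    · exact ⟨0, _, by rw [map_zero, zero_add], fun h => absurd rfl h,
        Submodule.subset_span ⟨x, rfl⟩⟩
  | zero => exact ⟨0, 0, by simp only [map_zero, add_zero], fun h => absurd rfl h, zero_mem _⟩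
  | add _ _ _ _ h h' =>
    obtain ⟨c, v, rfl, hc, hv⟩ := h
    obtain ⟨c', v', rfl, hc', hv'⟩ := h'
    refine ⟨c + c', v + v', by simp only [map_add]; abel, fun h => ?_, add_mem hv hv'⟩
    by_cases h0 : c = 0
    · exact hc' fun h1 => h (by rw [h0, h1, add_zero])
    · exact hc h0
  | smul r _ _ h =>
    obtain ⟨c, v, rfl, hc, hv⟩ := h
    refine ⟨r * c, r • v, ?_, fun h => hc (right_ne_zero_of_mul h), Submodule.smul_mem _ _ hv⟩
    rw [smul_add, map_smul, map_mul, ← Algebra.smul_def]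

/-- The derivation `shift x` is injective on generators, even modulo brackets. -/
theorem eq_zero_of_shift_boundary {x : X} {v : FreeLieAlgebra ℚ (ElimGen x)}
    (hv : v ∈ Submodule.span ℚ (Set.range (FreeLieAlgebra.of ℚ)))
    {w : ExteriorAlgebra ℚ (FreeLieAlgebra ℚ (ElimGen x))}
    (h : ι ℚ (shift x v) = CE.d _ w) : v = 0 := by
  let χ : FreeLieAlgebra ℚ (ElimGen x) →ₗ⁅ℚ⁆ Ab (FreeLieAlgebra ℚ (ElimGen x)) :=
    FreeLieAlgebra.lift ℚ fun p => ⟨.of ℚ (p.1, p.2 - 1)⟩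
  have hχ : ∀ p, χ (.of ℚ p) = ⟨.of ℚ (p.1, p.2 - 1)⟩ := FreeLieAlgebra.lift_of_apply _
  have h1 : χ (shift x v) = ⟨v⟩ := by
    clear h
    induction hv using Submodule.span_induction with
    | mem v hv => obtain ⟨p, rfl⟩ := hv; rw [shift_of, hχ]; rfl
    | zero => rw [map_zero, map_zero]; rfl
    | add u v _ _ hu hv => rw [map_add, map_add, hu, hv]; rfl
    | smul c v _ hv => rw [map_smul, map_smul, hv]; rfl
  have h2 := (low_degree_of_boundary Ab.lie_eq_zero χ (c := 0)
    (h := by rw [map_zero, zero_add]; exact h)).2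
  rw [h1] at h2
  exact congrArg Ab.val h2

/-- The generators `(ad x)ᵏ y` of the complement of `x` with `k > 0` are boundaries, of
`x ∧ (ad x)ᵏ⁻¹ y`. -/
theorem map_elim_basic {x : X} {T : Set (ℕ × Γ)} (h : ∀ p ∈ T, p.2 ∈ S)
    {w : ExteriorAlgebra ℚ (FreeLieAlgebra ℚ (ElimGen x))} (hw : w ∈ basic (elimDeg x ω) T) :
    CE.wmap (elim x) w ∈ trivialCycles ω S := by
  refine map_mem_of_span (CE.wmap (elim x)).toLinearMap ?_ hw
  rintro w (⟨rfl, h0⟩ | ⟨⟨y, k⟩, hp, rfl⟩)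
  · rw [AlgHom.toLinearMap_apply, map_one]
    exact basic_le (one_mem_basic (h 0 h0))
  · rw [AlgHom.toLinearMap_apply, ExteriorAlgebra.map_apply_ι, LieHom.coe_toLinearMap, elim_of]
    have hS : ω y + k • ω x ∈ S := h _ hp
    rcases k with _ | k
    · rw [zero_smul, add_zero] at hS
      exact basic_le (ι_mem_basic hS)
    · have : ι ℚ (adPow x y.1 (k + 1)) =
          CE.d _ (ι ℚ (FreeLieAlgebra.of ℚ x) * ι ℚ (adPow x y.1 k)) := by
        have h1 := CE.θ_ι_mul (FreeLieAlgebra.of ℚ x) (adPow x y.1 k) 1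
        rw [mul_one, mul_one, ← map_one (algebraMap ℚ _), CE.θ_algebraMap, mul_zero,
          add_zero] at h1
        rw [CE.d_ι_mul, CE.d_ι, mul_zero, sub_zero, h1, adPow]
      simp only
      rw [this]
      refine d_mem_trivialCycles (mul_mem_extGr ?_ ((LieMon.of x).mem (S := {ω x}) rfl)
        (ι_mem_extGr (adPow_mem (ω := ω) y.1 k)))
      rintro _ rfl _ rfl
      rwa [add_comm, add_assoc, ← succ_nsmul]

theorem map_elim_trivialCycles {x : X} {T : Set (ℕ × Γ)} (h : ∀ p ∈ T, p.2 ∈ S)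
    {w : ExteriorAlgebra ℚ (FreeLieAlgebra ℚ (ElimGen x))}
    (hw : w ∈ trivialCycles (elimDeg x ω) T) :
    CE.wmap (elim x) w ∈ trivialCycles ω S := by
  obtain ⟨e, he, _, ⟨y, hy, rfl⟩, rfl⟩ := Submodule.mem_sup.mp hw
  rw [map_add, CE.map_d]
  exact add_mem (map_elim_basic h he) (d_mem_trivialCycles (elim_mem_extGr h hy))

theorem ι_mul_d_elim (x : X) (y : ExteriorAlgebra ℚ (FreeLieAlgebra ℚ (ElimGen x))) :
    CE.d _ (ι ℚ (FreeLieAlgebra.of ℚ x) * CE.wmap (elim x) y) =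
      CE.wmap (elim x) (CE.ext (shift x : _ →ₗ[ℚ] _) y) -
        ι ℚ (FreeLieAlgebra.of ℚ x) * CE.wmap (elim x) (CE.d _ y) := by
  rw [CE.d_ι_mul, ← CE.map_d, CE.θ_map _ (shift x : _ →ₗ[ℚ] _) _ (lie_elim x)]

/-- Setting one generator `x` to zero does not change the class of a cycle `z`, modulo constants and
generators. With `z = a + a₀ + x ∧ b`, where `a`, `a₀`, `b` are chains on the free Lie algebra `M` with
generators `(ad x)ᵏ g`, and only those with `k = 0` occur in `a₀`, the chain `b` is a cycle in `⋀ M` with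
fewer generators than `z`. By induction `b = c + d y` up to generators of `M`, and these do not occur
because `ad x` is injective on them. Adding the boundary of `x ∧ y` replaces `z` by `a₁ + a₀ + c x`, and
induction applies to the difference of `a₁` and its value for `x = 0`, which is a cycle. -/
theorem sub_kill_mem {m : ℕ} (hm : HomologyBelow.{u} m) {wt : Γ →+ ℕ} (hwt : ∀ y, wt (ω y) = 1)
    (hS : ∀ γ ∈ S, wt γ < m + 1) {z : ExteriorAlgebra ℚ (FreeLieAlgebra ℚ X)}
    (hz : z ∈ extGr ω S) (hd : CE.d _ z = 0) (x : X) :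
    z - CE.wmap (kill {x}) z ∈ trivialCycles ω S := by
  obtain ⟨a, a₀, b, hzab, ha, hr, hb⟩ := exists_elim_extGr (x := x) wt hwt hS hz
  have h1 : CE.d _ (a + a₀) + CE.ext (shift x : _ →ₗ[ℚ] _) b = 0 ∧ -CE.d _ b = 0 := by
    refine elim_unique x ?_
    rw [hzab, map_add, ← CE.map_d, ι_mul_d_elim] at hd
    rw [← hd, map_add, map_neg]; noncomm_ring
  obtain ⟨h1, h2⟩ := h1
  obtain ⟨e, he, _, ⟨y, hy, rfl⟩, rfl⟩ := Submodule.mem_sup.mp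
    (hm _ _ (elimDeg x ω) (AddMonoidHom.fst ℕ Γ) (fun _ => rfl) _ (fun _ h => h.1) b hb
      (neg_eq_zero.mp h2))
  obtain ⟨c, v, rfl, hc, hv⟩ := exists_of_mem_basic he
  have hext : CE.ext (shift x : FreeLieAlgebra ℚ (ElimGen x) →ₗ[ℚ] _) (algebraMap ℚ _ c + ι ℚ v) =
      ι ℚ (shift x v) := by
    have := CE.ext_ι_mul (shift x : FreeLieAlgebra ℚ (ElimGen x) →ₗ[ℚ] _) v 1
    rw [mul_one, mul_one, ← map_one (algebraMap ℚ _), CE.ext_algebraMap, mul_zero,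
      add_zero] at this
    rw [map_add, CE.ext_algebraMap, zero_add, this]; rfl
  rw [map_add (CE.ext _), hext, ← CE.d_ext] at h1
  obtain rfl : v = 0 := by
    refine eq_zero_of_shift_boundary hv
      (w := -(a + a₀ + CE.ext (shift x : FreeLieAlgebra ℚ (ElimGen x) →ₗ[ℚ] _) y)) ?_
    rw [map_neg, map_add, eq_neg_iff_add_eq_zero, ← h1]; abel
  -- `a₁` is what remains of `a` when `b` is removed by the boundary of `x ∧ y`
  set a₁ := a + CE.ext (shift x : FreeLieAlgebra ℚ (ElimGen x) →ₗ[ℚ] _) y with ha₁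
  have h3 : CE.d _ a₁ = -CE.d _ a₀ := by
    rw [map_zero, map_zero, zero_add, map_add] at h1
    rw [eq_neg_iff_add_eq_zero, ← h1, ha₁, map_add]; abel
  have h4 : a₁ ∈ extGr (elimDeg x ω) {p | p.1 < m ∧ p.2 ∈ S} := by
    refine add_mem ha (ext_mem_extGr (shift x) (0, ω x) shift_gen_mem ?_ hy)
    rintro p hp; exact hp
  have h5 : a₁ - CE.wmap (kill {p : ElimGen x | p.2 ≠ 0}) a₁ ∈
      trivialCycles (elimDeg x ω) {p | p.1 < m ∧ p.2 ∈ S} := by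
    refine hm _ _ (elimDeg x ω) (AddMonoidHom.fst ℕ Γ) (fun _ => rfl) _ (fun _ h => h.1) _
      (sub_mem h4 (kill_mem_extGr h4)) ?_
    rw [map_sub, ← CE.map_d, h3, map_neg, CE.map_d, hr, sub_self]
  have hkx : ∀ w, CE.wmap (kill {x}) (ι ℚ (FreeLieAlgebra.of ℚ x) * w) = 0 := fun w => by
    rw [map_mul, ExteriorAlgebra.map_apply_ι, LieHom.coe_toLinearMap, kill_of_mem (Set.mem_singleton x),
      map_zero, zero_mul]
  have hkj : ∀ w, CE.wmap (kill {x}) (CE.wmap (elim x) w) =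
      CE.wmap (elim x) (CE.wmap (kill {p : ElimGen x | p.2 ≠ 0}) w) := fun w => by
    rw [← AlgHom.comp_apply, ← AlgHom.comp_apply, ExteriorAlgebra.map_comp_map,
      ExteriorAlgebra.map_comp_map]
    congr 2
    exact LinearMap.ext fun m => (elim_kill x m).symm
  -- the terms `a₀` are not affected by setting `x` to zero and cancel
  have h6 : z - CE.wmap (kill {x}) z =
      CE.wmap (elim x) (a₁ - CE.wmap (kill {p : ElimGen x | p.2 ≠ 0}) a₁) +
        c • ι ℚ (FreeLieAlgebra.of ℚ x) -
        CE.d _ (ι ℚ (FreeLieAlgebra.of ℚ x) * CE.wmap (elim x) y) := by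
    have h7 : CE.wmap (kill {x}) z =
        CE.wmap (elim x) (CE.wmap (kill {p : ElimGen x | p.2 ≠ 0}) a + a₀) := by
      rw [hzab, map_add, hkx, add_zero, hkj, map_add, hr]
    have h8 : CE.wmap (elim x) (CE.wmap (kill {p : ElimGen x | p.2 ≠ 0})
        (CE.ext (shift x : FreeLieAlgebra ℚ (ElimGen x) →ₗ[ℚ] _) y)) = 0 := by
      have := congrArg (CE.wmap (kill {x})) (ι_mul_d_elim x y)
      rw [CE.map_d, hkx, map_zero, map_sub, hkx, sub_zero, hkj] at this
      exact this.symm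
    rw [h7, hzab, ι_mul_d_elim, ha₁, map_zero, add_zero]
    simp only [map_add, map_sub, h8, mul_add, AlgHom.commutes, ← Algebra.commutes c,
      ← Algebra.smul_def]
    abel
  rw [h6]
  refine sub_mem (add_mem (map_elim_trivialCycles (fun _ h => h.2) h5) ?_)
    (d_mem_trivialCycles (mul_mem_extGr ?_ ((LieMon.of x).mem (S := {ω x}) rfl)
      (elim_mem_extGr (T := {γ | γ + ω x ∈ S}) (fun _ h => h.2) hy)))
  · by_cases h0 : c = 0
    · rw [h0, zero_smul]; exact zero_mem _
    · refine Submodule.smul_mem _ _ (basic_le (ι_mem_basic ?_))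
      have := (hc h0).2
      rwa [Prod.snd_zero, zero_add] at this
  · rintro _ rfl δ hδ
    rw [add_comm]; exact hδ

theorem wmap_kill_kill (s t : Set X) (w : ExteriorAlgebra ℚ (FreeLieAlgebra ℚ X)) :
    CE.wmap (kill s) (CE.wmap (kill t) w) = CE.wmap (kill (s ∪ t)) w := by
  rw [← AlgHom.comp_apply, ExteriorAlgebra.map_comp_map]
  congr 2
  exact LinearMap.ext fun m => kill_kill s t m

theorem sub_kill_finset_mem {m : ℕ} (hm : HomologyBelow.{u} m) {wt : Γ →+ ℕ}
    (hwt : ∀ y, wt (ω y) = 1) (hS : ∀ γ ∈ S, wt γ < m + 1)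
    {z : ExteriorAlgebra ℚ (FreeLieAlgebra ℚ X)} (hz : z ∈ extGr ω S) (hd : CE.d _ z = 0)
    (s : Finset X) : z - CE.wmap (kill (s : Set X)) z ∈ trivialCycles ω S := by
  classical
  induction s using Finset.induction_on with
  | empty =>
    have : kill (∅ : Set X) = LieHom.id := by
      apply FreeLieAlgebra.hom_ext
      intro y
      exact kill_of_notMem (Set.notMem_empty y)
    have h : CE.wmap (kill ((∅ : Finset X) : Set X)) z = z := by
      rw [Finset.coe_empty, CE.wmap, this]
      exact AlgHom.congr_fun ExteriorAlgebra.map_id z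
    rw [h, sub_self]
    exact zero_mem _
  | insert x s _ ih =>
    have h := sub_kill_mem hm hwt hS (kill_mem_extGr (s := (s : Set X)) hz)
      (by rw [← CE.map_d, hd, map_zero]) x
    rw [wmap_kill_kill, ← Set.insert_eq, ← Finset.coe_insert] at h
    simpa using add_mem ih h

theorem LieMon.exists_kill {γ : Γ} {u : FreeLieAlgebra ℚ X} (hu : LieMon ω γ u) :
    ∃ x : X, ∀ s : Set X, x ∈ s → kill s u = 0 := by
  induction hu with
  | of x => exact ⟨x, fun s hs => kill_of_mem hs⟩
  | lie _ _ ihu _ =>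
    obtain ⟨x, hx⟩ := ihu
    exact ⟨x, fun s hs => by rw [LieHom.map_lie, hx s hs, zero_lie]⟩

/-- If the generators in a large enough finite set are set to zero, only the constant term of a chain
remains. -/
theorem exists_kill_mem_basic {z : ExteriorAlgebra ℚ (FreeLieAlgebra ℚ X)} (hz : z ∈ extGr ω S) :
    ∃ s : Finset X, ∀ t : Set X, (s : Set X) ⊆ t → CE.wmap (kill t) z ∈ basic ω S := by
  classical
  induction hz using Submodule.span_induction with
  | mem w hw =>
    obtain ⟨γ, hγ, hw⟩ := hw
    cases hw with
    | one => exact ⟨∅, fun t _ => by rw [map_one]; exact one_mem_basic hγ⟩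
    | cons hu _ =>
      obtain ⟨x, hx⟩ := hu.exists_kill
      refine ⟨{x}, fun t ht => ?_⟩
      rw [map_mul, ExteriorAlgebra.map_apply_ι, LieHom.coe_toLinearMap, hx t (ht (by simp)),
        map_zero, zero_mul]
      exact zero_mem _
  | zero => exact ⟨∅, fun t _ => by rw [map_zero]; exact zero_mem _⟩
  | add v w _ _ hv hw =>
    obtain ⟨s, hs⟩ := hv
    obtain ⟨s', hs'⟩ := hw
    refine ⟨s ∪ s', fun t ht => ?_⟩
    rw [Finset.coe_union, Set.union_subset_iff] at ht
    rw [map_add]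
    exact add_mem (hs t ht.1) (hs' t ht.2)
  | smul c w _ hw =>
    obtain ⟨s, hs⟩ := hw
    exact ⟨s, fun t ht => by rw [map_smul]; exact Submodule.smul_mem _ _ (hs t ht)⟩

/-- By induction on the weight: all generators that occur in a cycle can be set to zero one after the
other without changing its class modulo constants and generators. -/
theorem homologyBelow (m : ℕ) : HomologyBelow.{u} m := by
  induction m with
  | zero =>
    intro X Γ _ ω wt _ S hS z hz _
    obtain rfl : S = ∅ := Set.eq_empty_iff_forall_notMem.mpr fun γ hγ => absurd (hS γ hγ) (by simp)
    have : extGr ω (∅ : Set Γ) = ⊥ := by simp [extGr]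
    rw [this, Submodule.mem_bot] at hz
    rw [hz]; exact zero_mem _
  | succ m ih =>
    intro X Γ _ ω wt hwt S hS z hz hd
    obtain ⟨s, hs⟩ := exists_kill_mem_basic hz
    have := add_mem (sub_kill_finset_mem ih hwt hS hz hd s) (basic_le (hs s subset_rfl))
    rwa [sub_add_cancel] at this

theorem mem_lieGr_univ (u : FreeLieAlgebra ℚ X) : u ∈ lieGr ω Set.univ := by
  induction u using FreeLie.induction with
  | hof x => exact (LieMon.of x).mem trivial
  | hadd u v hu hv => exact add_mem hu hv
  | hsmul c u hu => exact Submodule.smul_mem _ _ hu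
  | hlie u v hu hv => exact lie_mem_lieGr (fun _ _ _ _ => Set.mem_univ _) hu hv
  | h0 => exact zero_mem _

theorem mem_extGr_univ (w : ExteriorAlgebra ℚ (FreeLieAlgebra ℚ X)) :
    w ∈ extGr ω Set.univ := by
  induction w using CE.induction with
  | hr r =>
    rw [Algebra.algebraMap_eq_smul_one]
    exact Submodule.smul_mem _ _ (ExtMon.one.mem trivial)
  | ha v w hv hw => exact add_mem hv hw
  | hm u w hw => exact mul_mem_extGr (fun _ _ _ _ => Set.mem_univ _) (mem_lieGr_univ u) hw

/-- The homology of a free Lie algebra is spanned by the constants and the generators. -/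
theorem exists_of_cycle {z : ExteriorAlgebra ℚ (FreeLieAlgebra ℚ X)} (hz : CE.d _ z = 0) :
    ∃ (c : ℚ) (v : FreeLieAlgebra ℚ X) (y : ExteriorAlgebra ℚ (FreeLieAlgebra ℚ X)),
      v ∈ Submodule.span ℚ (Set.range (FreeLieAlgebra.of ℚ)) ∧
      z = algebraMap ℚ _ c + ι ℚ v + CE.d _ y := by
  obtain ⟨m, hm⟩ : ∃ m : ℕ, z ∈ extGr (fun _ : X => 1) {n | n < m} := by
    clear hz
    induction mem_extGr_univ (ω := fun _ : X => 1) z using Submodule.span_induction with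
    | mem w hw =>
      obtain ⟨n, -, hw⟩ := hw
      exact ⟨n + 1, hw.mem (Nat.lt_succ_self n)⟩
    | zero => exact ⟨0, zero_mem _⟩
    | add v w _ _ hv hw =>
      obtain ⟨m, hm⟩ := hv
      obtain ⟨n, hn⟩ := hw
      have h1 : ({k | k < m} : Set ℕ) ⊆ {k | k < m + n} := fun k (h : k < m) => Nat.lt_add_right n h
      have h2 : ({k | k < n} : Set ℕ) ⊆ {k | k < m + n} := fun k (h : k < n) => Nat.lt_add_left m h
      exact ⟨m + n, Submodule.add_mem _ (extGr_mono h1 hm) (extGr_mono h2 hn)⟩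
    | smul c w _ hw => exact hw.imp fun _ h => Submodule.smul_mem _ _ h
  have h := homologyBelow m X ℕ (fun _ => 1) (AddMonoidHom.id ℕ) (fun _ => rfl) {n | n < m}
    (fun _ h => h) z hm hz
  obtain ⟨e, he, _, ⟨y, _, rfl⟩, h⟩ := Submodule.mem_sup.mp h
  obtain ⟨c, v, rfl, -, hv⟩ := exists_of_mem_basic he
  exact ⟨c, v, y, hv, h.symm⟩

end Homology

end FreeLie

/-! ### Contractions of complexes, and the exterior algebra of a direct sum -/

/-- A complex is acyclic if it has an endomorphism `h` such that `1 - D h - h D` lowers a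
filtration. -/
theorem exists_eq_of_homotopy {M : Type*} [AddCommGroup M] [Module ℚ M] (D h : M →ₗ[ℚ] M)
    (F : ℕ → Submodule ℚ M) (h0 : F 0 = ⊥) (hD : ∀ x, D (D x) = 0)
    (hF : ∀ p, ∀ x ∈ F (p + 1), x - D (h x) - h (D x) ∈ F p) {p : ℕ} {x : M} (hx : x ∈ F p)
    (hd : D x = 0) : ∃ y, x = D y := by
  induction p generalizing x with
  | zero => rw [h0, Submodule.mem_bot] at hx; exact ⟨0, by rw [hx, map_zero]⟩
  | succ p ih =>
    have h1 := hF p x hx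
    rw [hd, map_zero, sub_zero] at h1
    obtain ⟨y, hy⟩ := ih h1 (by rw [map_sub, hd, hD, sub_zero])
    exact ⟨h x + y, by rw [map_add, ← hy]; abel⟩

/-- A quasi-isomorphism `f` from a vector space to a complex of vector spaces has a left inverse `P` and
a homotopy `h` from `f P` to the identity with `P d = 0` and `h f = 0`. -/
theorem exists_contraction {E M : Type*} [AddCommGroup E] [Module ℚ E] [AddCommGroup M]
    [Module ℚ M] (d : M →ₗ[ℚ] M) (hd : ∀ v, d (d v) = 0) (f : E →ₗ[ℚ] M) (hf : ∀ e, d (f e) = 0)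
    (hsurj : ∀ v, d v = 0 → ∃ e y, v = f e + d y) (hinj : ∀ e y, f e = d y → e = 0) :
    ∃ (P : M →ₗ[ℚ] E) (h : M →ₗ[ℚ] M), (∀ v, v = f (P v) + d (h v) + h (d v)) ∧
      (∀ e, P (f e) = e) ∧ (∀ v, P (d v) = 0) ∧ ∀ e, h (f e) = 0 := by
  -- `σ` splits `d` onto its image, `s` splits the cycles into the image of `f` and the boundaries, and
  -- `R` is the projection to the cycles along the image of `σ`
  obtain ⟨σ, hσ⟩ := d.rangeRestrict.exists_rightInverse_of_surjective d.range_rangeRestrict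
  have hσ' : ∀ v, d (σ (d.rangeRestrict v)) = d v := fun v =>
    congrArg Subtype.val (LinearMap.congr_fun hσ (d.rangeRestrict v))
  have hdb : ∀ b : LinearMap.range d, d b = 0 := by rintro ⟨_, v, rfl⟩; exact hd v
  let s : E × LinearMap.range d →ₗ[ℚ] LinearMap.ker d :=
    (f.coprod (LinearMap.range d).subtype).codRestrict _ fun p => by
      rw [LinearMap.mem_ker, LinearMap.coprod_apply, map_add, hf, zero_add]; exact hdb p.2
  have hs : ∀ p, (s p : M) = f p.1 + p.2 := fun p => rfl
  have hsb : Function.Bijective s := by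
    constructor
    · rw [← LinearMap.ker_eq_bot, LinearMap.ker_eq_bot']
      rintro ⟨e, _, y, rfl⟩ h
      have h1 : f e + d y = 0 := congrArg Subtype.val h
      have he : e = 0 := hinj e (-y) (by rw [map_neg, eq_neg_iff_add_eq_zero, h1])
      subst he
      rw [map_zero, zero_add] at h1
      exact Prod.ext rfl (Subtype.ext h1)
    · rintro ⟨v, hv⟩
      obtain ⟨e, y, rfl⟩ := hsurj v hv
      exact ⟨(e, ⟨d y, y, rfl⟩), Subtype.ext rfl⟩
  let S := LinearEquiv.ofBijective s hsb
  let R : M →ₗ[ℚ] LinearMap.ker d :=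
    (LinearMap.id - σ.comp d.rangeRestrict).codRestrict _ fun v => by
      rw [LinearMap.mem_ker, LinearMap.sub_apply, map_sub, LinearMap.comp_apply, hσ']
      exact sub_self _
  have hR : ∀ v, (R v : M) = v - σ (d.rangeRestrict v) := fun v => rfl
  have hSR : ∀ v p, v - σ (d.rangeRestrict v) = f p.1 + p.2 → S.symm (R v) = p := fun v p h => by
    rw [LinearEquiv.symm_apply_eq]; exact Subtype.ext h
  have hcyc : ∀ v, d v = 0 → d.rangeRestrict v = 0 := fun v h => Subtype.ext h
  have h1 : ∀ e, S.symm (R (f e)) = (e, 0) := fun e => hSR _ _ (by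
    rw [hcyc _ (hf e), map_zero, sub_zero]; exact (add_zero _).symm)
  have h2 : ∀ v, S.symm (R (d v)) = (0, d.rangeRestrict v) := fun v => hSR _ _ (by
    rw [hcyc _ (hd v), map_zero, sub_zero, map_zero, zero_add]; rfl)
  refine ⟨(LinearMap.fst ℚ _ _).comp (S.symm.toLinearMap.comp R),
    σ.comp ((LinearMap.snd ℚ _ _).comp (S.symm.toLinearMap.comp R)), fun v => ?_, fun e => ?_,
    fun v => ?_, fun e => ?_⟩
  · simp only [LinearMap.comp_apply, LinearEquiv.coe_coe, h2, LinearMap.fst_apply,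
      LinearMap.snd_apply]
    have h3 := hs (S.symm (R v))
    have h4 : s (S.symm (R v)) = R v := S.apply_symm_apply _
    have h5 : d (σ (S.symm (R v)).2) = (S.symm (R v)).2 := by
      have := congrArg Subtype.val (LinearMap.congr_fun hσ (S.symm (R v)).2)
      exact this
    rw [h5, ← h3, h4, hR, sub_add_cancel]
  · simp only [LinearMap.comp_apply, LinearEquiv.coe_coe, h1, LinearMap.fst_apply]
  · simp only [LinearMap.comp_apply, LinearEquiv.coe_coe, h2, LinearMap.fst_apply]
  · simp only [LinearMap.comp_apply, LinearEquiv.coe_coe, h1, LinearMap.snd_apply, map_zero]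

namespace CE

section Involution

variable {L : Type u} [LieRing L] [LieAlgebra ℚ L]

/-- The automorphism of the exterior algebra that is `(-1)ⁿ` in degree `n`. -/
noncomputable def invol : ExteriorAlgebra ℚ L →ₐ[ℚ] ExteriorAlgebra ℚ L :=
  ExteriorAlgebra.map (-LinearMap.id)

theorem invol_ι_mul (x : L) (w : ExteriorAlgebra ℚ L) : invol (ι ℚ x * w) = -(ι ℚ x * invol w) := by
  rw [invol, map_mul, ExteriorAlgebra.map_apply_ι, LinearMap.neg_apply, LinearMap.id_apply, map_neg,
    neg_mul]

theorem invol_invol (w : ExteriorAlgebra ℚ L) : invol (invol w) = w := by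
  induction w using CE.induction with
  | hr r => rw [AlgHom.commutes, AlgHom.commutes]
  | ha v w hv hw => rw [map_add, map_add, hv, hw]
  | hm x w hw => rw [invol_ι_mul, map_neg, invol_ι_mul, hw, neg_neg]

theorem invol_mem_gr {n : ℕ} {w : ExteriorAlgebra ℚ L} (h : w ∈ ⋀[ℚ]^n L) :
    invol w ∈ ⋀[ℚ]^n L := map_mem_gr _ n w h

theorem exists_mem_gr (w : ExteriorAlgebra ℚ L) : ∃ n, w ∈ ⨆ k : Fin n, ⋀[ℚ]^(k : ℕ) L := by
  induction w using CE.induction with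
  | hr r =>
    refine ⟨1, Submodule.mem_iSup_of_mem (0 : Fin 1) ?_⟩
    rw [Fin.val_zero, gr_zero]; exact Submodule.algebraMap_mem r
  | ha v w hv hw =>
    obtain ⟨m, hm⟩ := hv
    obtain ⟨n, hn⟩ := hw
    have key : ∀ a b : ℕ, a ≤ b → (⨆ k : Fin a, ⋀[ℚ]^(k : ℕ) L) ≤ ⨆ k : Fin b, ⋀[ℚ]^(k : ℕ) L :=
      fun a b h => iSup_le fun k => le_iSup_of_le (Fin.castLE h k) le_rfl
    exact ⟨m + n, add_mem (key _ _ (Nat.le_add_right m n) hm) (key _ _ (Nat.le_add_left n m) hn)⟩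
  | hm x w hw =>
    obtain ⟨n, hn⟩ := hw
    refine ⟨n + 1, ?_⟩
    have : (⨆ k : Fin n, ⋀[ℚ]^(k : ℕ) L) ≤
        (⨆ k : Fin (n + 1), ⋀[ℚ]^(k : ℕ) L).comap (wedgeLeft L x) :=
      iSup_le fun k v hv => Submodule.mem_iSup_of_mem k.succ (by
        rw [Fin.val_succ]; exact ι_mul_mem_gr x hv)
    exact this hn

end Involution

section Wedge

variable {G N L : Type u} [LieRing G] [LieAlgebra ℚ G] [LieRing N] [LieAlgebra ℚ N] [LieRing L]
  [LieAlgebra ℚ L] (i : G →ₗ⁅ℚ⁆ L) (j : N →ₗ⁅ℚ⁆ L)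

/-- The map `⋀ G ⊗ ⋀ N → ⋀ L` given by two morphisms to `L`. -/
noncomputable def wedge : ExteriorAlgebra ℚ G ⊗[ℚ] ExteriorAlgebra ℚ N →ₗ[ℚ] ExteriorAlgebra ℚ L :=
  TensorProduct.lift ((LinearMap.mul ℚ (ExteriorAlgebra ℚ L)).compl₁₂ (wmap i).toLinearMap
    (wmap j).toLinearMap)

theorem wedge_tmul (w : ExteriorAlgebra ℚ G) (v : ExteriorAlgebra ℚ N) :
    wedge i j (w ⊗ₜ v) = wmap i w * wmap j v := rfl

/-- `⋀ G ⊗ ⋀ N = ⋀ (G ⊕ N)`, as the case of zero quadratic forms of the corresponding statement for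
Clifford algebras. -/
theorem wedge_bijective (hb : Function.Bijective fun p : G × N => i p.1 + j p.2) :
    Function.Bijective (wedge i j) := by
  let e : (G × N) ≃ₗ[ℚ] L :=
    LinearEquiv.ofBijective ((i : G →ₗ[ℚ] L).coprod (j : N →ₗ[ℚ] L)) hb
  let e' : ((0 : QuadraticForm ℚ G).prod (0 : QuadraticForm ℚ N)).IsometryEquiv
      (0 : QuadraticForm ℚ L) :=
    { e with map_app' := fun m => by simp }
  have h : (wedge i j : _ → _) = CliffordAlgebra.equivOfIsometry e' ∘
      (CliffordAlgebra.prodEquiv (0 : QuadraticForm ℚ G) (0 : QuadraticForm ℚ N)).symm ∘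
      GradedTensorProduct.of ℚ (CliffordAlgebra.evenOdd (0 : QuadraticForm ℚ G))
        (CliffordAlgebra.evenOdd (0 : QuadraticForm ℚ N)) := by
    funext t
    induction t using TensorProduct.induction_on with
    | zero => simp only [Function.comp_apply, map_zero]
    | add s t hs ht => simp only [Function.comp_apply, map_add, hs, ht] at *
    | tmul w v =>
      have h1 : (CliffordAlgebra.equivOfIsometry e').toAlgHom.comp (CliffordAlgebra.map
          (QuadraticMap.Isometry.inl (0 : QuadraticForm ℚ G) (0 : QuadraticForm ℚ N))) =
          wmap i := by
        apply CliffordAlgebra.hom_ext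
        refine LinearMap.ext fun m => ?_
        refine Eq.trans ?_ (ExteriorAlgebra.map_apply_ι (i : G →ₗ[ℚ] L) m).symm
        change CliffordAlgebra.map _ (CliffordAlgebra.map _ (CliffordAlgebra.ι _ m)) = _
        rw [CliffordAlgebra.map_apply_ι, CliffordAlgebra.map_apply_ι]
        refine congrArg (ι ℚ) ?_
        change i m + j 0 = i m
        rw [map_zero, add_zero]
      have h2 : (CliffordAlgebra.equivOfIsometry e').toAlgHom.comp (CliffordAlgebra.map
          (QuadraticMap.Isometry.inr (0 : QuadraticForm ℚ G) (0 : QuadraticForm ℚ N))) =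
          wmap j := by
        apply CliffordAlgebra.hom_ext
        refine LinearMap.ext fun m => ?_
        refine Eq.trans ?_ (ExteriorAlgebra.map_apply_ι (j : N →ₗ[ℚ] L) m).symm
        change CliffordAlgebra.map _ (CliffordAlgebra.map _ (CliffordAlgebra.ι _ m)) = _
        rw [CliffordAlgebra.map_apply_ι, CliffordAlgebra.map_apply_ι]
        refine congrArg (ι ℚ) ?_
        change i 0 + j m = j m
        rw [map_zero, zero_add]
      rw [wedge_tmul, ← h1, ← h2]
      refine (map_mul (CliffordAlgebra.equivOfIsometry e') _ _).symm.trans ?_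
      refine congrArg (CliffordAlgebra.equivOfIsometry e') ?_
      rfl
  rw [h]
  exact (AlgEquiv.bijective _).comp ((AlgEquiv.bijective _).comp (LinearEquiv.bijective _))

end Wedge

end CE

/-! ### The complex of an extension of Lie algebras -/

namespace CE

section Filtration

variable (G : Type u) [LieRing G] [LieAlgebra ℚ G] (W W' : Type u) [AddCommGroup W] [Module ℚ W]
  [AddCommGroup W'] [Module ℚ W']

/-- The part of `⋀ G ⊗ W` with degree less than `p` in `⋀ G`. -/
noncomputable def filt (p : ℕ) : Submodule ℚ (ExteriorAlgebra ℚ G ⊗[ℚ] W) :=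
  Submodule.span ℚ {t | ∃ k < p, ∃ w ∈ ⋀[ℚ]^k G, ∃ v : W, t = w ⊗ₜ v}

variable {G W W'}

theorem tmul_mem_filt {k p : ℕ} (hk : k < p) {w : ExteriorAlgebra ℚ G} (hw : w ∈ ⋀[ℚ]^k G) (v : W) :
    w ⊗ₜ v ∈ filt G W p := Submodule.subset_span ⟨k, hk, w, hw, v, rfl⟩

theorem filt_zero : filt G W 0 = ⊥ := by
  rw [filt, Submodule.span_eq_bot]
  rintro _ ⟨k, hk, -⟩
  exact absurd hk (Nat.not_lt_zero k)

theorem filt_mono {p q : ℕ} (h : p ≤ q) : filt G W p ≤ filt G W q :=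
  Submodule.span_mono fun _ ⟨k, hk, r⟩ => ⟨k, hk.trans_le h, r⟩

theorem exists_mem_filt (t : ExteriorAlgebra ℚ G ⊗[ℚ] W) : ∃ p, t ∈ filt G W p := by
  induction t using TensorProduct.induction_on with
  | zero => exact ⟨0, zero_mem _⟩
  | add s t hs ht =>
    obtain ⟨p, hp⟩ := hs
    obtain ⟨q, hq⟩ := ht
    exact ⟨p + q, add_mem (filt_mono (Nat.le_add_right p q) hp) (filt_mono (Nat.le_add_left q p) hq)⟩
  | tmul w v =>
    obtain ⟨n, hn⟩ := exists_mem_gr w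
    refine ⟨n, ?_⟩
    have : (⨆ k : Fin n, ⋀[ℚ]^(k : ℕ) G) ≤
        (filt G W n).comap ((TensorProduct.mk ℚ (ExteriorAlgebra ℚ G) W).flip v) :=
      iSup_le fun k w hw => tmul_mem_filt k.2 hw v
    exact this hn

/-- To map a step of the filtration into a submodule, it suffices to do so for pure tensors. -/
theorem map_filt_mem {M : Type*} [AddCommGroup M] [Module ℚ M]
    (f : ExteriorAlgebra ℚ G ⊗[ℚ] W →ₗ[ℚ] M) {p : ℕ} {S : Submodule ℚ M}
    (h : ∀ k < p, ∀ w ∈ ⋀[ℚ]^k G, ∀ v : W, f (w ⊗ₜ v) ∈ S) {t : ExteriorAlgebra ℚ G ⊗[ℚ] W}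
    (ht : t ∈ filt G W p) : f t ∈ S := by
  have : filt G W p ≤ S.comap f := Submodule.span_le.mpr (by
    rintro _ ⟨k, hk, w, hw, v, rfl⟩
    exact h k hk w hw v)
  exact this ht

theorem lTensor_mem_filt (f : W →ₗ[ℚ] W') {p : ℕ} {t : ExteriorAlgebra ℚ G ⊗[ℚ] W}
    (ht : t ∈ filt G W p) : TensorProduct.map LinearMap.id f t ∈ filt G W' p :=
  map_filt_mem _ (fun k hk w hw v => by
    rw [TensorProduct.map_tmul, LinearMap.id_apply]; exact tmul_mem_filt hk hw _) ht

theorem invol_lTensor_mem_filt (f : W →ₗ[ℚ] W') {p : ℕ} {t : ExteriorAlgebra ℚ G ⊗[ℚ] W}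
    (ht : t ∈ filt G W p) : TensorProduct.map invol.toLinearMap f t ∈ filt G W' p :=
  map_filt_mem _ (fun k hk w hw v => by
    rw [TensorProduct.map_tmul]; exact tmul_mem_filt hk (invol_mem_gr hw) _) ht

end Filtration

section Main

variable {G N L : Type u} [LieRing G] [LieAlgebra ℚ G] [LieRing N] [LieAlgebra ℚ N] [LieRing L]
  [LieAlgebra ℚ L] {i : G →ₗ⁅ℚ⁆ L} {j : N →ₗ⁅ℚ⁆ L}

theorem ι_mul_wedge_mem (x : G) {p : ℕ} {z : ExteriorAlgebra ℚ L}
    (hz : z ∈ (filt G (ExteriorAlgebra ℚ N) p).map (wedge i j)) :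
    ι ℚ (i x) * z ∈ (filt G (ExteriorAlgebra ℚ N) (p + 1)).map (wedge i j) := by
  obtain ⟨t, ht, rfl⟩ := hz
  refine map_filt_mem ((wedgeLeft L (i x)).comp (wedge i j)) (fun k hk w hw v => ?_) ht
  refine ⟨(ι ℚ x * w) ⊗ₜ v, tmul_mem_filt (Nat.succ_lt_succ hk) (ι_mul_mem_gr x hw) v, ?_⟩
  rw [wedge_tmul, map_mul, ExteriorAlgebra.map_apply_ι, mul_assoc]; rfl

theorem ι_mul_map_comm (m : L) (w : ExteriorAlgebra ℚ G) :
    ι ℚ m * wmap i w = wmap i (invol w) * ι ℚ m := by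
  induction w using CE.induction with
  | hr r => simp only [AlgHom.commutes, Algebra.commutes]
  | ha v w hv hw => simp only [map_add, mul_add, add_mul, hv, hw]
  | hm x w hw =>
    rw [invol_ι_mul, map_neg, map_mul, map_mul, ExteriorAlgebra.map_apply_ι, ι_swap_mul, hw, neg_mul,
      mul_assoc]

theorem ι_mul_wedge_mem' (m : N) {p : ℕ} {z : ExteriorAlgebra ℚ L}
    (hz : z ∈ (filt G (ExteriorAlgebra ℚ N) p).map (wedge i j)) :
    ι ℚ (j m) * z ∈ (filt G (ExteriorAlgebra ℚ N) p).map (wedge i j) := by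
  obtain ⟨t, ht, rfl⟩ := hz
  refine map_filt_mem ((wedgeLeft L (j m)).comp (wedge i j)) (fun k hk w hw v => ?_) ht
  refine ⟨invol w ⊗ₜ (ι ℚ m * v), tmul_mem_filt hk (invol_mem_gr hw) _, ?_⟩
  rw [wedge_tmul, map_mul, ExteriorAlgebra.map_apply_ι, ← mul_assoc]
  change _ = ι ℚ (j m) * (wmap i w * wmap j v)
  rw [← mul_assoc, ι_mul_map_comm]; rfl

/-- Up to terms of lower degree in `⋀ G`, the differential of `⋀ L` is that of `⋀ N`. -/
theorem d_wedge_sub_mem (hij : ∀ x, ∃ D : N →ₗ[ℚ] N, ∀ m, ⁅i x, j m⁆ = j (D m)) {k : ℕ}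
    {w : ExteriorAlgebra ℚ G} (hw : w ∈ ⋀[ℚ]^k G) (v : ExteriorAlgebra ℚ N) :
    d L (wedge i j (w ⊗ₜ v)) - wedge i j (invol w ⊗ₜ d N v) ∈
      (filt G (ExteriorAlgebra ℚ N) k).map (wedge i j) := by
  refine gr_induction (P := fun k w => d L (wedge i j (w ⊗ₜ v)) - wedge i j (invol w ⊗ₜ d N v) ∈
    (filt G (ExteriorAlgebra ℚ N) k).map (wedge i j)) (fun r => ?_) (fun k w w' h h' => ?_)
    (fun k x w hw h => ?_) k w hw
  · simp only [wedge_tmul, AlgHom.commutes, ← Algebra.smul_def, map_smul, ← map_d, sub_self]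
    exact zero_mem _
  · simp only [TensorProduct.add_tmul, map_add] at h h' ⊢
    rw [add_sub_add_comm]
    exact add_mem h h'
  · obtain ⟨D, hD⟩ := hij x
    have h1 : d L (wedge i j ((ι ℚ x * w) ⊗ₜ v)) - wedge i j (invol (ι ℚ x * w) ⊗ₜ d N v) =
        wedge i j (θ x w ⊗ₜ v) + wedge i j (w ⊗ₜ ext D v) -
          ι ℚ (i x) * (d L (wedge i j (w ⊗ₜ v)) - wedge i j (invol w ⊗ₜ d N v)) := by
      rw [invol_ι_mul, TensorProduct.neg_tmul, map_neg]
      simp only [wedge_tmul, map_mul, ExteriorAlgebra.map_apply_ι, mul_assoc, d_ι_mul, θ_mul, map_θ, LieHom.coe_toLinearMap,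
        θ_map (j : N →ₗ[ℚ] L) D (i x) hD, mul_sub]
      abel
    rw [h1]
    exact sub_mem (add_mem ⟨_, tmul_mem_filt (Nat.lt_succ_self k) (θ_mem_gr x k w hw) v, rfl⟩
      ⟨_, tmul_mem_filt (Nat.lt_succ_self k) hw _, rfl⟩) (ι_mul_wedge_mem x h)

variable {E : Type u} [AddCommGroup E] [Module ℚ E]

/-- Let `L` be an extension of `G` by the ideal `N`. A map of complexes `⋀ G ⊗ E → ⋀ L` which, up to
terms of lower degree in `⋀ G`, is given by a quasi-isomorphism `E → ⋀ N`, is a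
quasi-isomorphism. This is the acyclicity of its cone, which is contracted up to lower terms by a
contraction of the cone of `E → ⋀ N`. -/
theorem quasiIso_of_fiber (hb : Function.Bijective fun p : G × N => i p.1 + j p.2)
    (hij : ∀ x, ∃ D : N →ₗ[ℚ] N, ∀ m, ⁅i x, j m⁆ = j (D m))
    (f : E →ₗ[ℚ] ExteriorAlgebra ℚ N) (hf : ∀ e, d N (f e) = 0)
    (hsurj : ∀ v, d N v = 0 → ∃ e y, v = f e + d N y) (hinj : ∀ e y, f e = d N y → e = 0)
    (K : ExteriorAlgebra ℚ G ⊗[ℚ] E →ₗ[ℚ] ExteriorAlgebra ℚ L)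
    (hK : ∀ w e, d L (K (w ⊗ₜ e)) = K (d G w ⊗ₜ e))
    (hKf : ∀ k, ∀ w ∈ ⋀[ℚ]^k G, ∀ e, K (w ⊗ₜ e) - wedge i j (w ⊗ₜ f e) ∈
      (filt G (ExteriorAlgebra ℚ N) k).map (wedge i j)) :
    (∀ z, d L z = 0 → ∃ t y, TensorProduct.map (d G) LinearMap.id t = 0 ∧ z = K t + d L y) ∧
    ∀ t y, TensorProduct.map (d G) LinearMap.id t = 0 → K t = d L y →
      ∃ u, t = TensorProduct.map (d G) LinearMap.id u := by
  obtain ⟨P, h, hv, hP, hPd, hh⟩ := exists_contraction (d N) d_d f hf hsurj hinj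
  let m := LinearEquiv.ofBijective (wedge i j) (wedge_bijective i j hb)
  have hm : ∀ t, m.symm (wedge i j t) = t := m.symm_apply_apply
  let dE : ExteriorAlgebra ℚ G ⊗[ℚ] E →ₗ[ℚ] ExteriorAlgebra ℚ G ⊗[ℚ] E :=
    TensorProduct.map (d G) LinearMap.id
  have hdE : ∀ t, dE (dE t) = 0 := fun t => by
    induction t using TensorProduct.induction_on with
    | zero => rw [map_zero, map_zero]
    | add s t hs ht => rw [map_add, map_add, hs, ht, add_zero]
    | tmul w e =>
      change (d G (d G w)) ⊗ₜ e = _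
      rw [d_d, TensorProduct.zero_tmul]
  have hK' : ∀ t, d L (K t) = K (dE t) := fun t => by
    induction t using TensorProduct.induction_on with
    | zero => simp only [map_zero]
    | add s t hs ht => simp only [map_add, hs, ht]
    | tmul w e => exact hK w e
  let P' : ExteriorAlgebra ℚ G ⊗[ℚ] ExteriorAlgebra ℚ N →ₗ[ℚ] ExteriorAlgebra ℚ G ⊗[ℚ] E :=
    TensorProduct.map LinearMap.id P
  let h' : ExteriorAlgebra ℚ G ⊗[ℚ] ExteriorAlgebra ℚ N →ₗ[ℚ]
      ExteriorAlgebra ℚ G ⊗[ℚ] ExteriorAlgebra ℚ N := TensorProduct.map invol.toLinearMap h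
  have hP' : ∀ w v, P' (w ⊗ₜ v) = w ⊗ₜ P v := fun w v => rfl
  have hh' : ∀ w v, h' (w ⊗ₜ v) = invol w ⊗ₜ h v := fun w v => rfl
  have hdE' : ∀ w e, dE (w ⊗ₜ e) = d G w ⊗ₜ e := fun w v => rfl
  -- the cone `C` of `K`, with differential `D`, and its contraction `H` up to the filtration `F` by the
  -- degree in `⋀ G`
  let C := (ExteriorAlgebra ℚ G ⊗[ℚ] E) × ExteriorAlgebra ℚ L
  let D : C →ₗ[ℚ] C :=
    (-(dE.comp (LinearMap.fst ℚ _ _))).prod (K.coprod (d L))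
  let H : C →ₗ[ℚ] C :=
    ((P'.comp m.symm.toLinearMap).comp (LinearMap.snd ℚ _ _)).prod
      ((((wedge i j).comp h').comp m.symm.toLinearMap).comp (LinearMap.snd ℚ _ _))
  have hD : ∀ c, D c = (-dE c.1, K c.1 + d L c.2) := fun c => rfl
  have hH : ∀ c, H c = (P' (m.symm c.2), wedge i j (h' (m.symm c.2))) := fun c => rfl
  let F : ℕ → Submodule ℚ C := fun p =>
    (filt G E p).prod ((filt G (ExteriorAlgebra ℚ N) p).map (wedge i j))
  have hdE_mem : ∀ k, ∀ w ∈ ⋀[ℚ]^k G, ∀ e : E, d G w ⊗ₜ e ∈ filt G E k := fun k w hw e => by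
    rcases k with _ | k
    · rw [gr_zero, Submodule.mem_one] at hw
      obtain ⟨r, rfl⟩ := hw
      rw [d_algebraMap, TensorProduct.zero_tmul]; exact zero_mem _
    · exact tmul_mem_filt (Nat.lt_succ_self k) (d_mem_gr k w hw) e
  have hlow : ∀ k z, z ∈ (filt G (ExteriorAlgebra ℚ N) k).map (wedge i j) →
      P' (m.symm z) ∈ filt G E k ∧
      wedge i j (h' (m.symm z)) ∈ (filt G (ExteriorAlgebra ℚ N) k).map (wedge i j) := by
    rintro k _ ⟨t, ht, rfl⟩
    rw [hm]
    exact ⟨lTensor_mem_filt P ht, ⟨_, invol_lTensor_mem_filt h ht, rfl⟩⟩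
  have hF : ∀ p, ∀ x ∈ F (p + 1), x - D (H x) - H (D x) ∈ F p := by
    intro p
    have hmono : ∀ {k}, k < p + 1 → F k ≤ F p := fun hk => Submodule.prod_mono
      (filt_mono (Nat.lt_succ_iff.mp hk)) (Submodule.map_mono (filt_mono (Nat.lt_succ_iff.mp hk)))
    -- the failure of `H` to be a contraction is computed on `⋀ G ⊗ E` and `⋀ L` separately
    let N' : C →ₗ[ℚ] C := LinearMap.id - D.comp H - H.comp D
    have hN' : ∀ x, N' x = x - D (H x) - H (D x) := fun _ => rfl
    have h1 : ∀ e ∈ filt G E (p + 1), N' (e, 0) ∈ F p := fun e he => by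
      refine map_filt_mem (N'.comp (LinearMap.inl ℚ _ _)) (fun k hk w hw e => hmono hk ?_) he
      obtain ⟨hl1, hl2⟩ := hlow k _ (hKf k w hw e)
      change N' (w ⊗ₜ e, 0) ∈ F k
      rw [map_sub, hm, map_sub, hP', hP] at hl1
      rw [map_sub, hm, map_sub, hh', hh, TensorProduct.tmul_zero, sub_zero] at hl2
      rw [hN', hH, hD, hD, hH]
      simp only [map_zero, add_zero, neg_zero]
      refine ⟨?_, ?_⟩
      · change w ⊗ₜ e - 0 - P' (m.symm (K (w ⊗ₜ e))) ∈ filt G E k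
        rw [sub_zero]
        have := neg_mem hl1
        rwa [neg_sub] at this
      · change 0 - 0 - wedge i j (h' (m.symm (K (w ⊗ₜ e)))) ∈ _
        rw [sub_zero, zero_sub]
        exact neg_mem hl2
    have h2 : ∀ z ∈ (filt G (ExteriorAlgebra ℚ N) (p + 1)).map (wedge i j), N' (0, z) ∈ F p := by
      rintro _ ⟨t, ht, rfl⟩
      refine map_filt_mem ((N'.comp (LinearMap.inr ℚ _ _)).comp (wedge i j))
        (fun k hk w hw v => hmono hk ?_) ht
      change N' (0, wedge i j (w ⊗ₜ v)) ∈ F k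
      obtain ⟨hl1, hl2⟩ := hlow k _ (d_wedge_sub_mem hij hw v)
      rw [map_sub, hm, map_sub, hP', hPd, TensorProduct.tmul_zero, sub_zero] at hl1
      rw [map_sub, hm, map_sub, hh', invol_invol, map_sub] at hl2
      have hl3 := hKf k w hw (P v)
      have hl4 := d_wedge_sub_mem hij (invol_mem_gr hw) (h v)
      rw [invol_invol] at hl4
      have h3 : wedge i j (w ⊗ₜ v) = wedge i j (w ⊗ₜ f (P v)) + wedge i j (w ⊗ₜ d N (h v)) +
          wedge i j (w ⊗ₜ h (d N v)) := by
        rw [← map_add, ← map_add, ← TensorProduct.tmul_add, ← TensorProduct.tmul_add, ← hv v]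
      rw [hN', hH, hD, hD, hH]
      simp only [map_zero, zero_add, hm, hP', hh']
      refine ⟨?_, ?_⟩
      · have := sub_mem (hdE_mem k w hw (P v)) hl1
        rw [← hdE'] at this
        change 0 - -dE (w ⊗ₜ P v) - P' (m.symm (d L (wedge i j (w ⊗ₜ v)))) ∈ filt G E k
        rwa [sub_neg_eq_add, zero_add]
      · have := neg_mem (add_mem (add_mem hl3 hl4) hl2)
        change wedge i j (w ⊗ₜ v) - (K (w ⊗ₜ P v) + d L (wedge i j (invol w ⊗ₜ h v))) -
          wedge i j (h' (m.symm (d L (wedge i j (w ⊗ₜ v))))) ∈ _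
        refine (congrArg (· ∈ _) ?_).mp this
        generalize h' (m.symm (d L (wedge i j (w ⊗ₜ v)))) = q
        rw [h3]
        abel
    rintro ⟨e, z⟩ ⟨he, hz⟩
    rw [← hN', show ((e, z) : C) = (e, 0) + (0, z) by simp, map_add]
    exact add_mem (h1 e he) (h2 z hz)
  have hex : ∀ c : C, ∃ p, c ∈ F p := fun ⟨e, z⟩ => by
    obtain ⟨p, hp⟩ := exists_mem_filt e
    obtain ⟨q, hq⟩ := exists_mem_filt (m.symm z)
    refine ⟨p + q, filt_mono (Nat.le_add_right p q) hp, ?_⟩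
    exact ⟨m.symm z, filt_mono (Nat.le_add_left q p) hq, m.apply_symm_apply z⟩
  have hacyc : ∀ c : C, D c = 0 → ∃ b, c = D b := fun c hc => by
    obtain ⟨p, hp⟩ := hex c
    refine exists_eq_of_homotopy D H F ?_ (fun c => ?_) hF hp hc
    · simp only [F, filt_zero, Submodule.map_bot, Submodule.prod_bot]
    · rw [hD, hD]
      simp only [map_neg, hdE, map_add, d_d, hK', neg_zero, add_zero, neg_add_cancel]
      rfl
  refine ⟨fun z hz => ?_, fun t y ht hy => ?_⟩
  · obtain ⟨⟨t, y⟩, h⟩ := hacyc (0, z) (by rw [hD]; simp only [map_zero, neg_zero, hz, add_zero]; rfl)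
    rw [hD, Prod.mk.injEq] at h
    exact ⟨t, y, neg_eq_zero.mp h.1.symm, h.2⟩
  · obtain ⟨⟨u, y⟩, h⟩ := hacyc (t, -y) (by
      rw [hD]; simp only [map_neg, hy, add_neg_cancel]
      rw [show dE t = 0 from ht, neg_zero]; rfl)
    rw [hD, Prod.mk.injEq] at h
    exact ⟨-u, by rw [map_neg]; exact h.1⟩

end Main

end CE

/-! ### Adding an element to `A`: the action of `t̃_A` on a free Lie algebra -/

namespace DK

section Lift

variable {A L : Type u} [LieRing L] [LieAlgebra ℚ L] (T : A → A → L) (S : A → L)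

/-- The morphism with prescribed values on the generators `t_{ab}` and `s_a`. -/
noncomputable def liftGen (symm : ∀ a b, T a b = T b a)
    (disj : ∀ a b c d, a ≠ b → a ≠ c → a ≠ d → b ≠ c → b ≠ d → c ≠ d → ⁅T a b, T c d⁆ = 0)
    (three : ∀ a b c, a ≠ b → a ≠ c → b ≠ c → ⁅T a c, T a b + T b c⁆ = 0)
    (hST : ∀ a b c, b ≠ c → ⁅S a, T b c⁆ = 0) (hSS : ∀ a b, ⁅S a, S b⁆ = 0) : DK A →ₗ⁅ℚ⁆ L :=
  lift (FreeLieAlgebra.lift ℚ (DKGen.rec (fun a b _ => T a b) S)) (by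
    have hT : ∀ a b h, FreeLieAlgebra.lift ℚ
      (DKGen.rec (fun a b _ => T a b) S) (genT a b h) = T a b :=
      fun a b h => FreeLieAlgebra.lift_of_apply _ _
    have hS : ∀ a, FreeLieAlgebra.lift ℚ (DKGen.rec (fun a b _ => T a b) S) (genS a) = S a :=
      fun a => FreeLieAlgebra.lift_of_apply _ _
    rintro r (⟨a, b, h⟩ | ⟨a, b, c, d, hab, hac, had, hbc, hbd, hcd⟩ | ⟨a, b, c, hab, hac, hbc⟩ |
      ⟨a, x⟩)
    · rw [map_sub, hT, hT, symm, sub_self]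
    · rw [LieHom.map_lie, hT, hT]
      exact disj a b c d hab hac had hbc hbd hcd
    · rw [LieHom.map_lie, map_add, hT, hT, hT]
      exact three a b c hab hac hbc
    · rw [LieHom.map_lie, hS]
      refine free_centralizes _ _ ?_ x
      rintro (⟨b, c, hbc⟩ | b)
      · rw [hT]
        exact hST a b c hbc
      · rw [hS]
        exact hSS a b)

variable {T S} {symm : ∀ a b, T a b = T b a}
    {disj : ∀ a b c d, a ≠ b → a ≠ c → a ≠ d → b ≠ c → b ≠ d → c ≠ d → ⁅T a b, T c d⁆ = 0}
    {three : ∀ a b c, a ≠ b → a ≠ c → b ≠ c → ⁅T a c, T a b + T b c⁆ = 0}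
    {hST : ∀ a b c, b ≠ c → ⁅S a, T b c⁆ = 0} {hSS : ∀ a b, ⁅S a, S b⁆ = 0}

theorem liftGen_t {a b : A} (h : a ≠ b) : liftGen T S symm disj three hST hSS (t a b) = T a b := by
  rw [t_of_ne h]
  exact FreeLieAlgebra.lift_of_apply _ _

theorem liftGen_s (a : A) : liftGen T S symm disj three hST hSS (s a) = S a :=
  FreeLieAlgebra.lift_of_apply _ _

/-- Induction for the Lie algebras `t̃_A`. -/
theorem induction {P : DK A → Prop} (ht : ∀ a b, a ≠ b → P (t a b)) (hs : ∀ a, P (s a))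
    (hadd : ∀ u v, P u → P v → P (u + v)) (hsmul : ∀ (c : ℚ) u, P u → P (c • u))
    (hlie : ∀ u v, P u → P v → P ⁅u, v⁆) (h0 : P 0) (u) : P u := by
  obtain ⟨u, rfl⟩ := proj_surjective u
  induction u using FreeLie.induction with
  | hof g =>
    rcases g with ⟨a, b, h⟩ | a
    · have := ht a b h
      rwa [t_of_ne h] at this
    · exact hs a
  | hadd u v hu hv => rw [map_add]; exact hadd _ _ hu hv
  | hsmul c u hu => rw [map_smul]; exact hsmul _ _ hu
  | hlie u v hu hv => rw [LieHom.map_lie]; exact hlie _ _ hu hv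
  | h0 => rw [map_zero]; exact h0

end Lift

section Action

variable {A : Type u}

open Classical in
/-- The derivation of the free Lie algebra on `A` by which `t_{ab}` acts: `a ↦ ⁅a, b⁆`,
`b ↦ ⁅b, a⁆`. -/
noncomputable def twist (a b : A) :
    LieDerivation ℚ (FreeLieAlgebra ℚ A) (FreeLieAlgebra ℚ A) :=
  FreeLie.der fun c => if c = a then ⁅FreeLieAlgebra.of ℚ a, FreeLieAlgebra.of ℚ b⁆ else
    if c = b then ⁅FreeLieAlgebra.of ℚ b, FreeLieAlgebra.of ℚ a⁆ else 0

theorem twist_left (a b : A) :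
    twist a b (.of ℚ a) = ⁅FreeLieAlgebra.of ℚ a, FreeLieAlgebra.of ℚ b⁆ := by
  rw [twist, FreeLie.der_of, if_pos rfl]

theorem twist_right (a b : A) :
    twist a b (.of ℚ b) = ⁅FreeLieAlgebra.of ℚ b, FreeLieAlgebra.of ℚ a⁆ := by
  rw [twist, FreeLie.der_of]
  by_cases h : b = a
  · subst h; rw [if_pos rfl]
  · rw [if_neg h, if_pos rfl]

theorem twist_of_ne {a b c : A} (h : c ≠ a) (h' : c ≠ b) : twist a b (.of ℚ c) = 0 := by
  rw [twist, FreeLie.der_of, if_neg h, if_neg h']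

theorem twist_symm (a b : A) : twist a b = twist b a := by
  apply FreeLie.der_ext
  intro c
  by_cases h : c = a
  · rw [h, twist_left, twist_right]
  by_cases h' : c = b
  · rw [h', twist_left, twist_right]
  rw [twist_of_ne h h', twist_of_ne h' h]

theorem twist_disj {a b c d : A} (hac : a ≠ c) (had : a ≠ d) (hbc : b ≠ c) (hbd : b ≠ d) :
    ⁅twist a b, twist c d⁆ = 0 := by
  apply FreeLie.der_ext
  intro x
  rw [LieDerivation.lie_apply, LieDerivation.zero_apply]
  by_cases h1 : x = a
  · subst h1
    rw [twist_of_ne hac had, map_zero, twist_left, LieDerivation.apply_lie_eq_add,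
      twist_of_ne hac had, twist_of_ne hbc hbd, lie_zero, zero_lie, add_zero, sub_zero]
  by_cases h2 : x = b
  · subst h2
    rw [twist_of_ne hbc hbd, map_zero, twist_right, LieDerivation.apply_lie_eq_add,
      twist_of_ne hac had, twist_of_ne hbc hbd, lie_zero, zero_lie, add_zero, sub_zero]
  rw [twist_of_ne h1 h2, map_zero, sub_zero]
  by_cases h3 : x = c
  · subst h3
    rw [twist_left, LieDerivation.apply_lie_eq_add, twist_of_ne h1 h2,
      twist_of_ne had.symm hbd.symm, lie_zero, zero_lie, add_zero]
  by_cases h4 : x = d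
  · subst h4
    rw [twist_right, LieDerivation.apply_lie_eq_add, twist_of_ne h1 h2,
      twist_of_ne hac.symm hbc.symm, lie_zero, zero_lie, add_zero]
  rw [twist_of_ne h3 h4, map_zero]

theorem twist_three {a b c : A} (hab : a ≠ b) (hac : a ≠ c) (hbc : b ≠ c) :
    ⁅twist a c, twist a b + twist b c⁆ = 0 := by
  apply FreeLie.der_ext
  intro x
  simp only [LieDerivation.lie_apply, LieDerivation.zero_apply, LieDerivation.add_apply]
  by_cases h1 : x = a
  · subst h1
    simp only [twist_left, twist_of_ne hab hac, add_zero, LieDerivation.apply_lie_eq_add,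
      twist_of_ne hab.symm hbc, twist_right, twist_of_ne hac.symm hbc.symm, lie_zero, zero_lie,
      zero_add]
    rw [lie_lie (FreeLieAlgebra.of ℚ x) (FreeLieAlgebra.of ℚ c), ← lie_skew ⁅FreeLieAlgebra.of ℚ x, FreeLieAlgebra.of ℚ b⁆]
    abel
  by_cases h2 : x = c
  · subst h2
    simp only [twist_right, twist_of_ne hac.symm hbc.symm, zero_add, LieDerivation.apply_lie_eq_add,
      twist_of_ne hab.symm hbc, twist_left, twist_of_ne hab hac, lie_zero, zero_lie,
      add_zero]
    rw [lie_lie (FreeLieAlgebra.of ℚ x) (FreeLieAlgebra.of ℚ a), ← lie_skew ⁅FreeLieAlgebra.of ℚ x, FreeLieAlgebra.of ℚ b⁆]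
    abel
  rw [twist_of_ne h1 h2, map_zero, map_zero, add_zero, sub_zero]
  by_cases h3 : x = b
  · subst h3
    simp only [twist_left, twist_right, map_add, LieDerivation.apply_lie_eq_add,
      twist_of_ne hab.symm hbc, zero_lie]
    rw [← lie_skew (FreeLieAlgebra.of ℚ c), lie_neg]
    abel
  rw [twist_of_ne h1 h3, twist_of_ne h3 h2, add_zero, map_zero]

/-- The action of `t̃_A` on the free Lie algebra generated by the `t_{a*}`, where `*` is an
additional element. -/
noncomputable def act :
    DK A →ₗ⁅ℚ⁆ LieDerivation ℚ (FreeLieAlgebra ℚ A) (FreeLieAlgebra ℚ A) :=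
  liftGen twist (fun _ => 0) twist_symm (fun _ _ _ _ _ hac had hbc hbd _ => twist_disj hac had hbc hbd)
    (fun _ _ _ => twist_three) (fun _ _ _ _ => zero_lie _) (fun _ _ => zero_lie _)

theorem act_t {a b : A} (h : a ≠ b) : act (t a b) = twist a b := liftGen_t h

theorem act_s (a : A) : act (s a) = 0 := liftGen_s a

/-- Values on the `t_{xy}` of the morphism from `t̃` to the semidirect product. -/
noncomputable def splitT : Option A → Option A → LieAlgebra.SemiDirectSum (FreeLieAlgebra ℚ A) (DK A) act
  | some a, some b => ⟨0, t a b⟩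
  | some a, none => ⟨.of ℚ a, 0⟩
  | none, some b => ⟨.of ℚ b, 0⟩
  | none, none => 0

/-- Values on the `s_x` of the morphism from `t̃` to the semidirect product. -/
noncomputable def splitS : Option A → LieAlgebra.SemiDirectSum (FreeLieAlgebra ℚ A) (DK A) act
  | some a => ⟨0, s a⟩
  | none => 0

/-- The morphism from `t̃` on `A` and an additional element `*` to the semidirect product of `t̃_A`
and the free Lie algebra on `A`; it is an isomorphism modulo `s_*`. -/
noncomputable def split :
    DK (Option A) →ₗ⁅ℚ⁆ LieAlgebra.SemiDirectSum (FreeLieAlgebra ℚ A) (DK A) act :=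
  liftGen splitT splitS
    (by rintro (_ | a) (_ | b) <;> simp only [splitT, t_symm])
    (by
      rintro (_ | a) (_ | b) (_ | c) (_ | d) hab hac had hbc hbd hcd <;>
        simp only [ne_eq, not_true_eq_false, Option.some.injEq] at hab hac had hbc hbd hcd
      · simp [splitT, act_t hcd, twist_of_ne hbc hbd]
      · simp [splitT, act_t hcd, twist_of_ne hac had]
      · simp [splitT, act_t hab, twist_of_ne (Ne.symm had) (Ne.symm hbd)]
      · simp [splitT, act_t hab, twist_of_ne (Ne.symm hac) (Ne.symm hbc)]
      · simp [splitT, t_disj hac had hbc hbd])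
    (by
      rintro (_ | a) (_ | b) (_ | c) hab hac hbc <;>
        simp only [ne_eq, not_true_eq_false, Option.some.injEq] at hab hac hbc
      · simp [splitT, act_t hbc, twist_right]
      · simp only [splitT, LieAlgebra.SemiDirectSum.add_eq_mk, LieAlgebra.SemiDirectSum.lie_eq_mk]
        simp [act_t hac, twist_left, twist_right]
        rw [← lie_skew, neg_add_cancel]
      · simp [splitT, act_t hab, twist_left]
      · simp [splitT, t_three hab hac hbc])
    (by rintro (_ | a) (_ | b) (_ | c) h <;> simp [splitT, splitS, act_s, s_central])
    (by rintro (_ | a) (_ | b) <;> simp [splitS, s_central])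

end Action

end DK

/-! ### Adding an element to `A`: the extension of `t̃_A` -/

namespace DK

section Split

variable {A : Type u}

theorem split_t_none (a : A) : split (t (some a) none) = ⟨.of ℚ a, 0⟩ :=
  liftGen_t (Option.some_ne_none a)

theorem split_s_none : split (s (none : Option A)) = 0 := liftGen_s _

open Classical in
/-- The linear form on `t̃` that is `1` on `s_*` and `0` on the other generators. -/
noncomputable def coeffS : DK (Option A) →ₗ⁅ℚ⁆ Ab (ULift.{u} ℚ) :=
  liftGen (fun _ _ => 0) (fun x => ⟨⟨if x = none then 1 else 0⟩⟩) (fun _ _ => rfl)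
    (fun _ _ _ _ _ _ _ _ _ _ => rfl) (fun _ _ _ _ _ _ => rfl) (fun _ _ _ _ => rfl)
    (fun _ _ => rfl)

variable (A) in
/-- The kernel of the map from `t̃` on `A` and an additional element `*` to `t̃_A` that forgets `*`:
the free Lie algebra generated by the `t_{a*}`, times the line spanned by `s_*`. -/
abbrev Fiber : Type u := FreeLieAlgebra ℚ A × Ab ℚ

/-- The inclusion of the free Lie algebra generated by the `t_{a*}`. -/
noncomputable def freeIncl : FreeLieAlgebra ℚ A →ₗ⁅ℚ⁆ DK (Option A) :=
  FreeLieAlgebra.lift ℚ fun a => t (some a) none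

theorem freeIncl_of (a : A) : freeIncl (.of ℚ a) = t (some a) none :=
  FreeLieAlgebra.lift_of_apply _ _

/-- The inclusion of the kernel of the map forgetting `*`. -/
noncomputable def fiberIncl : Fiber A →ₗ⁅ℚ⁆ DK (Option A) where
  toFun m := freeIncl m.1 + m.2.val • s none
  map_add' m m' := by
    rw [Prod.fst_add, Prod.snd_add, map_add, Ab.val_add]; module
  map_smul' c m := by
    rw [Prod.smul_fst, Prod.smul_snd, map_smul, Ab.val_smul, RingHom.id_apply, smul_add, smul_eq_mul,
      mul_smul]
  map_lie' {m m'} := by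
    rw [LieAlgebra.Prod.bracket_apply]
    simp only [Ab.lie_eq_zero, Ab.val_zero, zero_smul, add_zero, LieHom.map_lie, lie_add, add_lie,
      smul_lie, lie_smul, s_central, lie_s, smul_zero]

theorem fiberIncl_apply (m : Fiber A) : fiberIncl m = freeIncl m.1 + m.2.val • s none := rfl

variable [Finite A]

variable (A) in
/-- The inclusion of `t̃_A`. -/
noncomputable abbrev baseIncl : DK A →ₗ⁅ℚ⁆ DK (Option A) := cable (id : Option A → Option A)

variable (A) in
/-- The map forgetting `*`. -/
noncomputable abbrev forget : DK (Option A) →ₗ⁅ℚ⁆ DK A := cable fun a : A => some (some a)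

theorem fiber_id (a : A) : fiber (id : Option A → Option A) a = {some a} := by
  ext x; simp [mem_fiber]

theorem baseIncl_t {a b : A} (h : a ≠ b) : baseIncl A (t a b) = t (some a) (some b) := by
  rw [cable_t _ h, fiber_id, fiber_id, Finset.sum_singleton, Finset.sum_singleton]

theorem baseIncl_s (a : A) : baseIncl A (s a) = s (some a) := by
  rw [cable_s, fiber_id, Finset.sum_singleton, Finset.sum_singleton, Finset.sum_singleton,
    t_self, smul_zero, add_zero]

theorem fiber_some_some_none : fiber (fun a : A => some (some a)) none = ∅ := by
  ext x; simp [mem_fiber]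

theorem forget_baseIncl (x : DK A) : forget A (baseIncl A x) = x := by
  rw [cable_bind]
  exact LieHom.congr_fun cable_some x

theorem forget_freeIncl (v : FreeLieAlgebra ℚ A) : forget A (freeIncl v) = 0 := by
  have : (forget A).comp freeIncl = 0 := by
    apply FreeLieAlgebra.hom_ext
    intro a
    rw [LieHom.comp_apply, freeIncl_of, cable_t _ (Option.some_ne_none a), fiber_some_some_none]
    simp
  exact LieHom.congr_fun this v

theorem forget_s_none : forget A (s none) = 0 := by
  rw [cable_s, fiber_some_some_none]; simp

theorem forget_fiberIncl (m : Fiber A) : forget A (fiberIncl m) = 0 := by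
  rw [fiberIncl_apply, map_add, map_smul, forget_freeIncl, forget_s_none, smul_zero, add_zero]

/-- The action `act` is the bracket of `t̃_A` with the `t_{a*}`. -/
theorem baseIncl_lie_freeIncl (x : DK A) (v : FreeLieAlgebra ℚ A) :
    ⁅baseIncl A x, freeIncl v⁆ = freeIncl (act x v) := by
  induction x using DK.induction generalizing v with
  | ht a b h =>
    rw [baseIncl_t h, act_t h]
    have hne : ∀ {a b : A}, a ≠ b → some a ≠ some b := fun h h' => h (Option.some_injective _ h')
    have key : ∀ {a b : A}, a ≠ b →
        ⁅t (some a) (some b), t (some a) none⁆ = ⁅t (some a) none, t (some b) none⁆ := by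
      intro a b h
      have := t_three (hne h) (Option.some_ne_none a) (Option.some_ne_none b)
      rw [← lie_skew, eq_neg_of_add_eq_zero_left this, neg_neg]
    induction v using FreeLie.induction with
    | hof c =>
      by_cases h1 : c = a
      · rw [h1, twist_left, LieHom.map_lie, freeIncl_of, freeIncl_of, key h]
      by_cases h2 : c = b
      · rw [h2, twist_right, LieHom.map_lie, freeIncl_of, freeIncl_of, t_symm, key h.symm]
      rw [twist_of_ne h1 h2, map_zero, freeIncl_of]
      exact t_disj (hne (Ne.symm h1)) (Option.some_ne_none a) (hne (Ne.symm h2))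
        (Option.some_ne_none b)
    | hadd u v hu hv => simp only [map_add, lie_add, hu, hv]
    | hsmul c u hu => simp only [map_smul, lie_smul, hu]
    | hlie u v hu hv =>
      rw [LieHom.map_lie, leibniz_lie, hu, hv, LieDerivation.apply_lie_eq_add, map_add,
        LieHom.map_lie, LieHom.map_lie, add_comm]
    | h0 => simp only [map_zero, lie_zero]
  | hs a => rw [baseIncl_s, act_s, s_central, LieDerivation.zero_apply, map_zero]
  | hadd x y hx hy => rw [map_add, map_add, add_lie, hx, hy, LieDerivation.add_apply, map_add]
  | hsmul c x hx => rw [map_smul, map_smul, smul_lie, hx, LieDerivation.smul_apply, map_smul]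
  | hlie x y hx hy =>
    rw [LieHom.map_lie, LieHom.map_lie, lie_lie, hy, hx, hx, hy, LieDerivation.lie_apply, map_sub]
  | h0 => simp only [map_zero, zero_lie, LieDerivation.zero_apply]

/-- The kernel of the map forgetting `*` is stable under brackets with `t̃_A`. -/
theorem baseIncl_lie_fiberIncl (x : DK A) :
    ∃ D : Fiber A →ₗ[ℚ] Fiber A, ∀ m, ⁅baseIncl A x, fiberIncl m⁆ = fiberIncl (D m) := by
  refine ⟨(LinearMap.inl ℚ _ _).comp ((act x : FreeLieAlgebra ℚ A →ₗ[ℚ] _).comp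
    (LinearMap.fst ℚ _ _)), fun m => ?_⟩
  rw [fiberIncl_apply, lie_add, lie_smul, lie_s, smul_zero, add_zero, baseIncl_lie_freeIncl,
    fiberIncl_apply]
  simp only [LinearMap.comp_apply, LinearMap.inl_apply, LinearMap.fst_apply, Ab.val_zero, zero_smul,
    add_zero]
  rfl

/-- The sum of `t̃_A` and the kernel of the map forgetting `*` is a subalgebra containing the
generators. -/
theorem exists_baseIncl_add (z : DK (Option A)) : ∃ x m, z = baseIncl A x + fiberIncl m := by
  induction z using DK.induction with
  | ht x y h =>
    have hf : ∀ a : A, t (some a) none = baseIncl A 0 + fiberIncl (.of ℚ a, 0) := fun a => by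
      rw [map_zero, zero_add, fiberIncl_apply, freeIncl_of, Ab.val_zero, zero_smul, add_zero]
    rcases x with _ | a <;> rcases y with _ | b
    · exact absurd rfl h
    · exact ⟨_, _, (t_symm _ _).trans (hf b)⟩
    · exact ⟨_, _, hf a⟩
    · refine ⟨t a b, 0, ?_⟩
      rw [map_zero, add_zero, baseIncl_t fun h' => h (congrArg some h')]
  | hs x =>
    rcases x with _ | a
    · refine ⟨0, (0, ⟨1⟩), ?_⟩
      rw [map_zero, zero_add, fiberIncl_apply, map_zero, zero_add, one_smul]
    · exact ⟨s a, 0, by rw [map_zero, add_zero, baseIncl_s]⟩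
  | hadd u v hu hv =>
    obtain ⟨x, m, rfl⟩ := hu
    obtain ⟨x', m', rfl⟩ := hv
    exact ⟨x + x', m + m', by rw [map_add, map_add]; abel⟩
  | hsmul c u hu =>
    obtain ⟨x, m, rfl⟩ := hu
    exact ⟨c • x, c • m, by rw [map_smul, map_smul, smul_add]⟩
  | hlie u v hu hv =>
    obtain ⟨x, m, rfl⟩ := hu
    obtain ⟨x', m', rfl⟩ := hv
    obtain ⟨D, hD⟩ := baseIncl_lie_fiberIncl x
    obtain ⟨D', hD'⟩ := baseIncl_lie_fiberIncl x'
    refine ⟨⁅x, x'⁆, D m' - D' m + ⁅m, m'⁆, ?_⟩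
    rw [lie_add, add_lie, add_lie, hD, ← lie_skew (fiberIncl m), hD', LieHom.map_lie, map_add,
      map_sub, LieHom.map_lie]
    abel
  | h0 => exact ⟨0, 0, by rw [map_zero, map_zero, add_zero]⟩

/-- As a vector space, `t̃` on `A` and an additional element `*` is the direct sum of `t̃_A` and the
kernel of the map forgetting `*`. For the injectivity, `forget`, `split` and `coeffS` recover the
three components. -/
theorem baseIncl_add_bijective :
    Function.Bijective fun p : DK A × Fiber A => baseIncl A p.1 + fiberIncl p.2 := by
  constructor
  · have hsub : Function.Injective ((baseIncl A : DK A →ₗ[ℚ] DK (Option A)).coprod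
        (fiberIncl (A := A) : Fiber A →ₗ[ℚ] DK (Option A))) := by
      rw [← LinearMap.ker_eq_bot, LinearMap.ker_eq_bot']
      rintro ⟨x, m⟩ h
      change baseIncl A x + fiberIncl m = 0 at h
      obtain rfl : x = 0 := by
        have := congrArg (forget A) h
        rwa [map_add, forget_baseIncl, forget_fiberIncl, add_zero, map_zero] at this
      rw [map_zero, zero_add] at h
      have h1 : ∀ v, split (freeIncl v) = (⟨v, 0⟩ : LieAlgebra.SemiDirectSum _ (DK A) act) := by
        intro v
        have : (split (A := A)).comp freeIncl = LieAlgebra.SemiDirectSum.inl act := by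
          apply FreeLieAlgebra.hom_ext
          intro a
          rw [LieHom.comp_apply, freeIncl_of, split_t_none, LieAlgebra.SemiDirectSum.inl_eq_mk]
        exact LieHom.congr_fun this v
      have h2 : ∀ v : FreeLieAlgebra ℚ A, coeffS (freeIncl v) = 0 := by
        intro v
        have : (coeffS (A := A)).comp freeIncl = 0 := by
          apply FreeLieAlgebra.hom_ext
          intro a
          rw [LieHom.comp_apply, freeIncl_of, coeffS, liftGen_t (Option.some_ne_none a)]
          rfl
        exact LieHom.congr_fun this v
      have h3 := congrArg split h
      rw [fiberIncl_apply, map_add, map_smul, split_s_none, smul_zero, add_zero, h1, map_zero] at h3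
      have h4 := congrArg coeffS h
      rw [fiberIncl_apply, map_add, map_smul, h2, zero_add, map_zero, coeffS, liftGen_s,
        if_pos rfl] at h4
      have h5 : m.1 = 0 := congrArg LieAlgebra.SemiDirectSum.left h3
      have h6 : m.2.val * 1 = 0 := congrArg (fun x => x.val.down) h4
      rw [mul_one] at h6
      exact Prod.ext rfl (Prod.ext h5 (Ab.ext h6))
    exact hsub
  · intro z
    obtain ⟨x, m, rfl⟩ := exists_baseIncl_add z
    exact ⟨(x, m), rfl⟩

end Split

end DK

/-! ### Adding an element to `A`: the homology of `t̃` -/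

theorem CE.wmap_wmap {L M N : Type u} [LieRing L] [LieAlgebra ℚ L] [LieRing M] [LieAlgebra ℚ M]
    [LieRing N] [LieAlgebra ℚ N] (g : M →ₗ⁅ℚ⁆ N) (f : L →ₗ⁅ℚ⁆ M) (w : ExteriorAlgebra ℚ L) :
    wmap g (wmap f w) = wmap (g.comp f) w := by
  rw [← AlgHom.comp_apply, ExteriorAlgebra.map_comp_map]; rfl

theorem CE.wmap_id {L : Type u} [LieRing L] [LieAlgebra ℚ L] (w : ExteriorAlgebra ℚ L) :
    wmap (LieHom.id : L →ₗ⁅ℚ⁆ L) w = w :=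
  AlgHom.congr_fun ExteriorAlgebra.map_id w

namespace DK

section FiberHomology

variable {A : Type u}

/-- The homology classes of the free Lie algebra on `A`: the constant `1` and the generators. -/
noncomputable def freeClass (o : Option A) : ExteriorAlgebra ℚ (FreeLieAlgebra ℚ A) :=
  o.elim 1 fun a => ι ℚ (.of ℚ a)

/-- The generator `s_*`. -/
noncomputable def fiberS : Fiber A := (0, ⟨1⟩)

/-- The homology classes of the free Lie algebra on `A` times a line. -/
noncomputable def fiberClass (p : Option A × Bool) : ExteriorAlgebra ℚ (Fiber A) :=
  CE.wmap (LieHom.inl ℚ (FreeLieAlgebra ℚ A) (Ab ℚ)) (freeClass p.1) *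
    if p.2 then ι ℚ fiberS else 1

theorem exists_fiber_decomposition (z : ExteriorAlgebra ℚ (Fiber A)) :
    ∃ a b, z = CE.wmap (LieHom.inl ℚ (FreeLieAlgebra ℚ A) (Ab ℚ)) a +
      CE.wmap (LieHom.inl ℚ (FreeLieAlgebra ℚ A) (Ab ℚ)) b * ι ℚ fiberS := by
  obtain ⟨a, b, h⟩ := CE.exists_line_decomposition
    (LieHom.inl ℚ (FreeLieAlgebra ℚ A) (Ab ℚ) : _ →ₗ[ℚ] Fiber A) fiberS
    (fun v => ⟨v.1, v.2.val, Prod.ext (by simp [fiberS])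
      (Ab.ext (by simp [fiberS, Ab.val_smul]))⟩) z
  exact ⟨a, CE.invol b, by rw [h, ← CE.ι_mul_map_comm]⟩

theorem fiber_decomposition_unique {a b : ExteriorAlgebra ℚ (FreeLieAlgebra ℚ A)}
    (h : CE.wmap (LieHom.inl ℚ (FreeLieAlgebra ℚ A) (Ab ℚ)) a +
      CE.wmap (LieHom.inl ℚ (FreeLieAlgebra ℚ A) (Ab ℚ)) b * ι ℚ fiberS = 0) : a = 0 ∧ b = 0 := by
  let ξ : Fiber A →ₗ[ℚ] ℚ :=
    { toFun := fun v => v.2.val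
      map_add' := fun v w => rfl
      map_smul' := fun c v => rfl }
  rw [← CE.invol_invol b, ← CE.ι_mul_map_comm] at h
  obtain ⟨ha, hb⟩ := CE.line_decomposition_unique _ fiberS (LinearMap.fst ℚ _ _) ξ
    (fun _ => rfl) rfl (fun _ => rfl) rfl h
  exact ⟨ha, by rw [← CE.invol_invol b, hb, map_zero]⟩

theorem fiberS_central (v : Fiber A) : ⁅v, (fiberS : Fiber A)⁆ = 0 := by
  rw [LieAlgebra.Prod.bracket_apply, fiberS, lie_zero]; rfl

theorem d_fiber (a b : ExteriorAlgebra ℚ (FreeLieAlgebra ℚ A)) :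
    CE.d _ (CE.wmap (LieHom.inl ℚ (FreeLieAlgebra ℚ A) (Ab ℚ)) a +
      CE.wmap (LieHom.inl ℚ (FreeLieAlgebra ℚ A) (Ab ℚ)) b * ι ℚ fiberS) =
    CE.wmap (LieHom.inl ℚ (FreeLieAlgebra ℚ A) (Ab ℚ)) (CE.d _ a) +
      CE.wmap (LieHom.inl ℚ (FreeLieAlgebra ℚ A) (Ab ℚ)) (CE.d _ b) * ι ℚ fiberS := by
  rw [map_add, ← CE.map_d, CE.d_map_mul_ι _ _ fun m => fiberS_central _]

theorem d_freeClass (o : Option A) : CE.d _ (freeClass o) = 0 := by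
  rcases o with _ | a
  · exact CE.d_one
  · exact CE.d_ι _

variable [Fintype A]

theorem sum_freeClass (e : Option A → ℚ) : ∑ o, e o • freeClass o =
    algebraMap ℚ _ (e none) + ι ℚ (∑ a, e (some a) • FreeLieAlgebra.of ℚ a) := by
  rw [Fintype.sum_option, map_sum, Algebra.algebraMap_eq_smul_one]
  simp only [map_smul]; rfl

theorem exists_freeClass {z : ExteriorAlgebra ℚ (FreeLieAlgebra ℚ A)} (hz : CE.d _ z = 0) :
    ∃ (e : Option A → ℚ) (y : _), z = ∑ o, e o • freeClass o + CE.d _ y := by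
  obtain ⟨c, v, y, hv, rfl⟩ := FreeLie.exists_of_cycle hz
  obtain ⟨r, rfl⟩ := (Submodule.mem_span_range_iff_exists_fun ℚ).mp hv
  exact ⟨fun o => o.elim c r, y, by rw [sum_freeClass]; rfl⟩

theorem freeClass_injective (e : Option A → ℚ) (y : ExteriorAlgebra ℚ (FreeLieAlgebra ℚ A))
    (h : ∑ o, e o • freeClass o = CE.d _ y) : e = 0 := by
  classical
  rw [sum_freeClass] at h
  let χ : FreeLieAlgebra ℚ A →ₗ⁅ℚ⁆ Ab (A → ℚ) :=
    FreeLieAlgebra.lift ℚ fun a => ⟨Pi.single a 1⟩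
  have hχ : ∀ a, χ (.of ℚ a) = ⟨Pi.single a 1⟩ := FreeLieAlgebra.lift_of_apply _
  obtain ⟨h0, h1⟩ := FreeLie.low_degree_of_boundary Ab.lie_eq_zero χ h
  funext o
  rcases o with _ | a
  · exact h0
  · let ev : Ab (A → ℚ) →ₗ[ℚ] ℚ :=
      { toFun := fun v => v.val a
        map_add' := fun v w => rfl
        map_smul' := fun c v => rfl }
    have h2 := congrArg ev h1
    simp only [map_sum, map_smul, hχ, map_zero] at h2
    have h3 : ∀ b, ev ⟨Pi.single b 1⟩ = if a = b then 1 else 0 := fun b => by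
      change (Pi.single b (1 : ℚ) : A → ℚ) a = _
      rw [Pi.single_apply]
    simpa [h3] using h2

theorem sum_fiberClass (e : Option A × Bool → ℚ) : ∑ p, e p • fiberClass p =
    CE.wmap (LieHom.inl ℚ (FreeLieAlgebra ℚ A) (Ab ℚ)) (∑ o, e (o, false) • freeClass o) +
      CE.wmap (LieHom.inl ℚ (FreeLieAlgebra ℚ A) (Ab ℚ)) (∑ o, e (o, true) • freeClass o) *
        ι ℚ fiberS := by
  simp only [Fintype.sum_prod_type, Fintype.sum_bool, Finset.sum_add_distrib, fiberClass,
    map_sum, map_smul, Finset.sum_mul, if_true, mul_one, smul_mul_assoc, Bool.false_eq_true,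
    if_false]
  rw [add_comm]

theorem d_sum_fiberClass (e : Option A × Bool → ℚ) : CE.d _ (∑ p, e p • fiberClass p) = 0 := by
  rw [sum_fiberClass, d_fiber]
  simp only [map_sum, map_smul, d_freeClass, smul_zero, Finset.sum_const_zero]
  rw [map_zero, zero_mul, add_zero]

theorem exists_fiberClass {z : ExteriorAlgebra ℚ (Fiber A)} (hz : CE.d _ z = 0) :
    ∃ (e : Option A × Bool → ℚ) (y : _), z = ∑ p, e p • fiberClass p + CE.d _ y := by
  obtain ⟨a, b, rfl⟩ := exists_fiber_decomposition z
  rw [d_fiber] at hz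
  obtain ⟨ha, hb⟩ := fiber_decomposition_unique hz
  obtain ⟨e, y, rfl⟩ := exists_freeClass ha
  obtain ⟨e', y', rfl⟩ := exists_freeClass hb
  refine ⟨fun p => if p.2 then e' p.1 else e p.1,
    CE.wmap (LieHom.inl ℚ (FreeLieAlgebra ℚ A) (Ab ℚ)) y +
      CE.wmap (LieHom.inl ℚ (FreeLieAlgebra ℚ A) (Ab ℚ)) y' * ι ℚ fiberS, ?_⟩
  rw [d_fiber, sum_fiberClass, map_add, map_add, add_mul]
  simp only [if_true, Bool.false_eq_true, if_false]
  abel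

theorem fiberClass_injective (e : Option A × Bool → ℚ) (y : ExteriorAlgebra ℚ (Fiber A))
    (h : ∑ p, e p • fiberClass p = CE.d _ y) : e = 0 := by
  obtain ⟨a, b, rfl⟩ := exists_fiber_decomposition y
  rw [d_fiber, sum_fiberClass, ← sub_eq_zero, add_sub_add_comm, ← sub_mul, ← map_sub,
    ← map_sub] at h
  obtain ⟨ha, hb⟩ := fiber_decomposition_unique h
  have h1 := freeClass_injective (fun o => e (o, false)) a (sub_eq_zero.mp ha)
  have h2 := freeClass_injective (fun o => e (o, true)) b (sub_eq_zero.mp hb)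
  funext ⟨o, b⟩
  cases b
  · exact congrFun h1 o
  · exact congrFun h2 o

end FiberHomology

section Doubling

variable {A : Type u}

/-- The partial map `A ∪ {*} → A` that is the identity on `A` and sends `*` to `o`. -/
def attach (o x : Option A) : Option A := x <|> o

/-- The element `t_{a*}` if `o = a`, and `1` if `o` is empty. -/
noncomputable def tStar (o : Option A) : ExteriorAlgebra ℚ (DK (Option A)) :=
  o.elim 1 fun a => ι ℚ (t (some a) none)

/-- Either `1` or the element `s_*`. -/
noncomputable def sStar (b : Bool) : ExteriorAlgebra ℚ (DK (Option A)) :=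
  if b then ι ℚ (s none) else 1

variable [Finite A]

/-- The maps `w ↦ cable w · c` from `⋀ t̃_A` to `⋀ t̃_{A ∪ {*}}` where `c` is one of
`1, t_{a*}, s_*, t_{a*} s_*`, and where the cabling omits `*` in the first case and third case, and
doubles `a` in the others. -/
noncomputable def double (p : Option A × Bool) :
    ExteriorAlgebra ℚ (DK A) →ₗ[ℚ] ExteriorAlgebra ℚ (DK (Option A)) :=
  (LinearMap.mulRight ℚ (sStar p.2)).comp ((LinearMap.mulRight ℚ (tStar p.1)).comp
    (wcable (attach p.1)).toLinearMap)

theorem double_apply (p : Option A × Bool) (w : ExteriorAlgebra ℚ (DK A)) :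
    double p w = wcable (attach p.1) w * tStar p.1 * sStar p.2 := rfl

/-- If `*` doubles `a`, all values of the cabling commute with `t_{a*}`, because it is interior to the
cable. -/
theorem cable_attach_lie (a : A) (x : DK A) :
    ⁅cable (attach (some a)) x, t (some a) none⁆ = 0 := by
  have h1 : some a ∈ fiber (attach (some a)) a := mem_fiber.mpr rfl
  have h2 : none ∈ fiber (attach (some a)) a := mem_fiber.mpr rfl
  rw [← lie_skew, centralizes (cable (attach (some a))) (t (some a) none), neg_zero]
  · intro b c h
    rw [cable_t _ h]
    exact t_cableT _ h1 h2 h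
  · intro b
    rw [cable_s]
    exact t_cableS _ h1 h2 b

theorem d_double (p : Option A × Bool) (w : ExteriorAlgebra ℚ (DK A)) :
    CE.d _ (double p w) = double p (CE.d _ w) := by
  have h1 : CE.d _ (wcable (attach p.1) w * tStar p.1) =
      wcable (attach p.1) (CE.d _ w) * tStar p.1 := by
    obtain ⟨_ | a, b⟩ := p
    · simp only [tStar, Option.elim_none, mul_one]
      exact (CE.map_d _ _).symm
    · exact CE.d_map_mul_ι _ _ (cable_attach_lie a) w
  rw [double_apply, double_apply, ← h1]
  obtain ⟨o, _ | _⟩ := p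
  · simp only [sStar, Bool.false_eq_true, if_false, mul_one]
  · have := CE.d_map_mul_ι (LieHom.id : DK (Option A) →ₗ⁅ℚ⁆ _) (s none)
      (fun m => lie_s m none) (wcable (attach o) w * tStar o)
    rw [CE.wmap_id, CE.wmap_id] at this
    exact this

theorem forget_cable_attach (o : Option A) (x : DK A) : forget A (cable (attach o) x) = x := by
  rw [cable_bind]
  exact LieHom.congr_fun cable_some x

/-- The cabling maps are sections of the map forgetting `*`, so that they differ from `baseIncl` by
elements of its kernel. -/
theorem exists_double_ι_mul (p : Option A × Bool) (x : DK A) : ∃ m : Fiber A, ∀ w,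
    double p (ι ℚ x * w) = ι ℚ (baseIncl A x + fiberIncl m) * double p w := by
  obtain ⟨x', m, h⟩ := exists_baseIncl_add (cable (attach p.1) x)
  have hx : x' = x := by
    have := congrArg (forget A) h
    rwa [forget_cable_attach, map_add, forget_baseIncl, forget_fiberIncl, add_zero, eq_comm] at this
  subst hx
  refine ⟨m, fun w => ?_⟩
  rw [double_apply, double_apply, map_mul, ExteriorAlgebra.map_apply_ι, ← h, mul_assoc, mul_assoc,
    mul_assoc]
  rfl

theorem double_one (p : Option A × Bool) : double p 1 = CE.wmap fiberIncl (fiberClass p) := by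
  have h1 : CE.wmap fiberIncl (CE.wmap (LieHom.inl ℚ (FreeLieAlgebra ℚ A) (Ab ℚ))
      (freeClass p.1)) = tStar p.1 := by
    rw [CE.wmap_wmap]
    obtain ⟨_ | a, b⟩ := p
    · exact map_one _
    · refine (ExteriorAlgebra.map_apply_ι _ _).trans (congrArg (ι ℚ) ?_)
      change fiberIncl (.of ℚ a, 0) = _
      rw [fiberIncl_apply, Ab.val_zero, zero_smul, add_zero, freeIncl_of]
  have h2 : CE.wmap fiberIncl (if p.2 then ι ℚ fiberS else 1 : ExteriorAlgebra ℚ (Fiber A)) =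
      sStar p.2 := by
    obtain ⟨o, _ | _⟩ := p
    · exact map_one _
    · refine (ExteriorAlgebra.map_apply_ι _ _).trans (congrArg (ι ℚ) ?_)
      change fiberIncl fiberS = _
      rw [fiberIncl_apply, fiberS, map_zero, zero_add, one_smul]
  rw [double_apply, map_one, one_mul, fiberClass, map_mul, h1, h2]

open CE in
/-- Up to terms of lower degree in `⋀ t̃_A`, the map `double p` is the multiplication by the homology
class `fiberClass p` of the kernel of the map forgetting `*`. -/
theorem double_sub_mem (p : Option A × Bool) {k : ℕ} {w : ExteriorAlgebra ℚ (DK A)}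
    (hw : w ∈ ⋀[ℚ]^k (DK A)) :
    double p w - wedge (baseIncl A) fiberIncl (w ⊗ₜ fiberClass p) ∈
      (filt (DK A) (ExteriorAlgebra ℚ (Fiber A)) k).map (wedge (baseIncl A) fiberIncl) := by
  refine gr_induction (P := fun k w => double p w -
    wedge (baseIncl A) fiberIncl (w ⊗ₜ fiberClass p) ∈
      (filt (DK A) (ExteriorAlgebra ℚ (Fiber A)) k).map (wedge (baseIncl A) fiberIncl))
    (fun r => ?_) (fun k w w' h h' => ?_) (fun k x w hw h => ?_) k w hw
  · rw [Algebra.algebraMap_eq_smul_one, map_smul, double_one, wedge_tmul, map_smul, map_one,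
      smul_mul_assoc, one_mul, sub_self]
    exact zero_mem _
  · rw [map_add, TensorProduct.add_tmul, map_add, add_sub_add_comm]
    exact add_mem h h'
  · obtain ⟨m, hm⟩ := exists_double_ι_mul p x
    have h1 : double p (ι ℚ x * w) - wedge (baseIncl A) fiberIncl ((ι ℚ x * w) ⊗ₜ fiberClass p) =
        ι ℚ (baseIncl A x) * (double p w - wedge (baseIncl A) fiberIncl (w ⊗ₜ fiberClass p)) +
        (ι ℚ (fiberIncl m) * (double p w - wedge (baseIncl A) fiberIncl (w ⊗ₜ fiberClass p)) +
          ι ℚ (fiberIncl m) * wedge (baseIncl A) fiberIncl (w ⊗ₜ fiberClass p)) := by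
      rw [hm, map_add, wedge_tmul, wedge_tmul, map_mul, ExteriorAlgebra.map_apply_ι, mul_assoc,
        LieHom.coe_toLinearMap]
      noncomm_ring
    rw [h1]
    refine add_mem (ι_mul_wedge_mem x h) (add_mem ?_ (ι_mul_wedge_mem' m
      ⟨_, tmul_mem_filt (Nat.lt_succ_self k) hw _, rfl⟩))
    exact Submodule.map_mono (filt_mono (Nat.le_succ k)) (ι_mul_wedge_mem' m h)

end Doubling

section Total

variable {A : Type u} [Fintype A]

/-- The cycles of `⋀ t̃` on `A` and an additional element are, up to boundaries, the images of cycles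
of `⋀ t̃_A` under the maps `double`, and these cycles are unique up to boundaries. -/
theorem double_quasiIso :
    (∀ z : ExteriorAlgebra ℚ (DK (Option A)), CE.d _ z = 0 →
      ∃ (w : Option A × Bool → ExteriorAlgebra ℚ (DK A)) (y : _),
        (∀ p, CE.d _ (w p) = 0) ∧ z = ∑ p, double p (w p) + CE.d _ y) ∧
    ∀ (w : Option A × Bool → ExteriorAlgebra ℚ (DK A)) (y : ExteriorAlgebra ℚ (DK (Option A))),
      (∀ p, CE.d _ (w p) = 0) → ∑ p, double p (w p) = CE.d _ y →
        ∀ p, ∃ u, w p = CE.d _ u := by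
  classical
  -- `τ` regards `⋀ t̃_A ⊗ E`, with `E` the space of the homology classes of the kernel, as a power
  -- of `⋀ t̃_A`
  let τ := TensorProduct.piScalarRight ℚ ℚ (ExteriorAlgebra ℚ (DK A)) (Option A × Bool)
  have hτ : ∀ w e p, τ (w ⊗ₜ e) p = e p • w := fun w e p => by
    rw [TensorProduct.piScalarRight_apply, TensorProduct.piScalarRightHom_tmul]
  have hτd : ∀ t p, τ (TensorProduct.map (CE.d (DK A)) LinearMap.id t) p = CE.d _ (τ t p) := by
    intro t p
    induction t using TensorProduct.induction_on with
    | zero => simp only [map_zero, Pi.zero_apply]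
    | add s t hs ht => simp only [map_add, Pi.add_apply, hs, ht]
    | tmul w e => rw [TensorProduct.map_tmul, hτ, hτ, map_smul, LinearMap.id_apply]
  let K : ExteriorAlgebra ℚ (DK A) ⊗[ℚ] (Option A × Bool → ℚ) →ₗ[ℚ]
      ExteriorAlgebra ℚ (DK (Option A)) :=
    (∑ p, (double p).comp (LinearMap.proj p)).comp τ.toLinearMap
  have hK : ∀ t, K t = ∑ p, double p (τ t p) := fun t => by
    rw [LinearMap.comp_apply, LinearMap.sum_apply]; rfl
  have hKt : ∀ w e, K (w ⊗ₜ e) = ∑ p, e p • double p w := fun w e => by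
    rw [hK]; exact Finset.sum_congr rfl fun p _ => by rw [hτ, map_smul]
  have hf : ∀ e : Option A × Bool → ℚ, Fintype.linearCombination ℚ fiberClass e =
    ∑ p, e p • fiberClass p := fun e => Fintype.linearCombination_apply ℚ fiberClass e
  obtain ⟨h1, h2⟩ := CE.quasiIso_of_fiber (baseIncl_add_bijective (A := A)) baseIncl_lie_fiberIncl
    (Fintype.linearCombination ℚ fiberClass) (fun e => by rw [hf, d_sum_fiberClass])
    (fun v hv => by
      obtain ⟨e, y, h⟩ := exists_fiberClass hv
      exact ⟨e, y, by rw [hf]; exact h⟩)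
    (fun e y h => fiberClass_injective e y (by rw [← hf]; exact h)) K
    (fun w e => by
      rw [hKt, hKt, map_sum]
      exact Finset.sum_congr rfl fun p _ => by rw [map_smul, d_double])
    (fun k w hw e => by
      rw [hKt, hf, TensorProduct.tmul_sum, map_sum, ← Finset.sum_sub_distrib]
      refine sum_mem fun p _ => ?_
      rw [TensorProduct.tmul_smul, map_smul, ← smul_sub]
      exact Submodule.smul_mem _ _ (double_sub_mem p hw))
  constructor
  · intro z hz
    obtain ⟨t, y, ht, rfl⟩ := h1 z hz
    exact ⟨τ t, y, fun p => by rw [← hτd, ht, map_zero, Pi.zero_apply], by rw [hK]⟩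
  · intro w y hw h p
    obtain ⟨u, hu⟩ := h2 (τ.symm w) y
      (τ.injective (funext fun p => by rw [hτd, τ.apply_symm_apply, hw, map_zero, Pi.zero_apply]))
      (by rw [hK, τ.apply_symm_apply, h])
    exact ⟨τ u p, by rw [← hτd, ← hu, τ.apply_symm_apply]⟩

end Total

end DK

/-! ### The map `φ` -/

namespace DK

variable {A C : Type u}

/-- `∑ t_{ab}` over `a ∈ m` and `b ∈ m'`, with multiplicities. -/
noncomputable def pairSum (m m' : Multiset A) : DK A :=
  (m.map fun a => (m'.map fun b => t a b).sum).sum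

/-- `∑ s_a + ∑ t_{ab}` over the elements and the two-element subsets of `m`. -/
noncomputable def selfSum (m : Multiset A) : DK A :=
  -- `pairSum m m` counts each two-element subset twice; here `t_{aa} = 0`
  (m.map s).sum + (2⁻¹ : ℚ) • pairSum m m

theorem pairSum_add_left (m₁ m₂ m : Multiset A) :
    pairSum (m₁ + m₂) m = pairSum m₁ m + pairSum m₂ m := by
  simp only [pairSum, Multiset.map_add, Multiset.sum_add]

theorem pairSum_add_right (m m₁ m₂ : Multiset A) :
    pairSum m (m₁ + m₂) = pairSum m m₁ + pairSum m m₂ := by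
  simp only [pairSum, Multiset.map_add, Multiset.sum_add, Multiset.sum_map_add]

theorem pairSum_zero_left (m : Multiset A) : pairSum 0 m = 0 := by
  simp [pairSum]

theorem pairSum_zero_right (m : Multiset A) : pairSum m 0 = 0 := by
  simp [pairSum]

theorem pairSum_symm (m m' : Multiset A) : pairSum m m' = pairSum m' m := by
  rw [pairSum, Multiset.sum_map_sum_map]
  simp only [pairSum, fun a b : A => t_symm a b]

theorem pairSum_singleton (a b : A) : pairSum {a} {b} = t a b := by
  simp [pairSum]

theorem selfSum_singleton (a : A) : selfSum {a} = s a := by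
  simp [selfSum, pairSum_singleton, t_self]

theorem selfSum_add (m m' : Multiset A) :
    selfSum (m + m') = selfSum m + selfSum m' + pairSum m m' := by
  simp only [selfSum, pairSum_add_left, pairSum_add_right, Multiset.map_add, Multiset.sum_add,
    pairSum_symm m' m]
  module

theorem pairSum_induction {P : DK A → Prop} (h0 : P 0) (ha : ∀ x y, P x → P y → P (x + y))
    {m m' : Multiset A} (h : ∀ a ∈ m, ∀ b ∈ m', P (t a b)) : P (pairSum m m') := by
  refine Multiset.sum_induction P _ ha h0 fun x hx => ?_
  obtain ⟨a, hm, rfl⟩ := Multiset.mem_map.mp hx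
  refine Multiset.sum_induction P _ ha h0 fun x hx => ?_
  obtain ⟨b, hm', rfl⟩ := Multiset.mem_map.mp hx
  exact h a hm b hm'

theorem lie_selfSum_eq (x : DK A) (m : Multiset A) :
    ⁅x, selfSum m⁆ = (2⁻¹ : ℚ) • ⁅x, pairSum m m⁆ := by
  have : ⁅x, (m.map s).sum⁆ = 0 := by
    refine Multiset.sum_induction (fun y => ⁅x, y⁆ = 0) _ (fun y z hy hz => ?_) (lie_zero x)
      fun y hy => ?_
    · rw [lie_add, hy, hz, add_zero]
    · obtain ⟨a, _, rfl⟩ := Multiset.mem_map.mp hy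
      exact lie_s x a
  rw [selfSum, lie_add, this, zero_add, lie_smul]

/-- The preimage of a multiset under a partially defined map. -/
noncomputable def pull [Finite C] (f : C → Option A) (m : Multiset A) : Multiset C :=
  m.bind fun a => (fiber f a).val

theorem pull_add [Finite C] (f : C → Option A) (m m' : Multiset A) :
    pull f (m + m') = pull f m + pull f m' := Multiset.add_bind _ _ _

theorem pull_singleton [Finite C] (f : C → Option A) (a : A) : pull f {a} = (fiber f a).val :=
  Multiset.singleton_bind _ _

theorem pull_zero [Finite C] (f : C → Option A) : pull f 0 = 0 := Multiset.zero_bind _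

theorem pairSum_fiber [Finite C] (f : C → Option A) (a b : A) :
    pairSum (fiber f a).val (fiber f b).val = ∑ x ∈ fiber f a, ∑ y ∈ fiber f b, t x y := rfl

theorem cable_pairSum [Finite C] (f : C → Option A) {m m' : Multiset A} (h : Disjoint m m') :
    cable f (pairSum m m') = pairSum (pull f m) (pull f m') := by
  induction m using Multiset.induction with
  | empty => rw [pairSum_zero_left, map_zero, pull_zero, pairSum_zero_left]
  | cons a m ih =>
    rw [← Multiset.singleton_add, pairSum_add_left, map_add,
      ih (h.mono_left (Multiset.le_cons_self m a)), pull_add, pairSum_add_left]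
    congr 1
    have ha : a ∉ m' := Multiset.disjoint_left.mp h (Multiset.mem_cons_self a m)
    clear ih h
    induction m' using Multiset.induction with
    | empty => rw [pairSum_zero_right, map_zero, pull_zero, pairSum_zero_right]
    | cons b m' ih =>
      rw [Multiset.mem_cons, not_or] at ha
      rw [← Multiset.singleton_add, pairSum_add_right, map_add, ih ha.2, pull_add,
        pairSum_add_right, pairSum_singleton, cable_t f ha.1, pull_singleton, pull_singleton,
        pairSum_fiber]

theorem cable_selfSum [Finite C] (f : C → Option A) {m : Multiset A} (h : m.Nodup) :
    cable f (selfSum m) = selfSum (pull f m) := by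
  induction m using Multiset.induction with
  | empty => simp [pull_zero, selfSum, pairSum_zero_left]
  | cons a m ih =>
    rw [Multiset.nodup_cons] at h
    rw [← Multiset.singleton_add, selfSum_add, map_add, map_add, ih h.2, selfSum_singleton, cable_s,
      cable_pairSum f (Multiset.singleton_disjoint.mpr h.1), pull_add, selfSum_add, pull_singleton]
    rfl

/-- The element `∑ t_{xy}` over `x ∈ m`, `y ∈ m'` commutes with the `t_{ab}` for `a, b ∈ m`. -/
theorem lie_pairSum_pair {m m' : Multiset A} (hm : m.Nodup) (h : Disjoint m m') {a b : A}
    (ha : a ∈ m) (hb : b ∈ m) : ⁅t a b, pairSum m m'⁆ = 0 := by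
  by_cases hab : a = b
  · rw [hab, t_self, zero_lie]
  rw [pairSum_symm]
  refine Multiset.sum_induction (fun y => ⁅t a b, y⁆ = 0) _
    (fun y z hy hz => by rw [lie_add, hy, hz, add_zero]) (lie_zero _) fun y hy => ?_
  obtain ⟨w, hw, rfl⟩ := Multiset.mem_map.mp hy
  have := t_pair_sum (X := ⟨m, hm⟩) ha hb hab
    (w := w) (fun e => Multiset.disjoint_left.mp h ha (e ▸ hw))
    (fun e => Multiset.disjoint_left.mp h hb (e ▸ hw))
  rw [← lie_sum] at this
  simp only [t_symm w]
  exact this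

/-- The element `∑ t_{xy}` over the pairs in `m` commutes with the `t_{ab}` for `a, b ∈ m`. -/
theorem lie_selfSum {m : Multiset A} (hm : m.Nodup) {a b : A}
    (ha : a ∈ m) (hb : b ∈ m) : ⁅t a b, selfSum m⁆ = 0 := by
  by_cases hab : a = b
  · rw [hab, t_self, zero_lie]
  rw [lie_selfSum_eq]
  have := t_total_sum (X := ⟨m, hm⟩) ha hb hab
  rw [← lie_sum_sum] at this
  exact (congrArg _ this).trans (smul_zero _)

end DK

namespace FreeBV

open BVExpr DK

variable {un : Bool} {A C : Type u}

/-- The part of the free BV algebra spanned by the expressions with a given multiset of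
variables. -/
noncomputable def wt (un : Bool) (m : Multiset A) : Submodule ℚ (FreeBV un A) :=
  Submodule.span ℚ (mk '' {t | vars t = m})

theorem mk_mem_wt (t : BVExpr un A) : mk t ∈ wt un (vars t) := Submodule.subset_span ⟨t, rfl, rfl⟩

/-- The relations of BV algebras are homogeneous for the multiset of variables. -/
theorem rel_homogeneous_vars {r : BVExpr un A →₀ ℚ} (h : BVRel r) :
    ∃ m, r ∈ Finsupp.supported ℚ ℚ {t : BVExpr un A | vars t = m} := by
  have hs : ∀ {n : Multiset A} (t : BVExpr un A), vars t = n →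
      Finsupp.single t (1 : ℚ) ∈ Finsupp.supported ℚ ℚ {t : BVExpr un A | vars t = n} :=
    fun t ht => Finsupp.single_mem_supported ℚ 1 ht
  have hm : ∀ {n m : Multiset A} {r : BVExpr un A →₀ ℚ} (g : BVExpr un A → BVExpr un A),
      (∀ t, vars t = n → vars (g t) = m) →
      r ∈ Finsupp.supported ℚ ℚ {t : BVExpr un A | vars t = n} →
      Finsupp.lmapDomain ℚ ℚ g r ∈ Finsupp.supported ℚ ℚ {t : BVExpr un A | vars t = m} := by
    classical
    intro n m r g hg hr t ht
    obtain ⟨s, hs, rfl⟩ := Finset.mem_image.mp (Finsupp.mapDomain_support ht)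
    exact hg s (hr hs)
  induction h with
  | one_mul h x => exact ⟨vars x, sub_mem (hs _ (by simp only [vars, zero_add])) (hs _ rfl)⟩
  | mul_comm x y =>
    exact ⟨vars x + vars y, sub_mem (hs _ rfl)
      (Submodule.smul_mem _ _ (hs _ (add_comm _ _)))⟩
  | mul_assoc x y z =>
    exact ⟨vars x + vars y + vars z, sub_mem (hs _ rfl) (hs _ (add_assoc _ _ _).symm)⟩
  | br_skew x y =>
    exact ⟨vars x + vars y, add_mem (hs _ rfl)
      (Submodule.smul_mem _ _ (hs _ (add_comm _ _)))⟩
  | jacobi x y z =>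
    exact ⟨vars x + vars y + vars z, sub_mem (sub_mem (hs _ (add_assoc _ _ _).symm) (hs _ rfl))
      (Submodule.smul_mem _ _ (hs _ ((add_left_comm _ _ _).trans (add_assoc _ _ _).symm)))⟩
  | leibniz x y z =>
    exact ⟨vars x + vars y + vars z, sub_mem (sub_mem (hs _ (add_assoc _ _ _).symm) (hs _ rfl))
      (Submodule.smul_mem _ _ (hs _ ((add_left_comm _ _ _).trans (add_assoc _ _ _).symm)))⟩
  | del_del x => exact ⟨_, hs _ rfl⟩
  | br_eq x y =>
    exact ⟨vars x + vars y, add_mem (add_mem (sub_mem (hs _ rfl)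
      (Submodule.smul_mem _ _ (hs _ rfl))) (Submodule.smul_mem _ _ (hs _ rfl))) (hs _ rfl)⟩
  | mul_left w r _ ih =>
    obtain ⟨n, hn⟩ := ih
    exact ⟨vars w + n, hm _ (fun t ht => by simp only [vars, ht]) hn⟩
  | mul_right w r _ ih =>
    obtain ⟨n, hn⟩ := ih
    exact ⟨n + vars w, hm _ (fun t ht => by simp only [vars, ht]) hn⟩
  | br_left w r _ ih =>
    obtain ⟨n, hn⟩ := ih
    exact ⟨vars w + n, hm _ (fun t ht => by simp only [vars, ht]) hn⟩
  | br_right w r _ ih =>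
    obtain ⟨n, hn⟩ := ih
    exact ⟨n + vars w, hm _ (fun t ht => by simp only [vars, ht]) hn⟩
  | del r _ ih =>
    obtain ⟨n, hn⟩ := ih
    exact ⟨n, hm _ (fun t ht => by simp only [vars, ht]) hn⟩

/-- The value of `φ` on an expression, which need not be multilinear: each bracket contributes the sum
of the `t_{ab}` over its arguments, and each `Δ` the sum of the `s_a` and `t_{ab}` over its argument. -/
noncomputable def phiT : BVExpr un A → ExteriorAlgebra ℚ (DK A)
  | one _ => 1
  | var _ => 1
  | mul x y => phiT x * phiT y
  | br x y => phiT x * (ι ℚ (pairSum (vars x) (vars y)) * phiT y)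
  | del x => ι ℚ (selfSum (vars x)) * phiT x

theorem mul_mem_exteriorPower {L : Type u} [AddCommGroup L] [Module ℚ L] {i j : ℕ}
    {v w : ExteriorAlgebra ℚ L}
    (hv : v ∈ ⋀[ℚ]^i L) (hw : w ∈ ⋀[ℚ]^j L) : v * w ∈ ⋀[ℚ]^(i + j) L := by
  have h : ⋀[ℚ]^(i + j) L = ⋀[ℚ]^i L * ⋀[ℚ]^j L := pow_add _ _ _
  rw [h]
  exact Submodule.mul_mem_mul hv hw

theorem phiT_mem (t : BVExpr un A) : phiT t ∈ ⋀[ℚ]^(deg t) (DK A) := by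
  induction t with
  | one h => rw [deg, CE.gr_zero]; exact Submodule.one_le.mp le_rfl
  | var a => rw [deg, CE.gr_zero]; exact Submodule.one_le.mp le_rfl
  | mul x y hx hy => exact mul_mem_exteriorPower hx hy
  | br x y hx hy =>
    rw [deg, add_assoc]; exact mul_mem_exteriorPower hx (CE.ι_mul_mem_gr _ hy)
  | del x hx => exact CE.ι_mul_mem_gr _ hx

theorem mul_ι_mul {L : Type u} [LieRing L] [LieAlgebra ℚ L] {i : ℕ} {v : ExteriorAlgebra ℚ L}
    (hv : v ∈ ⋀[ℚ]^i L) (x : L) (w : ExteriorAlgebra ℚ L) :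
    v * (ι ℚ x * w) = (-1 : ℚ) ^ i • (ι ℚ x * (v * w)) := by
  rw [← mul_assoc, ← mul_assoc, CE.ι_mul_comm x i v hv, smul_mul_assoc, smul_smul, ← mul_pow,
    neg_one_mul, neg_neg, one_pow, one_smul]

theorem mul_swap_mul {L : Type u} [LieRing L] [LieAlgebra ℚ L] {i j : ℕ}
    {v v' : ExteriorAlgebra ℚ L}
    (hv : v ∈ ⋀[ℚ]^i L) (hv' : v' ∈ ⋀[ℚ]^j L) (w : ExteriorAlgebra ℚ L) :
    v * (v' * w) = (-1 : ℚ) ^ (i * j) • (v' * (v * w)) := by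
  rw [← mul_assoc, CE.graded_comm i j v v' hv hv', smul_mul_assoc, mul_assoc]

/-- The relations of BV algebras hold in `⋀ t̃`: the bracket of `x` and `y` is sent to
`φ x ∧ τ ∧ φ y`, where `τ` is biadditive in the sets of variables of `x` and `y`, and the relations
between `Δ` and the bracket follow from `selfSum_add`. -/
theorem phiT_rel (r : BVExpr un A →₀ ℚ) (h : BVRel r) :
    Finsupp.linearCombination ℚ phiT r = 0 := by
  have hl : ∀ (l : ExteriorAlgebra ℚ (DK A) →ₗ[ℚ] ExteriorAlgebra ℚ (DK A))
      (r : BVExpr un A →₀ ℚ), Finsupp.linearCombination ℚ phiT r = 0 →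
      Finsupp.linearCombination ℚ (fun x => l (phiT x)) r = 0 := by
    intro l r h
    have := lc_lin phiT phiT l 0 r
    simp only [LinearMap.zero_apply, add_zero] at this
    rw [this, h, map_zero]
  induction h with
  | one_mul h x =>
    simp only [map_sub, Finsupp.linearCombination_single, one_smul, phiT, _root_.one_mul, sub_self]
  | mul_comm x y =>
    simp only [map_sub, map_smul, Finsupp.linearCombination_single, one_smul, phiT]
    rw [CE.graded_comm _ _ _ _ (phiT_mem x) (phiT_mem y), sub_self]
  | mul_assoc x y z =>
    simp only [map_sub, Finsupp.linearCombination_single, one_smul, phiT]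
    rw [_root_.mul_assoc, sub_self]
  | br_skew x y =>
    simp only [map_add, map_smul, Finsupp.linearCombination_single, one_smul, phiT]
    rw [mul_ι_mul (phiT_mem x), mul_ι_mul (phiT_mem y), pairSum_symm (vars y),
      CE.graded_comm _ _ _ _ (phiT_mem y) (phiT_mem x)]
    rcases neg_one_pow_eq_or ℚ (deg x) with hi | hi <;>
    rcases neg_one_pow_eq_or ℚ (deg y) with hj | hj <;>
    simp only [mul_add, add_mul, mul_one, one_mul, pow_one, pow_add, pow_mul, hi, hj, one_pow,
      mul_smul_comm] <;> module
  | jacobi x y z =>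
    simp only [map_sub, map_smul, Finsupp.linearCombination_single, one_smul, phiT, vars,
      pairSum_add_left, pairSum_add_right, map_add, add_mul, mul_add, _root_.mul_assoc,
      mul_ι_mul (phiT_mem x), mul_ι_mul (phiT_mem y), mul_swap_mul (phiT_mem y) (phiT_mem x),
      mul_smul_comm, smul_mul_assoc, pairSum_symm (vars y) (vars x)]
    rw [CE.ι_swap_mul (pairSum (vars x) (vars z)) (pairSum (vars y) (vars z))]
    rcases neg_one_pow_eq_or ℚ (deg x) with hi | hi <;>
    rcases neg_one_pow_eq_or ℚ (deg y) with hj | hj <;>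
    simp only [mul_one, one_mul, pow_one, pow_add, pow_mul, hi, hj, one_pow] <;> module
  | leibniz x y z =>
    simp only [map_sub, map_smul, Finsupp.linearCombination_single, one_smul, phiT, vars,
      pairSum_add_right, map_add, add_mul, mul_add, _root_.mul_assoc,
      mul_ι_mul (phiT_mem x), mul_ι_mul (phiT_mem y), mul_swap_mul (phiT_mem y) (phiT_mem x),
      mul_smul_comm, smul_mul_assoc]
    rcases neg_one_pow_eq_or ℚ (deg x) with hi | hi <;>
    rcases neg_one_pow_eq_or ℚ (deg y) with hj | hj <;>
    simp only [mul_one, one_mul, pow_add, pow_mul, hi, hj, one_pow] <;> module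
  | del_del x =>
    simp only [Finsupp.linearCombination_single, one_smul, phiT, vars]
    rw [CE.ι_sq_mul]
  | br_eq x y =>
    simp only [map_sub, map_add, map_smul, Finsupp.linearCombination_single, one_smul, phiT, vars,
      selfSum_add, add_mul, _root_.mul_assoc, mul_ι_mul (phiT_mem x)]
    module
  | mul_left w r _ ih => rw [lc_map]; exact hl (LinearMap.mulLeft ℚ (phiT w)) r ih
  | mul_right w r _ ih => rw [lc_map]; exact hl (LinearMap.mulRight ℚ (phiT w)) r ih
  | br_left w r h ih =>
    obtain ⟨m, hm⟩ := rel_homogeneous_vars h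
    rw [lc_map]
    refine Eq.trans (lc_congr fun t ht => ?_)
      (hl (LinearMap.mulLeft ℚ (phiT w * ι ℚ (pairSum (vars w) m))) r ih)
    rw [phiT, show vars t = m from hm ht, LinearMap.mulLeft_apply, _root_.mul_assoc]
  | br_right w r h ih =>
    obtain ⟨m, hm⟩ := rel_homogeneous_vars h
    rw [lc_map]
    refine Eq.trans (lc_congr fun t ht => ?_)
      (hl (LinearMap.mulRight ℚ (ι ℚ (pairSum m (vars w)) * phiT w)) r ih)
    rw [phiT, show vars t = m from hm ht, LinearMap.mulRight_apply]
  | del r h ih =>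
    obtain ⟨m, hm⟩ := rel_homogeneous_vars h
    rw [lc_map]
    refine Eq.trans (lc_congr fun t ht => ?_)
      (hl (LinearMap.mulLeft ℚ (ι ℚ (selfSum m))) r ih)
    rw [phiT, show vars t = m from hm ht, LinearMap.mulLeft_apply]

/-- The map `φ`, on the whole free BV algebra. -/
noncomputable def phi : FreeBV un A →ₗ[ℚ] ExteriorAlgebra ℚ (DK A) := lift phiT phiT_rel

theorem phi_mk (t : BVExpr un A) : phi (mk t) = phiT t := lift_mk _ _ t

theorem phi_fmul (x y : FreeBV un A) : phi (fmul x y) = phi x * phi y := by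
  have : fmul.compr₂ phi = (LinearMap.mul ℚ _).compl₁₂ (phi (un := un) (A := A)) phi :=
    ext_all fun s => ext_all fun t => by
      simp only [LinearMap.compr₂_apply, LinearMap.compl₁₂_apply, fmul_mk, phi_mk, phiT,
        LinearMap.mul_apply']
  exact LinearMap.congr_fun₂ this x y

theorem wt_ext {M : Type*} [AddCommGroup M] [Module ℚ M] {m : Multiset A}
    {f g : FreeBV un A →ₗ[ℚ] M}
    (h : ∀ t, vars t = m → f (mk t) = g (mk t)) {x : FreeBV un A} (hx : x ∈ wt un m) :
    f x = g x := by
  refine LinearMap.eqOn_span (s := mk '' {t | vars t = m}) ?_ hx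
  rintro _ ⟨t, ht, rfl⟩
  exact h t ht

theorem wt_le {m : Multiset A} {N : Submodule ℚ (FreeBV un A)}
    (h : ∀ t, vars t = m → mk t ∈ N) : wt un m ≤ N :=
  Submodule.span_le.mpr (by rintro _ ⟨t, ht, rfl⟩; exact h t ht)

theorem phi_fbr {m m' : Multiset A} {x y : FreeBV un A} (hx : x ∈ wt un m) (hy : y ∈ wt un m') :
    phi (fbr x y) = phi x * (ι ℚ (pairSum m m') * phi y) := by
  refine wt_ext (f := phi.comp (fbr.flip y))
    (g := (LinearMap.mulRight ℚ (ι ℚ (pairSum m m') * phi y)).comp phi) ?_ hx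
  rintro s rfl
  refine wt_ext (f := phi.comp (fbr (mk s)))
    (g := (LinearMap.mulLeft ℚ (phi (mk s))).comp
      ((LinearMap.mulLeft ℚ (ι ℚ (pairSum (vars s) m'))).comp phi)) ?_ hy
  rintro t rfl
  simp only [LinearMap.comp_apply, fbr_mk, phi_mk, phiT, LinearMap.mulLeft_apply]

theorem phi_fdel {m : Multiset A} {x : FreeBV un A} (hx : x ∈ wt un m) :
    phi (fdel x) = ι ℚ (selfSum m) * phi x := by
  refine wt_ext (f := phi.comp fdel)
    (g := (LinearMap.mulLeft ℚ (ι ℚ (selfSum m))).comp phi) ?_ hx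
  rintro s rfl
  simp only [LinearMap.comp_apply, fdel_mk, phi_mk, phiT, LinearMap.mulLeft_apply]

theorem fmul_mem_wt {m m' : Multiset A} {x y : FreeBV un A} (hx : x ∈ wt un m)
    (hy : y ∈ wt un m') : fmul x y ∈ wt un (m + m') := by
  have h : ∀ t, vars t = m' → fmul x (mk t) ∈ wt un (m + m') := fun t ht =>
    wt_le (N := (wt un (m + m')).comap (fmul.flip (mk t))) (fun s hs => by
      subst hs; subst ht
      rw [Submodule.mem_comap, LinearMap.flip_apply, fmul_mk]; exact mk_mem_wt (mul s t)) hx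
  exact wt_le (N := (wt un (m + m')).comap (fmul x)) h hy

theorem fbr_mem_wt {m m' : Multiset A} {x y : FreeBV un A} (hx : x ∈ wt un m)
    (hy : y ∈ wt un m') : fbr x y ∈ wt un (m + m') := by
  have h : ∀ t, vars t = m' → fbr x (mk t) ∈ wt un (m + m') := fun t ht =>
    wt_le (N := (wt un (m + m')).comap (fbr.flip (mk t))) (fun s hs => by
      subst hs; subst ht
      rw [Submodule.mem_comap, LinearMap.flip_apply, fbr_mk]; exact mk_mem_wt (br s t)) hx
  exact wt_le (N := (wt un (m + m')).comap (fbr x)) h hy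

theorem fdel_mem_wt {m : Multiset A} {x : FreeBV un A} (hx : x ∈ wt un m) :
    fdel x ∈ wt un m :=
  wt_le (N := (wt un m).comap fdel) (fun s hs => by
      subst hs
      rw [Submodule.mem_comap, fdel_mk]; exact mk_mem_wt (del s)) hx

/-! ### The values of `φ` are cycles -/

/-- An element commuting with the `t_{ab}` for the variables of `t` commutes with the value of `φ`. -/
theorem θ_phiT (z : DK A) (t : BVExpr un A)
    (h : ∀ a ∈ vars t, ∀ b ∈ vars t, ⁅z, DK.t a b⁆ = 0) : CE.θ z (phiT t) = 0 := by
  induction t with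
  | one h => exact CE.θ_algebraMap z 1
  | var a => exact CE.θ_algebraMap z 1
  | mul x y hx hy =>
    rw [phiT, CE.θ_mul, hx fun a ha b hb => h a (Multiset.mem_add.mpr (.inl ha)) b
      (Multiset.mem_add.mpr (.inl hb)), hy fun a ha b hb => h a (Multiset.mem_add.mpr (.inr ha)) b
      (Multiset.mem_add.mpr (.inr hb)), zero_mul, mul_zero, add_zero]
  | br x y hx hy =>
    have : ⁅z, pairSum (vars x) (vars y)⁆ = 0 :=
      pairSum_induction (P := fun w => ⁅z, w⁆ = 0) (lie_zero z)
        (fun v w hv hw => by rw [lie_add, hv, hw, add_zero])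
        fun a ha b hb => h a (Multiset.mem_add.mpr (.inl ha)) b (Multiset.mem_add.mpr (.inr hb))
    rw [phiT, CE.θ_mul, CE.θ_ι_mul, hx fun a ha b hb => h a (Multiset.mem_add.mpr (.inl ha)) b
      (Multiset.mem_add.mpr (.inl hb)), hy fun a ha b hb => h a (Multiset.mem_add.mpr (.inr ha)) b
      (Multiset.mem_add.mpr (.inr hb)), this, zero_mul, map_zero, zero_mul, mul_zero, add_zero,
      mul_zero, add_zero]
  | del x hx =>
    have : ⁅z, selfSum (vars x)⁆ = 0 := by
      rw [lie_selfSum_eq, pairSum_induction (P := fun w => ⁅z, w⁆ = 0)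
        (m := vars x) (m' := vars x) (lie_zero z)
        (fun v w hv hw => by rw [lie_add, hv, hw, add_zero]) h, smul_zero]
    rw [phiT, CE.θ_ι_mul, this, hx h, map_zero, zero_mul, mul_zero, add_zero]

theorem θ_s (a : A) (w : ExteriorAlgebra ℚ (DK A)) : CE.θ (s a) w = 0 := by
  induction w using CE.induction with
  | hr r => exact CE.θ_algebraMap _ _
  | ha v w hv hw => rw [map_add, hv, hw, add_zero]
  | hm x w hw => rw [CE.θ_ι_mul, s_central, hw, map_zero, zero_mul, mul_zero, add_zero]

theorem θ_pairSum {m m' : Multiset A} {w : ExteriorAlgebra ℚ (DK A)}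
    (h : ∀ a ∈ m, ∀ b ∈ m', CE.θ (t a b) w = 0) : CE.θ (pairSum m m') w = 0 :=
  pairSum_induction (P := fun z => CE.θ z w = 0)
    (LinearMap.congr_fun (map_zero (CE.θLin (DK A))) w)
    (fun y z hy hz => by rw [CE.θ_add, hy, hz, add_zero]) h

theorem θ_selfSum {m : Multiset A} {w : ExteriorAlgebra ℚ (DK A)}
    (h : ∀ a ∈ m, ∀ b ∈ m, CE.θ (t a b) w = 0) : CE.θ (selfSum m) w = 0 := by
  have : CE.θ (m.map s).sum w = 0 :=
    Multiset.sum_induction (fun z => CE.θ z w = 0) _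
      (fun y z hy hz => by rw [CE.θ_add, hy, hz, add_zero])
      (LinearMap.congr_fun (map_zero (CE.θLin (DK A))) w) fun y hy => by
        obtain ⟨a, _, rfl⟩ := Multiset.mem_map.mp hy
        exact θ_s a w
  rw [selfSum, CE.θ_add, this, zero_add, CE.θ_smul, θ_pairSum h, smul_zero]

theorem lie_skew_zero {L : Type u} [LieRing L] {x y : L} (h : ⁅x, y⁆ = 0) : ⁅y, x⁆ = 0 := by
  rw [← lie_skew, h, neg_zero]

/-- Left multiplication by `φ t` commutes with the differential up to sign on elements that commute
with the `t_{ab}` for the variables of `t`: the elements of `t̃` contributed by a bracket or a `Δ`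
commute with those contributed by its arguments. -/
theorem d_phiT_mul (t : BVExpr un A) (ht : t.vars.Nodup) (w : ExteriorAlgebra ℚ (DK A))
    (hw : ∀ a ∈ t.vars, ∀ b ∈ t.vars, CE.θ (DK.t a b) w = 0) :
    CE.d _ (phiT t * w) = (-1 : ℚ) ^ deg t • (phiT t * CE.d _ w) := by
  induction t generalizing w with
  | one h => rw [phiT, one_mul, one_mul, deg, pow_zero, one_smul]
  | var a => rw [phiT, one_mul, one_mul, deg, pow_zero, one_smul]
  | mul x y hx hy =>
    rw [vars, Multiset.nodup_add] at ht
    have hdisj : ∀ c, c ∈ x.vars → c ∉ y.vars := fun _ => Multiset.disjoint_left.mp ht.2.2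
    rw [phiT, mul_assoc, hx ht.1, hy ht.2.1, mul_smul_comm, smul_smul, mul_assoc, deg, pow_add]
    · exact fun a ha b hb => hw a (Multiset.mem_add.mpr (.inr ha)) b (Multiset.mem_add.mpr (.inr hb))
    · intro a ha b hb
      rw [CE.θ_mul, hw a (Multiset.mem_add.mpr (.inl ha)) b (Multiset.mem_add.mpr (.inl hb)),
        θ_phiT, zero_mul, mul_zero, add_zero]
      intro c hc e he
      exact t_disj (fun h => hdisj _ ha (h ▸ hc)) (fun h => hdisj _ ha (h ▸ he))
        (fun h => hdisj _ hb (h ▸ hc)) (fun h => hdisj _ hb (h ▸ he))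
  | br x y hx hy =>
    rw [vars, Multiset.nodup_add] at ht
    have hdisj : ∀ c, c ∈ x.vars → c ∉ y.vars := fun _ => Multiset.disjoint_left.mp ht.2.2
    have hT : CE.θ (pairSum (vars x) (vars y)) (phiT y * w) = 0 := by
      rw [CE.θ_mul, θ_phiT, θ_pairSum, zero_mul, mul_zero, add_zero]
      · exact fun a ha b hb =>
          hw a (Multiset.mem_add.mpr (.inl ha)) b (Multiset.mem_add.mpr (.inr hb))
      · intro a ha b hb
        rw [pairSum_symm]
        exact lie_skew_zero (lie_pairSum_pair ht.2.1 ht.2.2.symm ha hb)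
    rw [phiT, mul_assoc, mul_assoc, hx ht.1, CE.d_ι_mul, hT, hy ht.2.1, deg, pow_succ, pow_add]
    · simp only [mul_assoc, zero_sub, mul_neg, mul_smul_comm]
      module
    · exact fun a ha b hb => hw a (Multiset.mem_add.mpr (.inr ha)) b (Multiset.mem_add.mpr (.inr hb))
    · intro a ha b hb
      rw [CE.θ_ι_mul, lie_pairSum_pair ht.1 ht.2.2 ha hb, map_zero, zero_mul, zero_add,
        CE.θ_mul, hw a (Multiset.mem_add.mpr (.inl ha)) b (Multiset.mem_add.mpr (.inl hb)),
        θ_phiT, zero_mul, mul_zero, add_zero, mul_zero]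
      intro c hc e he
      exact t_disj (fun h => hdisj _ ha (h ▸ hc)) (fun h => hdisj _ ha (h ▸ he))
        (fun h => hdisj _ hb (h ▸ hc)) (fun h => hdisj _ hb (h ▸ he))
  | del x hx =>
    have hS : CE.θ (selfSum (vars x)) (phiT x * w) = 0 := by
      rw [CE.θ_mul, θ_phiT, θ_selfSum (m := vars x) hw, zero_mul, mul_zero, add_zero]
      exact fun a ha b hb => lie_skew_zero (lie_selfSum ht ha hb)
    rw [phiT, mul_assoc, CE.d_ι_mul, hS, hx ht w hw, deg, pow_succ]
    simp only [mul_assoc, zero_sub, mul_smul_comm]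
    module

theorem d_phiT (t : BVExpr un A) (ht : t.vars.Nodup) : CE.d _ (phiT t) = 0 := by
  have h0 : CE.d (DK A) 1 = 0 := CE.d_algebraMap 1
  have := d_phiT_mul t ht 1 fun a _ b _ => CE.θ_algebraMap _ 1
  rwa [mul_one, h0, mul_zero, smul_zero] at this

end FreeBV

/-! ### `φ` as a morphism of operads -/

namespace FreeBV

open BVExpr DK

variable {un : Bool} {A B C : Type u}

theorem phi_mem {n : ℕ} {x : FreeBV un A} (hx : x ∈ gr un A n) : phi x ∈ ⋀[ℚ]^n (DK A) := by
  have : gr un A n ≤ (⋀[ℚ]^n (DK A)).comap phi := Submodule.span_le.mpr (by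
    rintro _ ⟨t, rfl, rfl⟩
    rw [SetLike.mem_coe, Submodule.mem_comap, phi_mk]
    exact phiT_mem t)
  exact this hx

theorem renT_mem_wt [Finite C] {f : C → Option A} {ν : A → Option C} (t : BVExpr un A)
    (h : ∀ a ∈ vars t, ∃ c, ν a = some c ∧ fiber f a = {c}) :
    renT ν t ∈ wt un (pull f (vars t)) := by
  induction t with
  | one h1 => rw [vars, pull_zero]; exact mk_mem_wt (one h1)
  | var a =>
    obtain ⟨c, hc, hf⟩ := h a (Multiset.mem_singleton_self a)
    rw [renT, hc, vars, pull_singleton, hf]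
    exact mk_mem_wt (var c)
  | mul x y hx hy =>
    rw [vars, pull_add]
    exact fmul_mem_wt (hx fun a ha => h a (Multiset.mem_add.mpr (.inl ha)))
      (hy fun a ha => h a (Multiset.mem_add.mpr (.inr ha)))
  | br x y hx hy =>
    rw [vars, pull_add]
    exact fbr_mem_wt (hx fun a ha => h a (Multiset.mem_add.mpr (.inl ha)))
      (hy fun a ha => h a (Multiset.mem_add.mpr (.inr ha)))
  | del x hx => exact fdel_mem_wt (hx h)

/-- `φ` turns the renaming of variables, inverse to `f`, into cabling along `f`. -/
theorem phi_renT [Finite C] {f : C → Option A} {ν : A → Option C} (t : BVExpr un A)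
    (h : ∀ a ∈ vars t, ∃ c, ν a = some c ∧ fiber f a = {c}) (ht : t.vars.Nodup) :
    phi (renT ν t) = wcable f (phiT t) := by
  induction t with
  | one h => rw [renT, phi_mk, phiT, phiT, map_one]
  | var a =>
    obtain ⟨c, hc, hf⟩ := h a (Multiset.mem_singleton_self a)
    rw [renT, hc, Option.elim_some, phi_mk, phiT, phiT, map_one]
  | mul x y hx hy =>
    rw [vars, Multiset.nodup_add] at ht
    rw [renT, phi_fmul, phiT, map_mul, hx (fun a ha => h a (Multiset.mem_add.mpr (.inl ha))) ht.1,
      hy (fun a ha => h a (Multiset.mem_add.mpr (.inr ha))) ht.2.1]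
  | br x y hx hy =>
    have h1 := fun a ha => h a (Multiset.mem_add.mpr (.inl ha))
    have h2 := fun a ha => h a (Multiset.mem_add.mpr (.inr ha))
    rw [vars, Multiset.nodup_add] at ht
    rw [renT, phi_fbr (renT_mem_wt x h1) (renT_mem_wt y h2), phiT, map_mul, map_mul, hx h1 ht.1,
      hy h2 ht.2.1, ExteriorAlgebra.map_apply_ι, LieHom.coe_toLinearMap, cable_pairSum f ht.2.2]
  | del x hx =>
    rw [renT, phi_fdel (renT_mem_wt x h), phiT, map_mul, hx h ht,
      ExteriorAlgebra.map_apply_ι, LieHom.coe_toLinearMap, cable_selfSum f (m := vars x) ht]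

/-- The data `ν`, `k`, `σ` of a substitution of `σ b` for the variable `b`: the other variables are
renamed by `ν`, and `f` maps the variables occurring in `σ b` to `b` and inverts the renaming. -/
structure IsInsertion [Finite C] (f : C → Option A) (b : A) (ν : A → Option C) (k : ℕ)
    (σ : A → FreeBV un C) : Prop where
  rename : ∀ a ≠ b, ∃ c, ν a = some c ∧ fiber f a = {c}
  zero : ∀ a ≠ b, σ a = 0
  mem_wt : σ b ∈ wt un (fiber f b).val
  mem_gr : σ b ∈ gr un C k

namespace IsInsertion

variable [Finite C] {f : C → Option A} {b : A} {ν : A → Option C} {k : ℕ} {σ : A → FreeBV un C}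

theorem rename_of_notMem (H : IsInsertion f b ν k σ) {m : Multiset A} (h : b ∉ m) :
    ∀ a ∈ m, ∃ c, ν a = some c ∧ fiber f a = {c} :=
  fun a ha => H.rename a fun e => h (e ▸ ha)

theorem σ_mem_gr (H : IsInsertion f b ν k σ) (a : A) : σ a ∈ gr un C k := by
  by_cases h : a = b
  · rw [h]; exact H.mem_gr
  · rw [H.zero a h]; exact zero_mem _

theorem derT_of_notMem (H : IsInsertion f b ν k σ) (t : BVExpr un A) (h : b ∉ vars t) :
    derT ν k σ t = 0 := by
  induction t with
  | one h => rfl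
  | var a => exact H.zero a fun e => h (e ▸ Multiset.mem_singleton_self a)
  | mul x y hx hy =>
    rw [vars, Multiset.mem_add, not_or] at h
    rw [derT, hx h.1, hy h.2, map_zero, map_zero, LinearMap.zero_apply, smul_zero, add_zero]
  | br x y hx hy =>
    rw [vars, Multiset.mem_add, not_or] at h
    rw [derT, hx h.1, hy h.2, map_zero, map_zero, LinearMap.zero_apply, smul_zero, add_zero]
  | del x hx => rw [derT, hx h, map_zero]

theorem derT_fmul_right (H : IsInsertion f b ν k σ) {x y : BVExpr un A} (h : b ∉ vars x) :
    derT ν k σ (mul x y) = fmul (renT ν x) (derT ν k σ y) := by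
  rw [derT, H.derT_of_notMem x h, map_zero, LinearMap.zero_apply, smul_zero, add_zero]

theorem derT_fmul_left (H : IsInsertion f b ν k σ) {x y : BVExpr un A} (h : b ∉ vars y) :
    derT ν k σ (mul x y) = (-1 : ℚ) ^ (k * deg y) • fmul (derT ν k σ x) (renT ν y) := by
  rw [derT, H.derT_of_notMem y h, map_zero, zero_add]

theorem derT_fbr_right (H : IsInsertion f b ν k σ) {x y : BVExpr un A} (h : b ∉ vars x) :
    derT ν k σ (br x y) = fbr (renT ν x) (derT ν k σ y) := by
  rw [derT, H.derT_of_notMem x h, map_zero, LinearMap.zero_apply, smul_zero, add_zero]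

theorem derT_fbr_left (H : IsInsertion f b ν k σ) {x y : BVExpr un A} (h : b ∉ vars y) :
    derT ν k σ (br x y) = (-1 : ℚ) ^ (k * (deg y + 1)) • fbr (derT ν k σ x) (renT ν y) := by
  rw [derT, H.derT_of_notMem y h, map_zero, zero_add]

theorem derT_mem_wt (H : IsInsertion f b ν k σ) (t : BVExpr un A) (h : b ∈ vars t)
    (ht : t.vars.Nodup) : derT ν k σ t ∈ wt un (pull f (vars t)) := by
  induction t with
  | one h' => exact absurd h (Multiset.notMem_zero b)
  | var a =>
    obtain rfl : b = a := Multiset.mem_singleton.mp h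
    rw [vars, pull_singleton]
    exact H.mem_wt
  | mul x y hx hy =>
    rw [vars, Multiset.nodup_add] at ht
    rw [vars, pull_add]
    by_cases hay : b ∈ y.vars
    · have hax : b ∉ x.vars := fun hax => Multiset.disjoint_left.mp ht.2.2 hax hay
      rw [H.derT_fmul_right hax]
      exact fmul_mem_wt (renT_mem_wt x (H.rename_of_notMem hax)) (hy hay ht.2.1)
    · have hax : b ∈ x.vars := (Multiset.mem_add.mp h).resolve_right hay
      rw [H.derT_fmul_left hay]
      exact Submodule.smul_mem _ _
        (fmul_mem_wt (hx hax ht.1) (renT_mem_wt y (H.rename_of_notMem hay)))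
  | br x y hx hy =>
    rw [vars, Multiset.nodup_add] at ht
    rw [vars, pull_add]
    by_cases hay : b ∈ y.vars
    · have hax : b ∉ x.vars := fun hax => Multiset.disjoint_left.mp ht.2.2 hax hay
      rw [H.derT_fbr_right hax]
      exact fbr_mem_wt (renT_mem_wt x (H.rename_of_notMem hax)) (hy hay ht.2.1)
    · have hax : b ∈ x.vars := (Multiset.mem_add.mp h).resolve_right hay
      rw [H.derT_fbr_left hay]
      exact Submodule.smul_mem _ _
        (fbr_mem_wt (hx hax ht.1) (renT_mem_wt y (H.rename_of_notMem hay)))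
  | del x hx => exact fdel_mem_wt (hx h ht)

/-- `φ` turns the substitution of `σ b` for `b` into cabling, followed by the multiplication by
`φ (σ b)` from the right; the Koszul signs are those of the graded-commutative exterior algebra. -/
theorem phi_derT (H : IsInsertion f b ν k σ) (t : BVExpr un A) (h : b ∈ vars t)
    (ht : t.vars.Nodup) : phi (derT ν k σ t) = wcable f (phiT t) * phi (σ b) := by
  have hk := phi_mem H.mem_gr
  induction t with
  | one h' => exact absurd h (Multiset.notMem_zero b)
  | var a =>
    obtain rfl : b = a := Multiset.mem_singleton.mp h
    rw [derT, phiT, map_one, one_mul]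
  | mul x y hx hy =>
    rw [vars, Multiset.nodup_add] at ht
    by_cases hay : b ∈ y.vars
    · have hax : b ∉ x.vars := fun hax => Multiset.disjoint_left.mp ht.2.2 hax hay
      rw [H.derT_fmul_right hax, phi_fmul, hy hay ht.2.1,
        phi_renT x (H.rename_of_notMem hax) ht.1, phiT, map_mul, mul_assoc]
    · have hax : b ∈ x.vars := (Multiset.mem_add.mp h).resolve_right hay
      rw [H.derT_fmul_left hay, map_smul, phi_fmul, hx hax ht.1,
        phi_renT y (H.rename_of_notMem hay) ht.2.1, phiT, map_mul, mul_assoc, mul_assoc,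
        CE.graded_comm _ _ _ _ hk (CE.map_mem_gr _ _ _ (phiT_mem y)), mul_smul_comm, smul_smul,
        ← mul_pow, neg_one_mul, neg_neg, one_pow, one_smul]
  | br x y hx hy =>
    rw [vars, Multiset.nodup_add] at ht
    by_cases hay : b ∈ y.vars
    · have hax : b ∉ x.vars := fun hax => Multiset.disjoint_left.mp ht.2.2 hax hay
      rw [H.derT_fbr_right hax, phi_fbr (renT_mem_wt x (H.rename_of_notMem hax))
        (H.derT_mem_wt y hay ht.2.1), hy hay ht.2.1,
        phi_renT x (H.rename_of_notMem hax) ht.1, phiT, map_mul, map_mul,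
        ExteriorAlgebra.map_apply_ι, LieHom.coe_toLinearMap, cable_pairSum f ht.2.2,
        mul_assoc, mul_assoc]
    · have hax : b ∈ x.vars := (Multiset.mem_add.mp h).resolve_right hay
      rw [H.derT_fbr_left hay, map_smul, phi_fbr (H.derT_mem_wt x hax ht.1)
        (renT_mem_wt y (H.rename_of_notMem hay)), hx hax ht.1,
        phi_renT y (H.rename_of_notMem hay) ht.2.1, phiT, map_mul, map_mul,
        ExteriorAlgebra.map_apply_ι, LieHom.coe_toLinearMap, cable_pairSum f ht.2.2, mul_assoc,
        mul_assoc, CE.graded_comm _ _ _ _ hk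
          (CE.ι_mul_mem_gr _ (CE.map_mem_gr _ _ _ (phiT_mem y))), mul_smul_comm, smul_smul,
        ← mul_pow, neg_one_mul, neg_neg, one_pow, one_smul]
  | del x hx =>
    rw [derT, phi_fdel (H.derT_mem_wt x h ht), hx h ht, phiT, map_mul,
      ExteriorAlgebra.map_apply_ι, LieHom.coe_toLinearMap, cable_selfSum f (m := vars x) ht,
      mul_assoc]

end IsInsertion

theorem multilinear_ext {M : Type*} [AddCommGroup M] [Module ℚ M] {f g : FreeBV un A →ₗ[ℚ] M}
    (h : ∀ t, t.IsMultilinear → f (mk t) = g (mk t)) {x : FreeBV un A}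
    (hx : x ∈ multilinear un A) : f x = g x := by
  refine LinearMap.eqOn_span (s := mk '' {t | t.IsMultilinear}) ?_ hx
  rintro _ ⟨t, ht, rfl⟩
  exact h t ht

theorem d_phi {x : FreeBV un A} (hx : x ∈ multilinear un A) : CE.d _ (phi x) = 0 := by
  refine multilinear_ext (f := (CE.d _).comp phi) (g := 0) (fun t ht => ?_) hx
  rw [LinearMap.comp_apply, phi_mk, d_phiT t ht.1, LinearMap.zero_apply]

theorem phi_relabel [Finite B] (e : A ≃ B) {x : FreeBV un A} (hx : x ∈ multilinear un A) :
    phi (ren (fun a => some (e a)) x) = wcable (fun b => some (e.symm b)) (phi x) := by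
  refine multilinear_ext (f := phi.comp (ren fun a => some (e a)))
    (g := (wcable fun b => some (e.symm b)).toLinearMap.comp phi) (fun t ht => ?_) hx
  rw [LinearMap.comp_apply, LinearMap.comp_apply, ren_mk, phi_mk]
  exact phi_renT t (fun a _ => ⟨e a, rfl, fiber_symm e a⟩) ht.1

theorem isInsertion_comp [Finite A] [Finite B] (a : A) (u : BVExpr un B) (hu : u.IsMultilinear) :
    IsInsertion (toLeft a : Ins a B → Option A) a (keep B a) (deg u) (plug a (mk u)) where
  rename b h := ⟨_, keep_ne h, fiber_toLeft_ne h⟩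
  zero b h := plug_ne h _
  mem_wt := by
    have : vars (FreeBV.rename Sum.inr u : BVExpr un (Ins a B)) =
        (fiber (toLeft a : Ins a B → Option A) a).val := by
      rw [vars_rename]
      refine (Multiset.Nodup.ext (hu.1.map Sum.inr_injective) (Finset.nodup _)).mpr ?_
      rintro (⟨b, hb⟩ | b)
      · simp [mem_fiber, toLeft, hb]
      · simp [mem_fiber, toLeft, hu.2]
    rw [plug_self, ren_mk_some, ← this]
    exact mk_mem_wt _
  mem_gr := plug_mem_gr a (mk_mem_gr u) a

theorem phi_comp [Finite A] [Finite B] (a : A) {x : FreeBV un A} {y : FreeBV un B}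
    (hx : x ∈ multilinear un A) (hy : y ∈ multilinear un B) :
    phi (comp a y x) = CE.mapProd (circ a) (phi x) (phi y) := by
  refine multilinear_ext (f := phi.comp ((comp a).flip x))
    (g := (CE.mapProd (circ a) (phi x)).comp phi) (fun u hu => ?_) hy
  refine multilinear_ext (f := phi.comp (comp a (mk u)))
    (g := ((CE.mapProd (circ a)).flip (phi (mk u))).comp phi) (fun t ht => ?_) hx
  have H := isInsertion_comp a u hu
  rw [LinearMap.comp_apply, LinearMap.comp_apply, comp_of_gr a (mk_mem_gr u), der_mk,
    H.phi_derT t (ht.2 a) ht.1, plug_self, ren_mk, LinearMap.flip_apply, mapProd_circ, phi_mk,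
    phi_mk]
  congr 1
  refine phi_renT u (fun b _ => ⟨_, rfl, ?_⟩) hu.1
  exact fiber_toRight a b

end FreeBV

namespace BV

open FreeBV BVExpr DK

/-- The morphism of operads `φ : BV → ⋀ t̃`. -/
noncomputable def phiHom (un : Bool) : Operad.Hom (BV.{u} un) wedgeDK.{u} where
  app A _ :=
    { toLin := phi.comp (multilinear un A).subtype
      map_gr := fun _ _ hx => phi_mem hx
      map_d := fun x => (map_zero _).trans (d_phi x.2).symm }
  naturality e x := phi_relabel e x.2
  app_comp a x y := phi_comp a x.2 y.2

theorem sendsGenerators_phiHom (un : Bool) : SendsGenerators (phiHom.{u} un) := by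
  refine ⟨fun A _ a b hab hA => ⟨?_, ?_⟩, fun A _ a hA => ?_⟩
  · refine (phi_mk _).trans ?_
    rw [phiT, phiT, phiT, mul_one]
  · refine (phi_mk _).trans ?_
    rw [phiT, phiT, phiT, mul_one, one_mul, vars, vars, pairSum_singleton]
  · refine (phi_mk _).trans ?_
    rw [phiT, phiT, mul_one, vars, selfSum_singleton]

end BV

/-! ### Inserting a new variable into a multilinear expression -/

namespace FreeBV

open BVExpr DK

variable {un : Bool} {A : Type u}

theorem fdel_fbr {i : ℕ} {x : FreeBV un A} (hx : x ∈ gr un A i) (y : FreeBV un A) :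
    fdel (fbr x y) = fbr (fdel x) y - (-1 : ℚ) ^ i • fbr x (fdel y) := by
  rw [fbr_eq hx, fbr_eq (fdel_mem_gr hx), fbr_eq hx]
  simp only [map_sub, map_smul, fdel_fdel, map_zero, LinearMap.zero_apply, pow_succ]
  rcases neg_one_pow_eq_or ℚ i with hi | hi <;> rw [hi] <;> module

/-- The bracket with the unit vanishes, since brackets are derivations of the product. -/
theorem fbr_one (h : un = true) (x : FreeBV un A) : fbr (mk (one h)) x = 0 := by
  have h1 : fmul (mk (one h : BVExpr un A)) (mk (one h)) = mk (one h) := fone_mul h _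
  refine LinearMap.congr_fun (g := 0) (ext_all fun t => ?_) x
  have h2 : fbr (mk t) (mk (one h)) = 0 := by
    have := fleibniz (mk_mem_gr t) (mk_mem_gr (one h : BVExpr un A)) (mk (one h))
    rw [h1, fmul_comm (fbr_mem_gr (mk_mem_gr t) (mk_mem_gr (one h : BVExpr un A)))
      (mk_mem_gr (one h : BVExpr un A)), fone_mul, show deg (one h : BVExpr un A) = 0 from rfl,
      Nat.mul_zero, pow_zero, one_smul, left_eq_add] at this
    exact this
  rw [fbr_skew (mk_mem_gr (one h)) (mk_mem_gr t), h2, smul_zero, neg_zero, LinearMap.zero_apply]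

/-- The expressions `*` and `Δ *` in the new variable `*`. -/
def star (un : Bool) (A : Type u) (r : Bool) : BVExpr un (Option A) :=
  if r then del (var none) else var none

theorem vars_star (r : Bool) : vars (star un A r) = {none} := by
  cases r <;> rfl

theorem phi_star (r : Bool) : phi (mk (star un A r)) = sStar r := by
  rw [phi_mk]
  cases r
  · rfl
  · exact (congrArg₂ (· * ·) (congrArg _ (selfSum_singleton _)) rfl).trans (mul_one _)

open Classical in
/-- The variables other than `b`, as variables of `Option A`. -/
noncomputable def keepStar (b a : A) : Option (Option A) := if a = b then none else some (some a)

open Classical in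
/-- The function on `A` with value `[b, *]` or `[b, Δ *]` at `b` and `0` elsewhere. -/
noncomputable def plugStar (un : Bool) (b : A) (r : Bool) (a : A) : FreeBV un (Option A) :=
  if a = b then mk (br (var (some b)) (star un A r)) else 0

theorem isInsertion_star [Finite A] (b : A) (r : Bool) :
    IsInsertion (attach (some b)) b (keepStar b) (deg (br (var (some b)) (star un A r)))
      (plugStar un b r) where
  rename a h := ⟨some a, if_neg h, by
    ext (_ | c)
    · simp [mem_fiber, attach, h.symm]
    · simp [mem_fiber, attach]⟩
  zero a h := if_neg h
  mem_wt := by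
    have : vars (br (var (some b)) (star un A r)) = (fiber (attach (some b)) b).val := by
      rw [vars, vars, vars_star]
      refine (Multiset.Nodup.ext ?_ (Finset.nodup _)).mpr ?_
      · simp
      · rintro (_ | c) <;> simp [mem_fiber, attach]
    rw [plugStar, if_pos rfl, ← this]
    exact mk_mem_wt _
  mem_gr := by
    rw [plugStar, if_pos rfl]
    exact mk_mem_gr _

/-- The linear maps from the free BV algebra on `A` to that on `A ⊔ {*}`: the multiplication by `*`
or `Δ *`, and the substitution of `[b, *]` or `[b, Δ *]` for a variable `b`. -/
noncomputable def insertStar [Finite A] (p : Option A × Bool) :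
    FreeBV un A →ₗ[ℚ] FreeBV un (Option A) :=
  p.1.elim ((fmul.flip (mk (star un A p.2))).comp (ren fun a => some (some a)))
    fun b => der (keepStar b) _ (plugStar un b p.2) (isInsertion_star b p.2).σ_mem_gr

theorem insertStar_none [Finite A] (r : Bool) (x : FreeBV un A) :
    insertStar (none, r) x = fmul (ren (fun a => some (some a)) x) (mk (star un A r)) := rfl

theorem insertStar_some [Finite A] (b : A) (r : Bool) (t : BVExpr un A) :
    insertStar (some b, r) (mk t) =
      derT (keepStar b) (deg (br (var (some b)) (star un A r))) (plugStar un b r) t :=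
  der_mk _ _ _ (isInsertion_star b r).σ_mem_gr t

/-- `φ` intertwines the insertions of a new variable with the maps that give the homology of
`⋀ t̃` of `A ⊔ {*}`. -/
theorem phi_insertStar [Finite A] (p : Option A × Bool) {x : FreeBV un A}
    (hx : x ∈ multilinear un A) : phi (insertStar p x) = double p (phi x) := by
  refine multilinear_ext (f := phi.comp (insertStar p)) (g := (double p).comp phi)
    (fun t ht => ?_) hx
  rw [LinearMap.comp_apply, LinearMap.comp_apply, double_apply]
  obtain ⟨_ | b, r⟩ := p
  · rw [insertStar_none, phi_fmul, phi_star, ren_mk, phi_mk, phi_renT (f := attach none) t _ ht.1]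
    · simp only [tStar, Option.elim_none, mul_one]
    · refine fun a _ => ⟨some a, rfl, ?_⟩
      ext (_ | c) <;> simp [mem_fiber, attach]
  · rw [insertStar_some, (isInsertion_star b r).phi_derT t (ht.2 b) ht.1, plugStar, if_pos rfl,
      ← fbr_mk, phi_fbr (mk_mem_wt _) (mk_mem_wt _), phi_star, phi_mk, phi_mk, vars_star, vars,
      pairSum_singleton, phiT, one_mul, mul_assoc]
    rfl

/-! ### Multilinear expressions in one more variable -/

/-- The inclusion of the expressions not containing the new variable. -/
noncomputable abbrev inc : FreeBV un A →ₗ[ℚ] FreeBV un (Option A) := ren fun a => some (some a)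

theorem renT_keepStar {b : A} {t : BVExpr un A} (h : b ∉ vars t) :
    renT (keepStar b) t = inc (mk t) := by
  rw [ren_mk]
  induction t with
  | one h => rfl
  | var a =>
    have : a ≠ b := fun e => h (e ▸ Multiset.mem_singleton_self a)
    rw [renT, keepStar, if_neg this]; rfl
  | mul x y hx hy =>
    rw [vars, Multiset.mem_add, not_or] at h
    rw [renT, renT, hx h.1, hy h.2]
  | br x y hx hy =>
    rw [vars, Multiset.mem_add, not_or] at h
    rw [renT, renT, hx h.1, hy h.2]
  | del x hx => rw [renT, renT, hx h]

theorem inc_mem_gr (s : BVExpr un A) : inc (mk s) ∈ gr un (Option A) (deg s) :=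
  ren_mem_gr _ (mk_mem_gr s)

theorem smul_neg_one_pow_mem_iff {M : Type*} [AddCommGroup M] [Module ℚ M] (N : Submodule ℚ M)
    (n : ℕ) (x : M) : (-1 : ℚ) ^ n • x ∈ N ↔ x ∈ N :=
  N.smul_mem_iff (pow_ne_zero n (by norm_num))

theorem fdel_star_true : fdel (mk (star un A true)) = 0 := by
  change fdel (mk (del (var none))) = 0
  rw [← fdel_mk, fdel_fdel]

theorem fdel_star_false : fdel (mk (star un A false)) = mk (star un A true) := fdel_mk _

/-- The variables of an expression other than the new one. -/
def oldVars (t : BVExpr un (Option A)) : Multiset A := (vars t).filterMap id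

theorem mem_oldVars {t : BVExpr un (Option A)} {a : A} : a ∈ oldVars t ↔ some a ∈ vars t := by
  simp [oldVars, Multiset.mem_filterMap]

theorem nodup_oldVars {t : BVExpr un (Option A)} (h : t.vars.Nodup) : (oldVars t).Nodup :=
  h.filterMap _ fun a a' b hb hb' => by
    simp only [id, Option.mem_def] at hb hb'
    rw [hb, hb']

theorem disjoint_oldVars {x y : BVExpr un (Option A)} (h : Disjoint (vars x) (vars y)) :
    Disjoint (oldVars x) (oldVars y) :=
  Multiset.disjoint_left.mpr fun ha hb =>
    Multiset.disjoint_left.mp h (mem_oldVars.mp ha) (mem_oldVars.mp hb)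

theorem exists_eq_inc (t : BVExpr un (Option A)) (h : none ∉ vars t) :
    ∃ s : BVExpr un A, vars s = oldVars t ∧ mk t = inc (mk s) := by
  induction t with
  | one h1 => exact ⟨one h1, rfl, (ren_mk _ (one h1)).symm⟩
  | var a =>
    cases a with
    | none => exact absurd (Multiset.mem_singleton_self _) h
    | some a => exact ⟨var a, rfl, (ren_mk (fun a => some (some a)) (var a)).symm⟩
  | mul x y hx hy =>
    rw [vars, Multiset.mem_add, not_or] at h
    obtain ⟨s, hs, hs'⟩ := hx h.1
    obtain ⟨t, ht, ht'⟩ := hy h.2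
    refine ⟨mul s t, ?_, ?_⟩
    · rw [vars, hs, ht, oldVars, oldVars, oldVars, vars, Multiset.filterMap_add]
    · rw [← fmul_mk, ← fmul_mk, ren_fmul, hs', ht']
  | br x y hx hy =>
    rw [vars, Multiset.mem_add, not_or] at h
    obtain ⟨s, hs, hs'⟩ := hx h.1
    obtain ⟨t, ht, ht'⟩ := hy h.2
    refine ⟨br s t, ?_, ?_⟩
    · rw [vars, hs, ht, oldVars, oldVars, oldVars, vars, Multiset.filterMap_add]
    · rw [← fbr_mk, ← fbr_mk, ren_fbr, hs', ht']
  | del x hx =>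
    obtain ⟨s, hs, hs'⟩ := hx h
    exact ⟨del s, hs, by rw [← fdel_mk, ← fdel_mk, ren_fdel, hs']⟩

/-- The span of the results of substituting `[b, *]` or `[b, Δ *]` for a variable `b` in the
expressions with variables `m`. -/
noncomputable def bracketSpan [Finite A] (un : Bool) (m : Multiset A) :
    Submodule ℚ (FreeBV un (Option A)) :=
  Submodule.span ℚ {x | ∃ b ∈ m, ∃ r t, vars t = m ∧ x = insertStar (some b, r) (mk t)}

section

variable [Finite A] {m : Multiset A}

theorem insertStar_mem_bracketSpan {b : A} (r : Bool) {t : BVExpr un A} (h : b ∈ vars t) :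
    insertStar (some b, r) (mk t) ∈ bracketSpan un (vars t) :=
  Submodule.subset_span ⟨b, h, r, t, rfl, rfl⟩

theorem bracketSpan_le {N : Submodule ℚ (FreeBV un (Option A))}
    (h : ∀ b r t, vars t = m → b ∈ vars t → insertStar (some b, r) (mk t) ∈ N) :
    bracketSpan un m ≤ N :=
  Submodule.span_le.mpr (by rintro _ ⟨b, hb, r, t, rfl, rfl⟩; exact h b r t rfl hb)

theorem fmul_mem_bracketSpan {s : BVExpr un A} (h : Disjoint (vars s) m)
    {y : FreeBV un (Option A)} (hy : y ∈ bracketSpan un m) :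
    fmul (inc (mk s)) y ∈ bracketSpan un (vars s + m) := by
  refine bracketSpan_le (N := (bracketSpan un (vars s + m)).comap (fmul (inc (mk s))))
    (fun b r t ht hb => ?_) hy
  subst ht
  have hs : b ∉ vars s := fun hs => Multiset.disjoint_left.mp h hs hb
  have := insertStar_mem_bracketSpan r (t := mul s t) (Multiset.mem_add.mpr (.inr hb))
  rwa [insertStar_some, (isInsertion_star b r).derT_fmul_right hs, renT_keepStar hs,
    ← insertStar_some] at this

theorem mul_fmul_mem_bracketSpan {s : BVExpr un A} (h : Disjoint (vars s) m)
    {y : FreeBV un (Option A)} (hy : y ∈ bracketSpan un m) :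
    fmul y (inc (mk s)) ∈ bracketSpan un (m + vars s) := by
  refine bracketSpan_le (N := (bracketSpan un (m + vars s)).comap (fmul.flip (inc (mk s))))
    (fun b r t ht hb => ?_) hy
  subst ht
  have hs : b ∉ vars s := fun hs => Multiset.disjoint_left.mp h hs hb
  have := insertStar_mem_bracketSpan r (t := mul t s) (Multiset.mem_add.mpr (.inl hb))
  rwa [insertStar_some, (isInsertion_star b r).derT_fmul_left hs, renT_keepStar hs,
    ← insertStar_some, smul_neg_one_pow_mem_iff] at this

theorem fbr_mem_bracketSpan {s : BVExpr un A} (h : Disjoint (vars s) m)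
    {y : FreeBV un (Option A)} (hy : y ∈ bracketSpan un m) :
    fbr (inc (mk s)) y ∈ bracketSpan un (vars s + m) := by
  refine bracketSpan_le (N := (bracketSpan un (vars s + m)).comap (fbr (inc (mk s))))
    (fun b r t ht hb => ?_) hy
  subst ht
  have hs : b ∉ vars s := fun hs => Multiset.disjoint_left.mp h hs hb
  have := insertStar_mem_bracketSpan r (t := br s t) (Multiset.mem_add.mpr (.inr hb))
  rwa [insertStar_some, (isInsertion_star b r).derT_fbr_right hs, renT_keepStar hs,
    ← insertStar_some] at this

theorem fdel_mem_bracketSpan {y : FreeBV un (Option A)} (hy : y ∈ bracketSpan un m) :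
    fdel y ∈ bracketSpan un m := by
  refine bracketSpan_le (N := (bracketSpan un m).comap fdel) (fun b r t ht hb => ?_) hy
  subst ht
  have := insertStar_mem_bracketSpan r (t := del t) hb
  rwa [insertStar_some, derT, ← insertStar_some] at this

/-- Brackets with `*` or `Δ *` are derivations: they replace one variable after the other by its
bracket with `*` or `Δ *`. -/
theorem fbr_star_mem_bracketSpan {s : BVExpr un A} (hs : s.vars.Nodup) (r : Bool) :
    fbr (inc (mk s)) (mk (star un A r)) ∈ bracketSpan un (vars s) := by
  have hr := mk_mem_gr (star un A r)
  induction s generalizing r with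
  | one h =>
    rw [ren_mk, renT, fbr_one]
    exact zero_mem _
  | var a =>
    have := insertStar_mem_bracketSpan r (t := (var a : BVExpr un A)) (Multiset.mem_singleton_self a)
    rw [insertStar_some, derT, plugStar, if_pos rfl] at this
    rwa [ren_mk, renT, Option.elim_some, fbr_mk]
  | mul x y hx hy =>
    rw [vars, Multiset.nodup_add] at hs
    rw [← fmul_mk, ren_fmul, fbr_skew (fmul_mem_gr (inc_mem_gr x) (inc_mem_gr y)) hr, neg_mem_iff,
      smul_neg_one_pow_mem_iff, fleibniz hr (inc_mem_gr x), fbr_skew hr (inc_mem_gr x),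
      fbr_skew hr (inc_mem_gr y), map_neg, map_neg, map_smul, map_smul, vars]
    refine add_mem ?_ ((smul_neg_one_pow_mem_iff _ _ _).mpr (neg_mem
      ((smul_neg_one_pow_mem_iff _ _ _).mpr (fmul_mem_bracketSpan hs.2.2 (hy hs.2.1 r hr)))))
    rw [LinearMap.neg_apply, LinearMap.smul_apply, neg_mem_iff, smul_neg_one_pow_mem_iff]
    exact mul_fmul_mem_bracketSpan hs.2.2.symm (hx hs.1 r hr)
  | br x y hx hy =>
    rw [vars, Multiset.nodup_add] at hs
    have := fjacobi (inc_mem_gr x) (inc_mem_gr y) (mk (star un A r))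
    rw [← fbr_mk, ren_fbr, ← sub_eq_of_eq_add this, vars]
    refine sub_mem (fbr_mem_bracketSpan hs.2.2 (hy hs.2.1 r hr))
      ((smul_neg_one_pow_mem_iff _ _ _).mpr ?_)
    rw [add_comm]
    exact fbr_mem_bracketSpan hs.2.2.symm (hx hs.1 r hr)
  | del x hx =>
    have := fdel_fbr (inc_mem_gr x) (mk (star un A r))
    rw [← fdel_mk, ren_fdel, sub_eq_iff_eq_add.mp this.symm]
    refine add_mem (fdel_mem_bracketSpan (hx hs r hr)) ((smul_neg_one_pow_mem_iff _ _ _).mpr ?_)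
    cases r
    · rw [fdel_star_false]
      exact hx hs true (mk_mem_gr _)
    · rw [fdel_star_true, map_zero]
      exact zero_mem _

/-- The span of the results of inserting the new variable into the expressions with
variables `m`, including `*` and `Δ *` themselves if `m` is empty. -/
noncomputable def insertSpan (un : Bool) (m : Multiset A) :
    Submodule ℚ (FreeBV un (Option A)) :=
  bracketSpan un m ⊔ Submodule.span ℚ
    ({x | ∃ r s, vars s = m ∧ x = fmul (inc (mk s)) (mk (star un A r))} ∪
      {x | m = 0 ∧ ∃ r, x = mk (star un A r)})

theorem bracketSpan_le_insertSpan : bracketSpan un m ≤ insertSpan un m := le_sup_left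

theorem fmul_star_mem_insertSpan (s : BVExpr un A) (r : Bool) :
    fmul (inc (mk s)) (mk (star un A r)) ∈ insertSpan un (vars s) :=
  Submodule.mem_sup_right (Submodule.subset_span (.inl ⟨r, s, rfl, rfl⟩))

theorem star_mem_insertSpan (r : Bool) : mk (star un A r) ∈ insertSpan un (0 : Multiset A) :=
  Submodule.mem_sup_right (Submodule.subset_span (.inr ⟨rfl, r, rfl⟩))

theorem insertSpan_le {N : Submodule ℚ (FreeBV un (Option A))} (h : bracketSpan un m ≤ N)
    (hs : ∀ s r, vars s = m → fmul (inc (mk s)) (mk (star un A r)) ∈ N)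
    (h0 : ∀ r, m = 0 → mk (star un A r) ∈ N) : insertSpan un m ≤ N :=
  sup_le h (Submodule.span_le.mpr (by
    rintro _ (⟨r, s, hm, rfl⟩ | ⟨hm, r, rfl⟩)
    · exact hs s r hm
    · exact h0 r hm))

theorem fmul_mem_insertSpan {s : BVExpr un A} (h : Disjoint (vars s) m)
    {y : FreeBV un (Option A)} (hy : y ∈ insertSpan un m) :
    fmul (inc (mk s)) y ∈ insertSpan un (vars s + m) := by
  refine insertSpan_le (N := (insertSpan un (vars s + m)).comap (fmul (inc (mk s))))
    (fun y hy => bracketSpan_le_insertSpan (fmul_mem_bracketSpan h hy)) ?_ ?_ hy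
  · rintro t r rfl
    rw [Submodule.mem_comap, ← fmul_assoc, ← ren_fmul, fmul_mk]
    exact fmul_star_mem_insertSpan (mul s t) r
  · rintro r rfl
    rw [Submodule.mem_comap, add_zero]
    exact fmul_star_mem_insertSpan s r

theorem fbr_mem_insertSpan {s : BVExpr un A} (hs : s.vars.Nodup) (h : Disjoint (vars s) m)
    {y : FreeBV un (Option A)} (hy : y ∈ insertSpan un m) :
    fbr (inc (mk s)) y ∈ insertSpan un (vars s + m) := by
  refine insertSpan_le (N := (insertSpan un (vars s + m)).comap (fbr (inc (mk s))))
    (fun y hy => bracketSpan_le_insertSpan (fbr_mem_bracketSpan h hy)) ?_ ?_ hy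
  · rintro t r rfl
    rw [Submodule.mem_comap, fleibniz (inc_mem_gr s) (inc_mem_gr t), ← ren_fbr, fbr_mk]
    refine add_mem (fmul_star_mem_insertSpan (br s t) r)
      ((smul_neg_one_pow_mem_iff _ _ _).mpr (bracketSpan_le_insertSpan ?_))
    rw [add_comm]
    exact fmul_mem_bracketSpan h.symm (fbr_star_mem_bracketSpan hs r)
  · rintro r rfl
    rw [Submodule.mem_comap, add_zero]
    exact bracketSpan_le_insertSpan (fbr_star_mem_bracketSpan hs r)

theorem fdel_mem_insertSpan (hm : m.Nodup) {y : FreeBV un (Option A)} (hy : y ∈ insertSpan un m) :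
    fdel y ∈ insertSpan un m := by
  refine insertSpan_le (N := (insertSpan un m).comap fdel)
    (fun y hy => bracketSpan_le_insertSpan (fdel_mem_bracketSpan hy)) ?_ ?_ hy
  · rintro s r rfl
    -- the definition of the bracket expresses `Δ (x *)` through `[x, *]`, `(Δ x) *` and `x (Δ *)`
    have h1 : fdel (fmul (inc (mk s)) (mk (star un A r))) =
        (-1 : ℚ) ^ deg s • fbr (inc (mk s)) (mk (star un A r)) +
        fmul (inc (mk (del s))) (mk (star un A r)) +
        (-1 : ℚ) ^ deg s • fmul (inc (mk s)) (fdel (mk (star un A r))) := by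
      rw [fbr_eq (inc_mem_gr s), ← fdel_mk, ren_fdel]
      rcases neg_one_pow_eq_or ℚ (deg s) with hi | hi <;> rw [hi] <;> module
    rw [Submodule.mem_comap, h1]
    refine add_mem (add_mem ((smul_neg_one_pow_mem_iff _ _ _).mpr (bracketSpan_le_insertSpan
      (fbr_star_mem_bracketSpan hm r))) (fmul_star_mem_insertSpan (del s) r))
      ((smul_neg_one_pow_mem_iff _ _ _).mpr ?_)
    cases r
    · rw [fdel_star_false]; exact fmul_star_mem_insertSpan s true
    · rw [fdel_star_true, map_zero]; exact zero_mem _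
  · rintro r rfl
    rw [Submodule.mem_comap]
    cases r
    · rw [fdel_star_false]; exact star_mem_insertSpan true
    · rw [fdel_star_true]; exact zero_mem _

/-- Every expression with pairwise different variables, among them the new one, is a combination of
results of inserting the new variable into expressions without it. -/
theorem mk_mem_insertSpan (t : BVExpr un (Option A)) (ht : t.vars.Nodup) (h : none ∈ vars t) :
    mk t ∈ insertSpan un (oldVars t) := by
  have hadd : ∀ x y : BVExpr un (Option A), (vars x + vars y).filterMap id =
      oldVars x + oldVars y := fun x y => Multiset.filterMap_add _ _ _
  induction t with
  | one h' => exact absurd h (Multiset.notMem_zero _)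
  | var a =>
    obtain rfl : none = a := Multiset.mem_singleton.mp h
    exact star_mem_insertSpan false
  | mul x y hx hy =>
    rw [vars, Multiset.nodup_add] at ht
    rw [oldVars, vars, hadd]
    by_cases hay : none ∈ y.vars
    · have hax : none ∉ x.vars := fun hax => Multiset.disjoint_left.mp ht.2.2 hax hay
      obtain ⟨s, hs, hs'⟩ := exists_eq_inc x hax
      rw [← fmul_mk, hs', ← hs]
      exact fmul_mem_insertSpan (hs ▸ disjoint_oldVars ht.2.2) (hy ht.2.1 hay)
    · have hax : none ∈ x.vars := (Multiset.mem_add.mp h).resolve_right hay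
      obtain ⟨s, hs, hs'⟩ := exists_eq_inc y hay
      rw [← fmul_mk, fmul_comm (mk_mem_gr x) (mk_mem_gr y), smul_neg_one_pow_mem_iff, hs', ← hs,
        add_comm]
      exact fmul_mem_insertSpan (hs ▸ disjoint_oldVars ht.2.2.symm) (hx ht.1 hax)
  | br x y hx hy =>
    rw [vars, Multiset.nodup_add] at ht
    rw [oldVars, vars, hadd]
    by_cases hay : none ∈ y.vars
    · have hax : none ∉ x.vars := fun hax => Multiset.disjoint_left.mp ht.2.2 hax hay
      obtain ⟨s, hs, hs'⟩ := exists_eq_inc x hax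
      rw [← fbr_mk, hs', ← hs]
      exact fbr_mem_insertSpan (hs ▸ nodup_oldVars ht.1) (hs ▸ disjoint_oldVars ht.2.2)
        (hy ht.2.1 hay)
    · have hax : none ∈ x.vars := (Multiset.mem_add.mp h).resolve_right hay
      obtain ⟨s, hs, hs'⟩ := exists_eq_inc y hay
      rw [← fbr_mk, fbr_skew (mk_mem_gr x) (mk_mem_gr y), neg_mem_iff, smul_neg_one_pow_mem_iff,
        hs', ← hs, add_comm]
      exact fbr_mem_insertSpan (hs ▸ nodup_oldVars ht.2.1) (hs ▸ disjoint_oldVars ht.2.2.symm)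
        (hx ht.1 hax)
  | del x hx =>
    rw [← fdel_mk]
    exact fdel_mem_insertSpan (nodup_oldVars ht) (hx ht h)

end

/-- The multilinear expressions in `A ⊔ {*}` are obtained by inserting `*` into those in `A`, unless
there are none of the latter (for `A` empty, in the absence of a unit). -/
theorem exists_eq_sum_insertStar [Fintype A] (h : un = true ∨ Nonempty A)
    {x : FreeBV un (Option A)} (hx : x ∈ multilinear un (Option A)) :
    ∃ w : Option A × Bool → multilinear un A, x = ∑ p, insertStar p (w p).1 := by
  classical
  let F : (Option A × Bool → multilinear un A) →ₗ[ℚ] FreeBV un (Option A) :=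
    LinearMap.lsum ℚ (fun _ => multilinear un A) ℚ fun p =>
      (insertStar p).comp (multilinear un A).subtype
  have hF : ∀ p t, t.IsMultilinear → insertStar p (mk t) ∈ LinearMap.range F := fun p t ht =>
    ⟨Pi.single p ⟨mk t, Submodule.subset_span ⟨t, ht, rfl⟩⟩, LinearMap.lsum_piSingle _ _ _ _ _ _⟩
  have key : multilinear un (Option A) ≤ LinearMap.range F := by
    refine Submodule.span_le.mpr ?_
    rintro _ ⟨t, ht, rfl⟩
    have hm : ∀ s : BVExpr un A, vars s = oldVars t → s.IsMultilinear := fun s hs => by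
      rw [IsMultilinear, hs]
      exact ⟨nodup_oldVars ht.1, fun a => mem_oldVars.mpr (ht.2 _)⟩
    refine insertSpan_le ?_ ?_ ?_ (mk_mem_insertSpan t ht.1 (ht.2 none))
    · exact bracketSpan_le fun b r s hs _ => hF (some b, r) s (hm s hs)
    · exact fun s r hs => hF (none, r) s (hm s hs)
    · intro r h0
      have hun : un = true := h.resolve_right fun ⟨a⟩ => by
        have := mem_oldVars.mpr (ht.2 (some a))
        rw [h0] at this
        exact Multiset.notMem_zero _ this
      have := hF (none, r) (one hun) (hm _ h0.symm)
      rwa [insertStar_none, ren_mk, renT, fone_mul] at this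
  obtain ⟨w, rfl⟩ := key hx
  exact ⟨w, by simp only [F, LinearMap.lsum_apply, LinearMap.sum_apply]; rfl⟩

end FreeBV

namespace FreeBV

open BVExpr DK

variable {un : Bool} {A B : Type u}

theorem mem_pull [Finite B] {f : B → Option A} {m : Multiset A} {c : B} :
    c ∈ pull f m ↔ ∃ a ∈ m, f c = some a := by
  simp [pull, Multiset.mem_bind, mem_fiber]

theorem nodup_pull [Finite B] (f : B → Option A) {m : Multiset A} (h : m.Nodup) :
    (pull f m).Nodup :=
  Multiset.nodup_bind.mpr ⟨fun _ _ => Finset.nodup _, h.pairwise fun _ _ _ _ hab =>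
    Multiset.disjoint_left.mpr fun hx hy => ne_of_mem_fiber hab hx hy rfl⟩

theorem wt_le_multilinear {m : Multiset A} (h : m.Nodup) (h' : ∀ a, a ∈ m) :
    wt un m ≤ multilinear un A :=
  wt_le fun t ht => Submodule.subset_span ⟨t, by subst ht; exact ⟨h, h'⟩, rfl⟩

theorem insertStar_mem_multilinear [Finite A] (p : Option A × Bool) {x : FreeBV un A}
    (hx : x ∈ multilinear un A) : insertStar p x ∈ multilinear un (Option A) := by
  have : multilinear un A ≤ (multilinear un (Option A)).comap (insertStar p) := by
    refine Submodule.span_le.mpr ?_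
    rintro _ ⟨t, ht, rfl⟩
    rw [SetLike.mem_coe, Submodule.mem_comap]
    obtain ⟨_ | b, r⟩ := p
    · rw [insertStar_none, ren_mk_some, fmul_mk]
      refine Submodule.subset_span ⟨_, ?_, rfl⟩
      rw [Set.mem_ofPred_eq, IsMultilinear, vars, vars_star, vars_rename]
      refine ⟨Multiset.nodup_add.mpr ⟨ht.1.map (Option.some_injective _),
        Multiset.nodup_singleton _, by simp⟩, ?_⟩
      rintro (_ | a)
      · simp
      · simp [ht.2 a]
    · rw [insertStar_some]
      refine wt_le_multilinear (nodup_pull _ ht.1) (fun c => mem_pull.mpr ?_)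
        ((isInsertion_star b r).derT_mem_wt t (ht.2 b) ht.1)
      cases c with
      | none => exact ⟨b, ht.2 b, rfl⟩
      | some a => exact ⟨a, ht.2 a, rfl⟩
  exact this hx

/-! ### The cycles of `⋀ t̃` -/

/-- The values of `φ` on multilinear expressions represent every homology class of `⋀ t̃_A` exactly
once. -/
def Represents (un : Bool) (A : Type u) : Prop :=
  (∀ z : ExteriorAlgebra ℚ (DK A), CE.d _ z = 0 →
    ∃ x ∈ multilinear un A, ∃ y, z = phi x + CE.d _ y) ∧
  ∀ x ∈ multilinear un A, ∀ y, phi x = CE.d _ y → x = 0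

theorem eq_zero_of_isEmpty [IsEmpty A] (x : DK A) : x = 0 := by
  have : (LieHom.id : DK A →ₗ⁅ℚ⁆ DK A) = 0 := hom_ext (fun a => isEmptyElim a) fun a => isEmptyElim a
  exact LieHom.congr_fun this x

theorem exists_algebraMap_of_isEmpty [IsEmpty A] (w : ExteriorAlgebra ℚ (DK A)) :
    ∃ c : ℚ, w = algebraMap ℚ _ c := by
  induction w using CE.induction with
  | hr r => exact ⟨r, rfl⟩
  | ha v w hv hw =>
    obtain ⟨c, rfl⟩ := hv
    obtain ⟨c', rfl⟩ := hw
    exact ⟨c + c', (map_add _ _ _).symm⟩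
  | hm x w _ => exact ⟨0, by rw [eq_zero_of_isEmpty x, map_zero, zero_mul, map_zero]⟩

theorem d_of_isEmpty [IsEmpty A] (w : ExteriorAlgebra ℚ (DK A)) : CE.d _ w = 0 := by
  obtain ⟨c, rfl⟩ := exists_algebraMap_of_isEmpty w
  exact CE.d_algebraMap c

theorem fdel_one (h : un = true) : fdel (mk (one h) : FreeBV un A) = 0 := by
  have h0 : (mk (one h) : FreeBV un A) ∈ gr un A 0 := mk_mem_gr (one h)
  have h1 := fbr_eq h0 (mk (one h))
  rw [fbr_one, pow_zero, one_smul, one_smul, fone_mul, fone_mul,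
    fmul_comm (fdel_mem_gr h0) h0, fone_mul, Nat.mul_zero, pow_zero, one_smul, sub_self,
    zero_sub, zero_eq_neg] at h1
  exact h1

theorem exists_smul_one [IsEmpty A] (h : un = true) {x : FreeBV un A} :
    ∃ c : ℚ, x = c • mk (one h) := by
  suffices H : ∀ t : BVExpr un A, mk t ∈ Submodule.span ℚ {(mk (one h) : FreeBV un A)} by
    have : x ∈ Submodule.span ℚ {(mk (one h) : FreeBV un A)} :=
      induction (P := fun x => x ∈ Submodule.span ℚ {(mk (one h) : FreeBV un A)}) (zero_mem _)
        (fun _ _ => add_mem) (fun c _ => Submodule.smul_mem _ c) H x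
    obtain ⟨c, hc⟩ := Submodule.mem_span_singleton.mp this
    exact ⟨c, hc.symm⟩
  intro t
  induction t with
  | one h' => exact Submodule.mem_span_singleton_self _
  | var a => exact isEmptyElim a
  | mul x y hx hy =>
    obtain ⟨c, hc⟩ := Submodule.mem_span_singleton.mp hx
    rw [← fmul_mk, ← hc, map_smul, LinearMap.smul_apply, fone_mul]
    exact Submodule.smul_mem _ c hy
  | br x y hx hy =>
    obtain ⟨c, hc⟩ := Submodule.mem_span_singleton.mp hx
    rw [← fbr_mk, ← hc, map_smul, LinearMap.smul_apply, fbr_one, smul_zero]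
    exact zero_mem _
  | del x hx =>
    obtain ⟨c, hc⟩ := Submodule.mem_span_singleton.mp hx
    rw [← fdel_mk, ← hc, map_smul, fdel_one, smul_zero]
    exact zero_mem _

theorem vars_ne_zero (h : un = false) (t : BVExpr un A) : vars t ≠ 0 := by
  induction t with
  | one h' => exact absurd (h.symm.trans h') Bool.false_ne_true
  | var a => exact Multiset.singleton_ne_zero a
  | mul x y hx _ => exact fun e => hx (add_eq_zero.mp e).1
  | br x y hx _ => exact fun e => hx (add_eq_zero.mp e).1
  | del x hx => exact hx

theorem exists_eq_sum_star [IsEmpty A] (h : un = false) {x : FreeBV un (Option A)}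
    (hx : x ∈ multilinear un (Option A)) : ∃ c : Bool → ℚ, x = ∑ r, c r • mk (star un A r) := by
  have key : multilinear un (Option A) ≤ Submodule.span ℚ (Set.range fun r => mk (star un A r)) := by
    refine Submodule.span_le.mpr ?_
    rintro _ ⟨t, ht, rfl⟩
    refine insertSpan_le ?_ ?_ ?_ (mk_mem_insertSpan t ht.1 (ht.2 none))
    · exact bracketSpan_le fun b => isEmptyElim b
    · intro s
      exact absurd (Multiset.eq_zero_of_forall_notMem fun a => isEmptyElim a) (vars_ne_zero h s)
    · exact fun r _ => Submodule.subset_span ⟨r, rfl⟩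
  obtain ⟨c, hc⟩ := (Submodule.mem_span_range_iff_exists_fun ℚ).mp (key hx)
  exact ⟨c, hc.symm⟩

theorem multilinear_of_isEmpty [IsEmpty A] (h : un = false) {x : FreeBV un A}
    (hx : x ∈ multilinear un A) : x = 0 := by
  have : {t : BVExpr un A | t.IsMultilinear} = ∅ := Set.eq_empty_of_forall_notMem fun t _ =>
    vars_ne_zero h t (Multiset.eq_zero_of_forall_notMem fun a => isEmptyElim a)
  rwa [multilinear, this, Set.image_empty, Submodule.span_empty, Submodule.mem_bot] at hx

theorem isMultilinear_star [IsEmpty A] (r : Bool) : (star un A r).IsMultilinear := by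
  rw [IsMultilinear, vars_star]
  refine ⟨Multiset.nodup_singleton _, ?_⟩
  rintro (_ | a)
  · exact Multiset.mem_singleton_self _
  · exact isEmptyElim a

theorem Represents.of_isEmpty [IsEmpty A] (h : un = true) : Represents un A := by
  constructor
  · intro z _
    obtain ⟨c, rfl⟩ := exists_algebraMap_of_isEmpty z
    refine ⟨c • mk (one h), Submodule.smul_mem _ c (Submodule.subset_span ⟨one h, ?_, rfl⟩), 0, ?_⟩
    · exact ⟨Multiset.nodup_zero, fun a => isEmptyElim a⟩
    · rw [map_zero, add_zero, map_smul, phi_mk, phiT, Algebra.algebraMap_eq_smul_one]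
  · intro x _ y hy
    obtain ⟨c, rfl⟩ := exists_smul_one h (x := x)
    rw [d_of_isEmpty, map_smul, phi_mk, phiT, ← Algebra.algebraMap_eq_smul_one] at hy
    rw [(ExteriorAlgebra.algebraMap_eq_zero_iff _ _).mp hy, zero_smul]

theorem sum_double_of_isEmpty [IsEmpty A] [Fintype A] (c : Option A × Bool → ℚ) :
    ∑ p, double p (algebraMap ℚ (ExteriorAlgebra ℚ (DK A)) (c p)) =
      phi (∑ r, c (none, r) • mk (star un A r)) := by
  simp only [Fintype.sum_prod_type, Fintype.sum_option, Finset.univ_eq_empty, Finset.sum_empty,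
    add_zero, map_sum, map_smul, phi_star]
  refine Finset.sum_congr rfl fun r _ => ?_
  rw [double_apply, AlgHom.commutes, tStar, Option.elim_none, mul_one, Algebra.smul_def]

/-- Without unit, the induction starts with a single variable, where `⋀ t̃` is spanned by `1`
and `s`. -/
theorem Represents.option_of_isEmpty [IsEmpty A] (h : un = false) :
    Represents un (Option A) := by
  have := Fintype.ofIsEmpty (α := A)
  constructor
  · intro z hz
    obtain ⟨w, y, _, rfl⟩ := double_quasiIso.1 z hz
    choose c hc using fun p => exists_algebraMap_of_isEmpty (w p)
    refine ⟨∑ r, c (none, r) • mk (star un A r), sum_mem fun r _ => Submodule.smul_mem _ _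
      (Submodule.subset_span ⟨_, isMultilinear_star r, rfl⟩), y, ?_⟩
    rw [← sum_double_of_isEmpty]
    simp only [hc]
  · intro x hx y hy
    obtain ⟨c, rfl⟩ := exists_eq_sum_star h hx
    rw [← sum_double_of_isEmpty (c := fun p => c p.2)] at hy
    have h0 : ∀ r, c r = 0 := fun r => by
      obtain ⟨u, hu⟩ := double_quasiIso.2 _ y (fun p => CE.d_algebraMap _) hy (none, r)
      rw [d_of_isEmpty] at hu
      exact (ExteriorAlgebra.algebraMap_eq_zero_iff _ _).mp hu
    simp only [h0, zero_smul, Finset.sum_const_zero]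

theorem Represents.option [Fintype A] (h : un = true ∨ Nonempty A) (H : Represents un A) :
    Represents un (Option A) := by
  constructor
  · intro z hz
    obtain ⟨w, y, hw, rfl⟩ := double_quasiIso.1 z hz
    choose x hx u hu using fun p => H.1 (w p) (hw p)
    refine ⟨∑ p, insertStar p (x p), sum_mem fun p _ => insertStar_mem_multilinear p (hx p),
      ∑ p, double p (u p) + y, ?_⟩
    rw [map_sum, map_add, map_sum, ← add_assoc, ← Finset.sum_add_distrib]
    congr 1
    refine Finset.sum_congr rfl fun p _ => ?_
    rw [d_double, phi_insertStar p (hx p), ← map_add, ← hu]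
  · intro x hx y hy
    obtain ⟨w, rfl⟩ := exists_eq_sum_insertStar h hx
    have h1 : ∀ p, phi (insertStar p (w p).1) = double p (phi (w p).1) :=
      fun p => phi_insertStar p (w p).2
    rw [map_sum, Finset.sum_congr rfl fun p _ => h1 p] at hy
    refine Finset.sum_eq_zero fun p _ => ?_
    obtain ⟨u, hu⟩ := double_quasiIso.2 _ y (fun p => d_phi (w p).2) hy p
    rw [H.2 _ (w p).2 u hu, map_zero]

theorem Represents.of_equiv [Finite A] [Finite B] (e : A ≃ B) (H : Represents un A) :
    Represents un B := by
  have hd : ∀ {A B : Type u} [Finite B] (e : A ≃ B) (w : ExteriorAlgebra ℚ (DK A)),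
      wcable (fun b => some (e.symm b)) (CE.d _ w) =
        CE.d _ (wcable (fun b => some (e.symm b)) w) := fun e w => CE.map_d (relabel e) w
  have hc : ∀ {A B : Type u} [Finite A] [Finite B] (e : A ≃ B) (w : ExteriorAlgebra ℚ (DK B)),
      wcable (fun b => some (e.symm b)) (wcable (fun a => some (e a)) w) = w := by
    intro A B _ _ e w
    rw [wcable_bind]
    simp only [Option.bind_some, Equiv.apply_symm_apply]
    rw [wcable, cable_some]
    exact AlgHom.congr_fun ExteriorAlgebra.map_id w
  constructor
  · intro z hz
    obtain ⟨x, hx, y, h⟩ := H.1 (wcable (fun a => some (e a)) z) (by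
      have := hd e.symm z
      rw [hz, map_zero] at this
      exact this.symm)
    refine ⟨_, ren_mem_multilinear e hx, wcable (fun b => some (e.symm b)) y, ?_⟩
    rw [phi_relabel e hx, ← hd, ← map_add, ← h, hc]
  · intro x hx y hy
    have h1 := phi_relabel e.symm hx
    rw [hy, hd] at h1
    have h2 := H.2 _ (ren_mem_multilinear e.symm hx) _ h1
    have h3 := ren_ren (fun b => some (e.symm b)) (fun a => some (e a)) x
    simp only [Option.bind_some, Equiv.apply_symm_apply, ren_some, h2, map_zero] at h3
    exact h3.symm

/-- By induction on `A`. If `*` is added to `A`, the homology classes of `⋀ t̃` are represented by the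
values of the maps `double` on those for `A`; these are the values of `φ` on the insertions of `*`
into the multilinear expressions on `A`, and the latter span the multilinear expressions. -/
theorem represents (un : Bool) (A : Type u) [Finite A] (h : un = true ∨ Nonempty A) :
    Represents un A := by
  have key : Finite A → un = true ∨ Nonempty A → Represents un A := by
    refine Finite.induction_empty_option
      (P := fun A => Finite A → un = true ∨ Nonempty A → Represents un A) ?_ ?_ ?_ A
    · intro A B e H _ h
      have := Finite.of_equiv B e.symm
      exact Represents.of_equiv e (H this (h.imp_right fun ⟨b⟩ => ⟨e.symm b⟩))
    · intro _ h
      exact Represents.of_isEmpty (h.resolve_right fun ⟨a⟩ => isEmptyElim a)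
    · intro A _ H _ _
      by_cases h : un = true ∨ Nonempty A
      · exact Represents.option h (H inferInstance h)
      · rw [not_or, not_nonempty_iff] at h
        have := h.2
        exact Represents.option_of_isEmpty (Bool.eq_false_iff.mpr h.1)
  exact key inferInstance h

end FreeBV

/-! ### Quasi-isomorphisms in terms of elements -/

section

variable {S T : ShortComplex (ModuleCat.{u} ℚ)}

theorem exists_cycle (S : ShortComplex (ModuleCat.{u} ℚ)) (x : S.X₂) (h : S.g x = 0) :
    ∃ c : S.cycles, S.iCycles c = x :=
  ⟨S.moduleCatCyclesIso.inv (⟨x, h⟩ : LinearMap.ker S.g.hom),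
    S.moduleCatCyclesIso_inv_iCycles_apply _⟩

theorem iCycles_injective (S : ShortComplex (ModuleCat.{u} ℚ)) : Function.Injective S.iCycles :=
  (ModuleCat.mono_iff_injective _).mp inferInstance

theorem g_iCycles (c : S.cycles) : S.g (S.iCycles c) = 0 :=
  ConcreteCategory.congr_hom S.iCycles_g c

theorem homologyπ_surjective (S : ShortComplex (ModuleCat.{u} ℚ)) :
    Function.Surjective S.homologyπ :=
  (ModuleCat.epi_iff_surjective _).mp inferInstance

theorem homologyπ_eq_zero_iff (c : S.cycles) :
    S.homologyπ c = 0 ↔ ∃ y, S.iCycles c = S.f y := by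
  constructor
  · intro h
    have h1 := ConcreteCategory.congr_hom S.π_moduleCatCyclesIso_hom c
    rw [ConcreteCategory.comp_apply, h, map_zero, ConcreteCategory.comp_apply] at h1
    obtain ⟨y, hy⟩ := (Submodule.Quotient.mk_eq_zero _).mp h1.symm
    refine ⟨y, ?_⟩
    have h2 := ConcreteCategory.congr_hom S.moduleCatCyclesIso_hom_i c
    exact h2.symm.trans (congrArg Subtype.val hy).symm
  · rintro ⟨y, hy⟩
    have h1 : c = S.toCycles y := iCycles_injective S
      (hy.trans (ConcreteCategory.congr_hom S.toCycles_i y).symm)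
    rw [h1]
    exact ConcreteCategory.congr_hom S.toCycles_comp_homologyπ y

theorem shortComplex_quasiIso (φ : S ⟶ T)
    (hs : ∀ z : T.X₂, T.g z = 0 → ∃ x : S.X₂, S.g x = 0 ∧ ∃ y : T.X₁, z = φ.τ₂ x + T.f y)
    (hi : ∀ x : S.X₂, S.g x = 0 → ∀ y : T.X₁, φ.τ₂ x = T.f y → ∃ w : S.X₁, x = S.f w) :
    ShortComplex.QuasiIso φ := by
  have hn : ∀ c : S.cycles, ShortComplex.homologyMap φ (S.homologyπ c) =
      T.homologyπ (ShortComplex.cyclesMap φ c) := fun c =>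
    ConcreteCategory.congr_hom (ShortComplex.homologyπ_naturality φ) c
  have hc : ∀ c : S.cycles, T.iCycles (ShortComplex.cyclesMap φ c) = φ.τ₂ (S.iCycles c) := fun c =>
    ConcreteCategory.congr_hom (ShortComplex.cyclesMap_i φ) c
  rw [ShortComplex.quasiIso_iff, ConcreteCategory.isIso_iff_bijective]
  constructor
  · rw [injective_iff_map_eq_zero]
    intro a ha
    obtain ⟨c, rfl⟩ := homologyπ_surjective S a
    rw [hn, homologyπ_eq_zero_iff] at ha
    obtain ⟨y, hy⟩ := ha
    rw [hc] at hy
    exact (homologyπ_eq_zero_iff c).mpr (hi _ (g_iCycles c) y hy)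
  · intro b
    obtain ⟨c, rfl⟩ := homologyπ_surjective T b
    obtain ⟨x, hx, y, hy⟩ := hs _ (g_iCycles c)
    obtain ⟨c', rfl⟩ := exists_cycle S x hx
    refine ⟨S.homologyπ c', ?_⟩
    rw [hn, ← sub_eq_zero, ← map_sub, homologyπ_eq_zero_iff]
    refine ⟨-y, ?_⟩
    rw [map_sub, hc, hy, map_neg]
    abel

end

namespace DGSpace

variable {C D : DGSpace.{u}}

theorem le_others (C : DGSpace.{u}) {i n : ℕ} (h : i ≠ n) :
    C.gr i ≤ ⨆ i, ⨆ (_ : i ≠ n), C.gr i :=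
  le_iSup₂ (f := fun i (_ : i ≠ n) => C.gr i) i h

theorem exists_component (C : DGSpace.{u}) (n : ℕ) (x : C) :
    ∃ a ∈ C.gr n, ∃ b ∈ ⨆ i, ⨆ (_ : i ≠ n), C.gr i, x = a + b := by
  have h : C.gr n ⊔ ⨆ i, ⨆ (_ : i ≠ n), C.gr i = ⊤ := by
    rw [eq_top_iff, ← C.isInternal.submodule_iSup_eq_top]
    refine iSup_le fun i => ?_
    by_cases hi : i = n
    · rw [hi]; exact le_sup_left
    · exact (C.le_others hi).trans le_sup_right
  obtain ⟨a, ha, b, hb, e⟩ := Submodule.mem_sup.mp (h ▸ Submodule.mem_top : x ∈ _)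
  exact ⟨a, ha, b, hb, e.symm⟩

theorem eq_zero_of_mem_of_mem (C : DGSpace.{u}) {n : ℕ} {x : C} (h : x ∈ C.gr n)
    (h' : x ∈ ⨆ i, ⨆ (_ : i ≠ n), C.gr i) : x = 0 :=
  Submodule.disjoint_def.mp (iSupIndep_def.mp C.isInternal.submodule_iSupIndep n) x h h'

/-- A morphism from a complex with zero differential is a quasi-isomorphism if its values represent
each homology class exactly once; homogeneity comes for free. -/
theorem Hom.quasiIso (f : Hom C D) (hC : ∀ x, C.d x = 0)
    (hs : ∀ z, D.d z = 0 → ∃ x y, z = f x + D.d y)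
    (hi : ∀ x y, f x = D.d y → x = 0) : QuasiIso f.toChainMap := by
  have hs' : ∀ n, ∀ z ∈ D.gr n, D.d z = 0 → ∃ x ∈ C.gr n, ∃ y ∈ D.gr (n + 1), z = f x + D.d y := by
    intro n z hz h0
    obtain ⟨x, y, e⟩ := hs z h0
    obtain ⟨x1, hx1, x2, hx2, rfl⟩ := C.exists_component n x
    obtain ⟨y1, hy1, y2, hy2, rfl⟩ := D.exists_component (n + 1) y
    refine ⟨x1, hx1, y1, hy1, ?_⟩
    have h1 : f x2 ∈ ⨆ i, ⨆ (_ : i ≠ n), D.gr i := by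
      have : ⨆ i, ⨆ (_ : i ≠ n), C.gr i ≤ (⨆ i, ⨆ (_ : i ≠ n), D.gr i).comap f.toLin :=
        iSup₂_le fun i h x hx => D.le_others h (f.map_gr i x hx)
      exact this hx2
    have h2 : D.d y2 ∈ ⨆ i, ⨆ (_ : i ≠ n), D.gr i := by
      have : ⨆ i, ⨆ (_ : i ≠ n + 1), D.gr i ≤ (⨆ i, ⨆ (_ : i ≠ n), D.gr i).comap D.d := by
        refine iSup₂_le fun i h x hx => ?_
        rw [Submodule.mem_comap]
        cases i with
        | zero => rw [D.d_gr_zero x hx]; exact zero_mem _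
        | succ i => exact D.le_others (fun e => h (congrArg (· + 1) e)) (D.d_mem i x hx)
      exact this hy2
    have h3 : z - (f x1 + D.d y1) = f x2 + D.d y2 := by
      rw [e, map_add, map_add]; abel
    refine sub_eq_zero.mp (D.eq_zero_of_mem_of_mem (n := n)
      (sub_mem hz (add_mem (f.map_gr n x1 hx1) (D.d_mem n y1 hy1))) ?_)
    rw [h3]
    exact add_mem h1 h2
  have hd : ∀ (E : DGSpace.{u}) (n : ℕ) (x : E.gr (n + 1)),
      ((E.toChainComplex.d (n + 1) n).hom x : E.gr n) = ⟨E.d x.1, E.d_mem n x.1 x.2⟩ := by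
    intro E n x
    have : E.toChainComplex.d (n + 1) n = ModuleCat.ofHom (E.d.restrict (E.d_mem n)) := by
      simp only [toChainComplex, ChainComplex.of_d]
    rw [this]
    rfl
  have hg : ∀ {n k : ℕ} (x : C.gr n), (C.toChainComplex.d n k).hom x = 0 := by
    intro n k x
    by_cases h : k + 1 = n
    · subst h
      exact (hd C k x).trans (Subtype.ext (hC x.1))
    · rw [C.toChainComplex.shape n k h]
      rfl
  refine ⟨fun n => ?_⟩
  obtain ⟨k, hk⟩ : ∃ k, (ComplexShape.down ℕ).next n = k := ⟨_, rfl⟩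
  rw [quasiIsoAt_iff' _ (n + 1) n k (ChainComplex.prev ℕ n) hk]
  refine shortComplex_quasiIso _ ?_ ?_
  · intro z hz
    have hz' : D.d (z : D.gr n).1 = 0 := by
      cases n with
      | zero => exact D.d_gr_zero _ (z : D.gr 0).2
      | succ n =>
        obtain rfl : n = k := (ChainComplex.next_nat_succ n).symm.trans hk
        exact congrArg Subtype.val ((hd D n z).symm.trans hz)
    obtain ⟨x, hx, y, hy, e⟩ := hs' n _ (z : D.gr n).2 hz'
    refine ⟨(⟨x, hx⟩ : C.gr n), hg _, (⟨y, hy⟩ : D.gr (n + 1)), ?_⟩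
    refine Subtype.ext (e.trans ?_)
    exact congrArg (fun v => f x + v) (congrArg Subtype.val (hd D n ⟨y, hy⟩)).symm
  · intro x _ y hy
    have h1 : f (x : C.gr n).1 = D.d (y : D.gr (n + 1)).1 :=
      congrArg Subtype.val (hy.trans (hd D n y))
    exact ⟨0, (Subtype.ext (hi _ _ h1) : (x : C.gr n) = 0).trans (map_zero _).symm⟩

end DGSpace

/-! ### Uniqueness of `φ` -/

namespace BV

open FreeBV BVExpr DK

section

variable {un : Bool} {A B : Type u}

/-- The expression `q` or `Δ q`. -/
def oneOrDel (un : Bool) {B : Type u} (r : Bool) (q : B) : BVExpr un B :=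
  if r then del (var q) else var q

theorem vars_oneOrDel (r : Bool) (q : B) : vars (oneOrDel un r q) = {q} := by
  cases r <;> rfl

theorem rename_oneOrDel (f : A → B) (r : Bool) (q : A) :
    rename f (oneOrDel un r q) = oneOrDel un r (f q) := by
  cases r <;> rfl

theorem star_eq (r : Bool) : star un A r = oneOrDel un r none := rfl

theorem deg_oneOrDel (r : Bool) (q : A) (q' : B) :
    deg (oneOrDel un r q) = deg (oneOrDel un r q') := by
  cases r <;> rfl

/-- The labelling of `(A - {b}) ⊔ {p, q}` by `A ⊔ {*}` that sends `p` to `b` and `q` to `*`. -/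
noncomputable def insEquiv (b : A) {p q : B} (hpq : p ≠ q) (hB : ∀ x, x = p ∨ x = q) :
    Ins b B ≃ Option A :=
  open Classical in
  Equiv.ofBijective (Sum.elim (fun a => some a.1) fun x => if x = p then some b else none) (by
    constructor
    · rintro (⟨a, ha⟩ | x) (⟨a', ha'⟩ | x') h
      · simpa using h
      · by_cases hx : x' = p
        · simp [hx, ha] at h
        · simp [hx] at h
      · by_cases hx : x = p
        · simp [hx, Ne.symm ha'] at h
        · simp [hx] at h
      · rcases hB x with rfl | rfl <;> rcases hB x' with rfl | rfl <;> simp_all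
    · rintro (_ | a)
      · exact ⟨Sum.inr q, by simp [hpq.symm]⟩
      · by_cases h : a = b
        · exact ⟨Sum.inr p, by simp [h]⟩
        · exact ⟨Sum.inl ⟨a, h⟩, rfl⟩)

theorem insEquiv_p (b : A) {p q : B} (hpq : p ≠ q) (hB : ∀ x, x = p ∨ x = q) :
    insEquiv b hpq hB (Sum.inr p) = some b :=
  if_pos rfl

theorem insEquiv_q (b : A) {p q : B} (hpq : p ≠ q) (hB : ∀ x, x = p ∨ x = q) :
    insEquiv b hpq hB (Sum.inr q) = none :=
  if_neg hpq.symm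

theorem insEquiv_inl {a b : A} (h : a ≠ b) {p q : B} (hpq : p ≠ q) (hB : ∀ x, x = p ∨ x = q) :
    insEquiv b hpq hB (Sum.inl ⟨a, h⟩) = some a :=
  rfl

/-- The labelling of `{p, q} - {p} ⊔ A` by `A ⊔ {*}` that sends `q` to `*`. -/
noncomputable def insEquiv' (A : Type u) {p q : B} (hpq : p ≠ q) (hB : ∀ x, x = p ∨ x = q) :
    Ins p A ≃ Option A where
  toFun := Sum.elim (fun _ => none) some
  invFun o := o.elim (Sum.inl ⟨q, hpq.symm⟩) Sum.inr
  left_inv := by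
    rintro (⟨x, hx⟩ | a)
    · obtain rfl := (hB x).resolve_left hx
      rfl
    · rfl
  right_inv := by rintro (_ | a) <;> rfl

/-- Inserting `[b, *]` or `[b, Δ *]` for `b` is the operadic composition of an expression with
`[p, q]` or `[p, Δ q]`, up to the names of the variables. -/
theorem insertStar_some_eq [Finite A] (b : A) (r : Bool) {p q : B} (hpq : p ≠ q)
    (hB : ∀ x, x = p ∨ x = q) (x : FreeBV un A) :
    insertStar (some b, r) x = ren (fun c => some (insEquiv b hpq hB c))
      (FreeBV.comp b (mk (br (var p) (oneOrDel un r q))) x) := by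
  have hdeg : deg (br (var p) (oneOrDel un r q)) = deg (br (var (some b)) (star un A r)) := by
    rw [deg, deg, star_eq, deg_oneOrDel r q none]; rfl
  refine LinearMap.congr_fun (g := (ren fun c => some (insEquiv b hpq hB c)).comp
      (FreeBV.comp b (mk (br (var p) (oneOrDel un r q))))) (ext_all fun t => ?_) x
  rw [LinearMap.comp_apply, insertStar_some, comp_of_gr b (mk_mem_gr _), der_mk, ren_derT, hdeg]
  congr 1
  · funext a
    by_cases h : a = b
    · rw [h, keep_self, keepStar, if_pos rfl]; rfl
    · rw [keep_ne h, keepStar, if_neg h, Option.bind_some, insEquiv_inl]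
  · funext a
    by_cases h : a = b
    · rw [h, plug_self, plugStar, if_pos rfl, ren_ren, ren_mk, star_eq]
      simp only [Option.bind_some]
      rw [renT_some (fun c => insEquiv b hpq hB (Sum.inr c)), FreeBV.rename, FreeBV.rename,
        rename_oneOrDel, insEquiv_p, insEquiv_q]
    · rw [plug_ne h, plugStar, if_neg h, map_zero]

/-- Multiplication by `*` or `Δ *` is, up to sign, the operadic composition of `p q` or `p (Δ q)` with an
expression, up to the names of the variables. -/
theorem insertStar_none_eq [Finite A] (r : Bool) {p q : B} (hpq : p ≠ q)
    (hB : ∀ x, x = p ∨ x = q) (t : BVExpr un A) :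
    ren (fun c => some (insEquiv' A hpq hB c))
        (FreeBV.comp p (mk t) (mk (mul (var p) (oneOrDel un r q)))) =
      (-1 : ℚ) ^ (deg t * oddRight p (mul (var p) (oneOrDel un r q))) •
        insertStar (none, r) (mk t) := by
  rw [comp_mk_mk p _ t (Multiset.mem_add.mpr (.inl (Multiset.mem_singleton_self p))), map_smul,
    insertStar_none, substT, ← fmul_mk, ren_fmul, substT, dif_neg (not_not.mpr rfl),
    ← ren_mk_some, ren_ren]
  · congr 2
    have : substT p (rename Sum.inr t : BVExpr un (Ins p A)) (oneOrDel un r q) =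
        oneOrDel un r (Sum.inl ⟨q, hpq.symm⟩) := by
      cases r
      · exact dif_pos hpq.symm
      · exact congrArg del (dif_pos hpq.symm)
    rw [this, ren_mk_some, rename_oneOrDel]
    rfl
  · rw [vars, vars, vars_oneOrDel]
    simpa using hpq

variable (φ ψ : Operad.Hom (BV.{u} un) wedgeDK.{u})

/-- The elements on which two morphisms of operads agree. -/
def Agree [Finite A] (x : (BV un).obj A) : Prop := φ.app A x = ψ.app A x

variable {φ ψ}

theorem Agree.map [Finite A] [Finite B] (e : A ≃ B) {x : (BV un).obj A} (h : Agree φ ψ x) :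
    Agree φ ψ ((BV un).map e x) := by
  rw [Agree, φ.naturality, ψ.naturality, h]

theorem Agree.comp [Finite A] [Finite B] (a : A) {x : (BV un).obj A} {y : (BV un).obj B}
    (hx : Agree φ ψ x) (hy : Agree φ ψ y) : Agree φ ψ ((BV un).comp a x y) := by
  rw [Agree, φ.app_comp, ψ.app_comp, hx, hy]

theorem Agree.smul [Finite A] (c : ℚ) {x : (BV un).obj A} (h : Agree φ ψ x) :
    Agree φ ψ (c • x) := by
  rw [Agree, map_smul, map_smul, h]

theorem Agree.add [Finite A] {x y : (BV un).obj A} (h : Agree φ ψ x) (h' : Agree φ ψ y) :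
    Agree φ ψ (x + y) := by
  rw [Agree, map_add, map_add, h, h']

theorem Agree.sum [Finite A] {I : Type*} (s : Finset I) (x : I → (BV un).obj A)
    (h : ∀ i ∈ s, Agree φ ψ (x i)) : Agree φ ψ (∑ i ∈ s, x i) := by
  rw [Agree, map_sum, map_sum]
  exact Finset.sum_congr rfl h

theorem Agree.of_smul_neg_one [Finite A] {n : ℕ} {x : (BV un).obj A}
    (h : Agree φ ψ ((-1 : ℚ) ^ n • x)) : Agree φ ψ x := by
  have := h.smul ((-1 : ℚ) ^ n)
  rwa [smul_smul, ← mul_pow, neg_one_mul, neg_neg, one_pow, one_smul] at this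

theorem pair_oneOrDel_isMultilinear (op : BVExpr un B → BVExpr un B → BVExpr un B)
    (hop : ∀ x y, vars (op x y) = vars x + vars y) {p q : B} (hpq : p ≠ q)
    (hB : ∀ x, x = p ∨ x = q) (r : Bool) :
    (op (var p) (oneOrDel un r q)).IsMultilinear := by
  rw [IsMultilinear, hop, vars_oneOrDel]
  exact pair_isMultilinear hpq hB

/-- Two morphisms with the prescribed values on the generators agree on `p q` and `[p, q]`, and on
`p (Δ q)` and `[p, Δ q]`, which are compositions of generators. -/
theorem agree_pair (hφ : SendsGenerators φ) (hψ : SendsGenerators ψ) (r : Bool) :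
    ∃ (B : Type u) (_ : Finite B) (p q : B) (hpq : p ≠ q) (hB : ∀ x, x = p ∨ x = q),
      Agree φ ψ (ofExpr un (mul (var p) (oneOrDel un r q))
        (pair_oneOrDel_isMultilinear mul (fun _ _ => rfl) hpq hB r)) ∧
      Agree φ ψ (ofExpr un (br (var p) (oneOrDel un r q))
        (pair_oneOrDel_isMultilinear br (fun _ _ => rfl) hpq hB r)) := by
  have hpq : (⟨true⟩ : ULift.{u} Bool) ≠ ⟨false⟩ := fun h => Bool.noConfusion (congrArg ULift.down h)
  have hB : ∀ x : ULift.{u} Bool, x = ⟨true⟩ ∨ x = ⟨false⟩ := by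
    rintro ⟨_ | _⟩
    · exact .inr rfl
    · exact .inl rfl
  have h1 : Agree φ ψ (genMul un _ _ hpq hB) :=
    (hφ.1 _ _ _ hpq hB).1.trans (hψ.1 _ _ _ hpq hB).1.symm
  have h2 : Agree φ ψ (genBr un _ _ hpq hB) :=
    (hφ.1 _ _ _ hpq hB).2.trans (hψ.1 _ _ _ hpq hB).2.symm
  cases r
  · exact ⟨_, inferInstance, _, _, hpq, hB, h1, h2⟩
  · have h3 : Agree φ ψ (genDel un (PUnit.unit : PUnit.{u + 1}) fun _ => rfl) :=
      (hφ.2 _ _ _).trans (hψ.2 _ _ _).symm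
    have hl : (Sum.inl ⟨⟨true⟩, hpq⟩ : Ins (⟨false⟩ : ULift.{u} Bool) PUnit.{u + 1}) ≠
      Sum.inr PUnit.unit := Sum.inl_ne_inr
    have hl' : ∀ x : Ins (⟨false⟩ : ULift.{u} Bool) PUnit.{u + 1},
        x = Sum.inl ⟨⟨true⟩, hpq⟩ ∨ x = Sum.inr PUnit.unit := by
      rintro (⟨⟨_ | _⟩, hx⟩ | x)
      · exact absurd rfl hx
      · exact .inl rfl
      · exact .inr rfl
    have hm : (⟨false⟩ : ULift.{u} Bool) ∈ vars (mul (var ⟨true⟩) (var ⟨false⟩) :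
        BVExpr un (ULift.{u} Bool)) := by simp [vars]
    refine ⟨_, inferInstance, _, _, hl, hl', ?_, ?_⟩
    · have h := h1.comp ⟨false⟩ h3
      refine (congrArg (Agree φ ψ) (Subtype.ext ?_)).mp h
      refine (comp_mk_mk _ _ _ hm (pair_isMultilinear hpq hB).1).trans ?_
      have h0 : oddRight (⟨false⟩ : ULift.{u} Bool) (mul (var ⟨true⟩) (var ⟨false⟩) :
        BVExpr un (ULift.{u} Bool)) = 0 := by simp [oddRight, vars]
      rw [h0, mul_zero, pow_zero, one_smul, substT, substT, substT, dif_pos hpq,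
        dif_neg (not_not.mpr rfl)]
      rfl
    · have h := h2.comp ⟨false⟩ h3
      refine (congrArg (Agree φ ψ) (Subtype.ext ?_)).mp h
      have hm : (⟨false⟩ : ULift.{u} Bool) ∈ vars (br (var ⟨true⟩) (var ⟨false⟩) :
        BVExpr un (ULift.{u} Bool)) := by simp [vars]
      refine (comp_mk_mk _ _ _ hm (pair_isMultilinear hpq hB).1).trans ?_
      have h0 : oddRight (⟨false⟩ : ULift.{u} Bool) (br (var ⟨true⟩) (var ⟨false⟩) :
        BVExpr un (ULift.{u} Bool)) = 0 := by simp [oddRight, vars]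
      rw [h0, mul_zero, pow_zero, one_smul, substT, substT, substT, dif_pos hpq,
        dif_neg (not_not.mpr rfl)]
      rfl

/-- Scalars are determined by their image under `1 ∘_p -`. -/
theorem eq_one_of_mapProd_circ [Finite A] [Finite B] (p : B) {w : ExteriorAlgebra ℚ (DK A)}
    (hw : w ∈ ⋀[ℚ]^0 (DK A)) (h : CE.mapProd (DK.circ p) 1 w = 1) : w = 1 := by
  rw [CE.gr_zero, Submodule.mem_one] at hw
  obtain ⟨c, rfl⟩ := hw
  rw [mapProd_circ, map_one, one_mul, AlgHom.commutes] at h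
  rw [(ExteriorAlgebra.algebraMap_eq_one_iff _ _).mp h, map_one]

/-- An element `x` of degree zero with `(p q) ∘_p x ↦ 1` is sent to `1`. -/
theorem app_eq_one (hφ : SendsGenerators φ) [Finite A] [Finite B] {p q : B} (hpq : p ≠ q)
    (hB : ∀ x, x = p ∨ x = q) {x : (BV un).obj A} (hx : x ∈ ((BV un).obj A).gr 0)
    (h : φ.app _ ((BV un).comp p (genMul un p q hpq hB) x) =
      (1 : ExteriorAlgebra ℚ (DK (Ins p A)))) :
    φ.app A x = (1 : ExteriorAlgebra ℚ (DK A)) := by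
  refine eq_one_of_mapProd_circ p ((φ.app A).map_gr 0 x hx) ?_
  rw [φ.app_comp, (hφ.1 B p q hpq hB).1] at h
  exact h

/-- The operad `BV` has identity `a ∈ BV_{{a}}`, which is sent to `1` since `(p q) ∘_p a = a q`. -/
theorem app_var_eq_one (hφ : SendsGenerators φ) [Finite A] (a : A)
    (hA : ∀ x, x = a) (h : (var a : BVExpr un A).IsMultilinear) :
    φ.app A (ofExpr un (var a) h) = (1 : ExteriorAlgebra ℚ (DK A)) := by
  obtain ⟨B, _, p, q, hpq, hB, -⟩ := agree_pair hφ hφ false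
  refine app_eq_one hφ hpq hB (mk_mem_gr (var a)) ?_
  refine Eq.trans (congrArg _ (Subtype.ext ?_)) (hφ.1 (Ins p A) (Sum.inr a) (Sum.inl ⟨q, hpq.symm⟩)
    Sum.inr_ne_inl ?_).1
  · refine (comp_mk_mk p (mul (var p) (var q)) _ (by simp [vars])
      (pair_isMultilinear hpq hB).1).trans ?_
    rw [show deg (var a : BVExpr un A) = 0 from rfl, Nat.zero_mul, pow_zero, one_smul, substT,
      substT, substT, dif_pos hpq.symm, dif_neg (not_not.mpr rfl)]
    rfl
  · rintro (⟨x, hx⟩ | x)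
    · obtain rfl := (hB x).resolve_left hx
      exact .inr rfl
    · rw [hA x]
      exact .inl rfl

/-- The unit `1 ∈ BV_∅` is sent to `1` since `(p q) ∘_p 1 = q`. -/
theorem app_one_eq_one (hφ : SendsGenerators φ) [Finite A] [IsEmpty A]
    (hun : un = true) (h : (one hun : BVExpr un A).IsMultilinear) :
    φ.app A (ofExpr un (one hun) h) = (1 : ExteriorAlgebra ℚ (DK A)) := by
  obtain ⟨B, _, p, q, hpq, hB, -⟩ := agree_pair hφ hφ false
  refine app_eq_one hφ hpq hB (mk_mem_gr (one hun)) ?_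
  have hq : ∀ x : Ins p A, x = Sum.inl ⟨q, hpq.symm⟩ := by
    rintro (⟨x, hx⟩ | x)
    · obtain rfl := (hB x).resolve_left hx
      rfl
    · exact isEmptyElim x
  refine Eq.trans (congrArg _ (Subtype.ext ?_)) (app_var_eq_one hφ (Sum.inl ⟨q, hpq.symm⟩) hq
    ⟨Multiset.nodup_singleton _, fun x => Multiset.mem_singleton.mpr (hq x)⟩)
  refine (comp_mk_mk p (mul (var p) (var q)) _ (by simp [vars])
    (pair_isMultilinear hpq hB).1).trans ?_
  rw [show deg (one hun : BVExpr un A) = 0 from rfl, Nat.zero_mul, pow_zero, one_smul, substT,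
    substT, substT, dif_pos hpq.symm, dif_neg (not_not.mpr rfl), FreeBV.rename, ← fmul_mk]
  exact fone_mul hun _

/-- Two morphisms that agree on the generators agree on `insertStar p x`, where `x ∈ BV_A`, if they
agree on `BV_A`. -/
theorem agree_insertStar (hφ : SendsGenerators φ) (hψ : SendsGenerators ψ) [Finite A]
    (ih : ∀ x : (BV un).obj A, Agree φ ψ x) (p : Option A × Bool) (x : multilinear un A) :
    Agree φ ψ (A := Option A)
      (⟨insertStar p x.1, insertStar_mem_multilinear p x.2⟩ : multilinear un (Option A)) := by
  obtain ⟨o, r⟩ := p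
  obtain ⟨B, _, p, q, hpq, hB, h1, h2⟩ := agree_pair hφ hψ r
  cases o with
  | some b =>
    have h := ((ih x).comp b h2).map (insEquiv b hpq hB)
    exact (congrArg (Agree φ ψ) (Subtype.ext (insertStar_some_eq b r hpq hB x.1))).mpr h
  | none =>
    obtain ⟨x, hx⟩ := x
    refine Submodule.span_induction (p := fun x hx => Agree φ ψ (A := Option A)
      (⟨insertStar (none, r) x, insertStar_mem_multilinear _ hx⟩ : multilinear un (Option A)))
      ?_ ?_ ?_ ?_ hx
    · rintro _ ⟨t, ht, rfl⟩
      have h := (h1.comp p (ih (ofExpr un t ht))).map (insEquiv' A hpq hB)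
      refine Agree.of_smul_neg_one (n := deg t * oddRight p (mul (var p) (oneOrDel un r q))) ?_
      exact (congrArg (Agree φ ψ) (Subtype.ext (insertStar_none_eq r hpq hB t))).mp h
    · refine (congrArg (Agree φ ψ) (Subtype.ext ?_)).mp ((map_zero _).trans (map_zero _).symm)
      exact (map_zero _).symm
    · intro x y _ _ h h'
      refine (congrArg (Agree φ ψ) (Subtype.ext ?_)).mp (h.add h')
      exact (map_add _ _ _).symm
    · intro c x _ h
      refine (congrArg (Agree φ ψ) (Subtype.ext ?_)).mp (h.smul c)
      exact (map_smul _ _ _).symm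

/-- By induction on `A`, since multilinear expressions in one more variable are obtained by insertion
of the new variable. -/
theorem agree_all (hφ : SendsGenerators φ) (hψ : SendsGenerators ψ) (A : Type u) [hA : Finite A] :
    ∀ x : (BV un).obj A, Agree φ ψ x := by
  refine Finite.induction_empty_option
    (P := fun A => ∀ (_ : Finite A) (x : (BV un).obj A), Agree φ ψ x) ?_ ?_ ?_ A hA
  · intro A B e ih hB x
    have hA : Finite A := Finite.of_equiv B e.symm
    have h := (ih hA ((BV un).map e.symm x)).map e
    rwa [← (BV un).map_trans, Equiv.symm_trans_self, (BV un).map_refl] at h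
  · intro _ x
    by_cases hun : un = true
    · obtain ⟨c, hc⟩ := exists_smul_one (A := PEmpty.{u + 1}) hun (x := x.1)
      have hm : (one hun : BVExpr un PEmpty.{u + 1}).IsMultilinear :=
        ⟨Multiset.nodup_zero, fun x => isEmptyElim x⟩
      have h : Agree φ ψ (ofExpr un (one hun) hm) :=
        (app_one_eq_one hφ hun hm).trans (app_one_eq_one hψ hun hm).symm
      exact (congrArg (Agree φ ψ) (Subtype.ext hc.symm)).mp (h.smul c)
    · have h0 := multilinear_of_isEmpty (Bool.eq_false_iff.mpr hun) x.2
      refine (congrArg (Agree φ ψ) (Subtype.ext h0.symm)).mp ((map_zero _).trans (map_zero _).symm)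
  · intro A _ ih _ x
    have hF : Finite A := inferInstance
    by_cases h : un = true ∨ Nonempty A
    · obtain ⟨w, hw⟩ := exists_eq_sum_insertStar h x.2
      have := Agree.sum Finset.univ _ fun p _ => agree_insertStar hφ hψ (ih hF) p (w p)
      refine (congrArg (Agree φ ψ) (Subtype.ext ?_)).mp this
      rw [hw]
      exact map_sum (multilinear un (Option A)).subtype _ _
    · rw [not_or, not_nonempty_iff, Bool.not_eq_true] at h
      obtain ⟨h, _⟩ := h
      obtain ⟨c, hc⟩ := exists_eq_sum_star h x.2
      have hn : ∀ y : Option A, y = none := fun y => by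
        cases y with
        | none => rfl
        | some a => exact isEmptyElim a
      have hs : ∀ r, Agree φ ψ (ofExpr un (star un A r) (isMultilinear_star r)) := by
        rintro (_ | _)
        · exact (app_var_eq_one hφ none hn _).trans (app_var_eq_one hψ none hn _).symm
        · exact (hφ.2 _ none hn).trans (hψ.2 _ none hn).symm
      have := Agree.sum Finset.univ _ fun r _ => (hs r).smul (c r)
      refine (congrArg (Agree φ ψ) (Subtype.ext ?_)).mp this
      rw [hc]
      exact map_sum (multilinear un (Option A)).subtype
        (fun r => c r • ofExpr un (star un A r) (isMultilinear_star r)) Finset.univ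

/-- A morphism of operads from `BV` to `⋀ t̃` is determined by the images of the generators. -/
theorem hom_ext (hφ : SendsGenerators φ) (hψ : SendsGenerators ψ) : φ = ψ := by
  have h : @φ.app = @ψ.app := by
    funext A _
    have h : (φ.app A).toLin = (ψ.app A).toLin := LinearMap.ext (agree_all hφ hψ A)
    cases h1 : φ.app A
    cases h2 : ψ.app A
    rw [h1, h2] at h
    cases h
    rfl
  cases φ
  cases ψ
  cases h
  rfl

end

end BV

end FramedDisks

theorem mainTheorem2 (un : Bool) :
    ∃ φ : FramedDisks.Operad.Hom (FramedDisks.BV.{u} un) FramedDisks.wedgeDK.{u},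
      FramedDisks.BV.SendsGenerators φ ∧
      (∀ (A : Type u) [Finite A], (un = true ∨ Nonempty A) →
        QuasiIso (φ.app A).toChainMap) ∧
      ∀ ψ : FramedDisks.Operad.Hom (FramedDisks.BV.{u} un) FramedDisks.wedgeDK.{u},
        FramedDisks.BV.SendsGenerators ψ → ψ = φ := by
  refine ⟨FramedDisks.BV.phiHom un, FramedDisks.BV.sendsGenerators_phiHom un, fun A _ h => ?_,
    fun ψ hψ => FramedDisks.BV.hom_ext hψ (FramedDisks.BV.sendsGenerators_phiHom un)⟩
  obtain ⟨hs, hi⟩ := FramedDisks.FreeBV.represents un A h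
  refine FramedDisks.DGSpace.Hom.quasiIso _ (fun _ => rfl) (fun z hz => ?_) fun x y hxy => ?_
  · obtain ⟨x, hx, y, h⟩ := hs z hz
    exact ⟨⟨x, hx⟩, y, h⟩
  · exact Subtype.ext (hi x.1 x.2 y hxy)
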